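/- Let $n\ge 2$, $m\ge 1$, $0<\phi<\frac{\pi}{2n}$, and for $\mathbf u\in\mathbb C^m$ put $|\mathbf u|=\sum_i|u_i|$. For $\rho\ge 0$ and an angle $\psi$ let $$\hat D_{\psi,\rho}=\{z\in\mathbb C:\ |z|>\rho,\ |\arg z|<\tfrac{\pi}{2}+\psi\}.$$ Consider, for one complex space variable $x$ and $\mathbf f(x,t)\in\mathbb C^m$, the system with zero initial data $$\partial_t\mathbf f+\mathcal P(\partial_x)\mathbf f=\sum_{\mathbf q}\ \sum_{\mathbf k}\mathbf b_{\mathbf q,\mathbf k}(x,t)\,\mathbf f^{\mathbf k}\prod_{l=1}^m\prod_{j=1}^n(\partial_x^jf_l)^{q_{l,j}}+\mathbf r(x,t),\qquad \mathbf f(x,0)=0,\tag{1.a}$$ where $\mathbf q=(q_{l,j})$ runs over the multiindices with $\sum_{l,j}jq_{l,j}\le n$, $\mathbf k$ over $\mathbb N^m$, $\mathbf b_{\mathbf 0,\mathbf 0}=0$, and $\mathcal P=\mathrm{diag}(\mathcal P_1,\dots,\mathcal P_m)$ with polynomials $\mathcal P_l$ of degree $n$ whose leading monomials $\mathcal P_{n;l}$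 satisfy $\Re\,\mathcal P_{n;l}(-p)>0$ for all $p\ne0$, $|\arg p|\le\phi$. *Exponents.* Let $\omega_1<\dots<\omega_{J_r}$, $\beta_1,\dots,\beta_K$, $\gamma_1,\dots,\gamma_K$ be positive numbers ($J_r,K\ge1$), $\beta\ge0$, $\alpha_{\mathbf q,1}>\dots>\alpha_{\mathbf q,J_{\mathbf q}}$ real ($J_{\mathbf q}\ge 1$), and $n'_j\in\mathbb N$, with $n'_j\beta_l-\omega_j\ge1$ for all $j,l$; $\hat n:=\beta_1/\gamma_1\ge n$; $\beta_1/\gamma_1\ge\dots\ge\beta_K/\gamma_K$, where $\beta_l>\beta_{l'}$ if $l<l'$ and $\beta_l/\gamma_l=\beta_{l'}/\gamma_{l'}$; and $\beta>0$ unless only finitely many $\mathbf b_{\mathbf q,\mathbf k}$ are nonzero. Whenever $\mathbf b_{\mathbf q,\mathbf k}\ne0$, assume $\alpha_{\mathbf q,j}+\beta|\mathbf k|\ge0$ for all $j$ and $$m_{\mathbf q,\mathbf k}:=\hat n+\omega_1(|\mathbf q|-1)-\alpha_{\mathbf q,1}+(\omega_1-\beta)|\mathbf k|-\tfrac{\hat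 n}{n}\sum_{l,j}jq_{l,j}\ge0 .$$ *Setting 1.* Let $T>0$ and $\phi<\phi_1\le\frac{\pi}{2n}$. The functions $\mathbf r$ and $\mathbf b_{\mathbf q,\mathbf k}$ are continuous on $\hat D_{\phi_1,0}\times(0,T]$, analytic in $x$, and there satisfy $$|\mathbf r(x,t)|\le t^{-1}\sum_{j=1}^{J_r}|x|^{\omega_j}\,\mathfrak h_j\big(t^{\gamma_1}|x|^{-\beta_1},\dots,t^{\gamma_K}|x|^{-\beta_K}\big),$$ $$|\mathbf b_{\mathbf q,\mathbf k}(x,t)|\le|x|^{-\beta|\mathbf k|}\sum_{j=1}^{J_{\mathbf q}}|x|^{-\alpha_{\mathbf q,j}}\,\mathfrak p_{\mathbf q,\mathbf k,j}\big(t^{\gamma_1}|x|^{-\beta_1},\dots,t^{\gamma_K}|x|^{-\beta_K}\big),$$ with polynomials with nonnegative coefficients, $\mathfrak h_j$ homogeneous of degree $n'_j$. For $\mathbf b_{\mathbf q,\mathbf k}\neq 0$: $\mathfrak p_{\mathbf q,\mathbf k,j}(\delta,\dots,\delta)\le AB^{|\mathbf k|}$ for some constants $A,B$, $\delta>0$ independent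 of $\mathbf q,\mathbf k,j$, and $\mathfrak p_{\mathbf q,\mathbf k,j}(0)=0$ if $\alpha_{\mathbf q,j}+\beta|\mathbf k|=0$. *Setting 2.* $\hat n=n$, $\mathcal P_l(-s)=s^n$ for all $l$, and for some $\delta>0$, for all $t>0$ and $x\in\hat D_{\phi,0}$ with all $t^{\gamma_l}|x|^{-\beta_l}<\delta$, $$\mathbf r(x,t)=\frac1t\sum_{j=1}^{J_r}x^{\omega_j}\mathfrak a_j\big(t^{\gamma_1}x^{-\beta_1},\dots,t^{\gamma_K}x^{-\beta_K}\big),\qquad \mathbf b_{\mathbf q,\mathbf k}(x,t)=x^{-\beta|\mathbf k|}\sum_{j=1}^{J_{\mathbf q}}x^{-\alpha_{\mathbf q,j}}\mathfrak a_{\mathbf q,\mathbf k,j}\big(t^{\gamma_1}x^{-\beta_1},\dots,t^{\gamma_K}x^{-\beta_K}\big)$$ (principal powers), where $\mathfrak a_j,\mathfrak a_{\mathbf q,\mathbf k,j}$ are analytic in the polydisc $\max_l|z_l|<\delta$, $|\mathfrak a_j(\mathbf z)|\le\mathfrak h_j(|z_1|,\dots,|z_K|)$ there with $\mathfrak h_j$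 as in Setting 1, and, for $\mathbf b_{\mathbf q,\mathbf k}\ne0$, $|\mathfrak a_{\mathbf q,\mathbf k,j}|\le AB^{|\mathbf k|}$ there, and $\mathfrak a_{\mathbf q,\mathbf k,j}(0)=0$ if $\alpha_{\mathbf q,j}+\beta|\mathbf k|=0$. Moreover $\omega>0$ is such that the numbers $m_{\mathbf q,\mathbf k}$ (for $\mathbf b_{\mathbf q,\mathbf k}\ne0$), $\omega_j-\omega_1$, $\alpha_{\mathbf q,1}-\alpha_{\mathbf q,j}$, $n\gamma_l-\beta_l$ are all integer multiples of $n\omega$ (for instance the largest such $\omega$, if there is one). A *solution* on $\hat D_{\phi,\rho}$ for $0<t\le T$ is a function $\mathbf f(x,t)$, defined for $0<t\le T$, $\zeta=xt^{-1/\hat n}\in\hat D_{\phi,\rho}$, analytic in $x$ and differentiable in $t$, with $|x|\,|\mathbf f(x,t)|$ bounded, for which the series over $\mathbf k$ in (1.a) converge, (1.a) holds, and $\mathbf f(x,t)\to0$ as $t\to0^+$ for each $x\in\hat D_{\phi,0}$. Write $\hat{\mathbf f}(\zeta,t)=\mathbf f(t^{1/\hat n}\zeta,t)$. **Theorem.**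 (i) In Setting 1 there are homogeneous polynomials $\mathfrak h_{(n'_j)}$ of degree $n'_j$ with nonnegative coefficients and $\rho_0>0$ such that for every $\rho\ge\rho_0$ there is a unique solution on $\hat D_{\phi,\rho}$ for $0<t\le T$, and for $\zeta\in\hat D_{\phi,\rho}$, $0<t\le T$, $$|\hat{\mathbf f}(\zeta,t)|\le\sum_{j=1}^{J_r}|\zeta|^{\omega_j}t^{\omega_j/\hat n}\,\mathfrak h_{(n'_j)}\big(|\zeta|^{-\beta_1},t^{\gamma_2-\beta_2/\hat n}|\zeta|^{-\beta_2},\dots,t^{\gamma_K-\beta_K/\hat n}|\zeta|^{-\beta_K}\big).\tag{fsbound}$$ (ii) In Setting 2, for every $T>0$ there is $\rho_0=\rho_0(T)>0$ such that for every $\rho\ge\rho_0$ there is a unique solution on $\hat D_{\phi,\rho}$ for $0<t\le T^{1/\omega}$; it satisfies a bound (fsbound) there, with polynomials independent of $\rho$, and the mapping $$(\zeta,\theta)\mapsto\theta^{-\omega_1/(n\omega)}\,\hat{\mathbf f}(\zeta,\theta^{1/\omega}),\qquad \zeta\in\hat D_{\phi,\rho},\ 0<\theta<T,$$ extends to an analytic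 function on $\hat D_{\phi,\rho}\times\{\theta\in\mathbb C:|\theta|<T\}$. -/

import Mathlib

open Filter Topology

/-- The `ℓ¹` size `|u| = ∑ |u_i|` of a vector of `ℂ^m`. -/
noncomputable def vecAbs {m : ℕ} (u : Fin m → ℂ) : ℝ := ∑ i, ‖u i‖

/-- The truncated sector `|z| > ρ`, `|arg z| < π/2 + φ`. -/
def wideSector (φ ρ : ℝ) : Set ℂ := {z | ρ < ‖z‖ ∧ |z.arg| < Real.pi / 2 + φ}

/-- The multiindices `q = (q_{l,j})`, `1 ≤ l ≤ m`, `1 ≤ j ≤ n`, with `∑ j q_{l,j} ≤ n`.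
The entry `q l j` with `j : Fin n` is the exponent of the derivative of order `j + 1`. -/
abbrev DerivIdx (m n : ℕ) : Type :=
  {q : Fin m → Fin n → ℕ // ∑ l : Fin m, ∑ j : Fin n, ((j : ℕ) + 1) * q l j ≤ n}

theorem DerivIdx.entry_le {m n : ℕ} (q : DerivIdx m n) (l : Fin m) (j : Fin n) :
    q.1 l j ≤ n := by
  have h1 : ((j : ℕ) + 1) * q.1 l j ≤ ∑ j : Fin n, ((j : ℕ) + 1) * q.1 l j :=
    Finset.single_le_sum (f := fun j : Fin n => ((j : ℕ) + 1) * q.1 l j)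
      (fun _ _ => Nat.zero_le _) (Finset.mem_univ j)
  have h2 : ∑ j : Fin n, ((j : ℕ) + 1) * q.1 l j ≤ ∑ l : Fin m, ∑ j : Fin n, ((j : ℕ) + 1) * q.1 l j :=
    Finset.single_le_sum (f := fun l : Fin m => ∑ j : Fin n, ((j : ℕ) + 1) * q.1 l j)
      (fun _ _ => Nat.zero_le _) (Finset.mem_univ l)
  have h3 := q.2
  nlinarith [Nat.zero_le ((j : ℕ) * q.1 l j)]

noncomputable instance DerivIdx.instFintype (m n : ℕ) : Fintype (DerivIdx m n) :=
  Fintype.ofInjective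
    (fun (q : DerivIdx m n) (l : Fin m) (j : Fin n) =>
      (⟨q.1 l j, Nat.lt_succ_of_le (q.entry_le l j)⟩ : Fin (n + 1)))
    (fun _ _ h => Subtype.ext (funext fun l => funext fun j =>
      congrArg Fin.val (congrFun (congrFun h l) j)))

/-- `|q| = ∑ q_{l,j}`. -/
def DerivIdx.size {m n : ℕ} (q : DerivIdx m n) : ℕ := ∑ l : Fin m, ∑ j : Fin n, q.1 l j

/-- The number of derivatives `∑ j q_{l,j}`. -/
def DerivIdx.order {m n : ℕ} (q : DerivIdx m n) : ℕ := ∑ l : Fin m, ∑ j : Fin n, ((j : ℕ) + 1) * q.1 l j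

/-- `|k| = ∑ k_l`. -/
def multiSize {m : ℕ} (k : Fin m → ℕ) : ℕ := ∑ l, k l

/-- The coefficients `b_{q,k}(x,t) ∈ ℂ^m` of a system. -/
abbrev Coeffs (m n : ℕ) : Type := DerivIdx m n → (Fin m → ℕ) → ℂ → ℝ → (Fin m → ℂ)

/-- The right-hand side `-P(∂ₓ) f + ∑_q b_q(x,t,f) ∏ (∂ₓ^j f_l)^{q_{l,j}} + r(x,t)` of the
evolution equation for `∂ₜ f`, with `b_q(x,t,f) = ∑_k b_{q,k}(x,t) f^k`. -/
noncomputable def evolutionRHS {m n : ℕ} (P : Fin m → Polynomial ℂ) (b : Coeffs m n)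
    (r : ℂ → ℝ → (Fin m → ℂ)) (f : ℂ → ℝ → (Fin m → ℂ)) (x : ℂ) (t : ℝ) : Fin m → ℂ := fun i =>
  -(∑ j ∈ Finset.range (n + 1), (P i).coeff j * iteratedDeriv j (fun y => f y t i) x)
  + (∑ q : DerivIdx m n, (∑' k : Fin m → ℕ, (∏ l, f x t l ^ k l) • b q k x t) i
      * ∏ l, ∏ j : Fin n, iteratedDeriv ((j : ℕ) + 1) (fun y => f y t l) x ^ q.1 l j)
  + r x t i

/-- The pairs `(x,t)` with `0 < t ≤ T` and `ζ = x t^{-1/N}` in the sector `|ζ| > ρ`,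
`|arg ζ| < π/2 + φ`. -/
def similarityRegion (N φ ρ T : ℝ) : Set (ℂ × ℝ) :=
  {p | 0 < p.2 ∧ p.2 ≤ T ∧ p.1 * ((p.2 ^ (-(1 / N)) : ℝ) : ℂ) ∈ wideSector φ ρ}

/-- `f` is a solution, with zero initial data, of the evolution system on the region
`similarityRegion N φ ρ T`: analytic in `x`, with `|x| |f|` bounded. -/
structure IsSolution {m n : ℕ} (P : Fin m → Polynomial ℂ) (b : Coeffs m n)
    (r : ℂ → ℝ → (Fin m → ℂ)) (N φ ρ T : ℝ) (f : ℂ → ℝ → (Fin m → ℂ)) : Prop where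
  analytic : ∀ t : ℝ,
    DifferentiableOn ℂ (fun x => f x t) {x | (x, t) ∈ similarityRegion N φ ρ T}
  bounded : ∃ C : ℝ, ∀ x t, (x, t) ∈ similarityRegion N φ ρ T → ‖x‖ * vecAbs (f x t) ≤ C
  summable : ∀ x t, (x, t) ∈ similarityRegion N φ ρ T → ∀ q : DerivIdx m n,
    Summable (fun k : Fin m → ℕ => (∏ l, f x t l ^ k l) • b q k x t)
  equation : ∀ x t, (x, t) ∈ similarityRegion N φ ρ T →
    HasDerivWithinAt (fun s => f x s) (evolutionRHS P b r f x t) (Set.Iic T) t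
  initial : ∀ x ∈ wideSector φ 0, Tendsto (fun t => f x t) (𝓝[>] 0) (𝓝 0)

/-- The numbers entering the hypotheses. Index sets start at `0`: `ω 0`, `β 0`, `γ 0`, `α q 0`
are the first members of their families, each of which is nonempty. -/
structure Exponents (m n : ℕ) where
  /-- number of pairs `(β_l, γ_l)`, minus one -/
  K : ℕ
  /-- number of exponents `ω_j`, minus one -/
  Jr : ℕ
  /-- number of exponents `α_{q,j}`, minus one -/
  J : DerivIdx m n → ℕ
  ω : Fin (Jr + 1) → ℝ
  β : Fin (K + 1) → ℝ
  γ : Fin (K + 1) → ℝ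
  /-- the degrees `n'_j` -/
  deg : Fin (Jr + 1) → ℕ
  /-- the exponent `β` (without index) that goes with `|k|` -/
  βk : ℝ
  α : (q : DerivIdx m n) → Fin (J q + 1) → ℝ

/-- `n̂ = β_1 / γ_1`. -/
noncomputable def Exponents.nhat {m n : ℕ} (E : Exponents m n) : ℝ := E.β 0 / E.γ 0

/-- `m_{q,k} = n̂ + ω_1(|q| - 1) - α_{q,1} + (ω_1 - β)|k| - (n̂/n) ∑ j q_{l,j}`. -/
noncomputable def Exponents.mqk {m n : ℕ} (E : Exponents m n) (q : DerivIdx m n)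
    (k : Fin m → ℕ) : ℝ :=
  E.nhat + E.ω 0 * ((q.size : ℝ) - 1) - E.α q 0 + (E.ω 0 - E.βk) * (multiSize k : ℝ)
    - E.nhat / n * (q.order : ℝ)

/-- The conditions on the exponents; `nz q k` stands for `b_{q,k} ≠ 0`. -/
structure Exponents.Admissible {m n : ℕ} (E : Exponents m n)
    (nz : DerivIdx m n → (Fin m → ℕ) → Prop) : Prop where
  ω_pos : ∀ j, 0 < E.ω j
  β_pos : ∀ l, 0 < E.β l
  γ_pos : ∀ l, 0 < E.γ l
  deg_cond : ∀ j l, 1 ≤ (E.deg j : ℝ) * E.β l - E.ω j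
  nhat_ge : (n : ℝ) ≤ E.nhat
  ratio_anti : Antitone (fun l => E.β l / E.γ l)
  ratio_tie : ∀ l l', l < l' → E.β l / E.γ l = E.β l' / E.γ l' → E.β l' < E.β l
  ω_mono : StrictMono E.ω
  α_anti : ∀ q, StrictAnti (E.α q)
  βk_cond : 0 < E.βk ∨ (E.βk = 0 ∧ {p : DerivIdx m n × (Fin m → ℕ) | nz p.1 p.2}.Finite)
  α_cond : ∀ q k, nz q k → ∀ j, 0 ≤ E.α q j + E.βk * (multiSize k : ℝ)
  m_cond : ∀ q k, nz q k → 0 ≤ E.mqk q k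

/-- `b_{q,k}` does not vanish identically on `S`. -/
def NonzeroOn {m n : ℕ} (b : Coeffs m n) (S : Set (ℂ × ℝ)) (q : DerivIdx m n)
    (k : Fin m → ℕ) : Prop := ∃ x t, (x, t) ∈ S ∧ b q k x t ≠ 0

/-- A polynomial with nonnegative coefficients. -/
def NonnegCoeffs {σ : Type*} (p : MvPolynomial σ ℝ) : Prop := ∀ s, 0 ≤ p.coeff s

/-- The first setting (data dominated by polynomials), for times `0 < t ≤ T`. The data are analytic
in a sector which is slightly wider than the one, given by `φ`, of the solution. -/
structure SettingOne {m n : ℕ} (φ T : ℝ) (E : Exponents m n) (b : Coeffs m n)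
    (r : ℂ → ℝ → (Fin m → ℂ)) (φ₁ : ℝ)
    (h : Fin (E.Jr + 1) → MvPolynomial (Fin (E.K + 1)) ℝ)
    (p : (q : DerivIdx m n) → (Fin m → ℕ) → Fin (E.J q + 1) →
      MvPolynomial (Fin (E.K + 1)) ℝ) : Prop where
  lt_φ₁ : φ < φ₁
  φ₁_le : φ₁ ≤ Real.pi / (2 * n)
  admissible : E.Admissible (NonzeroOn b (wideSector φ₁ 0 ×ˢ Set.Ioc 0 T))
  r_analytic : ∀ t ∈ Set.Ioc 0 T, DifferentiableOn ℂ (fun x => r x t) (wideSector φ₁ 0)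
  r_cont : ContinuousOn (fun z : ℂ × ℝ => r z.1 z.2) (wideSector φ₁ 0 ×ˢ Set.Ioc 0 T)
  b_analytic : ∀ q k, ∀ t ∈ Set.Ioc 0 T,
    DifferentiableOn ℂ (fun x => b q k x t) (wideSector φ₁ 0)
  b_cont : ∀ q k,
    ContinuousOn (fun z : ℂ × ℝ => b q k z.1 z.2) (wideSector φ₁ 0 ×ˢ Set.Ioc 0 T)
  b_zero : ∀ q k, q.size = 0 → multiSize k = 0 →
    ¬ NonzeroOn b (wideSector φ₁ 0 ×ˢ Set.Ioc 0 T) q k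
  h_hom : ∀ j, (h j).IsHomogeneous (E.deg j) ∧ NonnegCoeffs (h j)
  p_nonneg : ∀ q k j, NonnegCoeffs (p q k j)
  r_bound : ∀ x ∈ wideSector φ₁ 0, ∀ t ∈ Set.Ioc 0 T,
    vecAbs (r x t) ≤ t⁻¹ * ∑ j, ‖x‖ ^ E.ω j *
      MvPolynomial.eval (fun l => t ^ E.γ l * ‖x‖ ^ (-E.β l)) (h j)
  b_bound : ∀ q k, ∀ x ∈ wideSector φ₁ 0, ∀ t ∈ Set.Ioc 0 T,
    vecAbs (b q k x t) ≤ ‖x‖ ^ (-(E.βk * (multiSize k : ℝ))) * ∑ j, ‖x‖ ^ (-E.α q j) *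
      MvPolynomial.eval (fun l => t ^ E.γ l * ‖x‖ ^ (-E.β l)) (p q k j)
  /- the bounds are those of a family whose sum over `k` is analytic in `f` near zero -/
  p_unif : ∃ A B δ : ℝ, 0 < δ ∧ ∀ q k,
    NonzeroOn b (wideSector φ₁ 0 ×ˢ Set.Ioc 0 T) q k → ∀ j,
      MvPolynomial.eval (fun _ => δ) (p q k j) ≤ A * B ^ multiSize k
  /- every term of the bound of a coefficient decays as `x → ∞` -/
  p_decay : ∀ q k, NonzeroOn b (wideSector φ₁ 0 ×ˢ Set.Ioc 0 T) q k → ∀ j,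
    E.α q j + E.βk * (multiSize k : ℝ) = 0 → MvPolynomial.constantCoeff (p q k j) = 0

/-- The pairs `(x,t)`, `t > 0`, with `x` in the sector and all `t^{γ_l}|x|^{-β_l}` below `δ`. -/
def smallArgs {m n : ℕ} (E : Exponents m n) (φ δ : ℝ) : Set (ℂ × ℝ) :=
  {z | z.1 ∈ wideSector φ 0 ∧ 0 < z.2 ∧ ∀ l, z.2 ^ E.γ l * ‖z.1‖ ^ (-E.β l) < δ}

/-- The arguments `t^{γ_l} x^{-β_l}`, for complex `x`. -/
noncomputable def Exponents.args {m n : ℕ} (E : Exponents m n) (x : ℂ) (t : ℝ) :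
    Fin (E.K + 1) → ℂ := fun l => ((t ^ E.γ l : ℝ) : ℂ) * x ^ ((-E.β l : ℝ) : ℂ)

/-- The second setting: `n̂ = n`, `P(-s) = s^n`, data given by functions `a`, `c` analytic near the
origin, and commensurate exponents with step `n ω`. -/
structure SettingTwo {m n : ℕ} (φ : ℝ) (P : Fin m → Polynomial ℂ) (E : Exponents m n)
    (b : Coeffs m n) (r : ℂ → ℝ → (Fin m → ℂ)) (ω δ : ℝ)
    (a : Fin (E.Jr + 1) → (Fin (E.K + 1) → ℂ) → (Fin m → ℂ))
    (h : Fin (E.Jr + 1) → MvPolynomial (Fin (E.K + 1)) ℝ)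
    (c : (q : DerivIdx m n) → (Fin m → ℕ) → Fin (E.J q + 1) →
      (Fin (E.K + 1) → ℂ) → (Fin m → ℂ)) : Prop where
  ω_pos : 0 < ω
  δ_pos : 0 < δ
  nhat_eq : E.nhat = n
  P_eq : ∀ l, P l = (-Polynomial.X) ^ n
  admissible : E.Admissible (NonzeroOn b (smallArgs E φ δ))
  b_zero : ∀ q k, q.size = 0 → multiSize k = 0 → ¬ NonzeroOn b (smallArgs E φ δ) q k
  h_hom : ∀ j, (h j).IsHomogeneous (E.deg j) ∧ NonnegCoeffs (h j)
  a_analytic : ∀ j, AnalyticOnNhd ℂ (a j) (Metric.ball 0 δ)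
  a_bound : ∀ j, ∀ z ∈ Metric.ball (0 : Fin (E.K + 1) → ℂ) δ,
    vecAbs (a j z) ≤ MvPolynomial.eval (fun l => ‖z l‖) (h j)
  c_analytic : ∀ q k j, AnalyticOnNhd ℂ (c q k j) (Metric.ball 0 δ)
  c_unif : ∃ A B : ℝ, ∀ q k, NonzeroOn b (smallArgs E φ δ) q k → ∀ j,
    ∀ z ∈ Metric.ball (0 : Fin (E.K + 1) → ℂ) δ, vecAbs (c q k j z) ≤ A * B ^ multiSize k
  c_decay : ∀ q k, NonzeroOn b (smallArgs E φ δ) q k → ∀ j,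
    E.α q j + E.βk * (multiSize k : ℝ) = 0 → c q k j 0 = 0
  r_eq : ∀ x t, (x, t) ∈ smallArgs E φ δ →
    r x t = (t : ℂ)⁻¹ • ∑ j, x ^ ((E.ω j : ℝ) : ℂ) • a j (E.args x t)
  b_eq : ∀ q k x t, (x, t) ∈ smallArgs E φ δ →
    b q k x t = x ^ ((-(E.βk * (multiSize k : ℝ)) : ℝ) : ℂ) •
      ∑ j, x ^ ((-E.α q j : ℝ) : ℂ) • c q k j (E.args x t)
  m_int : ∀ q k, NonzeroOn b (smallArgs E φ δ) q k → ∃ z : ℤ, E.mqk q k = z * (n * ω)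
  ω_int : ∀ j, ∃ z : ℤ, E.ω j - E.ω 0 = z * (n * ω)
  α_int : ∀ q j, ∃ z : ℤ, E.α q 0 - E.α q j = z * (n * ω)
  γ_int : ∀ l, ∃ z : ℤ, n * E.γ l - E.β l = z * (n * ω)

/-- `f̂(ζ,t) = f(t^{1/n̂} ζ, t)`. -/
noncomputable def Exponents.hat {m n : ℕ} (E : Exponents m n) (f : ℂ → ℝ → (Fin m → ℂ))
    (ζ : ℂ) (t : ℝ) : Fin m → ℂ := f (((t ^ (1 / E.nhat) : ℝ) : ℂ) * ζ) t

/-- The bound of `f̂` on the sector for `0 < t ≤ T`, with the polynomials `g j`. -/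
def HatBound {m n : ℕ} (E : Exponents m n) (g : Fin (E.Jr + 1) → MvPolynomial (Fin (E.K + 1)) ℝ)
    (φ ρ T : ℝ) (f : ℂ → ℝ → (Fin m → ℂ)) : Prop :=
  ∀ ζ ∈ wideSector φ ρ, ∀ t ∈ Set.Ioc 0 T,
    vecAbs (E.hat f ζ t) ≤ ∑ j, ‖ζ‖ ^ E.ω j * t ^ (E.ω j / E.nhat) *
      MvPolynomial.eval (fun l => t ^ (E.γ l - E.β l / E.nhat) * ‖ζ‖ ^ (-E.β l)) (g j)

/-- `f` is a solution on the region, any other solution agrees with it there, and `f̂` obeys the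
bound with the polynomials `g j`. -/
def IsUniqueBoundedSolution {m n : ℕ} (P : Fin m → Polynomial ℂ) (E : Exponents m n)
    (b : Coeffs m n) (r : ℂ → ℝ → (Fin m → ℂ))
    (g : Fin (E.Jr + 1) → MvPolynomial (Fin (E.K + 1)) ℝ)
    (φ ρ T : ℝ) (f : ℂ → ℝ → (Fin m → ℂ)) : Prop :=
  IsSolution P b r E.nhat φ ρ T f ∧
  (∀ f' : ℂ → ℝ → (Fin m → ℂ), IsSolution P b r E.nhat φ ρ T f' →
    ∀ x t, (x, t) ∈ similarityRegion E.nhat φ ρ T → f' x t = f x t) ∧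
  HatBound E g φ ρ T f

noncomputable section
open MeasureTheory Set Real
open Complex (norm_real re_ofReal_mul ofReal_re add_re neg_re normSq_eq_norm_sq normSq_apply re_le_norm mul_re norm_exp I ofReal_mul continuous_ofReal ofRealCLM ofRealCLM_apply smul_re ofReal_zero ofReal_one sub_re ofReal_exp real_smul norm_mul_cos_arg abs_arg_le_pi continuous_re add_im ofReal_im im_ofReal_mul smul_im star_def conj_re conj_im mul_im abs_im_le_norm norm_I abs_re_le_norm I_sq continuous_im re_add_im ofReal_sub ofReal_ne_zero norm_cpow_real slitPlane arg_real_mul cpow_def_of_ne_zero ofReal_inj ofReal_injective re_mul_ofReal)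
open Finset (sum_nonneg sum_le_sum sum_mul mul_sum single_le_sum sum_congr prod_pow_eq_pow_sum prod_mul_distrib prod_le_prod)
open Metric (ball mem_ball isOpen_ball closedBall mem_closedBall ball_subset_ball)
open MvPolynomial (eval eval_eq')
open Complex renaming exp → cexp
open intervalIntegral (intervalIntegrable_rpow')

section

variable {a b c : ℝ} {U S : Set ℂ} {h : ℂ → ℂ}

lemma rpow_anti {a b c : ℝ} (ha : 0 < a) (h : a ≤ b) (hc : c ≤ 0) : b ^ c ≤ a ^ c :=
    rpow_le_rpow_of_nonpos ha h hc

lemma mul_le_l (h : b ≤ c) (ha : 0 ≤ a := by positivity) : a * b ≤ a * c :=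
    mul_le_mul_of_nonneg_left h ha

lemma mul_le_r (h : b ≤ c) (ha : 0 ≤ a := by positivity) : b * a ≤ c * a :=
    mul_le_mul_of_nonneg_right h ha

lemma mul_le_lr {d : ℝ} (h1 : a ≤ b) (h2 : c ≤ d) (hc : 0 ≤ c := by positivity)
    (hb : 0 ≤ b := by positivity) : a * c ≤ b * d := mul_le_mul h1 h2 hc hb

lemma ae_Ioi : ∀ᵐ r ∂volume.restrict (Ioi a), r ∈ Ioi a := ae_restrict_mem measurableSet_Ioi

lemma norm_coe {r : ℝ} (h : 0 ≤ r := by positivity) : ‖(r : ℂ)‖ = r := by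
  rw [norm_real, norm_of_nonneg h]

/-- Functions of `x`, `t`. -/
abbrev TimeFun := ℂ → ℝ → ℂ

/-- Functions of a parameter, of `x` or `p`, and of `t`. -/
abbrev ParamFun := ℂ → TimeFun

/-- Vector valued functions of `x`, `t`. -/
abbrev VecFun (m : ℕ) := ℂ → ℝ → Fin m → ℂ

/-- Families indexed as the coefficients of the system. -/
abbrev CoeffFam (m n : ℕ) (a : Type) := DerivIdx m n → (Fin m → ℕ) → Fin m → a

lemma hasDerivAt_integral_of_holomorphic {A : Type*} [MeasurableSpace A] {m : Measure A} (hU :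
    IsOpen U) {F : ℂ → A → ℂ} {bound : A → ℝ} (hmeas : ∀ z ∈ U, AEStronglyMeasurable (F z) m)
    (hd : ∀ᵐ a ∂m, DifferentiableOn ℂ (fun z => F z a) U)
    (hb : ∀ᵐ a ∂m, ∀ z ∈ U, ‖F z a‖ ≤ bound a) (hbi : Integrable bound m) {z0 : ℂ} (hz0 : z0 ∈ U) :
    Integrable (fun a => deriv (fun z => F z a) z0) m ∧
    HasDerivAt (fun z => ∫ a, F z a ∂m) (∫ a, deriv (fun z => F z a) z0 ∂m) z0 := by
  obtain ⟨e, he, heU⟩ := Metric.isOpen_iff.1 hU z0 hz0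
  have hsub : ∀ z ∈ ball z0 (e / 2), closedBall z (e / 4) ⊆ U := fun z hz w hw => by
    apply heU
    rw [mem_ball] at hz ⊢; rw [mem_closedBall] at hw
    linarith [dist_triangle w z z0]
  refine hasDerivAt_integral_of_dominated_loc_of_deriv_le (bound := fun a => bound a / (e / 4))
    (F' := fun z a => deriv (fun z => F z a) z)
    (Metric.ball_mem_nhds z0 (half_pos he)) ?_ ?_ ?_ ?_ (hbi.div_const _) ?_
  · exact (hU.eventually_mem hz0).mono hmeas
  · exact hbi.mono' (hmeas z0 hz0) (hb.mono fun a ha => ha z0 hz0)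
  · let u : ℕ → ℂ := fun k => z0 + ((e / 2 / (k + 1) : ℝ) : ℂ)
    have hut : Tendsto u atTop (𝓝[≠] z0) := by
      have h1 : Tendsto (fun k : ℕ => (e / 2 / (k + 1 : ℝ))) atTop (𝓝 0) := by
        have := (tendsto_one_div_add_atTop_nhds_zero_nat (𝕜 := ℝ)).const_mul (e / 2)
        simpa [div_eq_mul_inv, mul_assoc] using this
      rw [tendsto_nhdsWithin_iff]
      refine ⟨?_, .of_forall fun k => ?_⟩
      · have := (continuous_ofReal.tendsto 0).comp h1
        simpa [u] using this.const_add z0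
      · have : (e / 2 / (k + 1 : ℝ)) ≠ 0 := by positivity
        intro h
        exact this (by exact_mod_cast (add_eq_left.1 h))
    have huU : ∀ k, u k ∈ U := fun k => by
      apply heU
      have h2 : e / 2 / (k + 1) ≤ e / 2 := div_le_self (by positivity) (by linarith)
      simp only [u, mem_ball, dist_self_add_left, norm_real, Real.norm_eq_abs]
      rw [abs_of_pos (by positivity)]; linarith
    refine aestronglyMeasurable_of_tendsto_ae atTop
      (f := fun k a => slope (fun z => F z a) z0 (u k)) (fun k => ?_) ?_
    · simp only [slope_def_field]
      exact AEStronglyMeasurable.mul_const ((hmeas _ (huU k)).sub (hmeas _ hz0)) _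
    · filter_upwards [hd] with a ha
      have := (ha.differentiableAt (hU.mem_nhds hz0)).hasDerivAt
      exact (hasDerivAt_iff_tendsto_slope.1 this).comp hut
  · filter_upwards [hd, hb] with a ha hba z hz
    refine Complex.norm_deriv_le_of_forall_mem_sphere_norm_le (by positivity) ?_ ?_
    · exact ((ha.mono (hsub z hz)).mono
        (Metric.closedBall_subset_closedBall le_rfl)).diffContOnCl_ball subset_rfl
    · exact fun w hw => hba w (hsub z hz (Metric.sphere_subset_closedBall hw))
  · filter_upwards [hd] with a ha z hz
    exact (ha.differentiableAt (hU.mem_nhds (hsub z hz (Metric.mem_closedBall_self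
      (by positivity))))).hasDerivAt

lemma holomorphic_integral {A : Type*} [MeasurableSpace A] {m : Measure A} (hU : IsOpen U) {F : ℂ →
    A → ℂ} (hmeas : ∀ z ∈ U, AEStronglyMeasurable (F z) m)
    (hd : ∀ᵐ a ∂m, DifferentiableOn ℂ (fun z => F z a) U)
    (hb : ∀ z0 ∈ U, ∃ V ∈ 𝓝 z0, ∃ bound : A → ℝ, Integrable bound m ∧
    ∀ᵐ a ∂m, ∀ z ∈ V, z ∈ U → ‖F z a‖ ≤ bound a) :
    DifferentiableOn ℂ (fun z => ∫ a, F z a ∂m) U := fun z0 hz0 => by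
  obtain ⟨V, hV, bound, hbi, hbound⟩ := hb z0 hz0
  refine (hasDerivAt_integral_of_holomorphic (isOpen_interior.inter hU) (fun z hz => hmeas z hz.2)
    (hd.mono fun a ha => ha.mono inter_subset_right)
    (hbound.mono fun a ha z hz => ha z (interior_subset hz.1) hz.2) hbi
    ⟨mem_interior_iff_mem_nhds.2 hV, hz0⟩).2.differentiableAt.differentiableWithinAt

lemma ray_integral_rotation {D : Set ℂ} (hD : IsOpen D) (hDc : IsPreconnected D) (hS : IsOpen S) (hh
    : DifferentiableOn ℂ h S) {a : ℂ} (hmem : ∀ w ∈ D, ∀ r : ℝ, 0 < r → a + r * w ∈ S)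
    (hb : ∀ w0 ∈ D, ∃ V ∈ 𝓝 w0, ∃ g : ℝ → ℝ, IntegrableOn g (Ioi 0) ∧
    Tendsto (fun r => r * g r) (𝓝[>] 0) (𝓝 0) ∧ Tendsto (fun r => r * g r) atTop (𝓝 0) ∧
    ∀ w ∈ V, w ∈ D → ∀ r : ℝ, 0 < r → ‖h (a + r * w)‖ ≤ g r)
    {w1 w2 : ℂ} (hw1 : w1 ∈ D) (hw2 : w2 ∈ D) :
    w1 * ∫ r : ℝ in Ioi 0, h (a + r * w1) = w2 * ∫ r : ℝ in Ioi 0, h (a + r * w2) := by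
  have hcont : ∀ w ∈ D, ContinuousOn (fun r : ℝ => h (a + r * w)) (Ioi 0) := fun w hw =>
    hh.continuousOn.comp (by fun_prop) fun r hr => hmem w hw r hr
  have key : ∀ w ∈ D, HasDerivAt (fun w => w * ∫ r : ℝ in Ioi 0, h (a + r * w)) 0 w := fun w hw =>
    by
    obtain ⟨V, hV, g, hg, hg0, hgi, hgb⟩ := hb w hw
    obtain ⟨hi, hder⟩ := hasDerivAt_integral_of_holomorphic (isOpen_interior.inter hD)
      (fun z hz => (hcont z hz.2).aestronglyMeasurable measurableSet_Ioi) ((ae_Ioi).mono fun r hr =>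
      hh.comp (by fun_prop) fun z hz => hmem z hz.2 r hr) ((ae_Ioi).mono fun r hr z hz =>
      hgb z (interior_subset hz.1) hz.2 r hr) hg ⟨mem_interior_iff_mem_nhds.2 hV, hw⟩
    have hint := hg.mono' ((hcont w hw).aestronglyMeasurable measurableSet_Ioi)
      ((ae_Ioi).mono fun r hr => hgb w (mem_of_mem_nhds hV) hw r hr)
    have hd1 := fun r hr => (hh.differentiableAt (hS.mem_nhds (hmem w hw r hr))).hasDerivAt
    have hdw : ∀ r : ℝ, 0 < r → deriv (fun z => h (a + r * z)) w
      = deriv h (a + r * w) * r := fun r hr => by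
      have h2 : HasDerivAt (fun z : ℂ => a + r * z) (r : ℂ) w := by
        simpa using ((hasDerivAt_id w).const_mul (r : ℂ)).const_add a
      exact ((hd1 r hr).comp w h2).deriv
    have hft : ∫ r : ℝ in Ioi 0, (h (a + r * w) + w * deriv (fun z => h (a + r * z)) w)
      = 0 - (0 : ℝ) * h (a + (0 : ℝ) * w) := by
      refine integral_Ioi_of_hasDerivAt_of_tendsto (f := fun r => (r : ℂ) * h (a + r * w))
        ?_ ?_ ?_ ?_
      · rw [← continuousWithinAt_Ioi_iff_Ici]
        simp only [ContinuousWithinAt, ofReal_zero, zero_mul]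
        refine squeeze_zero_norm' ?_ hg0
        filter_upwards [self_mem_nhdsWithin] with r hr
        rw [norm_mul, norm_coe (le_of_lt hr)]
        exact mul_le_l (hgb w (mem_of_mem_nhds hV) hw r hr) (le_of_lt hr)
      · intro r hr
        rw [hdw r hr]
        have h2 : HasDerivAt (fun r : ℝ => a + r * w) w r := by
          simpa using ((ofRealCLM.hasDerivAt).mul_const w).const_add a
        refine ((ofRealCLM.hasDerivAt).mul ((hd1 r hr).comp_of_eq r h2 rfl)).congr_deriv ?_
        simp; ring
      · exact hint.add (hi.const_mul w)
      · refine squeeze_zero_norm' ?_ hgi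
        filter_upwards [eventually_gt_atTop 0] with r hr
        rw [norm_mul, norm_coe]; exact mul_le_l (hgb w (mem_of_mem_nhds hV) hw r hr)
    rw [integral_add hint (hi.const_mul w), integral_const_mul] at hft
    refine ((hasDerivAt_id w).mul hder).congr_deriv ?_
    simpa using hft
  exact hD.is_const_of_deriv_eq_zero hDc
    (fun w hw => (key w hw).differentiableAt.differentiableWithinAt)
    (fun w hw => (key w hw).deriv) hw1 hw2

lemma hasDerivAt_ray_integral (hU : IsOpen U) (hS : IsOpen S) (hh : DifferentiableOn ℂ h S) {w : ℂ}
    (hmem : ∀ c ∈ U, ∀ r : ℝ, 0 ≤ r → c + r * w ∈ S) {g : ℝ → ℝ} (hg : IntegrableOn g (Ioi 0))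
    (hgi : Tendsto g atTop (𝓝 0)) (hgb : ∀ c ∈ U, ∀ r : ℝ, 0 ≤ r → ‖h (c + r * w)‖ ≤ g r)
    {c : ℂ} (hc : c ∈ U) : HasDerivAt (fun c => w * ∫ r : ℝ in Ioi 0, h (c + r * w)) (-h c) c := by
  have hcont : ∀ c ∈ U, ContinuousOn (fun r : ℝ => h (c + r * w)) (Ioi 0) := fun c hc =>
    hh.continuousOn.comp (by fun_prop) fun r hr => hmem c hc r (le_of_lt hr)
  obtain ⟨hi, hder⟩ := hasDerivAt_integral_of_holomorphic hU
    (fun z hz => (hcont z hz).aestronglyMeasurable measurableSet_Ioi) ((ae_Ioi).mono fun r hr =>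
    hh.comp (by fun_prop) fun z hz => hmem z hz r (le_of_lt hr))
    ((ae_Ioi).mono fun r hr z hz => hgb z hz r (le_of_lt hr)) hg hc
  have hd1 := fun r hr => (hh.differentiableAt (hS.mem_nhds (hmem c hc r hr))).hasDerivAt
  have hdw : ∀ r : ℝ, 0 ≤ r → deriv (fun z => h (z + r * w)) c
    = deriv h (c + r * w) := fun r hr => by
    have h2 : HasDerivAt (fun z => z + r * w) 1 c := (hasDerivAt_id c).add_const _
    simpa [Function.comp_def] using ((hd1 r hr).comp c h2).deriv
  have hdr : ∀ r : ℝ, 0 ≤ r → HasDerivAt (fun r : ℝ => h (c + r * w))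
    (w * deriv (fun z : ℂ => h (z + r * w)) c) r := fun r hr => by
    rw [hdw r hr]
    have h2 : HasDerivAt (fun r : ℝ => c + r * w) w r := by
      simpa using ((ofRealCLM.hasDerivAt).mul_const w).const_add c
    refine ((hd1 r hr).comp_of_eq r h2 rfl).congr_deriv ?_
    ring
  have hft : ∫ r : ℝ in Ioi 0, w * deriv (fun z => h (z + r * w)) c = 0 - h (c + (0 : ℝ) * w) := by
    refine integral_Ioi_of_hasDerivAt_of_tendsto
      (hdr 0 le_rfl).continuousAt.continuousWithinAt (fun r hr => hdr r (le_of_lt hr))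
      (hi.const_mul w) ?_
    refine squeeze_zero_norm' ?_ hgi
    filter_upwards [eventually_ge_atTop 0] with r hr
    exact hgb c hc r hr
  rw [integral_const_mul] at hft
  refine (hder.const_mul w).congr_deriv ?_
  simpa using hft

end

section

variable {w x : ℂ} {F G : ℂ → ℂ} {v v' a C : ℝ}

/-- The convolution `∫₀ᵖ F(s) G(p-s) ds` along the segment from `0` to `p`. -/
def lconv (F G : ℂ → ℂ) (p : ℂ) : ℂ :=
  p * ∫ s in (0 : ℝ)..1, F (s * p) * G (((1 - s : ℝ) : ℂ) * p)

/-- The Laplace integral `∫ F(p) e^{-px} dp` along the ray with direction `w`. -/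
def rayLap (w : ℂ) (F : ℂ → ℂ) (x : ℂ) : ℂ :=
  w * ∫ r : ℝ in Ioi 0, F (r * w) * cexp (-(r * w * x))

/-- Integrability of `F` along the ray with direction `w`, against `e^{-vr}`. -/
def RayExp (w : ℂ) (F : ℂ → ℂ) (v : ℝ) : Prop :=
  IntegrableOn (fun r : ℝ => F (r * w) * ((exp (-(v * r)) : ℝ) : ℂ)) (Ioi 0)

lemma RayExp.integrable (h : RayExp w F v) (hx : v ≤ (w * x).re) :
    IntegrableOn (fun r : ℝ => F (r * w) * cexp (-(r * w * x))) (Ioi 0) := by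
  have h2 : IntegrableOn (fun r : ℝ => (F (r * w) * ((exp (-(v * r)) : ℝ) : ℂ)) *
    cexp (v * r - (r * w * x))) (Ioi 0) := by
    refine Integrable.mul_bdd (c := 1) h (by fun_prop) ?_
    filter_upwards [ae_Ioi] with r hr
    rw [norm_exp]
    refine exp_le_one_iff.2 ?_
    have : (v * r - r * w * x).re = r * (v - (w * x).re) := by
      rw [mul_assoc, sub_re, re_ofReal_mul, re_ofReal_mul, ofReal_re]; ring
    rw [this]; exact mul_nonpos_of_nonneg_of_nonpos (le_of_lt hr) (by linarith)
  refine h2.congr_fun (fun r _ => ?_) measurableSet_Ioi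
  simp only; rw [mul_assoc, ofReal_exp, ← Complex.exp_add]
  congr 2
  push_cast; ring

lemma RayExp.mono (h : RayExp w F v) (hv : v ≤ v') : RayExp w F v' := by
  have h2 : IntegrableOn (fun r : ℝ => (F (r * w) * ((exp (-(v * r)) : ℝ) : ℂ)) *
    ((exp (-((v' - v) * r)) : ℝ) : ℂ)) (Ioi 0) := by
    refine Integrable.mul_bdd (c := 1) h (by fun_prop) ?_
    filter_upwards [ae_Ioi] with r hr
    rw [norm_coe]
    refine exp_le_one_iff.2 ?_
    have := mul_nonneg (sub_nonneg.2 hv) (le_of_lt hr)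
    linarith
  refine h2.congr_fun (fun r _ => ?_) measurableSet_Ioi
  simp only; rw [mul_assoc, ← ofReal_mul, ← exp_add]
  ring_nf

lemma RayExp.mul_pow (h : RayExp w F v) (hv : v < v') (j : ℕ) :
    RayExp w (fun p => (-p) ^ j * F p) v' := by
  have h2 : IntegrableOn (fun r : ℝ => (F (r * w) * ((exp (-(v * r)) : ℝ) : ℂ)) *
    ((-(r * w)) ^ j * ((exp (-((v' - v) * r)) : ℝ) : ℂ))) (Ioi 0) := by
    refine Integrable.mul_bdd (c := ‖w‖ ^ j * (j.factorial / (v' - v) ^ j)) h (by fun_prop) ?_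
    filter_upwards [ae_Ioi] with r hr
    have hr' : 0 < r := hr
    rw [norm_mul, norm_pow, norm_neg, norm_mul, norm_real, norm_coe, norm_of_nonneg hr'.le,
      _root_.mul_pow, mul_comm (r ^ j), mul_assoc]
    refine mul_le_l ?_
    have h3 := pow_div_factorial_le_exp ((v' - v) * r) (by positivity) j
    rw [exp_neg, ← div_eq_mul_inv, div_le_div_iff₀ (exp_pos _) (by positivity)]
    rw [div_le_iff₀ (by positivity), _root_.mul_pow] at h3; linarith
  refine h2.congr_fun (fun r _ => ?_) measurableSet_Ioi
  simp only
  rw [show ∀ a b c d, a * b * (c * d) = c * a * (b * d) by intros; ring, ← ofReal_mul, ← exp_add]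
  ring_nf

lemma RayExp.const_mul (h : RayExp w F v) (c : ℂ) : RayExp w (fun p => c * F p) v := by
  refine (Integrable.const_mul h c).congr (.of_forall fun r => ?_)
  ring

lemma RayExp.add (hF : RayExp w F v) (hG : RayExp w G v) : RayExp w (fun p => F p + G p) v := by
  refine (Integrable.add hF hG).congr (.of_forall fun r => ?_)
  simp; ring

lemma RayExp.of_bound {B : ℝ → ℝ}
    (hF : AEStronglyMeasurable (fun r : ℝ => F (r * w)) (volume.restrict (Ioi 0)))
    (hB : IntegrableOn (fun r => B r * exp (-(v * r))) (Ioi 0))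
    (hFB : ∀ r : ℝ, 0 < r → ‖F (r * w)‖ ≤ B r) : RayExp w F v := by
  refine Integrable.mono' hB (hF.mul (by fun_prop)) ?_
  filter_upwards [ae_Ioi] with r hr
  rw [norm_mul, norm_coe]; exact mul_le_r (hFB r hr)

lemma integrableOn_rpow_exp {c : ℝ} (ha : 0 < a) (hc : 0 < c) :
    IntegrableOn (fun r : ℝ => r ^ (a - 1) * exp (-(c * r))) (Ioi 0) := by
  have := integrableOn_rpow_mul_exp_neg_mul_rpow (s := a - 1) (by linarith) one_pos hc
  simpa using this

lemma RayExp.of_rpow_bound {v0 : ℝ} (ha : 0 < a) (hv : v0 < v)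
    (hF : AEStronglyMeasurable (fun r : ℝ => F (r * w)) (volume.restrict (Ioi 0)))
    (hFB : ∀ r : ℝ, 0 < r → ‖F (r * w)‖ ≤ C * r ^ (a - 1) * exp (v0 * r)) : RayExp w F v := by
  refine RayExp.of_bound hF ?_ hFB
  refine IntegrableOn.congr_fun ((integrableOn_rpow_exp ha (sub_pos.2 hv)).const_mul C)
    (fun r _ => ?_) measurableSet_Ioi
  rw [mul_assoc (C * _), ← exp_add, mul_assoc]; ring_nf

lemma lconv_ray (F G : ℂ → ℂ) (w : ℂ) (r : ℝ) :
    lconv F G (r * w) = w * ∫ u in (0 : ℝ)..r, F (u * w) * G (((r - u : ℝ) : ℂ) * w) := by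
  have h := intervalIntegral.smul_integral_comp_mul_right (a := 0) (b := 1)
    (fun u => F (u * w) * G (((r - u : ℝ) : ℂ) * w)) r
  simp only [zero_mul, one_mul] at h; rw [← h, lconv, real_smul]
  rw [show ∀ a b c, a * (b * c) = b * a * c by intros; ring]; congr 2
  ext s
  congr 2 <;> push_cast <;> ring

lemma RayExp.lconv (hF : RayExp w F v) (hG : RayExp w G v) : RayExp w (lconv F G) v := by
  have h := integrable_posConvolution hF hG (ContinuousLinearMap.mul ℝ ℂ)
  have h2 := (h.integrableOn (s := Ioi 0)).const_mul w
  refine IntegrableOn.congr_fun h2 (fun r hr => ?_) measurableSet_Ioi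
  simp only [posConvolution, indicator_of_mem hr, ContinuousLinearMap.mul_apply']
  rw [lconv_ray, mul_assoc, ← intervalIntegral.integral_mul_const]; congr 1
  refine intervalIntegral.integral_congr fun u _ => ?_
  rw [show ∀ a b c d : ℂ, a * b * (c * d) = a * c * (b * d) by intros; ring,
    ← ofReal_mul, ← exp_add]
  congr 3; ring

lemma rayLap_lconv (hF : RayExp w F v) (hG : RayExp w G v) (hx : v ≤ (w * x).re) :
    rayLap w (lconv F G) x = rayLap w F x * rayLap w G x := by
  have h := integral_posConvolution (hF.integrable hx) (hG.integrable hx)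
    (ContinuousLinearMap.mul ℝ ℂ)
  simp only [ContinuousLinearMap.mul_apply'] at h
  rw [rayLap, rayLap, rayLap,
    show ∀ a b c d, a * b * (c * d) = a * (c * (b * d)) by intros; ring, ← h]
  congr 1; rw [← integral_const_mul]
  refine setIntegral_congr_fun measurableSet_Ioi fun r hr => ?_
  rw [lconv_ray, mul_assoc, ← intervalIntegral.integral_mul_const]; congr 1
  refine intervalIntegral.integral_congr fun u _ => ?_
  rw [show ∀ a b c d, a * b * (c * d) = a * c * (b * d) by intros; ring, ← Complex.exp_add]; congr 2
  push_cast; ring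

lemma rayLap_const_mul (w c : ℂ) (F : ℂ → ℂ) (x : ℂ) :
    rayLap w (fun p => c * F p) x = c * rayLap w F x := by
  simp only [rayLap, mul_assoc, integral_const_mul]; ring

lemma rayLap_add (hF : RayExp w F v) (hG : RayExp w G v) (hx : v ≤ (w * x).re) :
    rayLap w (fun p => F p + G p) x = rayLap w F x + rayLap w G x := by
  simp only [rayLap, add_mul]; rw [integral_add (hF.integrable hx) (hG.integrable hx), mul_add]

lemma hasDerivAt_rayLap (hF : RayExp w F v) (hx : v < (w * x).re) :
    HasDerivAt (rayLap w F) (rayLap w (fun p => -p * F p) x) x := by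
  have hU : IsOpen {x : ℂ | v < (w * x).re} := isOpen_lt continuous_const (by fun_prop)
  have hbd : ∀ r ∈ Ioi (0 : ℝ), ∀ z ∈ {x : ℂ | v < (w * x).re}, ‖F (r * w) * cexp (-(r * w * z))‖ ≤
    ‖F (r * w) * ((exp (-(v * r)) : ℝ) : ℂ)‖ := fun r hr z hz => by
    rw [norm_mul, norm_mul, norm_exp, norm_coe]
    refine mul_le_l (exp_le_exp.2 ?_)
    rw [neg_re, mul_assoc, re_ofReal_mul, neg_le_neg_iff, mul_comm]
    exact mul_le_l (le_of_lt hz) (le_of_lt hr)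
  obtain ⟨-, h⟩ := hasDerivAt_integral_of_holomorphic (m := volume.restrict (Ioi (0 : ℝ)))
    (F := fun x (r : ℝ) => F (r * w) * cexp (-(r * w * x)))
    (bound := fun r => ‖F (r * w) * ((exp (-(v * r)) : ℝ) : ℂ)‖) hU
    (fun z hz => (hF.integrable (le_of_lt hz)).1) (.of_forall fun r => by fun_prop)
    ((ae_Ioi).mono hbd) hF.norm hx
  refine (h.const_mul w).congr_deriv ?_
  rw [rayLap]; congr 1
  refine integral_congr_ae (.of_forall fun r => ?_)
  have h1 : HasDerivAt (fun z => -(r * w * z)) (-(r * w)) x := by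
    simpa using! ((hasDerivAt_id x).const_mul (r * w)).neg
  have := (h1.cexp.const_mul (F (r * w))).deriv
  simp only at this ⊢; rw [this]
  ring

lemma iteratedDeriv_rayLap (hF : RayExp w F v) (j : ℕ) : ∀ {x : ℂ}, v < (w * x).re →
    iteratedDeriv j (rayLap w F) x = rayLap w (fun p => (-p) ^ j * F p) x := by
  induction j with
  | zero => intro x _; simp
  | succ j ih =>
    intro x hx
    obtain ⟨v', h1, h2⟩ := exists_between hx
    have hU : IsOpen {x : ℂ | v < (w * x).re} := isOpen_lt continuous_const (by fun_prop)
    rw [iteratedDeriv_succ]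
    have : iteratedDeriv j (rayLap w F) =ᶠ[𝓝 x] rayLap w (fun p => (-p) ^ j * F p) := by
      filter_upwards [hU.mem_nhds hx] with y hy using ih hy
    rw [this.deriv_eq, (hasDerivAt_rayLap (hF.mul_pow h1 j) h2).deriv]; congr 1
    ext p
    ring

lemma rayLap_rotation {D : Set ℂ} (hD : IsOpen D) (hDc : IsPreconnected D)
    (h0 : (0 : ℂ) ∉ D) (hcone : ∀ w ∈ D, ∀ r : ℝ, 0 < r → r * w ∈ D)
    (hF : DifferentiableOn ℂ F D) (ha : 0 < a)
    (hFb : ∀ p ∈ D, ‖F p‖ ≤ C * ‖p‖ ^ (a - 1) * exp (v * ‖p‖))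
    (hx : ∀ w ∈ D, v * ‖w‖ < (w * x).re) {w1 w2 : ℂ} (hw₁ : w1 ∈ D) (hw₂ : w2 ∈ D) :
    rayLap w1 F x = rayLap w2 F x := by
  have key := ray_integral_rotation hD hDc (h := fun p => F p * cexp (-(p * x))) (S := D)
    hD (hF.mul (by fun_prop)) (a := 0) (fun w hw r hr => by simpa using hcone w hw r hr) ?_ hw₁ hw₂
  · simpa [rayLap] using key
  intro w0 hw0
  set d := ((w0 * x).re - v * ‖w0‖) / 2 with hd
  have hd0 := half_pos (sub_pos.2 (hx w0 hw0))
  have e1 : ∀ᶠ w in 𝓝 w0, ‖w‖ ^ (a - 1) < ‖w0‖ ^ (a - 1) + 1 := by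
    have : ContinuousAt (fun w => ‖w‖ ^ (a - 1)) w0 :=
      continuous_norm.continuousAt.rpow_const (Or.inl (norm_ne_zero_iff.2 (fun h => h0 (h ▸ hw0))))
    exact this.eventually (gt_mem_nhds (lt_add_one _))
  have e2 : ∀ᶠ w in 𝓝 w0, d < (w * x).re - v * ‖w‖ := by
    have : Continuous (fun w => (w * x).re - v * ‖w‖) := by fun_prop
    exact this.continuousAt.eventually (lt_mem_nhds (by rw [hd]; linarith))
  refine ⟨_, e1.and e2, fun r => |C| * (‖w0‖ ^ (a - 1) + 1) *
    (r ^ (a - 1) * exp (-(d * r))), (integrableOn_rpow_exp ha hd0).const_mul _, ?_, ?_, ?_⟩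
  · have h1 : Tendsto (fun r => |C| * (‖w0‖ ^ (a - 1) + 1) * (r ^ a * exp (-(d * r))))
      (𝓝[>] 0) (𝓝 0) := by
      have h2 : Continuous (fun r => |C| * (‖w0‖ ^ (a - 1) + 1) * (r ^ a * exp (-(d * r)))) :=
        continuous_const.mul ((continuous_rpow_const ha.le).mul (by fun_prop))
      have := h2.tendsto 0
      simp only [zero_rpow ha.ne', zero_mul, mul_zero] at this
      exact this.mono_left nhdsWithin_le_nhds
    refine h1.congr' ?_
    filter_upwards [self_mem_nhdsWithin] with r hr
    rw [rpow_sub_one (ne_of_gt hr)]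
    field_simp [ne_of_gt (mem_Ioi.1 hr)]
  · have h1 := (tendsto_rpow_mul_exp_neg_mul_atTop_nhds_zero a d hd0).const_mul
      (|C| * (‖w0‖ ^ (a - 1) + 1))
    rw [mul_zero] at h1
    refine h1.congr' ?_
    filter_upwards [eventually_gt_atTop 0] with r hr
    rw [rpow_sub_one (ne_of_gt hr)]
    field_simp
  · rintro w ⟨hw1, hw2⟩ hwD r hr
    rw [zero_add, norm_mul, norm_exp]
    have h3 := hFb _ (hcone w hwD r hr)
    rw [norm_mul, norm_coe, mul_rpow hr.le (norm_nonneg _)] at h3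
    calc _ ≤ (C * (r ^ (a - 1) * ‖w‖ ^ (a - 1)) * exp (v * (r * ‖w‖))) *
      exp (-(r * w * x)).re := mul_le_r h3
      _ = C * ‖w‖ ^ (a - 1) * (r ^ (a - 1) * exp (-(((w * x).re - v * ‖w‖) * r))) := by
          rw [neg_re, mul_assoc (r : ℂ), re_ofReal_mul, mul_assoc (C * _),
            ← exp_add, show v * (r * ‖w‖) + -(r * (w * x).re) =
            -(((w * x).re - v * ‖w‖) * r) by ring]
          ring
      _ ≤ _ := by
          have hp : 0 ≤ ‖w‖ ^ (a - 1) := by positivity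
          have hp2 : 0 ≤ r ^ (a - 1) := by positivity
          refine mul_le_lr ?_ ?_
          · exact (mul_le_r (le_abs_self C)).trans (mul_le_l hw1.le)
          · refine mul_le_l (exp_le_exp.2 ?_)
            have := mul_le_r hw2.le hr.le
            linarith

open FourierTransform in
lemma eq_zero_of_rayLap_eq_zero {N : ℝ}
    (hc : ContinuousOn (fun r : ℝ => F r) (Ioi 0)) (hF : RayExp 1 F N)
    (h0 : ∀ x : ℂ, x.re = N → rayLap 1 F x = 0) {r : ℝ} (hr : 0 < r) : F r = 0 := by
  set f := indicator (Ioi 0) (fun r : ℝ => F r * ((exp (-(N * r)) : ℝ) : ℂ)) with hf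
  have hfi : Integrable f := by
    rw [hf, integrable_indicator_iff measurableSet_Ioi]
    simpa [RayExp] using hF
  have hff : 𝓕 f = 0 := by
    ext y
    rw [fourier_eq']
    have h1 := h0 (N + 2 * π * y * I) (by simp)
    rw [rayLap, one_mul, ← integral_indicator measurableSet_Ioi] at h1; rw [Pi.zero_apply, ← h1]
    refine integral_congr_ae (.of_forall fun v => ?_)
    simp only [hf]
    by_cases hv : v ∈ Ioi 0
    · rw [indicator_of_mem hv, indicator_of_mem hv, smul_eq_mul, mul_one, ofReal_exp,
        show ∀ a b c, a * (b * c) = b * (a * c) by intros; ring, ← Complex.exp_add]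
      congr 2; simp
      ring
    · simp [indicator_of_notMem hv]
  have hinv := hfi.fourierInv_fourier_eq (v := r) (by rw [hff]; exact integrable_zero _ _ _) ?_
  · rw [hff] at hinv
    have h2 : (𝓕⁻ (0 : ℝ → ℂ)) r = 0 := by rw [fourierInv_eq']; simp
    rw [h2, hf, indicator_of_mem (mem_Ioi.2 hr)] at hinv
    exact (mul_eq_zero.1 hinv.symm).resolve_right (by exact_mod_cast (exp_pos _).ne')
  · have h4 : ContinuousOn (fun r : ℝ => F r * ((exp (-(N * r)) : ℝ) : ℂ)) (Ioi 0) :=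
      hc.mul (by fun_prop)
    refine (h4.continuousAt (Ioi_mem_nhds hr)).congr ?_
    filter_upwards [Ioi_mem_nhds hr] with v hv
    rw [hf, indicator_of_mem hv]

end

section

variable {r s R c : ℝ} {w : ℂ}

/-- The truncated cone `|z| > r`, `Re z > -s|z|`. -/
def cone (s r : ℝ) : Set ℂ := {z | r < ‖z‖ ∧ -(s * ‖z‖) < z.re}

lemma wideSector_eq_cone {f : ℝ} (h0 : 0 ≤ f) (h1 : f ≤ π / 2) (hr : 0 ≤ r) :
    wideSector f r = cone (sin f) r := by
  ext z
  refine and_congr_right fun hz => ?_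
  rw [← norm_mul_cos_arg z, ← cos_abs, ← neg_mul, mul_comm (-_),
    mul_lt_mul_iff_right₀ (hr.trans_lt hz), ← cos_add_pi_div_two, add_comm f]
  exact (strictAntiOn_cos.lt_iff_gt ⟨by linarith, by linarith⟩ ⟨abs_nonneg _, abs_arg_le_pi z⟩).symm

lemma isOpen_cone (s r : ℝ) : IsOpen (cone s r) :=
    (isOpen_lt continuous_const continuous_norm).inter (isOpen_lt (by fun_prop) continuous_re)

lemma cone_smul {z : ℂ} (hr : 0 < r) : r * z ∈ cone s (r * R) ↔ z ∈ cone s R := by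
  simp only [cone, mem_ofPred_eq, norm_mul, norm_coe hr.le, re_ofReal_mul]
  rw [mul_lt_mul_iff_right₀ hr, mul_left_comm, ← mul_neg, mul_lt_mul_iff_right₀ hr]

lemma cone_mono {s' r' : ℝ} (hs : s ≤ s') (hr : r' ≤ r) : cone s r ⊆ cone s' r' := fun z hz =>
    ⟨hr.trans_lt hz.1, lt_of_le_of_lt (neg_le_neg (mul_le_r hs)) hz.2⟩

lemma zero_notMem_cone : (0 : ℂ) ∉ cone s 0 := by simp [cone]

lemma le_re_add_norm_ray (hs : 0 ≤ s) (hc : 0 < c) (hw : -(s * ‖w‖) ≤ w.re) (hr : 0 ≤ r) :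
    (1 - s) * c ≤ ((c : ℂ) + r * w).re + s * ‖(c : ℂ) + r * w‖ := by
  have h1 : r * ‖w‖ - c ≤ ‖c + r * w‖ := by
    have := norm_sub_norm_le (r * w) (-c)
    rw [norm_neg, norm_mul, norm_coe, norm_coe, sub_neg_eq_add, add_comm] at this
    rwa [add_comm] at this ⊢
  have h2 := mul_le_l h1
  have h3 := mul_le_l hw
  simp; nlinarith

lemma le_norm_ray (hs : 0 ≤ s) (hs1 : s < 1) (hc : 0 < c) (hw : -(s * ‖w‖) ≤ w.re) (hr : 0 ≤ r) :
    (1 - s) / 2 * (c + r * ‖w‖) ≤ ‖(c : ℂ) + r * w‖ := by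
  have h1 : ‖c + r * w‖ ^ 2 = c ^ 2 + 2 * c * r * w.re + (r * ‖w‖) ^ 2 := by
    rw [mul_pow, ← normSq_eq_norm_sq, ← normSq_eq_norm_sq, normSq_apply, normSq_apply]; simp
    ring
  have h3 := mul_le_l hw (mul_nonneg hc.le hr)
  refine abs_le_of_sq_le_sq' ?_ (norm_nonneg _) |>.2
  set y := r * ‖w‖
  nlinarith [sq_nonneg (c - y), mul_nonneg hc.le (by positivity), sq_nonneg (c + y),
    mul_nonneg (sub_nonneg.2 hs1.le) (sq_nonneg (c - y)),
    mul_nonneg (mul_nonneg hs (sub_nonneg.2 hs1.le)) (sq_nonneg (c + y))]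

lemma ray_mem_cone (hs : 0 ≤ s) (hs1 : s < 1) (hc : 0 < c)
    (hR : R < (1 - s) / 2 * c) (hw : -(s * ‖w‖) ≤ w.re) (hr : 0 ≤ r) :
    (c : ℂ) + r * w ∈ cone s R := by
  constructor
  · refine (hR.trans_le ?_).trans_le (le_norm_ray hs hs1 hc hw hr)
    exact mul_le_l (by nlinarith [norm_nonneg w])
  · have := le_re_add_norm_ray hs hc hw hr
    nlinarith

lemma isPreconnected_cone (hs : 0 ≤ s) (hs1 : s < 1) (hR : 0 ≤ R) : IsPreconnected (cone s R) := by
  have h01 : 1 ∈ cone s 0 := by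
    constructor
    · simp
    · rw [norm_one, Complex.one_re]
      linarith
  have h1 : IsPreconnected (cone s 0) := by
    have : StarConvex ℝ 1 (cone s 0) := by
      rw [starConvex_iff_forall_pos h01]
      intro w hw a b ha hb hab
      have := ray_mem_cone (R := 0) hs hs1 ha (by nlinarith) hw.2.le hb.le
      simpa using this
    exact (this.isPathConnected h01).isConnected.isPreconnected
  have h2 : cone s R = (fun x => ((x.1 / ‖x.2‖ : ℝ) : ℂ) * x.2) '' (Ioi R ×ˢ cone s 0) := by
    ext z
    simp only [mem_image, mem_prod, Prod.exists]
    constructor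
    · intro hz
      refine ⟨‖z‖, z, ⟨hz.1, cone_mono le_rfl hR hz⟩, ?_⟩
      rw [div_self (hR.trans_lt hz.1).ne']; simp
    · rintro ⟨r, w, ⟨hr, hw⟩, rfl⟩
      have hr0 := hR.trans_lt hr
      have hw0 := hw.1
      constructor
      · rw [norm_mul, norm_coe, div_mul_cancel₀ _ hw0.ne']
        exact hr
      · have := (cone_smul (s := s) (R := 0) (z := w) (r := r / ‖w‖) (by positivity)).2 hw
        exact this.2
  rw [h2]
  refine (isPreconnected_Ioi.prod h1).image _ ?_
  refine ContinuousOn.mul ?_ (by fun_prop)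
  refine continuous_ofReal.comp_continuousOn ?_
  exact continuousOn_fst.div (by fun_prop) fun x hx => hx.2.1.ne'

end

section

variable {o d r s1 R0 c G : ℝ} {p w : ℂ} {g : ℂ → ℂ}

/-- The direction `i e^{io}` of the upper arm of the contour. -/
def armDir (o : ℝ) : ℂ := ⟨-sin o, cos o⟩

/-- The open cone `sin o Re p - cos o |Im p| > d|p|` around the positive axis. -/
def dualCone (o d : ℝ) : Set ℂ := {p | d * ‖p‖ + cos o * |p.im| < sin o * p.re}

lemma norm_armDir (o : ℝ) : ‖armDir o‖ = 1 := by
  rw [← sq_eq_sq₀ (norm_nonneg _) zero_le_one, ← normSq_eq_norm_sq, normSq_apply]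
  simp only [armDir]; nlinarith [sin_sq_add_cos_sq o]

lemma norm_armDir_conj (o : ℝ) : ‖star (armDir o)‖ = 1 := by rw [norm_star, norm_armDir]

lemma isOpen_dualCone (o d : ℝ) : IsOpen (dualCone o d) := isOpen_lt (by fun_prop) (by fun_prop)

lemma dualCone_smul (hp : p ∈ dualCone o d) (hr : 0 < r) : r * p ∈ dualCone o d := by
  have h : d * ‖p‖ + cos o * |p.im| < sin o * p.re := hp
  show d * ‖r * p‖ + cos o * |(r * p).im| < sin o * (r * p).re
  rw [norm_mul, norm_coe, im_ofReal_mul, re_ofReal_mul, abs_mul, abs_of_pos hr]; nlinarith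

lemma convex_dualCone (hd : 0 ≤ d) (ho : 0 ≤ cos o) :
    Convex ℝ (dualCone o d) := fun p hp q hq a b ha hb hab => by
  have hp : d * ‖p‖ + cos o * |p.im| < sin o * p.re := hp
  have hq : d * ‖q‖ + cos o * |q.im| < sin o * q.re := hq
  show d * ‖a • p + b • q‖ + cos o * |(a • p + b • q).im| < sin o * (a • p + b • q).re
  have h1 : ‖a • p + b • q‖ ≤ a * ‖p‖ + b * ‖q‖ := by
    refine (norm_add_le _ _).trans_eq ?_
    rw [norm_smul, norm_smul, norm_of_nonneg ha, norm_of_nonneg hb]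
  have h2 : |(a • p + b • q).im| ≤ a * |p.im| + b * |q.im| := by
    rw [add_im, smul_im, smul_im, smul_eq_mul, smul_eq_mul]
    refine (abs_add_le _ _).trans_eq ?_
    rw [abs_mul, abs_mul, abs_of_nonneg ha, abs_of_nonneg hb]
  have h3 := mul_le_l h1
  have h4 := mul_le_l h2
  rw [add_re, smul_re, smul_re, smul_eq_mul, smul_eq_mul]
  rcases ha.eq_or_lt with rfl | ha'
  · have : b = 1 := by linarith
    subst this
    nlinarith
  · nlinarith [mul_le_l hq.le]

lemma isPreconnected_dualCone (hd : 0 ≤ d) (ho : 0 ≤ cos o) :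
    IsPreconnected (dualCone o d) := (convex_dualCone hd ho).isPreconnected

lemma dualCone_arm (ho : 0 ≤ cos o) (hp : p ∈ dualCone o d) :
    (armDir o * p).re < -(d * ‖p‖) ∧ (star (armDir o) * p).re < -(d * ‖p‖) := by
  have hp : d * ‖p‖ + cos o * |p.im| < sin o * p.re := hp
  have h1 := mul_le_l (le_abs_self p.im)
  have h2 := mul_le_l (neg_abs_le p.im)
  constructor
  · simp only [armDir, mul_re]
    nlinarith
  · simp only [armDir, mul_re, star_def, conj_re, conj_im]
    nlinarith

lemma re_pos_of_mem_dualCone (hd : 0 ≤ d) (ho : 0 ≤ cos o)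
    (hs : 0 < sin o) (hp : p ∈ dualCone o d) : 0 < p.re := by
  have : 0 ≤ d * ‖p‖ + cos o * |p.im| := by positivity
  exact pos_of_mul_pos_right (this.trans_lt hp) hs.le

lemma zero_notMem_dualCone : (0 : ℂ) ∉ dualCone o d := fun h => by
  have h : d * ‖(0 : ℂ)‖ + cos o * |(0 : ℂ).im| < sin o * (0 : ℂ).re := h
  simp at h

lemma halfPlane_subset_cone (hd : 0 ≤ d) (ho : 0 ≤ cos o)
    (hs0 : 0 < sin o) (hs : sin o ≤ s1) (hR : 0 ≤ R0) (hc : R0 ≤ c)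
    (hw : w ∈ dualCone o d) {x : ℂ} (hx : c * ‖w‖ < (w * x).re) : x ∈ cone s1 R0 := by
  have hre := re_pos_of_mem_dualCone hd ho hs0 hw
  have hw0 : 0 < ‖w‖ := hre.trans_le (re_le_norm w)
  have hw' : d * ‖w‖ + cos o * |w.im| < sin o * w.re := hw
  have him : |w.im| ≤ sin o * ‖w‖ := by
    refine abs_le_of_sq_le_sq' ?_ (by positivity) |>.2
    rw [sq_abs, mul_pow, ← normSq_eq_norm_sq, normSq_apply]
    have h1 : cos o * |w.im| ≤ sin o * w.re := by nlinarith
    have h2 : (cos o * |w.im|) ^ 2 ≤ (sin o * w.re) ^ 2 := pow_le_pow_left₀ (by positivity) h1 2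
    rw [mul_pow, mul_pow, sq_abs] at h2; nlinarith [sin_sq_add_cos_sq o]
  set y := w * x with hy
  have hynorm : ‖y‖ = ‖w‖ * ‖x‖ := norm_mul _ _
  have hyre : 0 < y.re := lt_of_le_of_lt (by positivity [hR.trans hc]) hx
  have hre2 : ‖w‖ ^ 2 * x.re = y.re * w.re + y.im * w.im := by
    rw [hy, ← normSq_eq_norm_sq, normSq_apply, mul_re, mul_im]; ring
  constructor
  · have : c * ‖w‖ < ‖w‖ * ‖x‖ := hynorm ▸ hx.trans_le (re_le_norm y)
    nlinarith
  · have h1 : |y.im * w.im| ≤ (‖w‖ * ‖x‖) * (s1 * ‖w‖) := by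
      rw [abs_mul, ← hynorm]
      exact mul_le_mul (abs_im_le_norm y) (him.trans (mul_le_r hs)) (abs_nonneg _) (norm_nonneg _)
    have h2 := neg_abs_le (y.im * w.im)
    have h3 : 0 < ‖w‖ ^ 2 * (x.re + s1 * ‖x‖) := by nlinarith
    have := pos_of_mul_pos_right h3 (by positivity)
    linarith

/-- Parameters of the contours: the arms with directions `armDir o` and its conjugate lie in the
domain `cone s1 R0`. -/
structure Contour (s1 R0 o : ℝ) : Prop where
  cos_pos : 0 < cos o
  sin_pos : 0 < sin o
  sin_lt : sin o < s1
  lt_one : s1 < 1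
  pos : 0 < R0

/-- The part of the Bromwich integral over one arm of the contour. -/
def armInt (w : ℂ) (c : ℝ) (g : ℂ → ℂ) (p : ℂ) : ℂ :=
  w * ∫ r : ℝ in Ioi 0, g (c + r * w) * cexp ((c + r * w) * p)

/-- The inverse Laplace transform, over the contour with vertex `c`. -/
def invLap (o c : ℝ) (g : ℂ → ℂ) (p : ℂ) : ℂ :=
  (2 * π * I)⁻¹ *
    (armInt (armDir o) c g p - armInt (star (armDir o)) c g p)

lemma norm_exp_ray : ‖cexp ((c + r * w) * p)‖ = exp (c * p.re) * exp (r * (w * p).re) := by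
  rw [norm_exp, ← exp_add, add_mul, add_re, re_ofReal_mul, mul_assoc, re_ofReal_mul]

lemma norm_armInt_le (hw : ‖w‖ = 1) (hd : 0 < d)
    (hp : (w * p).re ≤ -d) (hg : ∀ r : ℝ, 0 < r → ‖g (c + r * w)‖ ≤ G) :
    ‖armInt w c g p‖ ≤ G * exp (c * p.re) / d := by
  have hi : IntegrableOn (fun r => G * exp (c * p.re) * exp (-d * r)) (Ioi 0) :=
    (integrableOn_exp_mul_Ioi (neg_lt_zero.2 hd) 0).const_mul _
  rw [armInt, norm_mul, hw, one_mul]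
  refine (norm_integral_le_of_norm_le hi ?_).trans_eq ?_
  · filter_upwards [ae_Ioi] with r hr
    have hr : 0 < r := hr
    rw [norm_mul, norm_exp_ray, mul_assoc G]
    refine mul_le_mul (hg r hr) (mul_le_l (exp_le_exp.2 ?_)) (by positivity) ((norm_nonneg _).trans
      (hg 1 one_pos))
    nlinarith
  · rw [integral_const_mul, integral_exp_mul_Ioi (neg_lt_zero.2 hd)]
    simp [div_eq_mul_inv]

lemma differentiableOn_armInt (hgc : ContinuousOn (fun r : ℝ => g (c + r * w)) (Ioi 0))
    (hg : ∀ r : ℝ, 0 < r → ‖g (c + r * w)‖ ≤ G) :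
    DifferentiableOn ℂ (armInt w c g) {p | (w * p).re < 0} := by
  refine DifferentiableOn.const_mul ?_ w
  refine holomorphic_integral (isOpen_lt (by fun_prop) continuous_const) (fun z _ => ?_)
    (.of_forall fun r => by fun_prop) fun p0 hp0 => ?_
  · exact (hgc.mul (by fun_prop)).aestronglyMeasurable measurableSet_Ioi
  · have hp0 : (w * p0).re < 0 := hp0
    set d := -(w * p0).re / 2 with hd
    have e1 : ∀ᶠ p in 𝓝 p0, (w * p).re < -d :=
      (show Continuous fun p => (w * p).re by fun_prop).continuousAt.eventually
      (gt_mem_nhds (by rw [hd]; linarith))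
    have e2 : ∀ᶠ p in 𝓝 p0, c * p.re < c * p0.re + 1 :=
      (show Continuous fun p : ℂ => c * p.re by fun_prop).continuousAt.eventually
      (gt_mem_nhds (lt_add_one _))
    refine ⟨_, e1.and e2, fun r => G * exp (c * p0.re + 1) * exp (-d * r),
      (integrableOn_exp_mul_Ioi (neg_lt_zero.2 (by rw [hd]; linarith)) 0).const_mul _, ?_⟩
    filter_upwards [ae_Ioi] with r hr p hp _
    have hr : 0 < r := hr
    rw [norm_mul, norm_exp_ray, mul_assoc G]
    refine mul_le_mul (hg r hr) (mul_le_mul (exp_le_exp.2 hp.2.le) (exp_le_exp.2 ?_)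
      (exp_pos _).le (exp_pos _).le) (by positivity) ((norm_nonneg _).trans (hg 1 one_pos))
    nlinarith

lemma Contour.re_armDir (h : Contour s1 R0 o) :
    -(s1 * ‖armDir o‖) ≤ (armDir o).re ∧ -(s1 * ‖star (armDir o)‖) ≤ (star (armDir o)).re := by
  rw [norm_armDir, norm_armDir_conj]; simp only [armDir, star_def, conj_re]
  have := h.sin_lt
  constructor <;> linarith

lemma Contour.arm_mem (h : Contour s1 R0 o) (hc : R0 < (1 - s1) / 2 * c) (hr : 0 ≤ r) :
    (c : ℂ) + r * armDir o ∈ cone s1 R0 ∧ (c : ℂ) + r * star (armDir o) ∈ cone s1 R0 := by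
  have hs := (h.sin_pos.trans h.sin_lt).le
  have hc0 : 0 < c := by
    have := h.pos.trans hc
    exact pos_of_mul_pos_right this (by linarith [h.lt_one])
  exact ⟨ray_mem_cone hs h.lt_one hc0 hc h.re_armDir.1 hr,
    ray_mem_cone hs h.lt_one hc0 hc h.re_armDir.2 hr⟩

lemma Contour.le_norm_arm (h : Contour s1 R0 o) (hc : 0 < c) (hr : 0 ≤ r) :
    (1 - s1) / 2 * (c + r) ≤ ‖(c : ℂ) + r * armDir o‖ ∧
    (1 - s1) / 2 * (c + r) ≤ ‖(c : ℂ) + r * star (armDir o)‖ := by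
  have hs := (h.sin_pos.trans h.sin_lt).le
  have h1 := le_norm_ray hs h.lt_one hc h.re_armDir.1 hr
  have h2 := le_norm_ray hs h.lt_one hc h.re_armDir.2 hr
  rw [norm_armDir, mul_one] at h1; rw [norm_armDir_conj, mul_one] at h2
  exact ⟨h1, h2⟩

lemma Contour.continuousOn_arm (h : Contour s1 R0 o)
    (hc : R0 < (1 - s1) / 2 * c) (hg : ContinuousOn g (cone s1 R0)) :
    ContinuousOn (fun r : ℝ => g (c + r * armDir o)) (Ioi 0) ∧
    ContinuousOn (fun r : ℝ => g (c + r * star (armDir o))) (Ioi 0) :=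
    ⟨hg.comp (by fun_prop) fun _ hr => (h.arm_mem hc (le_of_lt hr)).1,
    hg.comp (by fun_prop) fun _ hr => (h.arm_mem hc (le_of_lt hr)).2⟩

lemma norm_invLap_le (h : Contour s1 R0 o) (hd : 0 < d) (hc : R0 < (1 - s1) / 2 * c)
    (hG : ∀ z ∈ cone s1 R0, (1 - s1) / 2 * c ≤ ‖z‖ → ‖g z‖ ≤ G) (hp : p ∈ dualCone o d) :
    ‖invLap o c g p‖ ≤ G * exp (c * ‖p‖) / (d * ‖p‖) := by
  have hc0 : 0 < c := pos_of_mul_pos_right (h.pos.trans hc) (by linarith [h.lt_one])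
  have hp0 : 0 < ‖p‖ := norm_pos_iff.2 fun h0 => zero_notMem_dualCone (h0 ▸ hp)
  have hk : 0 ≤ (1 - s1) / 2 := by linarith [h.lt_one]
  obtain ⟨h1, h2⟩ := dualCone_arm h.cos_pos.le hp
  have hG0 : 0 ≤ G := by
    have := h.arm_mem hc le_rfl
    have h3 := (h.le_norm_arm hc0 (le_refl 0)).1
    rw [add_zero] at h3; exact (norm_nonneg _).trans (hG _ this.1 h3)
  have hnorm : ∀ r : ℝ, 0 < r → (1 - s1) / 2 * c ≤ (1 - s1) / 2 * (c + r) := fun r hr =>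
    mul_le_l (by linarith)
  have b1 := norm_armInt_le (norm_armDir o) (mul_pos hd hp0) h1.le
    fun r hr => hG _ (h.arm_mem hc hr.le).1 ((hnorm r hr).trans (h.le_norm_arm hc0 hr.le).1)
  have b2 := norm_armInt_le (norm_armDir_conj o) (mul_pos hd hp0) h2.le fun r hr => hG _ (h.arm_mem
    hc hr.le).2 ((hnorm r hr).trans (h.le_norm_arm hc0 hr.le).2)
  have he : G * exp (c * p.re) / (d * ‖p‖) ≤ G * exp (c * ‖p‖) / (d * ‖p‖) := by
    have := mul_le_l (re_le_norm p) hc0.le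
    gcongr
  have hpi : ‖(2 * π * I)⁻¹‖ ≤ 1 / 2 := by
    simp only [norm_inv, norm_mul, norm_I, norm_real, mul_one]
    rw [norm_of_nonneg pi_pos.le, Complex.norm_ofNat, ← one_div]
    exact one_div_le_one_div_of_le (by norm_num) (by linarith [two_le_pi])
  rw [invLap, norm_mul]
  calc _ ≤ 1 / 2 * (‖armInt (armDir o) c g p‖ + ‖armInt (star (armDir o)) c g p‖) :=
    mul_le_mul hpi (norm_sub_le _ _) (norm_nonneg _) (by norm_num)
    _ ≤ _ := by linarith

lemma differentiableOn_invLap (h : Contour s1 R0 o) (hd : 0 ≤ d)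
    (hc : R0 < (1 - s1) / 2 * c) (hg : ContinuousOn g (cone s1 R0))
    (hG : ∀ z ∈ cone s1 R0, ‖g z‖ ≤ G) : DifferentiableOn ℂ (invLap o c g) (dualCone o d) := by
  have hcont := h.continuousOn_arm hc hg
  refine (((differentiableOn_armInt hcont.1 (fun r hr => hG _ (h.arm_mem hc (le_of_lt hr)).1)).mono
    fun p hp => ?_).sub ((differentiableOn_armInt hcont.2 (fun r hr => hG _ (h.arm_mem hc (le_of_lt
    hr)).2)).mono fun p hp => ?_)).const_mul _
  · have := (dualCone_arm h.cos_pos.le hp).1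
    show (armDir o * p).re < 0
    nlinarith [mul_nonneg hd (norm_nonneg p)]
  · have := (dualCone_arm h.cos_pos.le hp).2
    show (star (armDir o) * p).re < 0
    nlinarith [mul_nonneg hd (norm_nonneg p)]

lemma hasDerivAt_armInt_vertex {c0 : ℝ} (hs : 0 ≤ s1) (hs1 : s1 < 1)
    (hR : 0 < R0) (hw1 : ‖w‖ = 1) (hw : -(s1 * ‖w‖) ≤ w.re) (hp : (w * p).re < 0)
    (hc : R0 < (1 - s1) / 2 * c0) (hg : DifferentiableOn ℂ g (cone s1 R0))
    (hG : ∀ z ∈ cone s1 R0, ‖g z‖ ≤ G) :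
    HasDerivAt (fun c : ℝ => armInt w c g p) (-(g c0 * cexp (c0 * p))) c0 := by
  have hc0 : 0 < c0 := pos_of_mul_pos_right (hR.trans hc) (by linarith)
  set e := min ((1 - s1) * c0 / 2) ((1 - s1) / 2 * c0 - R0)
  have hmem : ∀ c ∈ ball (c0 : ℂ) e, ∀ r : ℝ, 0 ≤ r → c + r * w ∈ cone s1 R0 := fun c hcm r hr => by
    rw [mem_ball, dist_eq_norm] at hcm
    have h1 := le_re_add_norm_ray hs hc0 hw hr
    have h2 := le_norm_ray hs hs1 hc0 hw hr
    have h3 : c + r * w = (c0 + r * w) + (c - c0) := by ring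
    have h4 : ‖(c0 : ℂ) + r * w‖ ≤ ‖c + r * w‖ + ‖c - c0‖ := by
      have := norm_sub_le (c + r * w) (c - c0)
      rwa [h3, add_sub_cancel_right, ← h3] at this
    have h5 : ((c0 : ℂ) + r * w).re ≤ (c + r * w).re + ‖c - c0‖ := by
      rw [h3, add_re _ (c - c0)]; linarith [(abs_le.1 (abs_re_le_norm (c - c0))).1]
    have h6 := hcm.trans_le (min_le_left _ _)
    have h7 := hcm.trans_le (min_le_right _ _)
    have h8 : (1 - s1) / 2 * c0 ≤ (1 - s1) / 2 * (c0 + r * ‖w‖) :=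
      mul_le_l (by nlinarith [norm_nonneg w])
    constructor
    · linarith
    · have := mul_le_l h4
      have h9 : s1 * ‖c - c0‖ ≤ ‖c - c0‖ := by nlinarith [norm_nonneg (c - c0)]
      linarith
  have hder := hasDerivAt_ray_integral (h := fun z => g z * cexp (z * p))
    (g := fun r => G * exp ((c0 + e) * ‖p‖) * exp ((w * p).re * r)) isOpen_ball (isOpen_cone s1 R0)
    (hg.mul (by fun_prop)) (w := w) hmem ((integrableOn_exp_mul_Ioi hp 0).const_mul _)
    ?_ ?_ (Metric.mem_ball_self (lt_min (by nlinarith) (by linarith)))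
  · have := hder.scomp_of_eq c0 (ofRealCLM.hasDerivAt) rfl
    simpa [armInt, Function.comp_def] using this
  · have h1 := (tendsto_exp_atBot.comp ((tendsto_const_mul_atBot_of_neg hp).2 tendsto_id)).const_mul
      (G * exp ((c0 + e) * ‖p‖))
    simpa using h1
  · intro c hcm r hr
    have hm := hG _ (hmem c hcm r hr)
    rw [norm_mul, norm_exp, mul_assoc, ← exp_add]
    refine mul_le_mul hm (exp_le_exp.2 ?_) (exp_pos _).le ((norm_nonneg _).trans hm)
    rw [add_mul, add_re, mul_assoc, re_ofReal_mul, mul_comm r]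
    refine add_le_add ?_ le_rfl
    refine (re_le_norm _).trans ?_
    rw [norm_mul]
    refine mul_le_r ?_
    rw [mem_ball, dist_eq_norm] at hcm
    have := norm_add_le (c0 : ℂ) (c - c0)
    rw [add_sub_cancel, norm_coe] at this; linarith

lemma invLap_vertex_eq {c' : ℝ} (h : Contour s1 R0 o) (hd : 0 ≤ d)
    (hc : R0 < (1 - s1) / 2 * c) (hc' : R0 < (1 - s1) / 2 * c')
    (hg : DifferentiableOn ℂ g (cone s1 R0))
    (hG : ∀ z ∈ cone s1 R0, ‖g z‖ ≤ G) (hp : p ∈ dualCone o d) :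
    invLap o c g p = invLap o c' g p := by
  have hk : 0 < (1 - s1) / 2 := by linarith [h.lt_one]
  have hs := (h.sin_pos.trans h.sin_lt).le
  obtain ⟨h1, h2⟩ := dualCone_arm h.cos_pos.le hp
  have hn := mul_nonneg hd (norm_nonneg p)
  have key : ∀ c : ℝ, c ∈ Ioi (R0 / ((1 - s1) / 2)) →
    HasDerivAt (fun c => invLap o c g p) 0 c := fun c hc => by
    have hc : R0 < (1 - s1) / 2 * c := by rw [mem_Ioi, div_lt_iff₀ hk] at hc; linarith
    refine (((hasDerivAt_armInt_vertex hs h.lt_one h.pos (norm_armDir o) h.re_armDir.1 (by linarith)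
      hc hg hG).sub (hasDerivAt_armInt_vertex hs h.lt_one h.pos (norm_armDir_conj o) h.re_armDir.2
      (by linarith) hc hg hG)).const_mul _).congr_deriv (by simp)
  refine isOpen_Ioi.is_const_of_deriv_eq_zero isPreconnected_Ioi
    (fun c hc => (key c hc).differentiableAt.differentiableWithinAt)
    (fun c hc => (key c hc).deriv) ?_ ?_ <;>
  · rw [mem_Ioi, div_lt_iff₀ hk]
    linarith

end

section

variable {k c C Z : ℝ} {D S : Set ℂ} {h : ℂ → ℂ}

lemma integrableOn_one_add_rpow (hk : 0 < k) :
    IntegrableOn (fun r : ℝ => (1 + r) ^ (-1 - k)) (Ioi 0) := by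
  have := integrableOn_add_rpow_Ioi_of_lt (a := -1 - k) (c := 0) (m := 1) (by linarith)
    (by norm_num)
  simpa [add_comm] using this

lemma exists_ray_bound_of_decay (hD : IsOpen D) (h0 : (0 : ℂ) ∉ D) (hh : ContinuousOn h S)
    (hc : 0 < c) (hmem : ∀ w ∈ D, ∀ r : ℝ, 0 ≤ r → (c : ℂ) + r * w ∈ S) {K : ℝ} (hK : 0 < K)
    (hb : ∀ z ∈ S, Z ≤ ‖z‖ → ‖h z‖ ≤ C * ‖z‖ ^ (-1 - K)) {w0 : ℂ} (hw0 : w0 ∈ D) :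
    ∃ V ∈ 𝓝 w0, ∃ A : ℝ, 0 ≤ A ∧ ∀ w ∈ V, w ∈ D → ∀ r : ℝ, 0 < r →
    ‖h (c + r * w)‖ ≤ A * (1 + r) ^ (-1 - K) := by
  have hw0' : 0 < ‖w0‖ := norm_pos_iff.2 fun h => h0 (h ▸ hw0)
  obtain ⟨E, hE, hED⟩ := Metric.isOpen_iff.1 hD w0 hw0
  set e := min (E / 2) (‖w0‖ / 2)
  have he0 : 0 < e := lt_min (by linarith) (by linarith)
  set k := ‖w0‖ / 2 with hk
  have hk0 : 0 < k := by rw [hk]; linarith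
  have hball : ∀ w ∈ closedBall w0 e, w ∈ D ∧ k ≤ ‖w‖ := fun w hw => by
    rw [mem_closedBall, dist_eq_norm] at hw
    constructor
    · apply hED
      rw [mem_ball, dist_eq_norm]; linarith [min_le_left (E / 2) (‖w0‖ / 2)]
    · have := norm_sub_norm_le w0 w
      rw [norm_sub_rev] at this; linarith [min_le_right (E / 2) (‖w0‖ / 2)]
  set R := max (2 * c / k) (2 * Z / k)
  have hlow : ∀ w ∈ closedBall w0 e, ∀ r : ℝ, R ≤ r → r * k / 2 ≤ ‖c + r * w‖ := fun w hw r hr => by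
    have h1 : 2 * c ≤ r * k := by
      have := (le_max_left _ _).trans hr
      rwa [div_le_iff₀ hk0] at this
    have hr0 := (by positivity : 0 ≤ 2 * c / k).trans ((le_max_left _ _).trans hr)
    have h2 := norm_sub_norm_le (r * w) (-c)
    rw [norm_neg, norm_mul, norm_coe, norm_coe, sub_neg_eq_add, add_comm] at h2
    have h3 := mul_le_l (hball w hw).2 hr0
    rw [add_comm]; rw [add_comm] at h2
    linarith
  obtain ⟨M, hM⟩ : ∃ M, ∀ x ∈ closedBall w0 e ×ˢ Icc (0 : ℝ) R, ‖h (c + x.2 * x.1)‖ ≤ M := by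
    refine ((isCompact_closedBall w0 e).prod isCompact_Icc).exists_bound_of_continuousOn ?_
    exact hh.comp (by fun_prop) fun x hx => hmem _ (hball _ hx.1).1 _ hx.2.1
  set A := |M| * (1 + R) ^ (1 + K) + |C| * (k / 2 * (R / (1 + R))) ^ (-1 - K)
  have hA1 : 0 ≤ |M| * (1 + R) ^ (1 + K) := by positivity
  have hA2 : 0 ≤ |C| * (k / 2 * (R / (1 + R))) ^ (-1 - K) := by positivity
  refine ⟨_, Metric.closedBall_mem_nhds w0 he0, A, by positivity, ?_⟩
  intro w hw _ r hr
  have h1r : 0 < 1 + r := by linarith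
  rcases le_total r R with hrR | hrR
  · have h1 := (hM (w, r) ⟨hw, hr.le, hrR⟩).trans (le_abs_self M)
    have h2 : 1 ≤ (1 + R) ^ (1 + K) * (1 + r) ^ (-1 - K) := by
      rw [show -1 - K = -(1 + K) by ring, rpow_neg h1r.le, ← div_eq_mul_inv,
        one_le_div (by positivity)]
      exact rpow_le_rpow h1r.le (by linarith) (by linarith)
    calc _ ≤ |M| * 1 := by rw [mul_one]; exact h1
      _ ≤ |M| * ((1 + R) ^ (1 + K) * (1 + r) ^ (-1 - K)) := mul_le_l h2
      _ = |M| * (1 + R) ^ (1 + K) * (1 + r) ^ (-1 - K) := by ring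
      _ ≤ _ := mul_le_r (by linarith)
  · have hl := hlow w hw r hrR
    have hZr : Z ≤ ‖c + r * w‖ := by
      have := (le_max_right _ _).trans hrR
      rw [div_le_iff₀ hk0] at this; linarith
    have h2 : k / 2 * (R / (1 + R)) * (1 + r) ≤ ‖c + r * w‖ := by
      refine le_trans ?_ hl
      have : R / (1 + R) * (1 + r) ≤ r := by
        rw [div_mul_eq_mul_div, div_le_iff₀ (by positivity)]; nlinarith
      nlinarith
    calc _ ≤ C * ‖c + r * w‖ ^ (-1 - K) := hb _ (hmem w (hball w hw).1 r hr.le) hZr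
      _ ≤ |C| * (k / 2 * (R / (1 + R)) * (1 + r)) ^ (-1 - K) := by
        refine mul_le_mul (le_abs_self C) ?_ (by positivity) (abs_nonneg _)
        exact rpow_anti (by positivity) h2 (by linarith)
      _ = |C| * (k / 2 * (R / (1 + R))) ^ (-1 - K) * (1 + r) ^ (-1 - K) := by
        rw [mul_rpow (by positivity) h1r.le]; ring
      _ ≤ _ := mul_le_r (by linarith)

lemma ray_integral_rotation_of_decay (hD : IsOpen D) (hDc : IsPreconnected D)
    (h0 : (0 : ℂ) ∉ D) (hS : IsOpen S) (hh : DifferentiableOn ℂ h S)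
    (hc : 0 < c) (hmem : ∀ w ∈ D, ∀ r : ℝ, 0 ≤ r → (c : ℂ) + r * w ∈ S) (hk : 0 < k)
    (hb : ∀ z ∈ S, Z ≤ ‖z‖ → ‖h z‖ ≤ C * ‖z‖ ^ (-1 - k)) {w1 w2 : ℂ} (hw1 : w1 ∈ D) (hw2 : w2 ∈ D) :
    w1 * ∫ r : ℝ in Ioi 0, h (c + r * w1) = w2 * ∫ r : ℝ in Ioi 0, h (c + r * w2) := by
  refine ray_integral_rotation hD hDc hS hh (fun w hw r hr => hmem w hw r hr.le) ?_ hw1 hw2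
  intro w0 hw0
  obtain ⟨V, hV, A, hA0, hVA⟩ := exists_ray_bound_of_decay hD h0 hh.continuousOn hc hmem hk hb hw0
  refine ⟨V, hV, fun r => A * (1 + r) ^ (-1 - k),
    (integrableOn_one_add_rpow hk).const_mul _, ?_, ?_, hVA⟩
  · have h1 : ContinuousAt (fun r => r * (A * (1 + r) ^ (-1 - k))) 0 := by
      refine continuousAt_id.mul (continuousAt_const.mul ?_)
      exact (by fun_prop : ContinuousAt (fun r : ℝ => 1 + r) 0).rpow_const (by norm_num)
    have := h1.tendsto
    simp at this; exact this.mono_left nhdsWithin_le_nhds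
  · have h1 : Tendsto (fun r => A * (1 + r) ^ (-k)) atTop (𝓝 0) := by
      have := ((tendsto_rpow_neg_atTop hk).comp
        (tendsto_atTop_add_const_left atTop 1 tendsto_id)).const_mul A
      simpa using this
    refine squeeze_zero' ?_ ?_ h1
    · filter_upwards [eventually_ge_atTop 0] with r hr
      positivity
    · filter_upwards [eventually_ge_atTop 0] with r hr
      have h2 : (1 + r) ^ (-k) = (1 + r) * (1 + r) ^ (-1 - k) := by
        rw [← rpow_one_add' (by linarith) (by linarith)]; ring_nf
      rw [h2]
      have h3 : 0 ≤ A * (1 + r) ^ (-1 - k) := by positivity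
      nlinarith

lemma integrableOn_ray_of_decay (hD : IsOpen D) (h0 : (0 : ℂ) ∉ D) (hh : ContinuousOn h S)
    (hc : 0 < c) (hmem : ∀ w ∈ D, ∀ r : ℝ, 0 ≤ r → (c : ℂ) + r * w ∈ S) (hk : 0 < k)
    (hb : ∀ z ∈ S, Z ≤ ‖z‖ → ‖h z‖ ≤ C * ‖z‖ ^ (-1 - k)) {w : ℂ} (hw : w ∈ D) :
    IntegrableOn (fun r : ℝ => h (c + r * w)) (Ioi 0) := by
  obtain ⟨V, hV, A, hA0, hVA⟩ := exists_ray_bound_of_decay hD h0 hh hc hmem hk hb hw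
  have hcont := hh.comp (by fun_prop) fun r hr => hmem w hw r (le_of_lt hr)
  refine Integrable.mono' ((integrableOn_one_add_rpow hk).const_mul A)
    (hcont.aestronglyMeasurable measurableSet_Ioi) ?_
  filter_upwards [ae_Ioi] with r hr
  exact hVA w (mem_of_mem_nhds hV) hw r hr

lemma integral_poisson_half {u : ℝ} (hu : 0 < u) :
    ∫ r : ℝ in Ioi 0, (2 * u : ℂ) / (((u : ℂ) + r * I) * (u - r * I)) = π := by
  have h1 : ∀ r : ℝ, (2 * u) / ((u + r * I) * (u - r * I))
    = ((2 * u / (u ^ 2 + r ^ 2) : ℝ) : ℂ) := fun r => by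
    have : (u + r * I) * (u - r * I) = u ^ 2 + r ^ 2 := by
      ring_nf
      rw [I_sq]; ring
    rw [this]
    push_cast
    rfl
  simp_rw [h1]
  rw [integral_complex_ofReal]; congr 1
  have h2 : ∀ r ∈ Ici 0, HasDerivAt (fun r => 2 * arctan (r / u))
    (2 * u / (u ^ 2 + r ^ 2)) r := fun r _ => by
    have := (((hasDerivAt_id r).div_const u).arctan).const_mul 2
    refine this.congr_deriv ?_
    simp only [id]
    field_simp
  have h3 : Tendsto (fun r => 2 * arctan (r / u)) atTop (𝓝 π) := by
    have := ((tendsto_nhds_of_tendsto_nhdsWithin tendsto_arctan_atTop).comp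
      (tendsto_id.atTop_div_const hu)).const_mul 2
    simpa using! this.trans (by rw [mul_div_cancel₀ _ two_ne_zero])
  have := integral_Ioi_of_hasDerivAt_of_nonneg' h2 (fun r _ => by positivity) h3
  rw [this]; simp

lemma cauchy_arms {s1 R0 o x : ℝ} (h : Contour s1 R0 o)
    (hc : R0 < (1 - s1) / 2 * c) (hk : 0 < k) (hk1 : k ≤ 1) {g : ℂ → ℂ}
    (hg : DifferentiableOn ℂ g (cone s1 R0))
    (hb : ∀ z ∈ cone s1 R0, ‖g z‖ ≤ C * ‖z‖ ^ (-k)) (hx : c < x) :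
    (armDir o * ∫ r : ℝ in Ioi 0, g (c + r * armDir o) / (x - (c + r * armDir o)))
    - star (armDir o) * (∫ r : ℝ in Ioi 0, g (c + r * star (armDir o)) /
    (x - (c + r * star (armDir o)))) = 2 * π * I * g x := by
  have hs : 0 ≤ s1 := (h.sin_pos.trans h.sin_lt).le
  have hc0 := pos_of_mul_pos_right (h.pos.trans hc) (by linarith [h.lt_one])
  have hx0 := hc0.trans hx
  set a := ((2 * c - x : ℝ) : ℂ) with ha
  have hxS : (x : ℂ) ∈ cone s1 R0 := by
    have := ray_mem_cone (w := 1) hs h.lt_one hc0 hc (by simp; linarith) (r := x - c) (by linarith)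
    simpa using this
  have hxa : (x : ℂ) ≠ a := by
    intro h1
    have := ofReal_injective h1
    linarith
  set S : Set ℂ := cone s1 R0 ∩ {a}ᶜ
  have hSo : IsOpen S := (isOpen_cone _ _).inter isOpen_compl_singleton
  have hray : ∀ w ∈ cone s1 0, ∀ r : ℝ, 0 ≤ r → c + r * w ∈ S := fun w hw r hr => by
    refine ⟨ray_mem_cone hs h.lt_one hc0 hc hw.2.le hr, ?_⟩
    intro h1
    have h1 := h1
    have h2 : (r : ℂ) * w = ((c - x : ℝ) : ℂ) := by
      rw [eq_sub_of_add_eq' h1, ha]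
      push_cast; ring
    rcases hr.eq_or_lt with rfl | hr
    · rw [ofReal_zero, zero_mul] at h2
      have := ofReal_injective (h2 : ((0 : ℝ) : ℂ) = _)
      linarith
    · have h3 := (cone_smul hr).2 hw
      rw [h2] at h3
      have h4 := h3.2
      rw [norm_real, Real.norm_eq_abs, abs_of_neg (by linarith), ofReal_re] at h4
      nlinarith [h.lt_one]
  set f := fun z => g z - g x * ((x - a) / (z - a)) with hf
  have hfx : f x = 0 := by simp [hf, div_self (sub_ne_zero.2 hxa)]
  have hkd : DifferentiableOn ℂ (fun z => (x - a) / (z - a)) S :=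
    (differentiableOn_const _).div (by fun_prop) fun z hz => sub_ne_zero.2 hz.2
  have hfd : DifferentiableOn ℂ f S := (hg.mono inter_subset_left).sub (hkd.const_mul _)
  have hdd := (Complex.differentiableOn_dslope (hSo.mem_nhds ⟨hxS, hxa⟩)).2 hfd
  set Z := max (max (2 * x) (2 * ‖a‖)) 1
  have hfar : ∀ z : ℂ, Z ≤ ‖z‖ → 1 ≤ ‖z‖ ∧ ‖z‖ / 2 ≤ ‖z - x‖ ∧ ‖z‖ / 2 ≤ ‖z - a‖ := fun z hz => by
    have h1 : 2 * x ≤ ‖z‖ := ((le_max_left _ _).trans (le_max_left _ _)).trans hz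
    have h2 : 2 * ‖a‖ ≤ ‖z‖ := ((le_max_right _ _).trans (le_max_left _ _)).trans hz
    refine ⟨(le_max_right _ _).trans hz, ?_, ?_⟩
    · have := norm_sub_norm_le z x
      rw [norm_coe] at this; linarith
    · have := norm_sub_norm_le z a
      linarith
  have hkb : ∀ z : ℂ, Z ≤ ‖z‖ → ‖(x - a) / (z - a)‖ ≤ 2 * ‖x - a‖ * ‖z‖ ^ (-k) := fun z hz => by
    obtain ⟨h1, h2, h3⟩ := hfar z hz
    rw [norm_div, div_le_iff₀ (by linarith)]
    have h4 : ‖z‖⁻¹ ≤ ‖z‖ ^ (-k) := by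
      rw [← rpow_neg_one]; exact rpow_le_rpow_of_exponent_le h1 (by linarith)
    calc ‖x - a‖ = 2 * ‖x - a‖ * (‖z‖⁻¹ * (‖z‖ / 2)) := by field_simp
      _ ≤ 2 * ‖x - a‖ * (‖z‖ ^ (-k) * ‖z - a‖) := by gcongr
      _ = _ := by ring
  have hdiv : ∀ (B : ℝ) (z y : ℂ), Z ≤ ‖z‖ → ‖y‖ ≤ B * ‖z‖ ^ (-k) →
    ‖y / (z - x)‖ ≤ 2 * B * ‖z‖ ^ (-1 - k) := fun B z y hz hy => by
    obtain ⟨h1, h2, h3⟩ := hfar z hz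
    have hz0 : 0 < ‖z‖ := by linarith
    rw [norm_div, div_le_iff₀ (by linarith)]
    refine hy.trans ?_
    have hB := (norm_nonneg _).trans hy
    have h5 : ‖z‖ ^ (-1 - k) = ‖z‖ ^ (-k) * ‖z‖⁻¹ := by
      rw [← rpow_neg_one, ← rpow_add hz0]; congr 1
      ring
    rw [h5]
    calc B * ‖z‖ ^ (-k) = B * ‖z‖ ^ (-k) * (2 * ‖z‖⁻¹ * (‖z‖ / 2)) := by field_simp
      _ ≤ B * ‖z‖ ^ (-k) * (2 * ‖z‖⁻¹ * ‖z - x‖) := by gcongr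
      _ = _ := by ring
  have hds : ∀ z : ℂ, z ≠ x → dslope f x z = f z / (z - x) := fun z hz => by
    rw [dslope_of_ne _ hz, slope_def_field, hfx, sub_zero]
  have hdb : ∀ z ∈ S, Z ≤ ‖z‖ →
    ‖dslope f x z‖ ≤ 2 * (C + ‖g x‖ * (2 * ‖(x : ℂ) - a‖)) * ‖z‖ ^ (-1 - k) := fun z hzS hz => by
    have hzx : z ≠ x := fun h1 => by
      obtain ⟨h2, h3, -⟩ := hfar z hz
      rw [h1, sub_self, norm_zero] at h3; rw [h1] at h2
      linarith
    rw [hds z hzx]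
    refine hdiv _ z _ hz ?_
    refine (norm_sub_le _ _).trans ?_
    rw [norm_mul, add_mul]
    refine add_le_add (hb z hzS.1) ?_
    rw [mul_assoc]; exact mul_le_l (hkb z hz)
  have hD0 : IsOpen (cone s1 0) := isOpen_cone _ _
  have hu1 : armDir o ∈ cone s1 0 := by
    refine ⟨by rw [norm_armDir]; norm_num, ?_⟩
    rw [norm_armDir, mul_one]; exact neg_lt_neg h.sin_lt
  have hu2 : star (armDir o) ∈ cone s1 0 := by
    refine ⟨by rw [norm_armDir_conj]; norm_num, ?_⟩
    rw [norm_armDir_conj, mul_one]; exact neg_lt_neg h.sin_lt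
  set H := fun z => -(((x : ℂ) - a) / (z - a) / (z - x)) with hH
  have hHd : DifferentiableOn ℂ H ({(x : ℂ)}ᶜ ∩ {a}ᶜ) := by
    refine (DifferentiableOn.div ?_ (by fun_prop) fun z hz => sub_ne_zero.2 hz.1).neg
    exact (differentiableOn_const _).div (by fun_prop) fun z hz => sub_ne_zero.2 hz.2
  have hHo : IsOpen ({(x : ℂ)}ᶜ ∩ {a}ᶜ) := isOpen_compl_singleton.inter isOpen_compl_singleton
  have hHb : ∀ z ∈ ({(x : ℂ)}ᶜ ∩ {a}ᶜ : Set ℂ), Z ≤ ‖z‖ →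
    ‖H z‖ ≤ 2 * (2 * ‖x - a‖) * ‖z‖ ^ (-1 - k) := fun z _ hz => by
    rw [hH, norm_neg]; exact hdiv _ z _ hz (hkb z hz)
  have hHray : ∀ w : ℂ, w.im ≠ 0 → ∀ r : ℝ, 0 ≤ r → (c : ℂ) + r * w ∈ ({(x : ℂ)}ᶜ ∩ {a}ᶜ : Set ℂ) :=
    fun w hw r hr => by
    have key : ∀ y : ℝ, y ≠ c → (c : ℂ) + r * w ≠ y := fun y hy h1 => by
      have h2 := congrArg Complex.im h1
      have h3 := congrArg Complex.re h1
      simp only [add_im, ofReal_im, im_ofReal_mul, zero_add, mul_eq_zero, hw, or_false] at h2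
      subst h2
      simp only [ofReal_zero, zero_mul, add_zero, ofReal_re] at h3; exact hy h3.symm
    exact ⟨key x hx.ne', key _ (by linarith)⟩
  have hPo1 : IsOpen {w : ℂ | 0 < w.im} := isOpen_lt continuous_const continuous_im
  have hPo2 : IsOpen {w : ℂ | w.im < 0} := isOpen_lt continuous_im continuous_const
  have him1 : armDir o ∈ {w : ℂ | 0 < w.im} := h.cos_pos
  have him2 : star (armDir o) ∈ {w : ℂ | w.im < 0} := by
    show (star (armDir o)).im < 0
    simp only [armDir, star_def, conj_im]; linarith [h.cos_pos]
  have hn1 : (0 : ℂ) ∉ {w : ℂ | 0 < w.im} := fun h => lt_irrefl (0 : ℝ) h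
  have hn2 : (0 : ℂ) ∉ {w : ℂ | w.im < 0} := fun h => lt_irrefl (0 : ℝ) h
  have hr1 : ∀ w ∈ {w : ℂ | 0 < w.im}, ∀ r : ℝ, 0 ≤ r →
    (c : ℂ) + r * w ∈ ({(x : ℂ)}ᶜ ∩ {a}ᶜ : Set ℂ) := fun w hw => hHray w (ne_of_gt hw)
  have hr2 : ∀ w ∈ {w : ℂ | w.im < 0}, ∀ r : ℝ, 0 ≤ r →
    (c : ℂ) + r * w ∈ ({(x : ℂ)}ᶜ ∩ {a}ᶜ : Set ℂ) := fun w hw => hHray w (ne_of_lt hw)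
  have hP1 := ray_integral_rotation_of_decay hPo1 (convex_halfSpace_im_gt 0).isPreconnected hn1
    hHo hHd hc0 hr1 hk hHb him1 (w2 := I) (by simp)
  have hP2 := ray_integral_rotation_of_decay hPo2 (convex_halfSpace_im_lt 0).isPreconnected hn2
    hHo hHd hc0 hr2 hk hHb him2 (w2 := -I) (by simp)
  have hpois := integral_poisson_half (sub_pos.2 hx)
  have e1 : ∫ r : ℝ in Ioi 0, H (c + r * I) = π := by
    rw [← hpois]; congr 1
    ext r
    simp only [hH, ha]; rw [div_div, ← div_neg]
    push_cast; congr 1 <;> ring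
  have e2 : ∫ r : ℝ in Ioi 0, H (c + r * -I) = π := by
    rw [← hpois]; congr 1
    ext r
    simp only [hH, ha]; rw [div_div, ← div_neg]
    push_cast; congr 1 <;> ring
  have split : ∀ w : ℂ, w ∈ cone s1 0 → w.im ≠ 0 →
    IntegrableOn (fun r : ℝ => dslope f x (c + r * w)) (Ioi 0) →
    IntegrableOn (fun r : ℝ => H (c + r * w)) (Ioi 0) →
    ∫ r : ℝ in Ioi 0, g (c + r * w) / (x - (c + r * w)) =
    -(∫ r : ℝ in Ioi 0, dslope f x (c + r * w)) + g x * ∫ r : ℝ in Ioi 0, H (c + r * w) := fun w hw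
    hwi h1 h2 => by
    rw [← integral_neg, ← integral_const_mul, 
      ← integral_add (f := fun r : ℝ => -dslope f x (c + r * w)) h1.neg (h2.const_mul _)]
    refine setIntegral_congr_fun measurableSet_Ioi fun r hr => ?_
    rw [hds _ (hHray w hwi r (le_of_lt hr)).1, hf, hH]; rw [← neg_sub (c + r * w) x, div_neg]
    ring
  rw [split _ hu1 (ne_of_gt him1) (integrableOn_ray_of_decay hD0 zero_notMem_cone hdd.continuousOn
    hc0 hray hk hdb hu1) (integrableOn_ray_of_decay hPo1 hn1 hHd.continuousOn hc0 hr1 hk hHb him1),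
    split _ hu2 (ne_of_lt him2) (integrableOn_ray_of_decay hD0 zero_notMem_cone hdd.continuousOn hc0
    hray hk hdb hu2) (integrableOn_ray_of_decay hPo2 hn2 hHd.continuousOn hc0 hr2 hk hHb him2)]
  rw [e1] at hP1; rw [e2] at hP2
  linear_combination -(ray_integral_rotation_of_decay hD0 (isPreconnected_cone hs h.lt_one le_rfl)
    zero_notMem_cone hSo hdd hc0 hray hk hdb hu1 hu2) + g x * hP1 - g x * hP2

end

section

variable {o k c C : ℝ} {w x : ℂ} {g : ℂ → ℂ}

lemma exp_neg_le_rpow {y : ℝ} (hy : 0 < y) (h0 : 0 ≤ o) (h1 : o ≤ 1) : exp (-y) ≤ y ^ (-o) := by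
  rw [exp_neg, rpow_neg hy.le]
  refine inv_anti₀ (by positivity) ?_
  rcases le_total y 1 with h | h
  · exact (rpow_le_one hy.le h h0).trans (one_le_exp hy.le)
  · calc _ ≤ y ^ 1 := rpow_le_rpow_of_exponent_le h h1
      _ = y := rpow_one y
      _ ≤ _ := by linarith [add_one_le_exp y]

lemma integrableOn_rpow_mul_one_add_rpow (hk : 0 < k) :
    IntegrableOn (fun r : ℝ => r ^ (k / 2 - 1) * (1 + r) ^ (-k)) (Ioi 0) := by
  have hc : ContinuousOn (fun r : ℝ => r ^ (k / 2 - 1) * (1 + r) ^ (-k)) (Ioi 0) := by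
    refine ContinuousOn.mul ?_ ?_
    · exact continuousOn_id.rpow_const fun r hr => Or.inl (ne_of_gt hr)
    · refine ContinuousOn.rpow_const (by fun_prop) fun r hr => Or.inl ?_
      have : 0 < r := hr
      positivity
  rw [← Ioc_union_Ioi_eq_Ioi (zero_le_one' ℝ)]
  refine IntegrableOn.union ?_ ?_
  · have h1 : IntegrableOn (fun r : ℝ => r ^ (k / 2 - 1)) (Ioc 0 1) := by
      rw [← intervalIntegrable_iff_integrableOn_Ioc_of_le zero_le_one]
      exact intervalIntegrable_rpow' (by linarith)
    refine Integrable.mono' h1 ((hc.mono Ioc_subset_Ioi_self).aestronglyMeasurable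
      measurableSet_Ioc) ?_
    filter_upwards [ae_restrict_mem measurableSet_Ioc] with r hr
    have hr0 := hr.1
    rw [norm_of_nonneg (by positivity)]
    exact mul_le_of_le_one_right (by positivity)
      (rpow_le_one_of_one_le_of_nonpos (by linarith) (by linarith))
  · have h1 : IntegrableOn (fun r : ℝ => r ^ (-1 - k / 2)) (Ioi 1) :=
      integrableOn_Ioi_rpow_of_lt (by linarith) one_pos
    refine Integrable.mono' h1 ((hc.mono (Ioi_subset_Ioi zero_le_one)).aestronglyMeasurable
      measurableSet_Ioi) ?_
    filter_upwards [ae_Ioi] with r hr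
    have hr1 : 1 < r := hr
    have hr0 : 0 < r := by linarith
    rw [norm_of_nonneg (by positivity)]
    calc _ ≤ r ^ (k / 2 - 1) * r ^ (-k) := by
          refine mul_le_l ?_
          exact rpow_anti hr0 (by linarith) (by linarith)
      _ = _ := by
          rw [← rpow_add hr0]; congr 1
          ring

lemma rayLap_armInt {u : ℂ} (hk : 0 < k) (hk1 : k ≤ 1)
    (hw : (u * w).re < 0) (hx : c * w.re < (w * x).re)
    (hgc : ContinuousOn (fun r : ℝ => g (c + r * u)) (Ioi 0))
    (hg : ∀ r : ℝ, 0 < r → ‖g (c + r * u)‖ ≤ C * (1 + r) ^ (-k)) :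
    RayExp w (armInt u c g) ((w * x).re) ∧ rayLap w (armInt u c g) x =
    u * ∫ r : ℝ in Ioi 0, g (c + r * u) / (x - (c + r * u)) := by
  set A := (w * x).re - c * w.re with hA
  set d := -(u * w).re with hd
  have hd0 := neg_pos.2 hw
  have hC : 0 ≤ C := by
    have := (norm_nonneg _).trans (hg 1 one_pos)
    exact nonneg_of_mul_nonneg_left this (by positivity)
  have hw0 : w ≠ 0 := by rintro rfl; simp at hw
  set K : ℝ × ℝ → ℂ := fun y =>
    g (c + y.2 * u) * cexp ((c + y.2 * u) * (y.1 * w)) * cexp (-(y.1 * w * x)) with hK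
  have hKn : ∀ y : ℝ × ℝ, ‖K y‖ =
    ‖g (c + y.2 * u)‖ * (exp (-(A * y.1)) * exp (-(y.1 * y.2 * d))) := fun y => by
    rw [hK]; simp only [norm_mul, norm_exp]
    rw [mul_assoc, ← exp_add, ← exp_add]; congr 2
    simp only [hA, hd, add_re, mul_re, neg_re, ofReal_re, ofReal_im, add_im, mul_im]; ring
  have hKc : ContinuousOn K (Ioi 0 ×ˢ Ioi 0) := by
    refine ContinuousOn.mul (ContinuousOn.mul ?_ (by fun_prop)) (by fun_prop)
    exact hgc.comp continuousOn_snd fun y hy => hy.2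
  have hKi : Integrable K ((volume.restrict (Ioi 0)).prod (volume.restrict (Ioi 0))) := by
    have h1 := (integrableOn_rpow_exp (half_pos hk) (sub_pos.2 hx)).mul_prod
      ((integrableOn_rpow_mul_one_add_rpow hk).const_mul (C * d ^ (k / 2 - 1)))
    rw [Measure.prod_restrict] at h1 ⊢
    refine h1.mono' (hKc.aestronglyMeasurable (measurableSet_Ioi.prod measurableSet_Ioi)) ?_
    filter_upwards [ae_restrict_mem (measurableSet_Ioi.prod measurableSet_Ioi)] with y hy
    have h2 : 0 < y.1 := hy.1
    have h3 : 0 < y.2 := hy.2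
    rw [hKn]
    have h4 := exp_neg_le_rpow (y := y.1 * y.2 * d) (o := 1 - k / 2) (by positivity)
      (by linarith) (by linarith)
    rw [neg_sub, mul_rpow (by positivity) hd0.le, mul_rpow h2.le h3.le] at h4
    calc _ ≤ C * (1 + y.2) ^ (-k) * (exp (-(A * y.1)) *
      (y.1 ^ (k / 2 - 1) * y.2 ^ (k / 2 - 1) * d ^ (k / 2 - 1))) := by
          refine mul_le_lr (hg _ h3) (mul_le_l h4)
      _ = _ := by ring
  have heq : ∀ R : ℝ, ∫ r : ℝ in Ioi 0, K (R, r) =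
    (∫ r : ℝ in Ioi 0, g (c + r * u) * cexp ((c + r * u) * (R * w))) *
    cexp (-(R * w * x)) := fun R => by rw [← integral_mul_const]
  constructor
  · have hi2 := hKi.integral_prod_left.const_mul u
    have hi3 : IntegrableOn (fun R : ℝ => armInt u c g (R * w) * cexp (-(R * w * x))) (Ioi 0) := by
      refine hi2.congr (.of_forall fun R => ?_)
      simp only; rw [heq, armInt]
      ring
    have hi4 : IntegrableOn (fun R : ℝ => armInt u c g (R * w) *
      cexp (-(R * w * x)) * cexp ((R * (w * x).im : ℝ) * I)) (Ioi 0) := by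
      refine Integrable.mul_bdd (c := 1) hi3 (by fun_prop) (.of_forall fun R => ?_)
      rw [Complex.norm_exp_ofReal_mul_I]
    refine hi4.congr (.of_forall fun R => ?_)
    simp only; rw [mul_assoc, ← Complex.exp_add, ofReal_exp]
    congr 2
    push_cast
    linear_combination (R : ℂ) * (re_add_im (w * x))
  · have hswap := integral_integral_swap (f := fun R r => K (R, r)) hKi
    have e1 : rayLap w (armInt u c g) x =
      w * (u * ∫ R : ℝ in Ioi 0, ∫ r : ℝ in Ioi 0, K (R, r)) := by
      rw [rayLap, ← integral_const_mul u]; congr 1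
      refine integral_congr_ae (.of_forall fun R => ?_)
      simp only; rw [heq, armInt]
      ring
    rw [e1, hswap, mul_left_comm, ← integral_const_mul w]; congr 1
    refine setIntegral_congr_fun measurableSet_Ioi fun r hr => ?_
    set z := c + r * u with hz
    have hre : (-(w * (x - z))).re < 0 := by
      have : (-(w * (x - z))).re = -(A + r * d) := by
        simp only [hA, hd, hz, neg_re, mul_re, sub_re, Complex.sub_im,
          add_re, add_im, ofReal_re, ofReal_im, mul_im]
        ring
      rw [this]
      have : 0 < r * d := mul_pos hr hd0
      linarith
    have hxz : x - z ≠ 0 := fun h0 => by rw [h0] at hre; simp at hre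
    have e2 : ∀ R : ℝ, K (R, r) = g z * cexp (-(w * (x - z)) * R) := fun R => by
      rw [hK]; simp only
      rw [mul_assoc, ← Complex.exp_add]; congr 2
      ring
    simp_rw [e2]
    rw [integral_const_mul, integral_exp_mul_complex_Ioi hre]; simp
    field_simp

lemma rayLap_invLap {s1 R0 d K : ℝ} (h : Contour s1 R0 o) (hd : 0 ≤ d)
    (hc : R0 < (1 - s1) / 2 * c) (hK : 0 < K) (hK1 : K ≤ 1) (hg : DifferentiableOn ℂ g (cone s1 R0))
    (hb : ∀ z ∈ cone s1 R0, ‖g z‖ ≤ C * ‖z‖ ^ (-K)) (hw : w ∈ dualCone o d) (hx : c * ‖w‖ < (w *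
    x).re) : RayExp w (invLap o c g) ((w * x).re) ∧ rayLap w (invLap o c g) x = g x := by
  have hc0 : 0 < c := pos_of_mul_pos_right (h.pos.trans hc) (by linarith [h.lt_one])
  have hk : 0 < (1 - s1) / 2 := by linarith [h.lt_one]
  have hC : 0 ≤ C := by
    have h1 := h.arm_mem hc (le_refl 0)
    have h2 := (norm_nonneg _).trans (hb _ h1.1)
    have h3 := h.pos.trans h1.1.1
    exact nonneg_of_mul_nonneg_left h2 (by positivity)
  have hwp := re_pos_of_mem_dualCone hd h.cos_pos.le h.sin_pos hw
  have hw0 := hwp.trans_le (re_le_norm w)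
  obtain ⟨hw1, hw2⟩ := dualCone_arm h.cos_pos.le hw
  have hn : 0 ≤ d * ‖w‖ := by positivity
  set k := (1 - s1) / 2 * min c 1 with hk'
  have hlow : ∀ r : ℝ, 0 < r → k * (1 + r) ≤ (1 - s1) / 2 * (c + r) := fun r hr => by
    rw [hk', mul_assoc]
    refine mul_le_l ?_
    nlinarith [min_le_left c 1, min_le_right c 1]
  have hgr : ∀ u : ℂ, (∀ r : ℝ, 0 < r → (c : ℂ) + r * u ∈ cone s1 R0 ∧
    (1 - s1) / 2 * (c + r) ≤ ‖c + r * u‖) →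
    ∀ r : ℝ, 0 < r → ‖g (c + r * u)‖ ≤ C * k ^ (-K) * (1 + r) ^ (-K) := fun u hu r hr => by
    refine (hb _ (hu r hr).1).trans ?_
    rw [mul_assoc, ← mul_rpow (mul_pos hk (lt_min hc0 one_pos)).le (by positivity)]
    refine mul_le_l ?_
    exact rpow_anti (by positivity) ((hlow r hr).trans (hu r hr).2) (by linarith)
  have hcont := h.continuousOn_arm hc hg.continuousOn
  have hmain : ∀ x : ℂ, c * ‖w‖ < (w * x).re → RayExp w (invLap o c g) ((w * x).re) ∧
    rayLap w (invLap o c g) x = (2 * π * I)⁻¹ *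
    ((armDir o * ∫ r : ℝ in Ioi 0, g (c + r * armDir o) / (x - (c + r * armDir o)))
    - star (armDir o) * (∫ r : ℝ in Ioi 0, g (c + r * star (armDir o)) /
    (x - (c + r * star (armDir o))))) := fun x hx => by
    have hx' : c * w.re < (w * x).re := (mul_le_l (re_le_norm w)).trans_lt hx
    obtain ⟨i1, l1⟩ := rayLap_armInt hK hK1 (by linarith) hx' hcont.1 (hgr _ fun r hr => ⟨(h.arm_mem
      hc hr.le).1, (h.le_norm_arm hc0 hr.le).1⟩)
    obtain ⟨i2, l2⟩ := rayLap_armInt hK hK1 (by linarith) hx' hcont.2 (hgr _ fun r hr => ⟨(h.arm_mem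
      hc hr.le).2, (h.le_norm_arm hc0 hr.le).2⟩)
    have i3 := i2.const_mul (-1)
    have e : invLap o c g = fun p => (2 * π * I)⁻¹ *
      (armInt (armDir o) c g p + -1 * armInt (star (armDir o)) c g p) := by
      ext p
      rw [invLap]; ring
    rw [e]
    refine ⟨(i1.add i3).const_mul _, ?_⟩
    rw [rayLap_const_mul, rayLap_add i1 i3 le_rfl, rayLap_const_mul, l1, l2]; ring
  refine ⟨(hmain x hx).1, ?_⟩
  set U := {x | c * ‖w‖ < (w * x).re}
  have hUo : IsOpen U := isOpen_lt continuous_const (by fun_prop)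
  have hcR : R0 ≤ c := by
    have := h.sin_pos.trans h.sin_lt
    nlinarith
  have hd1 : DifferentiableOn ℂ (rayLap w (invLap o c g)) U := fun y hy => by
    obtain ⟨v, hv1, hv2⟩ := exists_between (show c * ‖w‖ < (w * y).re from hy)
    obtain ⟨hi, -⟩ := hmain ((v / (w * w).re : ℝ) * 0 + v / w) (by
      rw [mul_zero, zero_add, mul_div_cancel₀ _ (norm_pos_iff.1 hw0)]
      simpa using hv1)
    rw [mul_zero, zero_add, mul_div_cancel₀ _ (norm_pos_iff.1 hw0), ofReal_re] at hi
    exact (hasDerivAt_rayLap hi hv2).differentiableAt.differentiableWithinAt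
  have hUc : IsPreconnected U := by
    refine Convex.isPreconnected ?_
    have : IsLinearMap ℝ fun x => (w * x).re := ⟨fun a b => by rw [mul_add, add_re], fun a b => by
        rw [mul_smul_comm, smul_re]⟩
    exact convex_halfSpace_gt this _
  set x0 := c * ‖w‖ / w.re + 1
  have hreal : ∀ y : ℝ, x0 ≤ y → (y : ℂ) ∈ U ∧ c < y := fun y hy => by
    have h1 : c * ‖w‖ < y * w.re := by
      have : c * ‖w‖ / w.re < y := by linarith
      rwa [div_lt_iff₀ hwp] at this
    refine ⟨?_, ?_⟩
    · show c * ‖w‖ < (w * y).re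
      rw [mul_comm w, re_ofReal_mul]; exact h1
    · have h2 := mul_le_l (re_le_norm w) hc0.le
      have : c * w.re < y * w.re := h2.trans_lt h1
      exact lt_of_mul_lt_mul_right this hwp.le
  have hfreq : ∃ᶠ y in 𝓝[≠] x0, rayLap w (invLap o c g) y = g y := by
    have ht : Tendsto (fun n : ℕ => ((x0 + 1 / ((n : ℝ) + 1) : ℝ) : ℂ)) atTop (𝓝[≠] (x0 : ℂ)) := by
      rw [tendsto_nhdsWithin_iff]
      constructor
      · have := (tendsto_one_div_add_atTop_nhds_zero_nat (𝕜 := ℝ)).const_add x0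
        rw [add_zero] at this; exact (continuous_ofReal.tendsto _).comp this
      · refine .of_forall fun n => ?_
        simp only [mem_compl_iff, mem_singleton_iff, ofReal_inj, add_eq_left]; positivity
    refine ht.frequently (Frequently.of_forall fun n => ?_)
    obtain ⟨h1, h2⟩ := hreal (x0 + 1 / ((n : ℝ) + 1)) (by linarith [(by positivity :
      (0 : ℝ) ≤ 1 / ((n : ℝ) + 1))])
    rw [(hmain _ h1).2, cauchy_arms h hc hK hK1 hg hb h2, ← mul_assoc, inv_mul_cancel₀, one_mul]
    simp
  exact (hd1.analyticOnNhd hUo).eqOn_of_preconnected_of_frequently_eq ((hg.mono (fun y hy =>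
    halfPlane_subset_cone hd h.cos_pos.le h.sin_pos h.sin_lt.le h.pos.le hcR hw hy)).analyticOnNhd
    hUo) hUc (hreal x0 le_rfl).1 hfreq hx

end

section

variable {p y : ℂ} {F G H : ParamFun} {t : ℝ} {lam : ℂ → ℂ}

/-- An open cone of the complex plane, without its vertex. -/
structure OpenCone (D : Set ℂ) : Prop where
  isOpen : IsOpen D
  smul_mem : ∀ p ∈ D, ∀ r : ℝ, 0 < r → (r : ℂ) * p ∈ D
  zero_notMem : (0 : ℂ) ∉ D

lemma OpenCone.ne_zero {D : Set ℂ} (hD : OpenCone D) (hp : p ∈ D) : p ≠ 0 :=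
    fun h => hD.zero_notMem (h ▸ hp)

lemma OpenCone.norm_pos {D : Set ℂ} (hD : OpenCone D) (hp : p ∈ D) : 0 < ‖p‖ :=
    norm_pos_iff.2 (hD.ne_zero hp)

/-- Functions `F y p t`, holomorphic in the parameter `y ∈ X` and in `p ∈ D`, continuous in
`t ∈ (0, T)`, with at most a singularity `|p|^(k-1)` at the vertex, locally uniformly in `t`. -/
structure HoloFam (X D : Set ℂ) (T k : ℝ) (F : ParamFun) : Prop where
  cont : ∀ y ∈ X, ∀ p ∈ D, ContinuousOn (F y p) (Ioo 0 T)
  holo : ∀ y ∈ X, ∀ t ∈ Ioo 0 T, DifferentiableOn ℂ (fun p => F y p t) D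
  holo_param : ∀ p ∈ D, ∀ t ∈ Ioo 0 T, DifferentiableOn ℂ (fun y => F y p t) X
  bound : ∀ t1 t2 r0 : ℝ, 0 < t1 → t2 < T → 0 < r0 → ∃ L, 0 ≤ L ∧ ∀ y ∈ X, ∀ p ∈ D, ‖p‖ ≤ r0 →
    ∀ t ∈ Icc t1 t2, ‖F y p t‖ ≤ L * ‖p‖ ^ (k - 1)

variable {X D : Set ℂ} {T k : ℝ}

lemma HoloFam.zero : HoloFam X D T k (fun _ _ _ => 0) :=
    ⟨fun _ _ _ _ => continuousOn_const, fun _ _ _ _ => differentiableOn_const _,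
    fun _ _ _ _ => differentiableOn_const _, fun _ _ _ _ _ _ => ⟨0, le_rfl, by simp⟩⟩

lemma HoloFam.add (hF : HoloFam X D T k F)
    (hG : HoloFam X D T k G) : HoloFam X D T k (fun y p t => F y p t + G y p t) := by
  refine ⟨fun y hy p hp => (hF.cont y hy p hp).add (hG.cont y hy p hp),
    fun y hy t ht => (hF.holo y hy t ht).add (hG.holo y hy t ht),
    fun p hp t ht => (hF.holo_param p hp t ht).add (hG.holo_param p hp t ht), ?_⟩
  intro t1 t2 r0 h1 h2 h3
  obtain ⟨L, hL, h⟩ := hF.bound t1 t2 r0 h1 h2 h3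
  obtain ⟨L', hL', h'⟩ := hG.bound t1 t2 r0 h1 h2 h3
  refine ⟨L + L', by positivity, fun y hy p hp hpr t ht => ?_⟩
  rw [add_mul]
  exact (norm_add_le _ _).trans (add_le_add (h y hy p hp hpr t ht) (h' y hy p hp hpr t ht))

lemma HoloFam.sum {J : Type*} (s : Finset J) {F : J → ParamFun}
    (hF : ∀ i ∈ s, HoloFam X D T k (F i)) : HoloFam X D T k (fun y p t => ∑ i ∈ s, F i y p t) := by
  classical
  induction s using Finset.induction_on with
  | empty => simpa using HoloFam.zero
  | insert a s ha ih =>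
    simp_rw [Finset.sum_insert ha]
    exact (hF a (Finset.mem_insert_self a s)).add
      (ih fun i hi => hF i (Finset.mem_insert_of_mem hi))

lemma HoloFam.entire_mul (hF : HoloFam X D T k F) {h : ℂ → ℂ}
    (hh : Differentiable ℂ h) : HoloFam X D T k (fun y p t => h p * F y p t) := by
  refine ⟨fun y hy p hp => continuousOn_const.mul (hF.cont y hy p hp),
    fun y hy t ht => hh.differentiableOn.mul (hF.holo y hy t ht),
    fun p hp t ht => (hF.holo_param p hp t ht).const_mul _, ?_⟩
  intro t1 t2 r0 h1 h2 h3
  obtain ⟨L, hL, h⟩ := hF.bound t1 t2 r0 h1 h2 h3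
  obtain ⟨M, hM⟩ := (isCompact_closedBall 0 r0).exists_bound_of_continuousOn
    hh.continuous.continuousOn
  have hM0 := (norm_nonneg _).trans (hM 0 (by simp [h3.le]))
  refine ⟨M * L, by positivity, fun y hy p hp hpr t ht => ?_⟩
  rw [norm_mul, mul_assoc]
  exact mul_le_mul (hM p (by simpa using hpr)) (h y hy p hp hpr t ht) (norm_nonneg _) hM0

lemma HoloFam.of_tendsto {J : Type*} {l : Filter J} [l.NeBot] (hX : IsOpen X)
    (hD : OpenCone D) {F : J → ParamFun} (hF : ∀ i, HoloFam X D T k (F i))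
    (hlim : ∀ t1 t2 r1 r0 : ℝ, 0 < t1 → t2 < T → 0 < r1 → 0 < r0 →
    TendstoUniformlyOn (fun i (z : ℂ × ℂ × ℝ) => F i z.1 z.2.1 z.2.2) (fun z => G z.1 z.2.1 z.2.2) l
    {z | z.1 ∈ X ∧ z.2.1 ∈ D ∧ r1 ≤ ‖z.2.1‖ ∧ ‖z.2.1‖ ≤ r0 ∧ z.2.2 ∈ Icc t1 t2})
    (hb : ∀ t1 t2 r0 : ℝ, 0 < t1 → t2 < T → 0 < r0 → ∃ L, 0 ≤ L ∧ ∀ y ∈ X, ∀ p ∈ D, ‖p‖ ≤ r0 →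
    ∀ t ∈ Icc t1 t2, ‖G y p t‖ ≤ L * ‖p‖ ^ (k - 1)) : HoloFam X D T k G := by
  refine ⟨?_, ?_, ?_, hb⟩
  · intro y hy p hp
    have hu : TendstoLocallyUniformlyOn (fun i t => F i y p t) (G y p) l (Ioo 0 T) := by
      rw [tendstoLocallyUniformlyOn_iff_forall_isCompact isOpen_Ioo]
      intro K hK hKc
      rcases K.eq_empty_or_nonempty with rfl | hne
      · exact tendstoUniformlyOn_empty
      obtain ⟨a, ha, ha'⟩ := hKc.exists_isLeast hne
      obtain ⟨b, hb, hb'⟩ := hKc.exists_isGreatest hne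
      have := (hlim a b ‖p‖ ‖p‖ (hK ha).1 (hK hb).2 (hD.norm_pos hp) (hD.norm_pos hp)).comp
        (fun t => ((y, p, t) : ℂ × ℂ × ℝ))
      exact this.mono fun t ht => ⟨hy, hp, le_rfl, le_rfl, ha' ht, hb' ht⟩
    exact hu.continuousOn (Frequently.of_forall fun i => (hF i).cont y hy p hp)
  · intro y hy t ht
    have hu : TendstoLocallyUniformlyOn (fun i p => F i y p t) (fun p => G y p t) l D := by
      rw [tendstoLocallyUniformlyOn_iff_forall_isCompact hD.isOpen]
      intro K hK hKc
      rcases K.eq_empty_or_nonempty with rfl | hne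
      · exact tendstoUniformlyOn_empty
      obtain ⟨a, ha, ha'⟩ := hKc.exists_isMinOn hne continuous_norm.continuousOn
      obtain ⟨b, hb, hb'⟩ := hKc.exists_isMaxOn hne continuous_norm.continuousOn
      have := (hlim t t ‖a‖ ‖b‖ ht.1 ht.2 (hD.norm_pos (hK ha)) (hD.norm_pos (hK hb))).comp
        (fun p => ((y, p, t) : ℂ × ℂ × ℝ))
      exact this.mono fun p hp => ⟨hy, hK hp, ha' hp, hb' hp, le_rfl, le_rfl⟩
    exact hu.differentiableOn (.of_forall fun i => (hF i).holo y hy t ht) hD.isOpen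
  · intro p hp t ht
    have hu : TendstoUniformlyOn (fun i y => F i y p t) (fun y => G y p t) l X := by
      have := (hlim t t ‖p‖ ‖p‖ ht.1 ht.2 (hD.norm_pos hp) (hD.norm_pos hp)).comp
        (fun y => ((y, p, t) : ℂ × ℂ × ℝ))
      exact this.mono fun y hy => ⟨hy, hp, le_rfl, le_rfl, le_rfl, le_rfl⟩
    exact hu.tendstoLocallyUniformlyOn.differentiableOn
      (.of_forall fun i => (hF i).holo_param p hp t ht) hX

lemma rpow_sub_one_le_of_mem {r r1 r0 : ℝ} (hr1 : 0 < r1) (h1 : r1 ≤ r) (h2 : r ≤ r0)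
    (hk1 : k ≤ 1) : r0 ^ (k - 1) ≤ r ^ (k - 1) ∧ r ^ (k - 1) ≤ r1 ^ (k - 1) :=
    ⟨rpow_anti (hr1.trans_le h1) h2 (by linarith), rpow_anti hr1 h1 (by linarith)⟩

lemma HoloFam.tsum {J : Type*} (hX : IsOpen X) (hD : OpenCone D) (hk1 : k ≤ 1)
    {F : J → ParamFun} (hF : ∀ i, HoloFam X D T k (F i))
    (hb : ∀ t1 t2 r0 : ℝ, 0 < t1 → t2 < T → 0 < r0 → ∃ u : J → ℝ, Summable u ∧
    ∀ i, ∀ y ∈ X, ∀ p ∈ D, ‖p‖ ≤ r0 → ∀ t ∈ Icc t1 t2, ‖F i y p t‖ ≤ u i * ‖p‖ ^ (k - 1)) :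
    HoloFam X D T k (fun y p t => ∑' i, F i y p t) := by
  refine HoloFam.of_tendsto (l := atTop) hX hD (fun s => HoloFam.sum s fun i _ => hF i) ?_ ?_
  · intro t1 t2 r1 r0 h1 h2 h3 h4
    obtain ⟨u, hu, h⟩ := hb t1 t2 r0 h1 h2 h4
    refine tendstoUniformlyOn_tsum (u := fun i => |u i| * r1 ^ (k - 1)) (hu.abs.mul_right _) ?_
    rintro i ⟨y, p, t⟩ ⟨hy, hp, hp1, hp0, ht⟩
    refine (h i y hy p hp hp0 t ht).trans (mul_le_mul (le_abs_self _)
      (rpow_sub_one_le_of_mem h3 hp1 hp0 hk1).2 (by positivity) (abs_nonneg _))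
  · intro t1 t2 r0 h1 h2 h3
    obtain ⟨u, hu, h⟩ := hb t1 t2 r0 h1 h2 h3
    refine ⟨∑' i, |u i|, tsum_nonneg fun i => abs_nonneg _, fun y hy p hp hpr t ht => ?_⟩
    rw [← tsum_mul_right]
    refine tsum_of_norm_bounded (hu.abs.mul_right _).hasSum fun i => ?_
    exact (h i y hy p hp hpr t ht).trans (mul_le_r (le_abs_self _))

lemma rpow_mul_rpow_one_sub_le {s : ℝ} (hk : 0 < k) (hk1 : k ≤ 1) (h0 : 0 < s) (h1 : s < 1) :
    s ^ (k - 1) * (1 - s) ^ (k - 1) ≤ 2 * (s ^ (k - 1) + (1 - s) ^ (k - 1)) := by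
  have key : ∀ a b : ℝ, 0 < a → 1 / 2 ≤ b → a ^ (k - 1) * b ^ (k - 1) ≤ 2 * a ^ (k - 1) := fun a b
    ha hb => by
    have h2 : b ^ (k - 1) ≤ 2 := by
      calc _ ≤ (1 / 2) ^ (k - 1) := rpow_anti (by norm_num) hb (by linarith)
        _ ≤ (1 / 2) ^ (-1) := rpow_le_rpow_of_exponent_ge (by norm_num) (by norm_num) (by linarith)
        _ = 2 := by rw [rpow_neg_one]; norm_num
    nlinarith [rpow_pos_of_pos ha (k - 1)]
  have h3 : 0 < 1 - s := by linarith
  rcases le_total (1 / 2) (1 - s) with h | h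
  · have := key s (1 - s) h0 h
    nlinarith [rpow_pos_of_pos h3 (k - 1)]
  · have := key (1 - s) s h3 (by linarith)
    nlinarith [rpow_pos_of_pos h0 (k - 1)]

lemma integrableOn_rpow_add_rpow_one_sub (hk : 0 < k) :
    IntegrableOn (fun s : ℝ => 2 * (s ^ (k - 1) + (1 - s) ^ (k - 1))) (Ioo 0 1) := by
  have h1 : IntervalIntegrable (fun s => s ^ (k - 1)) volume 0 1 :=
    intervalIntegrable_rpow' (by linarith)
  have h2 := (h1.comp_sub_left 1).symm
  rw [sub_zero, sub_self] at h2
  rw [← integrableOn_Ioc_iff_integrableOn_Ioo,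
    ← intervalIntegrable_iff_integrableOn_Ioc_of_le zero_le_one]
  exact (h1.add h2).const_mul 2

lemma lconv_eq_setIntegral (F G : ℂ → ℂ) (p : ℂ) :
    lconv F G p = p * ∫ s : ℝ in Ioo 0 1, F (s * p) * G (((1 - s : ℝ) : ℂ) * p) := by
  rw [lconv, intervalIntegral.integral_of_le zero_le_one, integral_Ioc_eq_integral_Ioo]

lemma OpenCone.aestronglyMeasurable_lconv (hD : OpenCone D) {F G : ℂ → ℂ}
    (hF : ContinuousOn F D) (hG : ContinuousOn G D) (hp : p ∈ D) :
    AEStronglyMeasurable (fun s : ℝ => F (s * p) * G (((1 - s : ℝ) : ℂ) * p))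
    (volume.restrict (Ioo 0 1)) := by
  refine ContinuousOn.aestronglyMeasurable (ContinuousOn.mul ?_ ?_) measurableSet_Ioo
  · exact hF.comp (by fun_prop) fun s hs => hD.smul_mem p hp s hs.1
  · exact hG.comp (by fun_prop) fun s hs => hD.smul_mem p hp (1 - s) (by linarith [hs.2])

lemma HoloFam.lconv (hX : IsOpen X) (hD : OpenCone D) (hk : 0 < k) (hk1 : k ≤ 1) (hF : HoloFam X D T
    k F) (hG : HoloFam X D T k G) :
    HoloFam X D T k (fun y p t => lconv (fun p => F y p t) (fun p => G y p t) p) := by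
  simp_rw [lconv_eq_setIntegral]
  set q : ℝ → ℝ := fun S => 2 * (S ^ (k - 1) + (1 - S) ^ (k - 1)) with hq
  have hqi := integrableOn_rpow_add_rpow_one_sub hk
  have hbound : ∀ t1 t2 r0 : ℝ, 0 < t1 → t2 < T → 0 < r0 → ∃ L, 0 ≤ L ∧ ∀ y ∈ X, ∀ p ∈ D,
    ‖p‖ ≤ r0 → ∀ t ∈ Icc t1 t2, ∀ S ∈ Ioo (0 : ℝ) 1,
    ‖F y (S * p) t * G y (((1 - S : ℝ) : ℂ) * p) t‖ ≤
    L * (‖p‖ ^ (k - 1) * ‖p‖ ^ (k - 1)) * q S := fun t1 t2 r0 h1 h2 h3 => by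
    obtain ⟨L, hL, h⟩ := hF.bound t1 t2 r0 h1 h2 h3
    obtain ⟨L', hL', h'⟩ := hG.bound t1 t2 r0 h1 h2 h3
    refine ⟨L * L', by positivity, fun y hy p hp hpr t ht S hS => ?_⟩
    have hs : 0 < 1 - S := by linarith [hS.2]
    have n1 : ‖(S : ℂ) * p‖ = S * ‖p‖ := by rw [norm_mul, norm_coe hS.1.le]
    have n2 : ‖((1 - S : ℝ) : ℂ) * p‖ = (1 - S) * ‖p‖ := by rw [norm_mul, norm_coe hs.le]
    have b1 := h y hy _ (hD.smul_mem p hp S hS.1)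
      (by rw [n1]; exact (mul_le_of_le_one_left (norm_nonneg _) hS.2.le).trans hpr) t ht
    have b2 := h' y hy _ (hD.smul_mem p hp (1 - S) hs)
      (by rw [n2]; exact (mul_le_of_le_one_left (norm_nonneg _) (by linarith [hS.1])).trans hpr) t
      ht
    rw [n1, mul_rpow hS.1.le (norm_nonneg _)] at b1; rw [n2, mul_rpow hs.le (norm_nonneg _)] at b2
    rw [norm_mul]
    calc _ ≤ _ := mul_le_mul b1 b2 (norm_nonneg _) (by have := hS.1; positivity)
      _ = L * L' * (‖p‖ ^ (k - 1) * ‖p‖ ^ (k - 1)) * (S ^ (k - 1) * (1 - S) ^ (k - 1)) := by ring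
      _ ≤ _ := mul_le_l (rpow_mul_rpow_one_sub_le hk hk1 hS.1 hS.2)
  have hmeas : ∀ y ∈ X, ∀ p ∈ D, ∀ t ∈ Ioo 0 T, AEStronglyMeasurable
    (fun S : ℝ => F y (S * p) t * G y (((1 - S : ℝ) : ℂ) * p) t)
    (volume.restrict (Ioo 0 1)) := fun y hy p hp t ht =>
    hD.aestronglyMeasurable_lconv (hF.holo y hy t ht).continuousOn (hG.holo y hy t ht).continuousOn
    hp
  refine ⟨?_, ?_, ?_, ?_⟩
  · intro y hy p hp
    refine continuousOn_const.mul fun t0 ht0 => ContinuousAt.continuousWithinAt ?_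
    obtain ⟨t1, h1, h1'⟩ := exists_between ht0.1
    obtain ⟨t2, h2, h2'⟩ := exists_between ht0.2
    obtain ⟨L, hL, h⟩ := hbound t1 t2 ‖p‖ h1 h2' (hD.norm_pos hp)
    refine continuousAt_of_dominated ?_ ?_ (hqi.const_mul (L * (‖p‖ ^ (k - 1) * ‖p‖ ^ (k - 1)))) ?_
    · filter_upwards [isOpen_Ioo.mem_nhds ht0] with t ht using hmeas y hy p hp t ht
    · filter_upwards [Icc_mem_nhds h1' h2] with t ht
      filter_upwards [ae_restrict_mem measurableSet_Ioo] with S hS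
      exact h y hy p hp le_rfl t ht S hS
    · filter_upwards [ae_restrict_mem measurableSet_Ioo] with S hS
      refine ContinuousAt.mul ?_ ?_
      · exact (hF.cont y hy _ (hD.smul_mem p hp S hS.1)).continuousAt (isOpen_Ioo.mem_nhds ht0)
      · exact (hG.cont y hy _ (hD.smul_mem p hp (1 - S) (by linarith [hS.2]))).continuousAt
          (isOpen_Ioo.mem_nhds ht0)
  · intro y hy t ht
    refine differentiableOn_id.mul (holomorphic_integral
      (F := fun p (S : ℝ) => F y (S * p) t * G y (((1 - S : ℝ) : ℂ) * p) t) hD.isOpen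
      (fun p hp => hmeas y hy p hp t ht) ?_ ?_)
    · filter_upwards [ae_restrict_mem measurableSet_Ioo] with S hS
      refine DifferentiableOn.mul ?_ ?_
      · exact (hF.holo y hy t ht).comp (f := fun p => (S : ℂ) * p) (by fun_prop)
          fun p hp => hD.smul_mem p hp S hS.1
      · exact (hG.holo y hy t ht).comp (f := fun p => ((1 - S : ℝ) : ℂ) * p) (by fun_prop)
          fun p hp => hD.smul_mem p hp (1 - S) (by linarith [hS.2])
    · intro p0 hp0
      have hn := hD.norm_pos hp0
      obtain ⟨L, hL, h⟩ := hbound t t (2 * ‖p0‖) ht.1 ht.2 (by linarith)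
      refine ⟨{p | ‖p0‖ / 2 < ‖p‖ ∧ ‖p‖ < 2 * ‖p0‖}, ?_, _, hqi.const_mul
        (L * ((‖p0‖ / 2) ^ (k - 1) * (‖p0‖ / 2) ^ (k - 1))), ?_⟩
      · exact ((isOpen_lt continuous_const continuous_norm).inter
          (isOpen_lt continuous_norm continuous_const)).mem_nhds ⟨half_lt_self hn, lt_two_mul_self
          hn⟩
      · filter_upwards [ae_restrict_mem measurableSet_Ioo] with S hS p hpV hp
        refine (h y hy p hp hpV.2.le t ⟨le_rfl, le_rfl⟩ S hS).trans ?_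
        have h5 := (rpow_sub_one_le_of_mem (half_pos hn) hpV.1.le hpV.2.le hk1).2
        have hq0 : 0 ≤ q S := by
          have := hS.1
          have : 0 < 1 - S := by linarith [hS.2]
          positivity
        gcongr
  · intro p hp t ht
    refine DifferentiableOn.const_mul (holomorphic_integral
      (F := fun y (S : ℝ) => F y (S * p) t * G y (((1 - S : ℝ) : ℂ) * p) t) hX
      (fun y hy => hmeas y hy p hp t ht) ?_ ?_) p
    · filter_upwards [ae_restrict_mem measurableSet_Ioo] with S hS
      exact (hF.holo_param _ (hD.smul_mem p hp S hS.1) t ht).mul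
        (hG.holo_param _ (hD.smul_mem p hp (1 - S) (by linarith [hS.2])) t ht)
    · intro y0 hy0
      obtain ⟨L, hL, h⟩ := hbound t t ‖p‖ ht.1 ht.2 (hD.norm_pos hp)
      refine ⟨univ, univ_mem, _, hqi.const_mul (L * (‖p‖ ^ (k - 1) * ‖p‖ ^ (k - 1))), ?_⟩
      filter_upwards [ae_restrict_mem measurableSet_Ioo] with S hS y _ hy
      exact h y hy p hp le_rfl t ⟨le_rfl, le_rfl⟩ S hS
  · intro t1 t2 r0 h1 h2 h3
    obtain ⟨L, hL, h⟩ := hbound t1 t2 r0 h1 h2 h3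
    have hq0 : 0 ≤ ∫ S in Ioo 0 1, q S := by
      refine setIntegral_nonneg measurableSet_Ioo fun S hS => ?_
      have := hS.1
      have : 0 < 1 - S := by linarith [hS.2]
      positivity
    refine ⟨L * r0 ^ k * ∫ S in Ioo 0 1, q S, by positivity, fun y hy p hp hpr t ht => ?_⟩
    have hn := hD.norm_pos hp
    have h4 : ‖∫ S : ℝ in Ioo 0 1, F y (S * p) t * G y (((1 - S : ℝ) : ℂ) * p) t‖ ≤
      ∫ S in Ioo 0 1, L * (‖p‖ ^ (k - 1) * ‖p‖ ^ (k - 1)) * q S :=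
      norm_integral_le_of_norm_le (hqi.const_mul _) (by
        filter_upwards [ae_restrict_mem measurableSet_Ioo] with S hS using
          h y hy p hp hpr t ht S hS)
    rw [integral_const_mul] at h4; rw [norm_mul]
    calc _ ≤ ‖p‖ * (L * (‖p‖ ^ (k - 1) * ‖p‖ ^ (k - 1)) * ∫ S in Ioo 0 1, q S) := mul_le_l h4 hn.le
      _ = L * (‖p‖ ^ (k - 1 + 1)) * (∫ S in Ioo 0 1, q S) * ‖p‖ ^ (k - 1) := by
          rw [rpow_add_one hn.ne']; ring
      _ ≤ _ := by
          rw [sub_add_cancel]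
          gcongr

/-- The Duhamel integral of a family. -/
def duhamel (lam : ℂ → ℂ) (H : ParamFun) (y p : ℂ) (t : ℝ) : ℂ :=
  ∫ u in (0 : ℝ)..t, cexp (-(lam p * (t - u))) * H y p u

lemma HoloFam.intervalIntegrable (hH : HoloFam X D T k H) (hy : y ∈ X) (hp : p ∈ D) {L m : ℝ} (hm :
    0 < m) (ht : t ∈ Ioo 0 T) (hb : ∀ u ∈ Ioc 0 t, ‖H y p u‖ ≤ L * u ^ (m - 1)) :
    IntervalIntegrable (H y p) volume 0 t := by
  have h1 : IntervalIntegrable (fun u => L * u ^ (m - 1)) volume 0 t :=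
    (intervalIntegrable_rpow' (by linarith)).const_mul L
  rw [intervalIntegrable_iff_integrableOn_Ioc_of_le ht.1.le] at h1 ⊢
  refine Integrable.mono' h1 (((hH.cont y hy p hp).mono fun u hu =>
    ⟨hu.1, hu.2.trans_lt ht.2⟩).aestronglyMeasurable measurableSet_Ioc) ?_
  filter_upwards [ae_restrict_mem measurableSet_Ioc] with u hu using hb u hu

lemma HoloFam.hasDerivAt_duhamel (hH : HoloFam X D T k H) (hy : y ∈ X) (hp : p ∈ D) (ht : t ∈ Ioo 0
    T) (hi : IntervalIntegrable (H y p) volume 0 t) :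
    HasDerivAt (duhamel lam H y p) (-(lam p) * duhamel lam H y p t + H y p t) t := by
  have e : duhamel lam H y p = fun t : ℝ => cexp (-(lam p * t)) *
    ∫ u in (0 : ℝ)..t, cexp (lam p * u) * H y p u := by
    ext t
    rw [duhamel, ← intervalIntegral.integral_const_mul]
    refine intervalIntegral.integral_congr fun u _ => ?_
    rw [← mul_assoc, ← Complex.exp_add]; congr 2
    ring
  have hc : ContinuousOn (fun u : ℝ => cexp (lam p * u) * H y p u) (Ioo 0 T) :=
    ContinuousOn.mul (by fun_prop) (hH.cont y hy p hp)
  have h1 : HasDerivAt (fun t : ℝ => ∫ u in (0 : ℝ)..t, cexp (lam p * u) * H y p u)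
    (cexp (lam p * t) * H y p t) t := by
    refine intervalIntegral.integral_hasDerivAt_right ?_ ?_ ?_
    · exact hi.continuousOn_mul (by fun_prop)
    · exact hc.stronglyMeasurableAtFilter isOpen_Ioo t ht
    · exact hc.continuousAt (isOpen_Ioo.mem_nhds ht)
  have h2 : HasDerivAt (fun t : ℝ => cexp (-(lam p * t))) (cexp (-(lam p * t)) * (-(lam p))) t := by
    have : HasDerivAt (fun t : ℝ => -(lam p * (t : ℂ))) (-(lam p)) t := by
      have h0 := ((ofRealCLM.hasDerivAt (x := t)).const_mul (lam p)).neg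
      rw [ofRealCLM_apply, ofReal_one, mul_one] at h0; exact h0
    exact this.cexp
  have h3 := h2.mul h1
  rw [e]
  refine h3.congr_deriv ?_
  have : cexp (-(lam p * t)) * cexp (lam p * t) = 1 := by
    rw [← Complex.exp_add, neg_add_cancel, Complex.exp_zero]
  linear_combination (H y p t) * this

lemma HoloFam.duhamel (hX : IsOpen X) (hD : OpenCone D) (hk1 : k ≤ 1)
    (hH : HoloFam X D T k H) (hlam : Differentiable ℂ lam)
    (hb : ∀ t2 r0 : ℝ, t2 < T → 0 < r0 → ∃ L m : ℝ, 0 ≤ L ∧ 0 < m ∧ ∀ y ∈ X, ∀ p ∈ D, ‖p‖ ≤ r0 →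
    ∀ t ∈ Ioc 0 t2, ‖H y p t‖ ≤ L * ‖p‖ ^ (k - 1) * t ^ (m - 1)) :
    HoloFam X D T k (duhamel lam H) := by
  have hloc : ∀ t2 r0 : ℝ, t2 < T → 0 < r0 → ∃ L m : ℝ, 0 ≤ L ∧ 0 < m ∧ ∀ y ∈ X, ∀ p ∈ D, ‖p‖ ≤ r0 →
    ∀ t ∈ Ioc 0 t2, ∀ u ∈ Ioc 0 t, ‖cexp (-(lam p * (t - u))) * H y p u‖ ≤
    L * ‖p‖ ^ (k - 1) * u ^ (m - 1) := fun t2 r0 ht2 hr0 => by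
    obtain ⟨L, m, hL, hm, h⟩ := hb t2 r0 ht2 hr0
    obtain ⟨M, hM⟩ := (isCompact_closedBall (0 : ℂ) r0).exists_bound_of_continuousOn
      hlam.continuous.continuousOn
    have hM0 : 0 ≤ M := (norm_nonneg _).trans (hM 0 (by simp [hr0.le]))
    refine ⟨exp (M * T) * L, m, by positivity, hm, fun y hy p hp hpr t ht u hu => ?_⟩
    rw [norm_mul, mul_assoc (exp (M * T)) L, mul_assoc (exp (M * T))]
    refine mul_le_mul ?_ (h y hy p hp hpr u ⟨hu.1, hu.2.trans ht.2⟩) (norm_nonneg _) (exp_pos _).le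
    refine (Complex.norm_exp_le_exp_norm _).trans (exp_le_exp.2 ?_)
    rw [norm_neg, norm_mul, ← ofReal_sub, norm_coe (by linarith [hu.2])]
    exact mul_le_mul (hM p (by simpa using hpr)) (by linarith [hu.1, ht.2]) (by linarith [hu.2]) hM0
  have hii : ∀ y ∈ X, ∀ p ∈ D, ∀ t ∈ Ioo 0 T, IntervalIntegrable (H y p) volume 0 t := fun y hy p hp
    t ht => by
    obtain ⟨L, m, hL, hm, h⟩ := hb t ‖p‖ ht.2 (hD.norm_pos hp)
    exact hH.intervalIntegrable (L := L * ‖p‖ ^ (k - 1)) hy hp hm ht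
      fun u hu => h y hy p hp le_rfl u hu
  have hset : ∀ y p t, 0 < t → _root_.duhamel lam H y p t =
    ∫ u : ℝ in Ioc 0 t, cexp (-(lam p * (t - u))) * H y p u := fun y p t ht => by
    rw [_root_.duhamel, intervalIntegral.integral_of_le ht.le]
  have hmeas : ∀ y ∈ X, ∀ p ∈ D, ∀ t ∈ Ioo 0 T, AEStronglyMeasurable
    (fun u : ℝ => cexp (-(lam p * (t - u))) * H y p u) (volume.restrict (Ioc 0 t)) := fun y hy p hp
    t ht => by
    refine ContinuousOn.aestronglyMeasurable (ContinuousOn.mul (by fun_prop) ?_) measurableSet_Ioc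
    exact (hH.cont y hy p hp).mono fun u hu => ⟨hu.1, hu.2.trans_lt ht.2⟩
  have hint : ∀ m t : ℝ, 0 < m → 0 < t → IntegrableOn (fun u : ℝ => u ^ (m - 1)) (Ioc 0 t) :=
    fun m t hm ht => by
      rw [← intervalIntegrable_iff_integrableOn_Ioc_of_le ht.le]
      exact intervalIntegrable_rpow' (by linarith)
  refine ⟨?_, ?_, ?_, ?_⟩
  · intro y hy p hp t ht
    exact (hH.hasDerivAt_duhamel hy hp ht (hii y hy p hp t ht)).continuousAt.continuousWithinAt
  · intro y hy t ht
    simp_rw [hset _ _ t ht.1]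
    refine holomorphic_integral
      (F := fun p (u : ℝ) => cexp (-(lam p * (t - u))) * H y p u) hD.isOpen
      (fun p hp => hmeas y hy p hp t ht) ?_ ?_
    · filter_upwards [ae_restrict_mem measurableSet_Ioc] with u hu
      refine DifferentiableOn.mul (by fun_prop) (hH.holo y hy u ⟨hu.1, hu.2.trans_lt ht.2⟩)
    · intro p0 hp0
      have hn := hD.norm_pos hp0
      obtain ⟨L, m, hL, hm, h⟩ := hloc t (2 * ‖p0‖) ht.2 (by linarith)
      refine ⟨{p | ‖p0‖ / 2 < ‖p‖ ∧ ‖p‖ < 2 * ‖p0‖}, ?_, _, (hint m t hm ht.1).const_mul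
        (L * (‖p0‖ / 2) ^ (k - 1)), ?_⟩
      · exact ((isOpen_lt continuous_const continuous_norm).inter
          (isOpen_lt continuous_norm continuous_const)).mem_nhds ⟨half_lt_self hn, lt_two_mul_self
          hn⟩
      · filter_upwards [ae_restrict_mem measurableSet_Ioc] with u hu p hpV hp
        refine (h y hy p hp hpV.2.le t ⟨ht.1, le_rfl⟩ u hu).trans ?_
        have h5 := (rpow_sub_one_le_of_mem (half_pos hn) hpV.1.le hpV.2.le hk1).2
        have := hu.1
        gcongr
  · intro p hp t ht
    simp_rw [hset _ _ t ht.1]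
    refine holomorphic_integral (F := fun y (u : ℝ) => cexp (-(lam p * (t - u))) * H y p u) hX
      (fun y hy => hmeas y hy p hp t ht) ?_ ?_
    · filter_upwards [ae_restrict_mem measurableSet_Ioc] with u hu
      exact (hH.holo_param p hp u ⟨hu.1, hu.2.trans_lt ht.2⟩).const_mul _
    · intro y0 hy0
      obtain ⟨L, m, hL, hm, h⟩ := hloc t ‖p‖ ht.2 (hD.norm_pos hp)
      refine ⟨univ, univ_mem, _, (hint m t hm ht.1).const_mul (L * ‖p‖ ^ (k - 1)), ?_⟩
      filter_upwards [ae_restrict_mem measurableSet_Ioc] with u hu y _ hy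
      exact h y hy p hp le_rfl t ⟨ht.1, le_rfl⟩ u hu
  · intro t1 t2 r0 h1 h2 h3
    rcases lt_or_ge t2 t1 with h12 | h12
    · exact ⟨0, le_rfl, fun y _ p _ _ t ht => absurd (ht.1.trans ht.2) (not_le.2 h12)⟩
    obtain ⟨L, m, hL, hm, h⟩ := hloc t2 r0 h2 h3
    have h20 : 0 < t2 := h1.trans_le h12
    refine ⟨L * ∫ u in Ioc 0 t2, u ^ (m - 1), mul_nonneg hL (setIntegral_nonneg measurableSet_Ioc
      fun u hu => rpow_nonneg hu.1.le _), fun y hy p hp hpr t ht => ?_⟩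
    have ht0 : 0 < t := h1.trans_le ht.1
    rw [hset _ _ _ ht0]
    have h4 : ‖∫ u : ℝ in Ioc 0 t, cexp (-(lam p * (t - u))) * H y p u‖ ≤
      ∫ u in Ioc 0 t, L * ‖p‖ ^ (k - 1) * u ^ (m - 1) :=
      norm_integral_le_of_norm_le ((hint m t hm ht0).const_mul _) (by
        filter_upwards [ae_restrict_mem measurableSet_Ioc] with u hu using
          h y hy p hp hpr t ⟨ht0, ht.2⟩ u hu)
    rw [integral_const_mul] at h4
    refine h4.trans ?_
    have h5 : ∫ u in Ioc 0 t, u ^ (m - 1) ≤ ∫ u in Ioc 0 t2, u ^ (m - 1) := by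
      refine setIntegral_mono_set (hint m t2 hm h20) ?_ (Ioc_subset_Ioc_right ht.2).eventuallyLE
      filter_upwards [ae_restrict_mem measurableSet_Ioc] with u hu using rpow_nonneg hu.1.le _
    calc _ ≤ L * ‖p‖ ^ (k - 1) * ∫ u in Ioc 0 t2, u ^ (m - 1) := mul_le_l h5 (by positivity)
      _ = _ := by ring

end

section

variable {y z k a r : ℝ} {f g v : ℝ → ℝ} {M : ℕ}

lemma one_add_pow_le_exp (m : ℕ) {d : ℝ} (hd : 0 < d) :
    ∃ K : ℝ, 1 ≤ K ∧ ∀ x : ℝ, 0 ≤ x → (1 + x) ^ m ≤ K * exp (d * x) := by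
  have h1 : Tendsto (fun x => x ^ m * exp (-(d * x))) atTop (𝓝 0) := by
    have := tendsto_pow_mul_exp_neg_atTop_nhds_zero m
    have h2 := (this.comp (tendsto_id.const_mul_atTop hd)).const_mul ((d ^ m)⁻¹)
    rw [mul_zero] at h2
    refine h2.congr fun x => ?_
    simp only [Function.comp, id, mul_pow]
    field_simp
  have hc : Continuous (fun x => x ^ m * exp (-(d * x))) := by fun_prop
  obtain ⟨x0, hx0⟩ := (h1.eventually (gt_mem_nhds one_pos)).exists_forall_of_atTop
  obtain ⟨C, hC⟩ := (isCompact_Icc (a := (0 : ℝ))).exists_bound_of_continuousOn hc.continuousOn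
  refine ⟨max C 1 * exp d, ?_, fun x hx => ?_⟩
  · exact one_le_mul_of_one_le_of_one_le (le_max_right _ _) (one_le_exp hd.le)
  have h3 : (1 + x) ^ m * exp (-(d * (1 + x))) ≤ max C 1 := by
    rcases le_total (1 + x) (max x0 0) with h | h
    · exact (le_abs_self _).trans ((hC (1 + x) ⟨by linarith, h⟩).trans (le_max_left _ _))
    · exact (hx0 (1 + x) ((le_max_left _ _).trans h)).le.trans (le_max_right _ _)
  rw [exp_neg, ← div_eq_mul_inv, div_le_iff₀ (exp_pos _)] at h3
  refine h3.trans_eq ?_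
  rw [mul_add, mul_one, exp_add, mul_assoc]

/-- The weight `e^y (1+y)^{-M}`. -/
def expWeight (M : ℕ) (y : ℝ) : ℝ := exp y / (1 + y) ^ M

lemma expWeight_pos (M : ℕ) (hy : 0 ≤ y) : 0 < expWeight M y := by unfold expWeight; positivity

lemma expWeight_le_exp (M : ℕ) (hy : 0 ≤ y) : expWeight M y ≤ exp y :=
    div_le_self (exp_pos _).le (one_le_pow₀ (by linarith))

lemma expWeight_le_shift (M : ℕ) (hy : 0 ≤ y) (hz : 0 ≤ z) :
    expWeight M y ≤ expWeight M (y + z) * ((1 + z) ^ M * exp (-z)) := by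
  have h1 : (1 + (y + z)) ^ M ≤ (1 + y) ^ M * (1 + z) ^ M := by
    rw [← mul_pow]; exact pow_le_pow_left₀ (by positivity) (by nlinarith) M
  have h2 : exp (y + z) * exp (-z) = exp y := by rw [← exp_add]; congr 1; ring
  unfold expWeight
  calc _ = exp y * (1 + z) ^ M / ((1 + y) ^ M * (1 + z) ^ M) := by field_simp
    _ ≤ exp y * (1 + z) ^ M / (1 + (y + z)) ^ M :=
      div_le_div_of_nonneg_left (by positivity) (by positivity) h1
    _ = _ := by rw [← h2]; ring

lemma expWeight_mul_le_of_le (M : ℕ) (hy : 0 ≤ y) (hyz : y ≤ z) :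
    expWeight M y * expWeight M z ≤ 2 ^ M * expWeight M (y + z) * (1 / (1 + y) ^ M) := by
  have hz := hy.trans hyz
  have h1 : (1 + (y + z)) ^ M ≤ 2 ^ M * (1 + z) ^ M := by
    rw [← mul_pow]; exact pow_le_pow_left₀ (by positivity) (by linarith) M
  unfold expWeight
  rw [exp_add]
  calc _ = exp y * exp z * 2 ^ M / (2 ^ M * (1 + z) ^ M) * (1 / (1 + y) ^ M) := by field_simp
    _ ≤ exp y * exp z * 2 ^ M / (1 + (y + z)) ^ M * (1 / (1 + y) ^ M) := by gcongr
    _ = _ := by ring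

/-- `f * g ≤ k v` for the convolution on the half line, by means of an integrable bound. -/
def ConvBound (f g : ℝ → ℝ) (k : ℝ) (v : ℝ → ℝ) : Prop :=
  ∀ r : ℝ, 0 < r → ∃ q : ℝ → ℝ, IntegrableOn q (Ioo 0 1) ∧
    (∀ s ∈ Ioo (0 : ℝ) 1, f (s * r) * g ((1 - s) * r) ≤ q s) ∧ r * ∫ s in Ioo 0 1, q s ≤ k * v r

lemma ConvBound.mono {k' : ℝ} (h : ConvBound f g k v) (hk : k ≤ k')
    (hv : ∀ r, 0 < r → 0 ≤ v r) : ConvBound f g k' v := fun r hr => by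
  obtain ⟨q, h1, h2, h3⟩ := h r hr
  exact ⟨q, h1, h2, h3.trans (mul_le_r hk (hv r hr))⟩

lemma norm_lconv_le {F G : ℂ → ℂ} {A B : ℝ} {D : Set ℂ} (hD : OpenCone D)
    (h : ConvBound f g k v) (hA : 0 ≤ A) (hB : 0 ≤ B)
    {a b : ℕ} (hf : ∀ r, 0 < r → 0 ≤ f r) (hg : ∀ r, 0 < r → 0 ≤ g r)
    (hF : ∀ p ∈ D, ‖F p‖ ≤ A * ‖p‖ ^ a * f ‖p‖) (hG : ∀ p ∈ D, ‖G p‖ ≤ B * ‖p‖ ^ b * g ‖p‖)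
    {p : ℂ} (hp : p ∈ D) : ‖lconv F G p‖ ≤ A * B * k * ‖p‖ ^ (a + b) * v ‖p‖ := by
  have hn := hD.norm_pos hp
  obtain ⟨q, h1, h2, h3⟩ := h ‖p‖ hn
  rw [lconv_eq_setIntegral, norm_mul]
  have h4 : ‖∫ S : ℝ in Ioo 0 1, F (S * p) * G (((1 - S : ℝ) : ℂ) * p)‖ ≤
    ∫ S in Ioo 0 1, A * B * ‖p‖ ^ (a + b) * q S := by
    refine norm_integral_le_of_norm_le (h1.const_mul _) ?_
    filter_upwards [ae_restrict_mem measurableSet_Ioo] with S hS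
    have hs : 0 < 1 - S := by linarith [hS.2]
    have n1 : ‖(S : ℂ) * p‖ = S * ‖p‖ := by rw [norm_mul, norm_coe hS.1.le]
    have n2 : ‖((1 - S : ℝ) : ℂ) * p‖ = (1 - S) * ‖p‖ := by rw [norm_mul, norm_coe]
    have e1 := hF _ (hD.smul_mem p hp S hS.1)
    have e2 := hG _ (hD.smul_mem p hp (1 - S) hs)
    rw [n1] at e1; rw [n2] at e2
    have f0 := hf (S * ‖p‖) (mul_pos hS.1 hn)
    have g0 := hg ((1 - S) * ‖p‖) (mul_pos hs hn)
    have p1 := pow_le_pow_left₀ (mul_nonneg hS.1.le hn.le) (mul_le_of_le_one_left hn.le hS.2.le) a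
    have p2 := pow_le_pow_left₀ (mul_nonneg hs.le hn.le)
      (mul_le_of_le_one_left hn.le (by linarith [hS.1])) b
    rw [norm_mul]
    calc _ ≤ (A * ‖p‖ ^ a * f (S * ‖p‖)) * (B * ‖p‖ ^ b * g ((1 - S) * ‖p‖)) := by
          refine mul_le_lr (e1.trans ?_) (e2.trans ?_)
          · gcongr
          · gcongr
      _ = A * B * ‖p‖ ^ (a + b) * (f (S * ‖p‖) * g ((1 - S) * ‖p‖)) := by rw [pow_add]; ring
      _ ≤ _ := mul_le_l (h2 S hS)
  rw [integral_const_mul] at h4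
  calc _ ≤ ‖p‖ * (A * B * ‖p‖ ^ (a + b) * ∫ S in Ioo 0 1, q S) := mul_le_l h4
    _ = A * B * ‖p‖ ^ (a + b) * (‖p‖ * ∫ S in Ioo 0 1, q S) := by ring
    _ ≤ A * B * ‖p‖ ^ (a + b) * (k * v ‖p‖) := mul_le_l h3
    _ = _ := by ring

lemma setIntegral_comp_mul_le (hg : IntegrableOn g (Ioi 0))
    (h0 : ∀ x, 0 < x → 0 ≤ g x) (ha : 0 < a) : IntegrableOn (fun s => g (a * s)) (Ioo 0 1) ∧
    a * ∫ s in Ioo 0 1, g (a * s) ≤ ∫ x in Ioi 0, g x := by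
  have h1 : IntegrableOn (fun s => g (a * s)) (Ioi 0) := by
    rw [integrableOn_Ioi_comp_mul_left_iff g 0 ha, mul_zero]; exact hg
  refine ⟨h1.mono_set Ioo_subset_Ioi_self, ?_⟩
  have h2 := integral_comp_mul_left_Ioi g 0 ha
  rw [mul_zero, smul_eq_mul] at h2
  have h3 : ∫ s in Ioo 0 1, g (a * s) ≤ ∫ s in Ioi 0, g (a * s) := by
    refine setIntegral_mono_set h1 ?_ Ioo_subset_Ioi_self.eventuallyLE
    filter_upwards [ae_Ioi] with s hs using h0 _ (mul_pos ha hs)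
  calc _ ≤ a * (a⁻¹ * ∫ x in Ioi 0, g x) := by rw [← h2]; exact mul_le_l h3
    _ = _ := by rw [← mul_assoc, mul_inv_cancel₀ ha.ne', one_mul]

lemma setIntegral_comp_mul_one_sub_le (hg : IntegrableOn g (Ioi 0))
    (h0 : ∀ x, 0 < x → 0 ≤ g x) (ha : 0 < a) : IntegrableOn (fun s => g (a * (1 - s))) (Ioo 0 1) ∧
    a * ∫ s in Ioo 0 1, g (a * (1 - s)) ≤ ∫ x in Ioi 0, g x := by
  obtain ⟨h1, h2⟩ := setIntegral_comp_mul_le hg h0 ha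
  rw [← integrableOn_Ioc_iff_integrableOn_Ioo,
    ← intervalIntegrable_iff_integrableOn_Ioc_of_le zero_le_one] at h1 ⊢
  rw [← integral_Ioc_eq_integral_Ioo, ← intervalIntegral.integral_of_le zero_le_one] at h2 ⊢
  refine ⟨by simpa using (h1.comp_sub_left 1).symm, ?_⟩
  rw [intervalIntegral.integral_comp_sub_left (fun s => g (a * s)), sub_self, sub_zero]; exact h2

variable {J : Type*} [Fintype J]

/-- The weight `∑ A_i r^{b_i-1} e^{cr} (1+cr)^{-M}`. -/
def sumWeight (A b : J → ℝ) (M : ℕ) (c r : ℝ) : ℝ :=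
  (∑ i, A i * r ^ (b i - 1)) * expWeight M (c * r)

lemma sumWeight_nonneg {A b : J → ℝ} {c : ℝ} (hA : ∀ i, 0 ≤ A i) (hc : 0 ≤ c)
    (hr : 0 ≤ r) : 0 ≤ sumWeight A b M c r :=
    mul_nonneg (sum_nonneg fun i _ => mul_nonneg (hA i) (rpow_nonneg hr _))
    (expWeight_pos M (mul_nonneg hc hr)).le

lemma sum_rpow_mono {A b : J → ℝ} (hA : ∀ i, 0 ≤ A i) (hb : ∀ i, 1 ≤ b i) {s : ℝ}
    (hs : 0 ≤ s) (hsr : s ≤ r) : ∑ i, A i * s ^ (b i - 1) ≤ ∑ i, A i * r ^ (b i - 1) :=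
    sum_le_sum fun i _ => mul_le_l (rpow_le_rpow hs hsr (by linarith [hb i])) (hA i)

lemma convBound_sumWeight {b : J → ℝ} (hb : ∀ i, 1 ≤ b i) (hM : ∀ i, b i + 1 ≤ M) :
    ∃ K : ℝ, 0 ≤ K ∧ ∀ (A : J → ℝ) (c : ℝ), (∀ i, 0 ≤ A i) → 0 < c →
    ConvBound (sumWeight A b M c) (sumWeight A b M c) (K * ∑ i, A i * c ^ (-b i))
    (sumWeight A b M c) := by
  set g : ℝ → ℝ := fun x => (1 + x) ^ (-1 - 1 : ℝ) with hg
  have hgi : IntegrableOn g (Ioi 0) := integrableOn_one_add_rpow one_pos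
  have hg0 : ∀ x, 0 < x → 0 ≤ g x := fun x hx => by positivity
  have hI : 0 ≤ ∫ x in Ioi 0, g x := setIntegral_nonneg measurableSet_Ioi fun x hx => hg0 x hx
  refine ⟨2 ^ M * 2 * ∫ x in Ioi 0, g x, by positivity, fun A c hA hc r hr => ?_⟩
  have hcr := mul_pos hc hr
  obtain ⟨i1, b1⟩ := setIntegral_comp_mul_le hgi hg0 hcr
  obtain ⟨i2, b2⟩ := setIntegral_comp_mul_one_sub_le hgi hg0 hcr
  set S := ∑ i, A i * c ^ (-b i) with hS
  have hS0 : 0 ≤ S := sum_nonneg fun i _ => mul_nonneg (hA i) (by positivity)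
  have hv0 := sumWeight_nonneg (b := b) (M := M) hA hc.le hr.le
  have hu : ∀ s, 0 < s → (∑ i, A i * s ^ (b i - 1)) * (1 / (1 + c * s) ^ M) ≤
    S * c * g (c * s) := fun s hs => by
    have hcs : 0 < c * s := mul_pos hc hs
    rw [hS, sum_mul, sum_mul, sum_mul]
    refine sum_le_sum fun i _ => ?_
    have e1 : (c * s) ^ (b i - 1) * (1 / (1 + c * s) ^ M) ≤ g (c * s) := by
      rw [one_div, ← rpow_natCast, ← rpow_neg (by positivity)]
      calc _ ≤ (1 + c * s) ^ (b i - 1) * (1 + c * s) ^ (-(M : ℝ)) := by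
            refine mul_le_r ?_
            exact rpow_le_rpow hcs.le (by linarith) (by linarith [hb i])
        _ = (1 + c * s) ^ (b i - 1 + -(M : ℝ)) := (rpow_add (by positivity) _ _).symm
        _ ≤ _ := rpow_le_rpow_of_exponent_le (by linarith) (by linarith [hM i])
    have e2 : s ^ (b i - 1) = c ^ (-b i) * c * (c * s) ^ (b i - 1) := by
      rw [mul_rpow hc.le hs.le, ← mul_assoc, mul_assoc (c ^ (-b i)), mul_comm c,
        ← rpow_add_one hc.ne', sub_add_cancel, ← rpow_add hc, neg_add_cancel, rpow_zero, one_mul]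
    rw [e2]
    calc _ = A i * (c ^ (-b i) * c) * ((c * s) ^ (b i - 1) * (1 / (1 + c * s) ^ M)) := by ring
      _ ≤ A i * (c ^ (-b i) * c) * g (c * s) := mul_le_l e1 (mul_nonneg (hA i) (by positivity))
      _ = _ := by ring
  have key : ∀ s s', 0 < s → s ≤ s' → s + s' = r → sumWeight A b M c s * sumWeight A b M c s' ≤
    2 ^ M * sumWeight A b M c r * (S * c * g (c * s)) := fun s s' hs hss' hr' => by
    have hs' := hs.trans_le hss'
    have hw := expWeight_mul_le_of_le M (mul_pos hc hs).le (mul_le_l hss')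
    rw [← mul_add, hr'] at hw
    have h0 : ∀ s, 0 < s → 0 ≤ ∑ i, A i * s ^ (b i - 1) := fun s hs =>
      sum_nonneg fun i _ => mul_nonneg (hA i) (rpow_nonneg hs.le _)
    unfold sumWeight at *
    calc _ = (∑ i, A i * s ^ (b i - 1)) * (∑ i, A i * s' ^ (b i - 1)) *
      (expWeight M (c * s) * expWeight M (c * s')) := by ring
      _ ≤ (∑ i, A i * s ^ (b i - 1)) * (∑ i, A i * r ^ (b i - 1)) *
        (2 ^ M * expWeight M (c * r) * (1 / (1 + c * s) ^ M)) := by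
          refine mul_le_mul (mul_le_l (sum_rpow_mono hA hb hs'.le (by linarith : s' ≤ r)) (h0 s hs))
            hw ?_ ?_
          · exact mul_nonneg (expWeight_pos M (by positivity)).le
              (expWeight_pos M (by positivity)).le
          · exact mul_nonneg (h0 s hs) (h0 r hr)
      _ = 2 ^ M * ((∑ i, A i * r ^ (b i - 1)) * expWeight M (c * r)) *
        ((∑ i, A i * s ^ (b i - 1)) * (1 / (1 + c * s) ^ M)) := by ring
      _ ≤ _ := mul_le_l (hu s hs)
  refine ⟨fun y => 2 ^ M * sumWeight A b M c r * (S * c) *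
    (g (c * r * y) + g (c * r * (1 - y))), (i1.add i2).const_mul _, fun y hy => ?_, ?_⟩
  · have hs : 0 < 1 - y := by linarith [hy.2]
    have e1 : c * (y * r) = c * r * y := by ring
    have e2 : c * ((1 - y) * r) = c * r * (1 - y) := by ring
    have p1 := hg0 _ (mul_pos hcr hy.1)
    have p2 := hg0 _ (mul_pos hcr hs)
    have hco : 0 ≤ 2 ^ M * sumWeight A b M c r * (S * c) := by positivity
    rcases le_total y (1 - y) with h | h
    · have := key (y * r) ((1 - y) * r) (mul_pos hy.1 hr) (mul_le_r h) (by ring)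
      rw [e1] at this; nlinarith
    · have := key ((1 - y) * r) (y * r) (mul_pos hs hr) (mul_le_r h) (by ring)
      rw [e2] at this; nlinarith
  · rw [integral_const_mul, integral_add i1 i2]
    have hco : 0 ≤ 2 ^ M * sumWeight A b M c r * S := by positivity
    nlinarith [mul_le_l (add_le_add b1 b2)]

lemma convBound_sumWeight_rpow {b : J → ℝ} (hb : ∀ i, 1 ≤ b i) (hk : 0 < k) :
    ∃ K : ℝ, 0 ≤ K ∧ ∀ (A : J → ℝ) (c R' : ℝ), (∀ i, 0 ≤ A i) → 0 < c → 2 * R' ≤ c →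
    ConvBound (sumWeight A b M c) (fun r => r ^ (k - 1) * exp (R' * r)) (K * c ^ (-k))
    (sumWeight A b M c) := by
  obtain ⟨K, hK1, hK⟩ := one_add_pow_le_exp M (d := 1 / 4) (by norm_num)
  set g : ℝ → ℝ := fun x => x ^ (k - 1) * exp (-(1 / 4 * x))
  have hg0 : ∀ x, 0 < x → 0 ≤ g x := fun x hx => by positivity
  have hI : 0 ≤ ∫ x in Ioi 0, g x := setIntegral_nonneg measurableSet_Ioi fun x hx => hg0 x hx
  refine ⟨K * ∫ x in Ioi 0, g x, by positivity, fun A c R' hA hc hR r hr => ?_⟩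
  have hcr := mul_pos hc hr
  obtain ⟨i2, b2⟩ := setIntegral_comp_mul_one_sub_le (integrableOn_rpow_exp hk (by norm_num)) hg0
    hcr
  have hv0 := sumWeight_nonneg (b := b) (M := M) hA hc.le hr.le
  refine ⟨fun S => sumWeight A b M c r * K * c ^ (1 - k) * g (c * r * (1 - S)), i2.const_mul _,
    fun S hS => ?_, ?_⟩
  · have hs : 0 < 1 - S := by linarith [hS.2]
    set s := (1 - S) * r with hs'
    have hs0 : 0 < s := mul_pos hs hr
    have hSr : 0 < S * r := mul_pos hS.1 hr
    have e0 : c * (S * r) + c * s = c * r := by rw [hs']; ring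
    have e1 : c * r * (1 - S) = c * s := by rw [hs']; ring
    have h1 := expWeight_le_shift M (mul_pos hc hSr).le (mul_pos hc hs0).le
    rw [e0] at h1
    have h3 : ∀ s, 0 < s → 0 ≤ ∑ i, A i * s ^ (b i - 1) := fun s hs =>
      sum_nonneg fun i _ => mul_nonneg (hA i) (rpow_nonneg hs.le _)
    have hE := expWeight_pos M hcr.le
    have h4 : (1 + c * s) ^ M * exp (-(c * s)) * exp (R' * s) ≤ K * exp (-(1 / 4 * (c * s))) := by
      calc _ ≤ K * exp (1 / 4 * (c * s)) * exp (-(c * s)) * exp (1 / 2 * (c * s)) := by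
            refine mul_le_lr (mul_le_r (hK _ (by positivity))) (exp_le_exp.2 (by nlinarith))
        _ = _ := by rw [mul_assoc, mul_assoc, ← exp_add, ← exp_add]; congr 2; ring
    have e2 : c ^ (1 - k) * (c * s) ^ (k - 1) = s ^ (k - 1) := by
      rw [mul_rpow hc.le hs0.le, ← mul_assoc, ← rpow_add hc]; simp
    beta_reduce
    rw [e1]
    unfold sumWeight
    calc _ ≤ ((∑ i, A i * r ^ (b i - 1)) * (expWeight M (c * r) *
      ((1 + c * s) ^ M * exp (-(c * s))))) * (s ^ (k - 1) * exp (R' * s)) := by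
          refine mul_le_r (mul_le_mul (sum_rpow_mono hA hb hSr.le (mul_le_of_le_one_left hr.le
            hS.2.le)) h1 (expWeight_pos M (by positivity)).le (h3 r hr))
      _ = (∑ i, A i * r ^ (b i - 1)) * expWeight M (c * r) * s ^ (k - 1) *
        ((1 + c * s) ^ M * exp (-(c * s)) * exp (R' * s)) := by ring
      _ ≤ (∑ i, A i * r ^ (b i - 1)) * expWeight M (c * r) * s ^ (k - 1) *
        (K * exp (-(1 / 4 * (c * s)))) := mul_le_l h4
      _ = _ := by rw [← e2]; ring
  · rw [integral_const_mul]
    have e3 : c ^ (1 - k) = c * c ^ (-k) := by rw [sub_eq_add_neg, rpow_add hc, rpow_one]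
    have hco : 0 ≤ sumWeight A b M c r * K * c ^ (-k) := by positivity
    rw [e3]; nlinarith [mul_le_l b2]

end

section

variable {J : Type*} [Fintype J]

variable {M : ℕ} {h v t m X T : ℝ}

/-- The weight `∑ t^{a_i} r^{b_i-1} e^y (1+y)^{-M}` with `y = v t^h r`. -/
def timeWeight (a b : J → ℝ) (M : ℕ) (h v t r : ℝ) : ℝ :=
  sumWeight (fun i => t ^ a i) b M (v * t ^ h) r

lemma timeWeight_nonneg {a b : J → ℝ} {r : ℝ} (hv : 0 ≤ v) (ht : 0 ≤ t)
    (hr : 0 ≤ r) : 0 ≤ timeWeight a b M h v t r :=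
    sumWeight_nonneg (fun _ => rpow_nonneg ht _) (mul_nonneg hv (rpow_nonneg ht _)) hr

lemma timeWeight_le_mul {a b : J → ℝ} (M : ℕ) (hh : 0 ≤ h) (hm : ∀ i, m ≤ a i) :
    ∃ K : ℝ, 0 < K ∧ ∀ v u t r : ℝ, 0 ≤ v → 0 < u → u ≤ t → 0 ≤ r →
    timeWeight a b M h v u r ≤ K * (u / t) ^ m * timeWeight a b M h v t r := by
  obtain ⟨K, hK1, hK⟩ := one_add_pow_le_exp M one_pos
  refine ⟨K, by linarith, fun v u t r hv hu hut hr => ?_⟩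
  have ht := hu.trans_le hut
  have hy : 0 ≤ v * u ^ h * r := by positivity
  have hyt : v * u ^ h * r ≤ v * t ^ h * r := by gcongr
  have h1 : expWeight M (v * u ^ h * r) ≤ K * expWeight M (v * t ^ h * r) := by
    have := expWeight_le_shift M hy (sub_nonneg.2 hyt)
    rw [add_sub_cancel] at this
    refine this.trans ?_
    rw [mul_comm]
    refine mul_le_r ?_ (expWeight_pos M (by positivity)).le
    rw [exp_neg, ← div_eq_mul_inv, div_le_iff₀ (exp_pos _)]
    simpa using hK _ (sub_nonneg.2 hyt)
  have h2 : ∑ i, u ^ a i * r ^ (b i - 1) ≤ (u / t) ^ m * ∑ i, t ^ a i * r ^ (b i - 1) := by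
    rw [mul_sum]
    refine sum_le_sum fun i _ => ?_
    rw [← mul_assoc]
    refine mul_le_r ?_
    calc _ = (u / t) ^ a i * t ^ a i := by
          rw [← mul_rpow (by positivity) ht.le, div_mul_cancel₀ _ ht.ne']
      _ ≤ _ := by
          refine mul_le_r ?_
          exact rpow_le_rpow_of_exponent_ge (by positivity) ((div_le_one ht).2 hut) (hm i)
  unfold timeWeight sumWeight
  calc _ ≤ ((u / t) ^ m * ∑ i, t ^ a i * r ^ (b i - 1)) * (K * expWeight M (v * t ^ h * r)) :=
    mul_le_mul h2 h1 (expWeight_pos M hy).le (mul_nonneg (by positivity)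
    (sum_nonneg fun i _ => by positivity))
    _ = _ := by ring

lemma integral_exp_mul_sub (hX : 0 < X) :
    ∫ u in (0 : ℝ)..t, exp (-(X * (t - u))) = (1 - exp (-(X * t))) / X := by
  have : ∀ u, HasDerivAt (fun u => exp (-(X * (t - u))) / X) (exp (-(X * (t - u)))) u := fun u => by
    have h1 : HasDerivAt (fun u => -(X * (t - u))) X u := by
      have := (((hasDerivAt_id u).const_sub t).const_mul X).neg
      simpa using! this
    refine (h1.exp.div_const X).congr_deriv ?_
    field_simp
  rw [intervalIntegral.integral_eq_sub_of_hasDerivAt (fun u _ => this u)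
    ((by fun_prop : Continuous fun u => exp (-(X * (t - u)))).intervalIntegrable _ _)]
  simp [sub_div]

lemma norm_integral_duhamel_le {c C0 : ℝ} (hc : 0 < c) (hC0 : 0 ≤ C0) (hm : 0 < m)
    (ht : 0 < t) (htT : t ≤ T) (hX : 0 < X) {lam : ℂ} (hlam : c * X - C0 ≤ lam.re) {B : ℝ}
    (hB : 0 ≤ B) {H : ℝ → ℂ} (hH : ∀ u ∈ Ioc 0 t, ‖H u‖ ≤ B * (u⁻¹ * (1 + X * u) * (u / t) ^ m)) :
    ‖∫ u in (0 : ℝ)..t, cexp (-(lam * (t - u))) * H u‖ ≤ exp (C0 * T) * (1 / m + 1 / c) * B := by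
  have hi1 : IntervalIntegrable (fun u => t ^ (-m) * u ^ (m - 1)) volume 0 t :=
    (intervalIntegrable_rpow' (by linarith)).const_mul _
  have hi2 : IntervalIntegrable (fun u => X * exp (-(c * X * (t - u)))) volume 0 t :=
    (by fun_prop : Continuous fun u => X * exp (-(c * X * (t - u)))).intervalIntegrable _ _
  have hb : ∀ u ∈ Ioc 0 t, ‖cexp (-(lam * (t - u))) * H u‖ ≤
    exp (C0 * T) * B * (t ^ (-m) * u ^ (m - 1) + X * exp (-(c * X * (t - u)))) := fun u hu => by
    have hu0 : 0 < u := hu.1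
    have hs : 0 ≤ t - u := sub_nonneg.2 hu.2
    have e1 : ‖cexp (-(lam * (t - u)))‖ ≤ exp (C0 * T) * exp (-(c * X * (t - u))) := by
      rw [norm_exp, ← ofReal_sub, ← exp_add, neg_re, re_mul_ofReal]
      refine exp_le_exp.2 ?_
      have h1 := mul_le_r hlam hs
      have h2 : C0 * (t - u) ≤ C0 * T := mul_le_l (by linarith) hC0
      linarith
    have e2 : exp (-(c * X * (t - u))) ≤ 1 := by
      rw [exp_le_one_iff]
      have : 0 ≤ c * X * (t - u) := by positivity
      linarith
    have e3 := rpow_le_one (by positivity) ((div_le_one ht).2 hu.2) hm.le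
    have e4 : u⁻¹ * (u / t) ^ m = t ^ (-m) * u ^ (m - 1) := by
      rw [div_rpow hu0.le ht.le, rpow_neg ht.le, rpow_sub_one hu0.ne']
      field_simp
    rw [norm_mul]
    calc _ ≤ (exp (C0 * T) * exp (-(c * X * (t - u)))) * (B * (u⁻¹ * (1 + X * u) * (u / t) ^ m)) :=
      mul_le_mul e1 (hH u hu) (norm_nonneg _) (by positivity)
      _ = exp (C0 * T) * B * ((t ^ (-m) * u ^ (m - 1)) * exp (-(c * X * (t - u))) +
        X * exp (-(c * X * (t - u))) * (u / t) ^ m) := by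
          rw [← e4]
          field_simp
      _ ≤ _ := by
          refine mul_le_l (add_le_add ?_ ?_)
          · exact mul_le_of_le_one_right (by positivity) e2
          · exact mul_le_of_le_one_right (by positivity) e3
  refine (intervalIntegral.norm_integral_le_of_norm_le ht.le (.of_forall hb)
    ((hi1.add hi2).const_mul _)).trans ?_
  rw [intervalIntegral.integral_const_mul, intervalIntegral.integral_add hi1 hi2,
    intervalIntegral.integral_const_mul, intervalIntegral.integral_const_mul,
    integral_exp_mul_sub (by positivity), integral_rpow (Or.inl (by linarith))]
  rw [sub_add_cancel, zero_rpow hm.ne', sub_zero]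
  have f1 : t ^ (-m) * (t ^ m / m) = 1 / m := by
    rw [rpow_neg ht.le]
    have := (rpow_pos_of_pos ht m).ne'
    field_simp
  have f2 : X * ((1 - exp (-(c * X * t))) / (c * X)) ≤ 1 / c := by
    rw [mul_div_assoc', mul_comm c X, mul_div_mul_left _ _ hX.ne']
    exact div_le_div_of_nonneg_right (by linarith [exp_pos (-(X * c * t))]) hc.le
  rw [f1]
  calc _ ≤ exp (C0 * T) * B * (1 / m + 1 / c) := mul_le_l (by linarith)
    _ = _ := by ring

lemma convBound_timeWeight {a b : J → ℝ} {h' : ℝ} (hb : ∀ i, 1 ≤ b i)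
    (hM : ∀ i, b i + 1 ≤ M) (hab : ∀ i, h' ≤ a i - b i * h) (hT : 0 < T) :
    ∃ K : ℝ, 0 ≤ K ∧ ∀ v t : ℝ, 1 ≤ v → 0 < t → t < T →
    ConvBound (timeWeight a b M h v t) (timeWeight a b M h v t) (K * (t ^ h' / v))
    (timeWeight a b M h v t) := by
  obtain ⟨K, hK0, hK⟩ := convBound_sumWeight hb hM
  refine ⟨K * ∑ i, T ^ (a i - b i * h - h'), mul_nonneg hK0
    (sum_nonneg fun i _ => by positivity), fun v t hv ht htT => ?_⟩
  have hv0 : 0 < v := by linarith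
  refine (hK (fun i => t ^ a i) (v * t ^ h) (fun i => by positivity) (by positivity)).mono ?_
    fun r hr => timeWeight_nonneg hv0.le ht.le hr.le
  rw [mul_assoc, sum_mul]
  refine mul_le_l (sum_le_sum fun i _ => ?_)
  have e1 : t ^ a i * (v * t ^ h) ^ (-b i) = v ^ (-b i) * (t ^ (a i - b i * h - h') * t ^ h') := by
    rw [mul_rpow hv0.le (by positivity), ← rpow_mul ht.le, ← rpow_add ht,
      mul_left_comm, ← rpow_add ht]
    congr 2; ring
  have e2 : v ^ (-b i) ≤ v⁻¹ := by
    rw [← rpow_neg_one]; exact rpow_le_rpow_of_exponent_le hv (by linarith [hb i])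
  have e3 : t ^ (a i - b i * h - h') ≤ T ^ (a i - b i * h - h') :=
    rpow_le_rpow ht.le htT.le (by linarith [hab i])
  rw [e1]
  calc _ ≤ v⁻¹ * (T ^ (a i - b i * h - h') * t ^ h') := by gcongr
    _ = _ := by ring

lemma exists_timeWeight_le {a b : J → ℝ} (ha : ∀ i, 0 ≤ a i) (hh : 0 ≤ h)
    (hb : ∀ i, 1 ≤ b i) (hv : 0 ≤ v) {r0 : ℝ} :
    ∃ L : ℝ, 0 ≤ L ∧ ∀ t, 0 < t → t ≤ T → ∀ r, 0 < r → r ≤ r0 → timeWeight a b M h v t r ≤ L := by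
  refine ⟨(∑ i, |T| ^ a i * |r0| ^ (b i - 1)) * exp (v * |T| ^ h * |r0|), by positivity,
    fun t ht htT r hr hr0 => ?_⟩
  have h1 := htT.trans (le_abs_self _)
  have h2 := hr0.trans (le_abs_self _)
  have h3 := rpow_le_rpow ht.le h1 hh
  unfold timeWeight sumWeight
  refine mul_le_lr (sum_le_sum fun i _ => mul_le_lr (rpow_le_rpow ht.le h1 (ha i))
    (rpow_le_rpow hr.le h2 (by linarith [hb i]))) ?_ (expWeight_pos M (by positivity)).le
  refine (expWeight_le_exp M (by positivity)).trans (exp_le_exp.2 ?_)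
  gcongr

end

section

variable {m n : ℕ}

variable {F G : ℂ → ℂ} {k N : ℝ} {p : ℂ}

/-- The transform `(-p)^j U_l(p)` of the derivative `∂^j f_l`. -/
def derivFactor (U : Fin m → ℂ → ℂ) (a : Fin m × ℕ) (p : ℂ) : ℂ := (-p) ^ a.2 * U a.1 p

/-- The convolution of `B` with the factors `derivFactor U a`, `a` in a list. -/
def convMon (U : Fin m → ℂ → ℂ) (B : ℂ → ℂ) : List (Fin m × ℕ) → ℂ → ℂ
  | [] => B
  | a :: L => lconv (derivFactor U a) (convMon U B L)

/-- The list of the factors of `f^k ∏ (∂^j f_l)^{q_{l,j}}`. -/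
def factors (q : DerivIdx m n) (k : Fin m → ℕ) : List (Fin m × ℕ) :=
  (∑ l, k l • ({(l, 0)} : Multiset (Fin m × ℕ)) +
    ∑ l, ∑ j : Fin n, q.1 l j • ({(l, (j : ℕ) + 1)} : Multiset (Fin m × ℕ))).toList

lemma length_factors (q : DerivIdx m n) (k : Fin m → ℕ) :
    (factors q k).length = multiSize k + q.size := by simp [factors, multiSize, DerivIdx.size]

lemma Multiset.map_finsetSum {a y J : Type*} (g : a → y) (s : Finset J) (F : J → Multiset a) :
    Multiset.map g (∑ i ∈ s, F i) = ∑ i ∈ s, Multiset.map g (F i) :=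
    map_sum (Multiset.mapAddMonoidHom g) F s

lemma prod_factors {R : Type*} [CommMonoid R] (q : DerivIdx m n) (k : Fin m → ℕ)
    (g : Fin m × ℕ → R) : ((factors q k).map g).prod =
    (∏ l, g (l, 0) ^ k l) * ∏ l, ∏ j : Fin n, g (l, (j : ℕ) + 1) ^ q.1 l j := by
  rw [← Multiset.prod_coe, ← Multiset.map_coe, factors, Multiset.coe_toList]
  simp [Multiset.map_finsetSum, Multiset.prod_sum, Multiset.map_nsmul, Multiset.prod_nsmul]

lemma sum_snd_factors (q : DerivIdx m n) (k : Fin m → ℕ) :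
    ((factors q k).map Prod.snd).sum = q.order := by
  rw [← Multiset.sum_coe, ← Multiset.map_coe, factors, Multiset.coe_toList]
  simp [Multiset.map_finsetSum, Multiset.sum_sum,
    Multiset.map_nsmul, Multiset.sum_nsmul, DerivIdx.order, mul_comm]

lemma norm_derivFactor_le {D : Set ℂ} {U : Fin m → ℂ → ℂ} {A : ℝ} {v : ℝ → ℝ}
    (hU : ∀ l, ∀ p ∈ D, ‖U l p‖ ≤ A * v ‖p‖) (a : Fin m × ℕ) :
    ∀ p ∈ D, ‖derivFactor U a p‖ ≤ A * ‖p‖ ^ a.2 * v ‖p‖ := fun p hp => by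
  rw [derivFactor, norm_mul, norm_pow, norm_neg]
  calc _ ≤ ‖p‖ ^ a.2 * (A * v ‖p‖) := mul_le_l (hU _ p hp)
    _ = _ := by ring

/-- The weights entering the estimates of the convolutions. -/
structure ConvWeights (v y : ℝ → ℝ) (k1 k2 : ℝ) : Prop where
  v_nonneg : ∀ r, 0 < r → 0 ≤ v r
  β_nonneg : ∀ r, 0 < r → 0 ≤ y r
  k₁_nonneg : 0 ≤ k1
  k₂_nonneg : 0 ≤ k2
  conv_β : ConvBound v y k1 v
  conv_v : ConvBound v v k2 v

lemma norm_convMon_le {D : Set ℂ} (hD : OpenCone D) {v y : ℝ → ℝ} {k1 k2 : ℝ}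
    (W : ConvWeights v y k1 k2) {U : Fin m → ℂ → ℂ} {B : ℂ → ℂ} {A c : ℝ} (hA : 0 ≤ A) (hc : 0 ≤ c)
    (hU : ∀ l, ∀ p ∈ D, ‖U l p‖ ≤ A * v ‖p‖) (hB : ∀ p ∈ D, ‖B p‖ ≤ c * y ‖p‖)
    (a : Fin m × ℕ) (L : List (Fin m × ℕ)) : ∀ p ∈ D,
    ‖convMon U B (a :: L) p‖ ≤ c * k1 * A * (A * k2) ^ L.length *
    ‖p‖ ^ (((a :: L).map Prod.snd).sum) * v ‖p‖ := by
  induction L generalizing a with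
  | nil =>
    intro p hp
    refine (norm_lconv_le hD W.conv_β hA hc (b := 0) W.v_nonneg W.β_nonneg
      (norm_derivFactor_le hU a) (fun p hp => by simpa using! hB p hp) hp).trans_eq ?_
    simp only [List.length_nil, pow_zero, List.map_cons, List.map_nil, List.sum_cons, List.sum_nil]
    ring
  | cons b L ih =>
    intro p hp
    have hk := W.k₁_nonneg
    have hk2 := W.k₂_nonneg
    refine (norm_lconv_le hD W.conv_v hA (by positivity)
      W.v_nonneg W.v_nonneg (norm_derivFactor_le hU a) (ih b) hp).trans_eq ?_
    simp only [List.length_cons, List.map_cons, List.sum_cons]; ring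

lemma integrable_lconv {D : Set ℂ} (hD : OpenCone D) {f g v : ℝ → ℝ} {A B : ℝ}
    (h : ConvBound f g k v) (hA : 0 ≤ A) (hB : 0 ≤ B) {a b : ℕ} (hf : ∀ r, 0 < r → 0 ≤ f r)
    (hg : ∀ r, 0 < r → 0 ≤ g r) (hF : ∀ p ∈ D, ‖F p‖ ≤ A * ‖p‖ ^ a * f ‖p‖)
    (hG : ∀ p ∈ D, ‖G p‖ ≤ B * ‖p‖ ^ b * g ‖p‖) (hFc : ContinuousOn F D) (hGc : ContinuousOn G D)
    (hp : p ∈ D) : IntegrableOn (fun S : ℝ => F (S * p) * G (((1 - S : ℝ) : ℂ) * p)) (Ioo 0 1) := by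
  have hn := hD.norm_pos hp
  obtain ⟨q, h1, h2, -⟩ := h ‖p‖ hn
  refine (h1.const_mul (A * ‖p‖ ^ a * (B * ‖p‖ ^ b))).mono'
    (hD.aestronglyMeasurable_lconv hFc hGc hp) ?_
  filter_upwards [ae_restrict_mem measurableSet_Ioo] with S hS
  have hs : 0 < 1 - S := by linarith [hS.2]
  have n1 : ‖(S : ℂ) * p‖ = S * ‖p‖ := by rw [norm_mul, norm_coe hS.1.le]
  have n2 : ‖((1 - S : ℝ) : ℂ) * p‖ = (1 - S) * ‖p‖ := by rw [norm_mul, norm_coe]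
  have e1 := hF _ (hD.smul_mem p hp S hS.1)
  have e2 := hG _ (hD.smul_mem p hp (1 - S) hs)
  rw [n1] at e1; rw [n2] at e2
  have f0 := hf (S * ‖p‖) (mul_pos hS.1 hn)
  have g0 := hg ((1 - S) * ‖p‖) (mul_pos hs hn)
  have p1 := pow_le_pow_left₀ (mul_nonneg hS.1.le hn.le) (mul_le_of_le_one_left hn.le hS.2.le) a
  have p2 := pow_le_pow_left₀ (mul_nonneg hs.le hn.le)
    (mul_le_of_le_one_left hn.le (by linarith [hS.1])) b
  rw [norm_mul]
  calc _ ≤ (A * ‖p‖ ^ a * f (S * ‖p‖)) * (B * ‖p‖ ^ b * g ((1 - S) * ‖p‖)) := by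
        refine mul_le_lr (e1.trans ?_) (e2.trans ?_)
        · gcongr
        · gcongr
    _ = A * ‖p‖ ^ a * (B * ‖p‖ ^ b) * (f (S * ‖p‖) * g ((1 - S) * ‖p‖)) := by ring
    _ ≤ _ := mul_le_l (h2 S hS)

lemma lconv_sub_lconv {F' G' : ℂ → ℂ}
    (h1 : IntegrableOn (fun s : ℝ => F (s * p) * G (((1 - s : ℝ) : ℂ) * p)) (Ioo 0 1))
    (h2 : IntegrableOn (fun s : ℝ => F' (s * p) * G (((1 - s : ℝ) : ℂ) * p)) (Ioo 0 1))
    (h3 : IntegrableOn (fun s : ℝ => F' (s * p) * G' (((1 - s : ℝ) : ℂ) * p)) (Ioo 0 1)) :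
    lconv F G p - lconv F' G' p =
    lconv (fun p => F p - F' p) G p + lconv F' (fun p => G p - G' p) p := by
  simp only [lconv_eq_setIntegral, sub_mul, mul_sub]; rw [integral_sub h1 h2, integral_sub h2 h3]
  ring

lemma norm_convMon_sub_le {D : Set ℂ} (hD : OpenCone D) {v y : ℝ → ℝ} {k1 k2 : ℝ}
    (W : ConvWeights v y k1 k2) {U V : Fin m → ℂ → ℂ} {B : ℂ → ℂ} {A c o : ℝ} (hA : 0 ≤ A)
    (hc : 0 ≤ c) (he : 0 ≤ o) (hU : ∀ l, ∀ p ∈ D, ‖U l p‖ ≤ A * v ‖p‖)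
    (hV : ∀ l, ∀ p ∈ D, ‖V l p‖ ≤ A * v ‖p‖) (hUV : ∀ l, ∀ p ∈ D, ‖U l p - V l p‖ ≤ o * v ‖p‖)
    (hB : ∀ p ∈ D, ‖B p‖ ≤ c * y ‖p‖) (hUc : ∀ l, ContinuousOn (U l) D)
    (hVc : ∀ l, ContinuousOn (V l) D) (hUm : ∀ L, ContinuousOn (convMon U B L) D)
    (hVm : ∀ L, ContinuousOn (convMon V B L) D) (a : Fin m × ℕ) (L : List (Fin m × ℕ)) : ∀ p ∈ D,
    ‖convMon U B (a :: L) p - convMon V B (a :: L) p‖ ≤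
    (L.length + 1 : ℕ) * (c * k1 * o * (A * k2) ^ L.length) *
    ‖p‖ ^ (((a :: L).map Prod.snd).sum) * v ‖p‖ := by
  have hk := W.k₁_nonneg
  have hk2 := W.k₂_nonneg
  have hfc : ∀ {U : Fin m → ℂ → ℂ}, (∀ l, ContinuousOn (U l) D) → ∀ a,
    ContinuousOn (derivFactor U a) D := fun h a => ContinuousOn.mul (by fun_prop) (h a.1)
  have hsub : ∀ a, ∀ p ∈ D, ‖derivFactor U a p - derivFactor V a p‖ ≤ o * ‖p‖ ^ a.2 * v ‖p‖ := fun a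
    p hp => by
    have := norm_derivFactor_le hUV a p hp
    rwa [derivFactor, mul_sub] at this
  induction L generalizing a with
  | nil =>
    intro p hp
    have hB' : ∀ p ∈ D, ‖B p‖ ≤ c * ‖p‖ ^ 0 * y ‖p‖ := fun p hp => by simpa using! hB p hp
    have i2 := integrable_lconv hD W.conv_β hA hc W.v_nonneg W.β_nonneg
      (norm_derivFactor_le hV a) hB' (hfc hVc a) (hUm []) hp
    have e := lconv_sub_lconv (integrable_lconv hD W.conv_β hA hc W.v_nonneg W.β_nonneg
      (norm_derivFactor_le hU a) hB' (hfc hUc a) (hUm []) hp) i2 i2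
    have e0 : lconv (derivFactor V a) (fun p => convMon U B [] p - B p) p = 0 := by
      simp [lconv, convMon]
    simp only [convMon] at e e0 ⊢; rw [e, e0, add_zero]
    refine (norm_lconv_le hD W.conv_β he hc W.v_nonneg W.β_nonneg (hsub a) hB' hp).trans_eq ?_
    simp only [List.length_nil, pow_zero, List.map_cons, List.map_nil, List.sum_cons, List.sum_nil,
      zero_add, Nat.cast_one]
    ring
  | cons b L ih =>
    intro p hp
    have bU := norm_convMon_le hD W hA hc hU hB b L
    have hcc : 0 ≤ c * k1 * A * (A * k2) ^ L.length := by positivity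
    change ‖lconv (derivFactor U a) (convMon U B (b :: L)) p -
      lconv (derivFactor V a) (convMon V B (b :: L)) p‖ ≤ _
    rw [(lconv_sub_lconv (integrable_lconv hD W.conv_v hA hcc W.v_nonneg W.v_nonneg
      (norm_derivFactor_le hU a) bU (hfc hUc a) (hUm (b :: L)) hp) (integrable_lconv hD W.conv_v hA
      hcc W.v_nonneg W.v_nonneg (norm_derivFactor_le hV a) bU (hfc hVc a) (hUm (b :: L)) hp)
      (integrable_lconv hD W.conv_v hA hcc W.v_nonneg W.v_nonneg (norm_derivFactor_le hV a)
      (norm_convMon_le hD W hA hc hV hB b L) (hfc hVc a) (hVm (b :: L)) hp))]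
    refine (norm_add_le _ _).trans ((add_le_add (norm_lconv_le hD W.conv_v he hcc W.v_nonneg
      W.v_nonneg (hsub a) bU hp) (norm_lconv_le hD W.conv_v hA (by positivity) W.v_nonneg W.v_nonneg
      (norm_derivFactor_le hV a) (ih b) hp)).trans_eq ?_)
    simp; ring

lemma HoloFam.convMon {X D : Set ℂ} {T : ℝ} (hX : IsOpen X) (hD : OpenCone D)
    (hk : 0 < k) (hk1 : k ≤ 1) {U : Fin m → ParamFun} {B : ParamFun}
    (hU : ∀ l, HoloFam X D T k (U l)) (hB : HoloFam X D T k B) (L : List (Fin m × ℕ)) :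
    HoloFam X D T k (fun Y p t => convMon (fun l p => U l Y p t) (fun p => B Y p t) L p) := by
  induction L with
  | nil => exact hB
  | cons a L ih =>
    exact HoloFam.lconv hX hD hk hk1 ((hU a.1).entire_mul (h := fun p => (-p) ^ a.2)
      (by fun_prop)) ih

/-- The transform of the nonlinearity. -/
def nonlin (U : Fin m → ℂ → ℂ) (B : CoeffFam m n (ℂ → ℂ))
    (i : Fin m) (p : ℂ) : ℂ :=
  ∑ q : DerivIdx m n, ∑' k : Fin m → ℕ, convMon U (B q k i) (factors q k) p

lemma summable_pow_multiSize {x : ℝ} (h0 : 0 ≤ x) (h1 : x < 1) (m : ℕ) :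
    Summable (fun k : Fin m → ℕ => x ^ multiSize k) := by
  induction m with
  | zero => exact Summable.of_finite
  | succ m ih =>
    rw [← (Fin.consEquiv fun _ => ℕ).summable_iff]
    have := (summable_geometric_of_lt_one h0 h1).mul_of_nonneg ih (pow_nonneg h0)
      (fun k => pow_nonneg h0 _)
    refine this.congr fun k => ?_
    simp [multiSize, pow_add]

lemma natCast_mul_quarter_pow_le (L : ℕ) : ((L + 1 : ℕ) : ℝ) * (1 / 4) ^ L ≤ (1 / 2) ^ L := by
  calc _ ≤ 2 ^ L * (1 / 4) ^ L := mul_le_r (by exact_mod_cast Nat.lt_two_pow_self)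
    _ = _ := by rw [← mul_pow]; norm_num

/-- The bounds of the coefficients of the nonlinearity, for one value of time. -/
structure CoeffBounds (D : Set ℂ) (y : ℝ → ℝ) (k1 k2 A E : ℝ) (c : DerivIdx m n → (Fin m → ℕ) → ℝ)
    (w : ℝ → ℝ) (B : CoeffFam m n (ℂ → ℂ)) : Prop where
  c_nonneg : ∀ q k, 0 ≤ c q k
  bound : ∀ q k i, ∀ p ∈ D, ‖B q k i p‖ ≤ c q k * y ‖p‖
  eq_zero : ∀ q k i, multiSize k + q.size = 0 → ∀ p ∈ D, B q k i p = 0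
  le : ∀ q k L, multiSize k + q.size = L + 1 → ∀ r, 0 < r →
    c q k * k1 * (A * k2) ^ L * r ^ q.order ≤ E * (1 / 4) ^ L * w r

variable {D : Set ℂ} {v y : ℝ → ℝ} {k1 k2 A E o : ℝ} {c : DerivIdx m n → (Fin m → ℕ) → ℝ}
    {w : ℝ → ℝ} {B : CoeffFam m n (ℂ → ℂ)} {U V : Fin m → ℂ → ℂ}

lemma half_pow_le_of_multiSize {q : DerivIdx m n} {k : Fin m → ℕ} {L : ℕ}
    (h : multiSize k + q.size = L + 1) : (1 / 2 : ℝ) ^ L ≤ 2 * (1 / 2) ^ multiSize k := by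
  calc (1 / 2 : ℝ) ^ L = 2 * (1 / 2) ^ (L + 1) := by rw [pow_succ]; ring
    _ ≤ _ := by
      gcongr ?_ * ?_
      exact pow_le_pow_of_le_one (by norm_num) (by norm_num) (by omega)

lemma CoeffBounds.norm_term_le (hD : OpenCone D) (W : ConvWeights v y k1 k2)
    (h : CoeffBounds D y k1 k2 A E c w B) (hA : 0 ≤ A) (hE : 0 ≤ E) (hw : ∀ r, 0 < r → 0 ≤ w r)
    (hU : ∀ l, ∀ p ∈ D, ‖U l p‖ ≤ A * v ‖p‖) (q : DerivIdx m n) (k : Fin m → ℕ) (i : Fin m) (hp : p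
    ∈ D) : ‖convMon U (B q k i) (factors q k) p‖ ≤
    A * E * w ‖p‖ * v ‖p‖ * (2 * (1 / 2) ^ multiSize k) := by
  have hn := hD.norm_pos hp
  have hv := W.v_nonneg _ hn
  have hw := hw _ hn
  have hlen := length_factors q k
  have hsum := sum_snd_factors q k
  rcases hL : factors q k with _ | ⟨a, L⟩
  · rw [hL] at hlen
    rw [convMon, h.eq_zero q k i hlen.symm p hp, norm_zero]; positivity
  · rw [hL] at hlen hsum
    have h1 := norm_convMon_le hD W hA (h.c_nonneg q k) hU (h.bound q k i) a L p hp
    rw [hsum] at h1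
    have h4 : (1 / 4 : ℝ) ^ L.length ≤ (1 / 2) ^ L.length :=
      pow_le_pow_left₀ (by norm_num) (by norm_num) _
    calc _ ≤ _ := h1
      _ = A * v ‖p‖ * (c q k * k1 * (A * k2) ^ L.length * ‖p‖ ^ q.order) := by ring
      _ ≤ A * v ‖p‖ * (E * (1 / 4) ^ L.length * w ‖p‖) :=
        mul_le_l (h.le q k L.length hlen.symm ‖p‖ hn)
      _ = A * E * w ‖p‖ * v ‖p‖ * (1 / 4) ^ L.length := by ring
      _ ≤ _ := mul_le_l (h4.trans (half_pow_le_of_multiSize hlen.symm))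

lemma CoeffBounds.norm_term_sub_le (hD : OpenCone D) (W : ConvWeights v y k1 k2)
    (h : CoeffBounds D y k1 k2 A E c w B) (hA : 0 ≤ A) (hE : 0 ≤ E) (he : 0 ≤ o)
    (hw : ∀ r, 0 < r → 0 ≤ w r)
    (hU : ∀ l, ∀ p ∈ D, ‖U l p‖ ≤ A * v ‖p‖) (hV : ∀ l, ∀ p ∈ D, ‖V l p‖ ≤ A * v ‖p‖)
    (hUV : ∀ l, ∀ p ∈ D, ‖U l p - V l p‖ ≤ o * v ‖p‖) (hUc : ∀ l, ContinuousOn (U l) D)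
    (hVc : ∀ l, ContinuousOn (V l) D) (q : DerivIdx m n) (k : Fin m → ℕ) (i : Fin m)
    (hUm : ∀ L, ContinuousOn (convMon U (B q k i) L) D)
    (hVm : ∀ L, ContinuousOn (convMon V (B q k i) L) D) (hp : p ∈ D) :
    ‖convMon U (B q k i) (factors q k) p - convMon V (B q k i) (factors q k) p‖ ≤
    o * E * w ‖p‖ * v ‖p‖ * (2 * (1 / 2) ^ multiSize k) := by
  have hn := hD.norm_pos hp
  have hv := W.v_nonneg _ hn
  have hw := hw _ hn
  have hlen := length_factors q k
  have hsum := sum_snd_factors q k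
  rcases hL : factors q k with _ | ⟨a, L⟩
  · rw [convMon, convMon, sub_self, norm_zero]
    positivity
  · rw [hL] at hlen hsum
    have h1 := norm_convMon_sub_le hD W hA (h.c_nonneg q k) he hU hV hUV (h.bound q k i)
      hUc hVc hUm hVm a L p hp
    rw [hsum] at h1
    calc _ ≤ _ := h1
      _ = o * v ‖p‖ * (L.length + 1 : ℕ) *
        (c q k * k1 * (A * k2) ^ L.length * ‖p‖ ^ q.order) := by ring
      _ ≤ o * v ‖p‖ * (L.length + 1 : ℕ) * (E * (1 / 4) ^ L.length * w ‖p‖) :=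
        mul_le_l (h.le q k L.length hlen.symm ‖p‖ hn)
      _ = o * E * w ‖p‖ * v ‖p‖ * ((L.length + 1 : ℕ) * (1 / 4) ^ L.length) := by ring
      _ ≤ _ := mul_le_l ((natCast_mul_quarter_pow_le _).trans (half_pow_le_of_multiSize hlen.symm))

/-- The sum over all indices of the bounds of the terms. -/
def indexSum (m n : ℕ) : ℝ :=
  ∑ _q : DerivIdx m n, ∑' k : Fin m → ℕ, 2 * (1 / 2 : ℝ) ^ multiSize k

lemma summable_half_pow (m : ℕ) : Summable fun k : Fin m → ℕ => 2 * (1 / 2 : ℝ) ^ multiSize k :=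
    (summable_pow_multiSize (by norm_num) (by norm_num) m).mul_left 2

lemma indexSum_nonneg (m n : ℕ) : 0 ≤ indexSum m n :=
    sum_nonneg fun _ _ => tsum_nonneg fun _ => by positivity

lemma CoeffBounds.norm_nonlin_le (hD : OpenCone D) (W : ConvWeights v y k1 k2)
    (h : CoeffBounds D y k1 k2 A E c w B) (hA : 0 ≤ A) (hE : 0 ≤ E) (hw : ∀ r, 0 < r → 0 ≤ w r)
    (hU : ∀ l, ∀ p ∈ D, ‖U l p‖ ≤ A * v ‖p‖) (i : Fin m) (hp : p ∈ D) :
    ‖nonlin U B i p‖ ≤ A * E * indexSum m n * w ‖p‖ * v ‖p‖ := by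
  have e : A * E * indexSum m n * w ‖p‖ * v ‖p‖ = ∑ _q : DerivIdx m n, ∑' k : Fin m → ℕ,
    A * E * w ‖p‖ * v ‖p‖ * (2 * (1 / 2) ^ multiSize k) := by
    simp_rw [tsum_mul_left (a := A * E * w ‖p‖ * v ‖p‖), ← mul_sum]
    rw [indexSum]; ring
  rw [e]
  refine (norm_sum_le _ _).trans (sum_le_sum fun q _ => ?_)
  exact tsum_of_norm_bounded ((summable_half_pow m).mul_left _).hasSum fun k =>
    h.norm_term_le hD W hA hE hw hU q k i hp

lemma CoeffBounds.norm_nonlin_sub_le (hD : OpenCone D) (W : ConvWeights v y k1 k2)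
    (h : CoeffBounds D y k1 k2 A E c w B) (hA : 0 ≤ A) (hE : 0 ≤ E) (he : 0 ≤ o)
    (hw : ∀ r, 0 < r → 0 ≤ w r)
    (hU : ∀ l, ∀ p ∈ D, ‖U l p‖ ≤ A * v ‖p‖) (hV : ∀ l, ∀ p ∈ D, ‖V l p‖ ≤ A * v ‖p‖)
    (hUV : ∀ l, ∀ p ∈ D, ‖U l p - V l p‖ ≤ o * v ‖p‖) (hUc : ∀ l, ContinuousOn (U l) D)
    (hVc : ∀ l, ContinuousOn (V l) D) (hUm : ∀ q k i L, ContinuousOn (convMon U (B q k i) L) D)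
    (hVm : ∀ q k i L, ContinuousOn (convMon V (B q k i) L) D) (i : Fin m) (hp : p ∈ D) :
    ‖nonlin U B i p - nonlin V B i p‖ ≤ o * E * indexSum m n * w ‖p‖ * v ‖p‖ := by
  have e : o * E * indexSum m n * w ‖p‖ * v ‖p‖ = ∑ _q : DerivIdx m n, ∑' k : Fin m → ℕ,
    o * E * w ‖p‖ * v ‖p‖ * (2 * (1 / 2) ^ multiSize k) := by
    simp_rw [tsum_mul_left (a := o * E * w ‖p‖ * v ‖p‖), ← mul_sum]
    rw [indexSum]; ring
  have hs : ∀ {U : Fin m → ℂ → ℂ}, (∀ l, ∀ p ∈ D, ‖U l p‖ ≤ A * v ‖p‖) → ∀ q,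
    Summable fun k => convMon U (B q k i) (factors q k) p := fun hU q =>
    Summable.of_norm_bounded ((summable_half_pow m).mul_left _) fun k =>
    h.norm_term_le hD W hA hE hw hU q k i hp
  rw [e, nonlin, nonlin, ← Finset.sum_sub_distrib]
  refine (norm_sum_le _ _).trans (sum_le_sum fun q _ => ?_)
  rw [← (hs hU q).tsum_sub (hs hV q)]
  exact tsum_of_norm_bounded ((summable_half_pow m).mul_left _).hasSum fun k =>
    h.norm_term_sub_le hD W hA hE he hw hU hV hUV hUc hVc q k i (hUm q k i) (hVm q k i) hp

lemma rayLap_convMon {w : ℂ} {B : ℂ → ℂ} {N' : ℝ} (hN : N < N')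
    (hU : ∀ l, RayExp w (U l) N) (hB : RayExp w B N') (L : List (Fin m × ℕ)) :
    RayExp w (convMon U B L) N' ∧ ∀ x : ℂ, N' ≤ (w * x).re → rayLap w (convMon U B L) x =
    (L.map fun a => iteratedDeriv a.2 (rayLap w (U a.1)) x).prod * rayLap w B x := by
  induction L with
  | nil => exact ⟨hB, fun x _ => by simp [convMon]⟩
  | cons a L ih =>
    have h1 : RayExp w (derivFactor U a) N' := (hU a.1).mul_pow hN a.2
    refine ⟨h1.lconv ih.1, fun x hx => ?_⟩
    rw [convMon, rayLap_lconv h1 ih.1 hx, ih.2 x hx, List.map_cons, List.prod_cons,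
      iteratedDeriv_rayLap (hU a.1) a.2 (hN.trans_le hx), mul_assoc]
    rfl

lemma rayLap_tsum {J : Type*} [Countable J] {w : ℂ} {G : J → ℂ → ℂ} {u : J → ℝ} {F : ℝ → ℝ} (hu :
    Summable u) (hG : ∀ i, RayExp w (G i) N)
    (hF : IntegrableOn (fun r => F r * exp (-(N * r))) (Ioi 0))
    (hb : ∀ i, ∀ r : ℝ, 0 < r → ‖G i (r * w)‖ ≤ u i * F r) :
    RayExp w (fun p => ∑' i, G i p) N ∧ ∀ x : ℂ, N ≤ (w * x).re →
    HasSum (fun i => rayLap w (G i) x) (rayLap w (fun p => ∑' i, G i p) x) := by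
  have key : ∀ e : ℝ → ℂ, (∀ i, IntegrableOn (fun r : ℝ => G i (r * w) * e r) (Ioi 0)) →
    (∀ r : ℝ, 0 < r → ‖e r‖ ≤ exp (-(N * r))) →
    IntegrableOn (fun r : ℝ => (∑' i, G i (r * w)) * e r) (Ioi 0) ∧
    HasSum (fun i => ∫ r : ℝ in Ioi 0, G i (r * w) * e r)
    (∫ r : ℝ in Ioi 0, (∑' i, G i (r * w)) * e r) := fun e hi he => by
    have hbd : ∀ i, ∀ r : ℝ, 0 < r → ‖G i (r * w) * e r‖ ≤ |u i| * |F r * exp (-(N * r))| := fun i r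
      hr => by
      rw [norm_mul, abs_mul, ← mul_assoc, ← abs_mul]
      exact mul_le_mul ((hb i r hr).trans (le_abs_self _)) ((he r hr).trans (le_abs_self _))
        (norm_nonneg _) (abs_nonneg _)
    have hsum : Summable fun i => ∫ r : ℝ in Ioi 0, ‖G i (r * w) * e r‖ := by
      refine Summable.of_nonneg_of_le (fun i => integral_nonneg fun r => norm_nonneg _)
        (fun i => ?_) (hu.abs.mul_right (∫ r in Ioi 0, |F r * exp (-(N * r))|))
      rw [← integral_const_mul]
      exact setIntegral_mono_on (hi i).norm (hF.abs.const_mul _) measurableSet_Ioi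
        fun r hr => hbd i r hr
    have h1 := hasSum_integral_of_summable_integral_norm hi hsum
    have e1 : ∀ r : ℝ, ∑' i, G i (r * w) * e r = (∑' i, G i (r * w)) * e r := fun r =>
      tsum_mul_right
    simp_rw [e1] at h1
    refine ⟨?_, h1⟩
    have h2 : AEStronglyMeasurable (fun r : ℝ => (∑' i, G i (r * w)) * e r)
      (volume.restrict (Ioi 0)) := by
      have : ∀ i, AEStronglyMeasurable (fun r : ℝ => G i (r * w) * e r)
        (volume.restrict (Ioi 0)) := fun i => (hi i).aestronglyMeasurable
      exact (AEMeasurable.aestronglyMeasurable (AEMeasurable.tsum fun i => (this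
        i).aemeasurable)).congr (.of_forall e1)
    refine Integrable.mono' (hF.abs.const_mul (∑' i, |u i|)) h2 ?_
    filter_upwards [ae_Ioi] with r hr
    rw [← e1, ← tsum_mul_right]
    exact tsum_of_norm_bounded (hu.abs.mul_right _).hasSum fun i => hbd i r hr
  constructor
  · refine (key (fun r => (exp (-(N * r)) : ℝ)) (hG) fun r hr => ?_).1
    rw [norm_coe]
  · intro x hx
    refine ((key (fun r => cexp (-(r * w * x))) (fun i => (hG i).integrable hx)
      fun r hr => ?_).2).mul_left w
    rw [norm_exp]
    refine exp_le_exp.2 ?_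
    rw [neg_re, mul_assoc, re_ofReal_mul]; nlinarith [mul_le_l hx hr.le]

end

section

variable {t R0 c c1 G : ℝ} {p w : ℂ}

/-- Functions `g y x t`, defined for `x` in a region which grows like `t^h`, holomorphic in `x` and
in the parameter `y ∈ X`, and continuous in time. -/
structure SectorFun (X : Set ℂ) (s1 R h T : ℝ) (g : ParamFun) : Prop where
  holo : ∀ y ∈ X, ∀ t ∈ Ioo 0 T, DifferentiableOn ℂ (fun x => g y x t) (cone s1 (R * t ^ h))
  holo_param : ∀ t ∈ Ioo 0 T, ∀ x ∈ cone s1 (R * t ^ h),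
    DifferentiableOn ℂ (fun y => g y x t) X
  cont : ∀ y ∈ X, ∀ x ∈ cone s1 (R * T ^ h), ContinuousOn (g y x) (Ioo 0 T)

/-- The decay which is necessary for an inverse Laplace transform near the vertex. -/
def SectorDecay (X : Set ℂ) (s1 R h T k : ℝ) (g : ParamFun) : Prop :=
  ∀ t1 t2 : ℝ, 0 < t1 → t2 < T → ∃ G, 0 ≤ G ∧ ∀ y ∈ X, ∀ t ∈ Icc t1 t2,
    ∀ x ∈ cone s1 (R * t ^ h), ‖g y x t‖ ≤ G * ‖x‖ ^ (-k)

variable {X : Set ℂ} {s1 R h T k o d : ℝ} {g : ParamFun}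

lemma mul_rpow_le_of_mem (hh : 0 ≤ h) (hR : 0 ≤ R) (ht : t ∈ Ioo 0 T) : R * t ^ h ≤ R * T ^ h :=
    mul_le_l (rpow_le_rpow ht.1.le ht.2.le hh)

lemma Contour.of_radius {R1 : ℝ} (H : Contour s1 R0 o) (h : 0 < R1) :
    Contour s1 R1 o := ⟨H.cos_pos, H.sin_pos, H.sin_lt, H.lt_one, h⟩

lemma norm_invLap_le_rpow {J : Type*} [Fintype J] (H : Contour s1 R0 o)
    (hd : 0 < d) (hc : R0 < (1 - s1) / 2 * c) {g : ℂ → ℂ} {C b : J → ℝ}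
    (hg : DifferentiableOn ℂ g (cone s1 R0)) (hC : ∀ i, 0 ≤ C i) (hb : ∀ i, 0 ≤ b i)
    (hgb : ∀ z ∈ cone s1 R0, ‖g z‖ ≤ ∑ i, C i * ‖z‖ ^ (-b i)) (hp : p ∈ dualCone o d) :
    ‖invLap o c g p‖ ≤ exp 1 / d * (∑ i, ((1 - s1) / 2) ^ (-b i) *
    (C i * ‖p‖ ^ (b i - 1))) * exp (c * ‖p‖) := by
  have hp0 : 0 < ‖p‖ := norm_pos_iff.2 fun h0 => zero_notMem_dualCone (h0 ▸ hp)
  have hk : 0 < (1 - s1) / 2 := by linarith [H.lt_one]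
  have hR := H.pos
  have hc0 := pos_of_mul_pos_right (hR.trans hc) hk.le
  have hc' : R0 < (1 - s1) / 2 * (c + 1 / ‖p‖) :=
    hc.trans (mul_lt_mul_of_pos_left (lt_add_of_pos_right _ (by positivity)) hk)
  rw [invLap_vertex_eq H hd.le hc hc' hg (fun z hz => (hgb z hz).trans (sum_le_sum fun i _ =>
    mul_le_l (rpow_anti hR hz.1.le (by linarith [hb i])) (hC i))) hp]
  have h1 := norm_invLap_le H hd hc' (g := g)
    (G := ∑ i, ((1 - s1) / 2) ^ (-b i) * (C i * ‖p‖ ^ (b i))) (fun z hz hz' => ?_) hp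
  · refine h1.trans_eq ?_
    rw [add_mul, one_div_mul_cancel hp0.ne', exp_add]
    have e : ∀ i, ((1 - s1) / 2) ^ (-b i) * (C i * ‖p‖ ^ b i) =
      ((1 - s1) / 2) ^ (-b i) * (C i * ‖p‖ ^ (b i - 1)) * ‖p‖ := fun i => by
      have : ‖p‖ ^ b i = ‖p‖ ^ (b i - 1) * ‖p‖ := by rw [← rpow_add_one hp0.ne', sub_add_cancel]
      rw [this]; ring
    simp_rw [e, ← sum_mul]
    field_simp
  · refine (hgb z hz).trans (sum_le_sum fun i _ => ?_)
    have h2 : (1 - s1) / 2 * (1 / ‖p‖) ≤ ‖z‖ := (mul_le_l (by linarith)).trans hz'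
    have h3 : ‖z‖ ^ (-b i) ≤ ((1 - s1) / 2 * (1 / ‖p‖)) ^ (-b i) :=
      rpow_anti (by positivity) h2 (by linarith [hb i])
    have h4 : ((1 - s1) / 2 * (1 / ‖p‖)) ^ (-b i) = ((1 - s1) / 2) ^ (-b i) * ‖p‖ ^ b i := by
      rw [mul_rpow hk.le (by positivity), one_div, inv_rpow hp0.le, rpow_neg hp0.le, inv_inv]
    calc _ ≤ C i * (((1 - s1) / 2) ^ (-b i) * ‖p‖ ^ b i) := by rw [← h4]; exact mul_le_l h3 (hC i)
      _ = _ := by ring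

lemma invLap_eq_of_time (H : Contour s1 R o) (hd : 0 ≤ d) (hh : 0 ≤ h)
    (hc1 : R < (1 - s1) / 2 * c1) (ht : t ∈ Ioo 0 T) {g : ℂ → ℂ}
    (hg : DifferentiableOn ℂ g (cone s1 (R * t ^ h)))
    (hb : ∀ z ∈ cone s1 (R * t ^ h), ‖g z‖ ≤ G) (hp : p ∈ dualCone o d) :
    invLap o (c1 * T ^ h) g p = invLap o (c1 * t ^ h) g p := by
  have ht0 := rpow_pos_of_pos ht.1 h
  refine invLap_vertex_eq (H.of_radius (mul_pos H.pos ht0)) hd ?_ ?_ hg hb hp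
  · refine (mul_rpow_le_of_mem hh H.pos.le ht).trans_lt ?_
    rw [← mul_assoc]; exact mul_lt_mul_of_pos_right hc1 (rpow_pos_of_pos (ht.1.trans ht.2) h)
  · rw [← mul_assoc]
    exact mul_lt_mul_of_pos_right hc1 ht0

lemma OpenCone.dualCone (o d : ℝ) : OpenCone (dualCone o d) :=
    ⟨isOpen_dualCone o d, fun _ hp _ hr => dualCone_smul hp hr, zero_notMem_dualCone⟩

lemma continuousOn_armInt_param {I : Set ℝ} (hI : IsOpen I)
    {g : TimeFun} (hgc : ∀ t ∈ I, ContinuousOn (fun r : ℝ => g (c + r * w) t) (Ioi 0))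
    (hgt : ∀ r : ℝ, 0 < r → ContinuousOn (g (c + r * w)) I)
    (hg : ∀ t0 ∈ I, ∃ G, ∀ᶠ t in 𝓝 t0, ∀ r : ℝ, 0 < r → ‖g (c + r * w) t‖ ≤ G)
    (hp : (w * p).re < 0) : ContinuousOn (fun t => armInt w c (fun x => g x t) p) I := by
  refine continuousOn_const.mul fun t0 ht0 => ContinuousAt.continuousWithinAt ?_
  obtain ⟨G, hG⟩ := hg t0 ht0
  refine continuousAt_of_dominated (bound := fun r => G * exp (c * p.re) *
    exp ((w * p).re * r)) ?_ ?_ ((integrableOn_exp_mul_Ioi hp 0).const_mul _) ?_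
  · filter_upwards [hI.mem_nhds ht0] with t ht
    exact ((hgc t ht).mul (by fun_prop)).aestronglyMeasurable measurableSet_Ioi
  · filter_upwards [hG] with t ht
    filter_upwards [ae_Ioi] with r hr
    rw [norm_mul, norm_exp_ray, mul_assoc G, mul_comm r]; exact mul_le_r (ht r hr)
  · filter_upwards [ae_Ioi] with r hr
    exact ((hgt r hr).continuousAt (hI.mem_nhds ht0)).mul continuousAt_const

lemma differentiableOn_armInt_param (hX : IsOpen X) {g : ℂ → ℂ → ℂ}
    (hgc : ∀ y ∈ X, ContinuousOn (fun r : ℝ => g y (c + r * w)) (Ioi 0))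
    (hgy : ∀ r : ℝ, 0 < r → DifferentiableOn ℂ (fun y => g y (c + r * w)) X)
    (hg : ∀ y ∈ X, ∀ r : ℝ, 0 < r → ‖g y (c + r * w)‖ ≤ G) (hp : (w * p).re < 0) :
    DifferentiableOn ℂ (fun y => armInt w c (g y) p) X := by
  refine DifferentiableOn.const_mul ?_ w
  refine holomorphic_integral hX (fun y hy => ?_) ?_ fun y0 hy0 => ?_
  · exact ((hgc y hy).mul (by fun_prop)).aestronglyMeasurable measurableSet_Ioi
  · filter_upwards [ae_Ioi] with r hr using (hgy r hr).mul_const _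
  · refine ⟨univ, univ_mem, fun r => G * exp (c * p.re) *
      exp ((w * p).re * r), (integrableOn_exp_mul_Ioi hp 0).const_mul _, ?_⟩
    filter_upwards [ae_Ioi] with r hr y _ hy
    rw [norm_mul, norm_exp_ray, mul_assoc G, mul_comm r]; exact mul_le_r (hg y hy r hr)

lemma SectorFun.invLap (H : Contour s1 R o) (hX : IsOpen X) (hd : 0 < d) (hh : 0 ≤ h)
    (hK : 0 ≤ k) (hc1 : R < (1 - s1) / 2 * c1) (hg : SectorFun X s1 R h T g)
    (hb : SectorDecay X s1 R h T k g) : HoloFam X (dualCone o d) T k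
    (fun y p t => invLap o (c1 * T ^ h) (fun x => g y x t) p) := by
  rcases le_or_gt T 0 with hT | hT
  · have : ∀ t, t ∉ Ioo 0 T := fun t ht => absurd (ht.1.trans ht.2) (not_lt.2 hT)
    refine ⟨fun y _ p _ t ht => (this t ht).elim, fun y _ t ht => (this t ht).elim,
      fun p _ t ht => (this t ht).elim, fun t1 t2 r0 h1 h2 _ => ⟨0, le_rfl, fun y _ p _ _ t ht =>
      (this t ⟨h1.trans_le ht.1, ht.2.trans_lt h2⟩).elim⟩⟩
  have hT0 := rpow_pos_of_pos hT h
  have H' := H.of_radius (mul_pos H.pos hT0)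
  have hc : R * T ^ h < (1 - s1) / 2 * (c1 * T ^ h) := by
    rw [← mul_assoc]; exact mul_lt_mul_of_pos_right hc1 hT0
  have hsub : ∀ t ∈ Ioo 0 T, cone s1 (R * T ^ h) ⊆ cone s1 (R * t ^ h) := fun t ht =>
    cone_mono le_rfl (mul_rpow_le_of_mem hh H.pos.le ht)
  have hholo : ∀ y ∈ X, ∀ t ∈ Ioo 0 T, DifferentiableOn ℂ (fun x => g y x t)
    (cone s1 (R * T ^ h)) := fun y hy t ht => (hg.holo y hy t ht).mono (hsub t ht)
  have hbd : ∀ t1 t2 : ℝ, 0 < t1 → t2 < T → ∃ G, 0 ≤ G ∧ ∀ y ∈ X, ∀ t ∈ Icc t1 t2,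
    ∀ x ∈ cone s1 (R * T ^ h), ‖g y x t‖ ≤ G * (R * T ^ h) ^ (-k) := fun t1 t2 h1 h2 => by
    obtain ⟨G, hG0, hG⟩ := hb t1 t2 h1 h2
    refine ⟨G, hG0, fun y hy t ht x hx => (hG y hy t ht x
      (hsub t ⟨h1.trans_le ht.1, ht.2.trans_lt h2⟩ hx)).trans ?_⟩
    exact mul_le_l (rpow_anti H'.pos hx.1.le (by linarith)) hG0
  have harm : ∀ p ∈ dualCone o d, (armDir o * p).re < 0 ∧ (star (armDir o) * p).re < 0 := fun p hp
    => by
    have := dualCone_arm H.cos_pos.le hp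
    have h0 := mul_nonneg hd.le (norm_nonneg p)
    exact ⟨by linarith [this.1], by linarith [this.2]⟩
  refine ⟨?_, ?_, ?_, ?_⟩
  · intro y hy p hp
    have hgb : ∀ w : ℂ, (∀ r : ℝ, 0 < r → (((c1 * T ^ h : ℝ) : ℂ) + r * w) ∈ cone s1 (R * T ^ h)) →
      ∀ t0 ∈ Ioo 0 T, ∃ G, ∀ᶠ t in 𝓝 t0, ∀ r : ℝ, 0 < r →
      ‖g y (((c1 * T ^ h : ℝ) : ℂ) + r * w) t‖ ≤ G := fun w hw t0 ht0 => by
      obtain ⟨t1, h1, h1'⟩ := exists_between ht0.1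
      obtain ⟨t2, h2, h2'⟩ := exists_between ht0.2
      obtain ⟨G, -, hG⟩ := hbd t1 t2 h1 h2'
      refine ⟨G * (R * T ^ h) ^ (-k), ?_⟩
      filter_upwards [Icc_mem_nhds h1' h2] with t ht r hr using hG y hy t ht _ (hw r hr)
    refine continuousOn_const.mul (ContinuousOn.sub ?_ ?_)
    · refine continuousOn_armInt_param isOpen_Ioo
        (fun t ht => (H'.continuousOn_arm hc (hholo y hy t ht).continuousOn).1)
        (fun r hr => hg.cont y hy _ (H'.arm_mem hc hr.le).1)
        (hgb _ fun r hr => (H'.arm_mem hc hr.le).1) (harm p hp).1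
    · refine continuousOn_armInt_param isOpen_Ioo
        (fun t ht => (H'.continuousOn_arm hc (hholo y hy t ht).continuousOn).2)
        (fun r hr => hg.cont y hy _ (H'.arm_mem hc hr.le).2)
        (hgb _ fun r hr => (H'.arm_mem hc hr.le).2) (harm p hp).2
  · intro y hy t ht
    obtain ⟨G, -, hG⟩ := hbd t t ht.1 ht.2
    exact differentiableOn_invLap H' hd.le hc (hholo y hy t ht).continuousOn
      fun z hz => hG y hy t ⟨le_rfl, le_rfl⟩ z hz
  · intro p hp t ht
    obtain ⟨G, -, hG⟩ := hbd t t ht.1 ht.2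
    refine DifferentiableOn.const_mul (DifferentiableOn.sub ?_ ?_) _
    · exact differentiableOn_armInt_param hX
        (fun y hy => (H'.continuousOn_arm hc (hholo y hy t ht).continuousOn).1)
        (fun r hr => hg.holo_param t ht _ (hsub t ht (H'.arm_mem hc hr.le).1))
        (fun y hy r hr => hG y hy t ⟨le_rfl, le_rfl⟩ _ (H'.arm_mem hc hr.le).1) (harm p hp).1
    · exact differentiableOn_armInt_param hX
        (fun y hy => (H'.continuousOn_arm hc (hholo y hy t ht).continuousOn).2)
        (fun r hr => hg.holo_param t ht _ (hsub t ht (H'.arm_mem hc hr.le).2))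
        (fun y hy r hr => hG y hy t ⟨le_rfl, le_rfl⟩ _ (H'.arm_mem hc hr.le).2) (harm p hp).2
  · intro t1 t2 r0 h1 h2 h3
    obtain ⟨G, hG0, hG⟩ := hb t1 t2 h1 h2
    have hc0 : 0 < c1 * T ^ h := pos_of_mul_pos_right (H'.pos.trans hc) (by linarith [H.lt_one])
    have hk : 0 < (1 - s1) / 2 := by linarith [H.lt_one]
    refine ⟨exp 1 / d * (((1 - s1) / 2) ^ (-k) * G) * exp (c1 * T ^ h * r0),
      by positivity, fun y hy p hp hpr t ht => ?_⟩
    have ht' : t ∈ Ioo 0 T := ⟨h1.trans_le ht.1, ht.2.trans_lt h2⟩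
    have h4 := norm_invLap_le_rpow (J := Unit) H' hd hc (C := fun _ => G) (b := fun _ => k)
      (hholo y hy t ht') (fun _ => hG0) (fun _ => hK)
      (fun z hz => by simpa using hG y hy t ht z (hsub t ht' hz)) hp
    rw [Fintype.sum_unique] at h4
    refine h4.trans ?_
    have h5 : exp (c1 * T ^ h * ‖p‖) ≤ exp (c1 * T ^ h * r0) := exp_le_exp.2 (mul_le_l hpr hc0.le)
    calc _ ≤ exp 1 / d * (((1 - s1) / 2) ^ (-k) * (G * ‖p‖ ^ (k - 1))) *
      exp (c1 * T ^ h * r0) := mul_le_l h5 (by positivity)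
      _ = _ := by ring

end

section

lemma exists_fixedPoint_of_contraction {y : Type*} {dom : Set y} {v : y → ℝ} {S : Set (y → ℂ)}
    {G : (y → ℂ) → y → ℂ} {U0 : y → ℂ} (hU0 : U0 ∈ S) (hG : ∀ U ∈ S, G U ∈ S) {A : ℝ} (hA : 0 ≤ A)
    (hb : ∀ U ∈ S, ∀ a ∈ dom, ‖U a‖ ≤ A * v a)
    (hc : ∀ U ∈ S, ∀ V ∈ S, ∀ e : ℝ, 0 ≤ e → (∀ a ∈ dom, ‖U a - V a‖ ≤ e * v a) →
    ∀ a ∈ dom, ‖G U a - G V a‖ ≤ e / 2 * v a) (hcl : ∀ (F : ℕ → y → ℂ) (U : y → ℂ), (∀ k, F k ∈ S) →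
    (∀ k, ∀ a ∈ dom, ‖F k a - U a‖ ≤ 4 * A * (1 / 2) ^ k * v a) → U ∈ S) :
    ∃ U ∈ S, ∀ a ∈ dom, U a = G U a := by
  set F := fun k => G^[k] U0 with hF
  have hS : ∀ k, F k ∈ S := by
    intro k
    induction k with
    | zero => exact hU0
    | succ k ih => rw [hF]; simp only [Function.iterate_succ_apply']; exact hG _ ih
  have hstep : ∀ k, F (k + 1) = G (F k) := fun k => by
    rw [hF]; simp only [Function.iterate_succ_apply']
  have hd : ∀ k, ∀ a ∈ dom, ‖F k a - F (k + 1) a‖ ≤ 2 * A * (1 / 2) ^ k * v a := by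
    intro k
    induction k with
    | zero =>
      intro a ha
      refine (norm_sub_le _ _).trans ?_
      have h1 := hb _ (hS 0) a ha
      have h2 := hb _ (hS 1) a ha
      linarith
    | succ k ih =>
      intro a ha
      rw [hstep (k + 1)]
      nth_rewrite 1 [hstep k]
      refine (hc _ (hS _) _ (hS _) (2 * A * (1 / 2) ^ k) (by positivity) ih a ha).trans_eq ?_
      rw [pow_succ]; ring
  have hlim : ∀ a ∈ dom, ∃ u, Tendsto (fun k => F k a) atTop (𝓝 u) := fun a ha => by
    refine cauchySeq_tendsto_of_complete (cauchySeq_of_le_geometric (1 / 2) (2 * A * v a)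
      (by norm_num) fun k => ?_)
    rw [dist_eq_norm]
    refine (hd k a ha).trans_eq (by ring)
  choose! U hU using hlim
  have hUb : ∀ k, ∀ a ∈ dom, ‖F k a - U a‖ ≤ 4 * A * (1 / 2) ^ k * v a := fun k a ha => by
    have := dist_le_of_le_geometric_of_tendsto (1 / 2) (2 * A * v a) (by norm_num)
      (fun k => by rw [dist_eq_norm]; exact (hd k a ha).trans_eq (by ring)) (hU a ha) k
    rw [dist_eq_norm] at this
    refine this.trans_eq (by ring)
  have hUS := hcl F U hS hUb
  refine ⟨U, hUS, fun a ha => tendsto_nhds_unique (hU a ha) ?_⟩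
  rw [← tendsto_add_atTop_iff_nat 1]
  simp_rw [hstep]
  rw [tendsto_iff_norm_sub_tendsto_zero]
  refine squeeze_zero (fun k => norm_nonneg _) (fun k => hc _ (hS k) _ hUS _ (by positivity) (hUb k)
    a ha) ?_
  have : Tendsto (fun k => (1 / 2 : ℝ) ^ k) atTop (𝓝 0) :=
    tendsto_pow_atTop_nhds_zero_of_lt_one (by norm_num) (by norm_num)
  simpa using ((this.const_mul (4 * A)).div_const 2).mul_const (v a)

end

section

variable {y : Type*} {m n : ℕ}

/-- The conditions on the exponents of the weights. -/
structure WeightParams (a b : y → ℝ) (M : ℕ) (h h' K T : ℝ) : Prop where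
  h_pos : 0 < h
  h'_pos : 0 < h'
  κ_pos : 0 < K
  κ_le : K ≤ 1
  T_pos : 0 < T
  one_le_b : ∀ i, 1 ≤ b i
  b_le : ∀ i, b i + 1 ≤ M
  le_sub : ∀ i, h' ≤ a i - b i * h

lemma WeightParams.le_a {a b : y → ℝ} {M : ℕ} {h h' K T : ℝ}
    (W : WeightParams a b M h h' K T) (i : y) : h' ≤ a i := by
  have := W.le_sub i
  nlinarith [W.one_le_b i, W.h_pos]

variable [Fintype y]

/-- The power of `t` in the bound of a coefficient. -/
def coeffExp (h h' K : ℝ) (q : DerivIdx m n) (k : Fin m → ℕ) : ℝ :=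
  K * h - ((multiSize k : ℝ) + q.size - 1) * h' - 1 + (q.order : ℝ) / n

/-- The bounds of the transformed data. -/
structure TransformedData (X D : Set ℂ) (a b : y → ℝ) (M : ℕ) (h h' K T c1 C1 Q : ℝ)
    (RT : Fin m → ParamFun)
    (BT : CoeffFam m n ParamFun) : Prop where
  c₁_nonneg : 0 ≤ c1
  C₁_nonneg : 0 ≤ C1
  one_le_Q : 1 ≤ Q
  R_holo : ∀ i, HoloFam X D T K (RT i)
  B_holo : ∀ q k i, HoloFam X D T K (BT q k i)
  R_bound : ∀ v, 2 * c1 ≤ v → ∀ i, ∀ Y ∈ X, ∀ p ∈ D, ∀ t ∈ Ioo 0 T,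
    ‖RT i Y p t‖ ≤ C1 * t⁻¹ * timeWeight a b M h v t ‖p‖
  B_bound : ∀ q k i, ∀ Y ∈ X, ∀ p ∈ D, ∀ t ∈ Ioo 0 T,
    ‖BT q k i Y p t‖ ≤ C1 * Q ^ multiSize k * t ^ coeffExp h h' K q k *
      (‖p‖ ^ (K - 1) * exp (c1 * t ^ h * ‖p‖))
  B_zero : ∀ q k i, multiSize k + q.size = 0 → ∀ Y ∈ X, ∀ p ∈ D, ∀ t ∈ Ioo 0 T,
    BT q k i Y p t = 0

variable {X D : Set ℂ} {a b : y → ℝ} {M : ℕ} {h h' K T c1 C1 Q : ℝ}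
    {RT : Fin m → ParamFun} {BT : CoeffFam m n ParamFun}

lemma WeightParams.exists_convWeights (W : WeightParams a b M h h' K T) (c1 : ℝ) :
    ∃ K1 K2 : ℝ, 0 ≤ K1 ∧ 0 ≤ K2 ∧ ∀ v, 1 ≤ v → 2 * c1 ≤ v → ∀ t ∈ Ioo 0 T,
    ConvWeights (timeWeight a b M h v t)
    (fun r => r ^ (K - 1) * exp (c1 * t ^ h * r)) (K1 * (v * t ^ h) ^ (-K))
    (K2 * (t ^ h' / v)) := by
  obtain ⟨K1, h1, H1⟩ := convBound_sumWeight_rpow W.one_le_b W.κ_pos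
  obtain ⟨K2, h2, H2⟩ := convBound_timeWeight W.one_le_b W.b_le W.le_sub W.T_pos
  refine ⟨K1, K2, h1, h2, fun v hv hv' t ht => ?_⟩
  have ht0 := ht.1
  have hth := rpow_pos_of_pos ht0 h
  have hv0 : 0 < v := by linarith
  exact ⟨fun r hr => timeWeight_nonneg hv0.le ht0.le hr.le, fun r hr => by positivity,
    by positivity, by positivity,
    H1 (fun i => t ^ a i) (v * t ^ h) (c1 * t ^ h) (fun i => by positivity) (by positivity)
    (by nlinarith), H2 v t hv ht0 ht.2⟩

lemma rpow_mul_rpow_le_one_add {r t : ℝ} (hr : 0 < r) (ht : 0 < t) {J n : ℕ} (hJ : J ≤ n)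
    (hn : 0 < n) : t ^ ((J : ℝ) / n) * r ^ J ≤ 1 + r ^ n * t := by
  have hn' : (0 : ℝ) < n := by exact_mod_cast hn
  have e : t ^ ((J : ℝ) / n) * r ^ J = (r ^ n * t) ^ ((J : ℝ) / n) := by
    rw [mul_rpow (by positivity) ht.le, ← rpow_natCast r n, ← rpow_mul hr.le,
      mul_div_cancel₀ _ hn'.ne', rpow_natCast, mul_comm]
  rw [e]
  have hx : 0 < r ^ n * t := by positivity
  rcases le_total (r ^ n * t) 1 with h | h
  · exact (rpow_le_one hx.le h (by positivity)).trans (by linarith)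
  ·
      calc _ ≤ (r ^ n * t) ^ 1 := rpow_le_rpow_of_exponent_le h ((div_le_one hn').2 (by exact_mod_cast hJ))
      _ ≤ _ := by rw [rpow_one]; linarith

lemma TransformedData.coeffBounds (hn : 0 < n) 
    (H : TransformedData X D a b M h h' K T c1 C1 Q RT BT) {K1 K2 A v : ℝ} (hK1 : 0 ≤ K1)
    (hK2 : 0 ≤ K2) (hA : 0 ≤ A) (hv : 1 ≤ v) (hv' : 4 * (Q * A * K2) ≤ v) {Y : ℂ} (hY : Y ∈ X)
    {t : ℝ} (ht : t ∈ Ioo 0 T) :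
    CoeffBounds D (fun r => r ^ (K - 1) * exp (c1 * t ^ h * r)) (K1 * (v * t ^ h) ^ (-K))
    (K2 * (t ^ h' / v)) A (C1 * Q * K1 * v ^ (-K))
    (fun q k => C1 * Q ^ multiSize k * t ^ coeffExp h h' K q k) (fun r => t⁻¹ * (1 + r ^ n * t))
    (fun q k i p => BT q k i Y p t) := by
  have ht0 := ht.1
  have hC := H.C₁_nonneg
  have hQ := H.one_le_Q
  have hv0 : 0 < v := by linarith
  refine ⟨fun q k => by positivity, fun q k i p hp => H.B_bound q k i Y hY p hp t ht,
    fun q k i h0 p hp => H.B_zero q k i h0 Y hY p hp t ht, fun q k L hL r hr => ?_⟩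
  have hqn : q.order ≤ n := q.2
  have e0 : coeffExp h h' K q k = K * h - L * h' - 1 + q.order / n := by
    have : (multiSize k : ℝ) + q.size = L + 1 := by exact_mod_cast hL
    rw [coeffExp, this]; ring
  have e1 : t ^ coeffExp h h' K q k * (t ^ h) ^ (-K) * (t ^ h') ^ L =
    t⁻¹ * t ^ ((q.order : ℝ) / n) := by
    rw [← rpow_natCast (t ^ h') L, ← rpow_mul ht0.le, ← rpow_mul ht0.le,
      ← rpow_add ht0, ← rpow_add ht0, ← rpow_neg_one, ← rpow_add ht0, e0]
    congr 1; ring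
  have h1 : Q ^ multiSize k ≤ Q * Q ^ L := by
    rw [← pow_succ']; exact pow_le_pow_right₀ hQ (by omega)
  have h2 : (Q * A * K2 / v) ^ L ≤ (1 / 4) ^ L := by
    refine pow_le_pow_left₀ (by positivity) ?_ L
    rw [div_le_iff₀ hv0]; linarith
  have h3 := rpow_mul_rpow_le_one_add hr ht0 hqn hn
  have hth : 0 < t ^ h := rpow_pos_of_pos ht0 h
  calc C1 * Q ^ multiSize k * t ^ coeffExp h h' K q k * (K1 * (v * t ^ h) ^ (-K)) *
    (A * (K2 * (t ^ h' / v))) ^ L * r ^ q.order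
    = C1 * K1 * v ^ (-K) * Q ^ multiSize k * (A * K2 / v) ^ L *
    (t ^ coeffExp h h' K q k * (t ^ h) ^ (-K) * (t ^ h') ^ L) * r ^ q.order := by
        rw [mul_rpow hv0.le hth.le]; simp only [mul_pow, div_pow]
        ring
    _ ≤ C1 * K1 * v ^ (-K) * (Q * Q ^ L) * (A * K2 / v) ^ L *
      (t⁻¹ * t ^ ((q.order : ℝ) / n)) * r ^ q.order := by
        rw [e1]
        gcongr
    _ = C1 * Q * K1 * v ^ (-K) * (Q * A * K2 / v) ^ L *
      (t⁻¹ * (t ^ ((q.order : ℝ) / n) * r ^ q.order)) := by simp only [mul_pow, div_pow]; ring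
    _ ≤ C1 * Q * K1 * v ^ (-K) * (1 / 4) ^ L * (t⁻¹ * (1 + r ^ n * t)) := by gcongr

/-- The transformed nonlinearity, as a family. -/
def nonlinFam (U : Fin m → ParamFun)
    (BT : CoeffFam m n ParamFun) (i : Fin m) (Y p : ℂ) (t : ℝ) : ℂ :=
  nonlin (fun l p => U l Y p t) (fun q k i p => BT q k i Y p t) i p

lemma holoFam_nonlin (hX : IsOpen X) (hD : OpenCone D) (hk : 0 < K) (hk1 : K ≤ 1)
    {U : Fin m → ParamFun} (hU : ∀ l, HoloFam X D T K (U l))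
    (hB : ∀ q k i, HoloFam X D T K (BT q k i)) {B : ℝ → ℝ → ℝ} (i : Fin m)
    (hb : ∀ q k, ∀ Y ∈ X, ∀ p ∈ D, ∀ t ∈ Ioo 0 T,
    ‖convMon (fun l p => U l Y p t) (fun p => BT q k i Y p t) (factors q k) p‖ ≤
    B t ‖p‖ * (2 * (1 / 2) ^ multiSize k))
    (hBL : ∀ t1 t2 r0 : ℝ, 0 < t1 → t2 < T → 0 < r0 → ∃ L, 0 ≤ L ∧ ∀ t ∈ Icc t1 t2, ∀ r,
    0 < r → r ≤ r0 → B t r ≤ L) : HoloFam X D T K (nonlinFam U BT i) := by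
  refine HoloFam.sum Finset.univ fun q _ => ?_
  refine HoloFam.tsum hX hD hk1 (fun k => HoloFam.convMon hX hD hk hk1 hU (hB q k i) _) ?_
  intro t1 t2 r0 h1 h2 h3
  obtain ⟨L, hL0, hL⟩ := hBL t1 t2 r0 h1 h2 h3
  refine ⟨fun k => L * (r0 ^ (K - 1))⁻¹ * (2 * (1 / 2) ^ multiSize k),
    (summable_half_pow m).mul_left _, fun k Y hY p hp hpr t ht => ?_⟩
  have hn := hD.norm_pos hp
  refine (hb q k Y hY p hp t ⟨h1.trans_le ht.1, ht.2.trans_lt h2⟩).trans ?_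
  calc _ ≤ L * (2 * (1 / 2) ^ multiSize k) := mul_le_r (hL t ht _ hn hpr)
    _ ≤ L * (2 * (1 / 2) ^ multiSize k) * ((r0 ^ (K - 1))⁻¹ * ‖p‖ ^ (K - 1)) :=
      le_mul_of_one_le_right (by positivity)
      (by rw [inv_mul_eq_div, one_le_div (by positivity)]; exact (rpow_sub_one_le_of_mem hn le_rfl hpr hk1).1)
    _ = _ := by ring

lemma exists_nat_ge_add_one (b : y → ℝ) : ∃ M : ℕ, ∀ i, b i + 1 ≤ M := by
  obtain ⟨M, hM⟩ := exists_nat_ge (∑ i, |b i + 1|)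
  exact ⟨M, fun i => (le_abs_self _).trans ((single_le_sum
    (fun _ _ => abs_nonneg _) (Finset.mem_univ i)).trans hM)⟩

lemma TransformedData.exists_solution (hn : 0 < n) (hX : IsOpen X) (hD : OpenCone D)
    (W : WeightParams a b M h h' K T) (H : TransformedData X D a b M h h' K T c1 C1 Q RT BT)
    {lam : Fin m → ℂ → ℂ} (hlam : ∀ i, Differentiable ℂ (lam i)) {c C0 : ℝ} (hc : 0 < c)
    (hC0 : 0 ≤ C0) (hlb : ∀ i, ∀ p ∈ D, c * ‖p‖ ^ n - C0 ≤ (lam i p).re) :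
    ∃ A N B : ℝ, 0 ≤ A ∧ 1 ≤ N ∧ c1 ≤ N ∧ 0 ≤ B ∧ ∃ U : Fin m → ParamFun,
    (∀ l, HoloFam X D T K (U l)) ∧ (∀ i, HoloFam X D T K (nonlinFam U BT i)) ∧
    (∀ l, ∀ Y ∈ X, ∀ p ∈ D, ∀ t ∈ Ioo 0 T, ‖U l Y p t‖ ≤ A * timeWeight a b M h N t ‖p‖) ∧
    (∀ q k i, ∀ Y ∈ X, ∀ p ∈ D, ∀ t ∈ Ioo 0 T,
    ‖convMon (fun l p => U l Y p t) (fun p => BT q k i Y p t) (factors q k) p‖ ≤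
    B * (t⁻¹ * (1 + ‖p‖ ^ n * t)) * timeWeight a b M h N t ‖p‖ * (2 * (1 / 2) ^ multiSize k)) ∧
    (∀ i, ∀ Y ∈ X, ∀ p ∈ D, ∀ t ∈ Ioo 0 T, ‖nonlinFam U BT i Y p t + RT i Y p t‖ ≤
    B * (t⁻¹ * (1 + ‖p‖ ^ n * t)) * timeWeight a b M h N t ‖p‖) ∧
    ∀ i, ∀ Y ∈ X, ∀ p ∈ D, ∀ t ∈ Ioo 0 T, U i Y p t =
    duhamel (lam i) (fun Y p t => nonlinFam U BT i Y p t + RT i Y p t) Y p t := by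
  obtain ⟨K1, K2, hK1, hK2, hW⟩ := W.exists_convWeights c1
  obtain ⟨Kw, hKw, hKwb⟩ := timeWeight_le_mul M W.h_pos.le (W.le_a)
  have hh' := W.h'_pos
  have hT := W.T_pos
  have hC1 := H.C₁_nonneg
  have hQ := H.one_le_Q
  set S := indexSum m n
  have hS0 : 0 ≤ S := indexSum_nonneg m n
  set Kd : ℝ := exp (C0 * T) * (1 / h' + 1 / c) * Kw with hKd
  set A : ℝ := 2 * Kd * C1 with hA
  have hA0 : 0 ≤ A := by positivity
  have hev : ∀ᶠ N : ℝ in atTop, Kd * (C1 * Q * K1 * N ^ (-K)) * S ≤ 1 / 2 := by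
    have h1 := (((tendsto_rpow_neg_atTop W.κ_pos).const_mul (C1 * Q * K1)).const_mul Kd).mul_const S
    rw [mul_zero, mul_zero, zero_mul] at h1
    exact (h1.eventually (gt_mem_nhds (by norm_num : (0 : ℝ) < 1 / 2))).mono fun N h => h.le
  obtain ⟨N, hNE, hN1, hNc, hNA⟩ := (hev.and ((eventually_ge_atTop 1).and
    ((eventually_ge_atTop (2 * c1)).and (eventually_ge_atTop (4 * (Q * A * K2)))))).exists
  have hN0 : 0 < N := by linarith
  set E : ℝ := C1 * Q * K1 * N ^ (-K)
  have hE0 : 0 ≤ E := by positivity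
  set v : ℝ → ℝ → ℝ := timeWeight a b M h N
  have hv0 : ∀ t r, 0 < t → 0 < r → 0 ≤ v t r := fun t r ht hr =>
    timeWeight_nonneg hN0.le ht.le hr.le
  have hCB : ∀ Y ∈ X, ∀ t ∈ Ioo 0 T, _ := fun Y hY t ht =>
    H.coeffBounds hn hK1 hK2 hA0 hN1 hNA hY ht
  have hw0 : ∀ t, 0 < t → ∀ r : ℝ, 0 < r → 0 ≤ t⁻¹ * (1 + r ^ n * t) := fun t ht r hr => by
    positivity
  set good : (Fin m → ParamFun) → Prop := fun U => (∀ l, HoloFam X D T K (U l)) ∧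
    ∀ l, ∀ Y ∈ X, ∀ p ∈ D, ∀ t ∈ Ioo 0 T, ‖U l Y p t‖ ≤ A * v t ‖p‖
  have hterm : ∀ U, good U → ∀ q k i, ∀ Y ∈ X, ∀ p ∈ D, ∀ t ∈ Ioo 0 T,
    ‖convMon (fun l p => U l Y p t) (fun p => BT q k i Y p t) (factors q k) p‖ ≤
    A * E * (t⁻¹ * (1 + ‖p‖ ^ n * t)) * v t ‖p‖ * (2 * (1 / 2) ^ multiSize k) :=
    fun U hU q k i Y hY p hp t ht => (hCB Y hY t ht).norm_term_le hD (hW N hN1 hNc t ht) hA0 hE0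
    (hw0 t ht.1) (fun l p hp => hU.2 l Y hY p hp t ht) q k i hp
  have hloc : ∀ G t1 t2 r0 : ℝ, 0 ≤ G → 0 < t1 → t2 < T → 0 < r0 → ∃ L, 0 ≤ L ∧ ∀ t ∈ Icc t1 t2,
    ∀ r, 0 < r → r ≤ r0 → G * (t⁻¹ * (1 + r ^ n * t)) * v t r ≤ L := fun G t1 t2 r0 hG h1 h2 h3 =>
    by
    obtain ⟨L, hL0, hL⟩ := exists_timeWeight_le (fun i => hh'.le.trans (W.le_a i)) W.h_pos.le
      W.one_le_b hN0.le
    refine ⟨G * (t1⁻¹ * (1 + r0 ^ n * T)) * L, by positivity, fun t ht r hr hr0 => ?_⟩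
    have ht0 := h1.trans_le ht.1
    have htT := ht.2.trans h2.le
    have := hL t ht0 htT r hr hr0
    have h5 := inv_anti₀ h1 ht.1
    have h6 := hv0 t r ht0 hr
    gcongr
  have hnl := fun U hU i => holoFam_nonlin hX hD W.κ_pos W.κ_le
    hU.1 H.B_holo i (fun q k Y hY p hp t ht => hterm U hU q k i Y hY p hp t ht)
    fun t1 t2 r0 h1 h2 h3 => hloc (A * E) t1 t2 r0 (by positivity) h1 h2 h3
  have hnlb : ∀ U, good U → ∀ i, ∀ Y ∈ X, ∀ p ∈ D, ∀ t ∈ Ioo 0 T,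
    ‖nonlinFam U BT i Y p t‖ ≤ A * E * S * (t⁻¹ * (1 + ‖p‖ ^ n * t)) * v t ‖p‖ :=
    fun U hU i Y hY p hp t ht => (hCB Y hY t ht).norm_nonlin_le hD (hW N hN1 hNc t ht) hA0 hE0
    (hw0 t ht.1) (fun l p hp => hU.2 l Y hY p hp t ht) i hp
  have hHb : ∀ U, good U → ∀ i, ∀ Y ∈ X, ∀ p ∈ D, ∀ t ∈ Ioo 0 T,
    ‖nonlinFam U BT i Y p t + RT i Y p t‖ ≤
    (A * E * S + C1) * (t⁻¹ * (1 + ‖p‖ ^ n * t)) * v t ‖p‖ := fun U hU i Y hY p hp t ht => by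
    have h1 := hnlb U hU i Y hY p hp t ht
    have h2 := H.R_bound N hNc i Y hY p hp t ht
    have ht0 := ht.1
    have h3 : C1 * t⁻¹ * v t ‖p‖ ≤ C1 * (t⁻¹ * (1 + ‖p‖ ^ n * t)) * v t ‖p‖ := by
      refine mul_le_r ?_ (hv0 t _ ht0 (hD.norm_pos hp))
      refine mul_le_l ?_ hC1
      exact le_mul_of_one_le_right (by positivity) (le_add_of_nonneg_right (by positivity))
    refine (norm_add_le _ _).trans ((add_le_add h1 (h2.trans h3)).trans_eq ?_)
    ring
  have hduh : ∀ (i : Fin m) G (F : ℝ → ℂ), 0 ≤ G → ∀ p ∈ D, ∀ t ∈ Ioo 0 T,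
    (∀ u ∈ Ioc 0 t, ‖F u‖ ≤ G * (u⁻¹ * (1 + ‖p‖ ^ n * u)) * v u ‖p‖) →
    ‖∫ u in 0..t, cexp (-(lam i p * (t - u))) * F u‖ ≤ Kd * G * v t ‖p‖ := fun i G F hG p hp t ht hF
    => by
    have hp0 := hD.norm_pos hp
    have hvt := hv0 t _ ht.1 hp0
    refine (norm_integral_duhamel_le hc hC0 hh' ht.1 ht.2.le (pow_pos hp0 n) (hlb i p hp)
      (B := G * Kw * v t ‖p‖) (by positivity) fun u hu => (hF u hu).trans ?_).trans_eq ?_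
    · have := hKwb N u t ‖p‖ hN0.le hu.1 hu.2 hp0.le
      have hu0 := hu.1
      calc _ ≤ G * (u⁻¹ * (1 + ‖p‖ ^ n * u)) * (Kw * (u / t) ^ h' * v t ‖p‖) := mul_le_l this
        _ = _ := by ring
    · rw [hKd]; ring
  set P : (Fin m × ℂ × ℂ × ℝ → ℂ) → Fin m × ℂ × ℂ × ℝ → ℂ := fun U z =>
    duhamel (lam z.1) (fun Y p t => nonlinFam (fun l Y p t => U (l, Y, p, t)) BT z.1 Y p t +
    RT z.1 Y p t) z.2.1 z.2.2.1 z.2.2.2 with hP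
  have hPgood : ∀ U, good U → good fun l => duhamel (lam l)
    (fun Y p t => nonlinFam U BT l Y p t + RT l Y p t) := fun U hU => by
    refine ⟨fun l => ((hnl U hU l).add (H.R_holo l)).duhamel hX hD W.κ_le (hlam l) ?_,
      fun l Y hY p hp t ht => ?_⟩
    · intro t2 r0 ht₂ hr₀
      obtain ⟨L, hL0, hL⟩ := exists_timeWeight_le (b := b) (M := M) (h := h) (v := N) (T := T)
        (r0 := r0) (fun i => hh'.le.trans (W.le_a i)) W.h_pos.le W.one_le_b hN0.le
      refine ⟨(A * E * S + C1) * (1 + r0 ^ n * T) * (Kw * T ^ (-h') * L) * (r0 ^ (K - 1))⁻¹, h',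
        by positivity, hh', fun Y hY p hp hpr t ht => ?_⟩
      have htT : t < T := ht.2.trans_lt ht₂
      have ht0 : 0 < t := ht.1
      have hp0 := hD.norm_pos hp
      have h3 := hL T hT le_rfl ‖p‖ hp0 hpr
      have h4 := (rpow_sub_one_le_of_mem hp0 le_rfl hpr W.κ_le).1
      have e1 : t⁻¹ * (t / T) ^ h' = T ^ (-h') * t ^ (h' - 1) := by
        rw [div_rpow ht0.le hT.le, rpow_neg hT.le, rpow_sub_one ht0.ne']
        field_simp
      calc _ ≤ _ := hHb U hU l Y hY p hp t ⟨ht0, htT⟩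
        _ ≤ (A * E * S + C1) * (t⁻¹ * (1 + r0 ^ n * T)) * (Kw * (t / T) ^ h' * L) := by
            refine mul_le_lr ?_ ((hKwb N t T ‖p‖ hN0.le ht0 htT.le hp0.le).trans (mul_le_l h3
              (by positivity))) (hv0 t _ ht0 hp0)
            gcongr
        _ = (A * E * S + C1) * (1 + r0 ^ n * T) * Kw * L * (t⁻¹ * (t / T) ^ h') := by ring
        _ ≤ (A * E * S + C1) * (1 + r0 ^ n * T) * Kw * L * (t⁻¹ * (t / T) ^ h') *
          ((r0 ^ (K - 1))⁻¹ * ‖p‖ ^ (K - 1)) := le_mul_of_one_le_right (by positivity)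
          (by rw [inv_mul_eq_div, one_le_div (by positivity)]; exact h4)
        _ = _ := by rw [e1]; ring
    · refine (hduh l (A * E * S + C1) _ (by positivity) p hp t ht fun u hu =>
        hHb U hU l Y hY p hp u ⟨hu.1, hu.2.trans_lt ht.2⟩).trans ?_
      refine mul_le_r ?_ (hv0 t _ ht.1 (hD.norm_pos hp))
      have : A * (Kd * E * S) ≤ A * (1 / 2) := mul_le_l hNE hA0
      nlinarith
  have hint : ∀ U, good U → ∀ i, ∀ Y ∈ X, ∀ p ∈ D, ∀ t ∈ Ioo 0 T, IntervalIntegrable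
    (fun u : ℝ => nonlinFam U BT i Y p u + RT i Y p u) volume 0 t := fun U hU i Y hY p hp t ht => by
    have hp0 := hD.norm_pos hp
    refine ((hnl U hU i).add (H.R_holo i)).intervalIntegrable (m := h')
      (L := (A * E * S + C1) * (1 + ‖p‖ ^ n * T) * (Kw * t ^ (-h') * v t ‖p‖)) hY hp hh' ht
      fun u hu => ?_
    have hu0 : 0 < u := hu.1
    have ht0 := ht.1
    have h1 := hHb U hU i Y hY p hp u ⟨hu.1, hu.2.trans_lt ht.2⟩
    have h2 := hKwb N u t ‖p‖ hN0.le hu.1 hu.2 hp0.le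
    have huT : u ≤ T := hu.2.trans ht.2.le
    have e1 : u⁻¹ * (u / t) ^ h' = t ^ (-h') * u ^ (h' - 1) := by
      rw [div_rpow hu0.le ht0.le, rpow_neg ht0.le, rpow_sub_one hu0.ne']
      field_simp
    calc _ ≤ _ := h1
      _ ≤ (A * E * S + C1) * (u⁻¹ * (1 + ‖p‖ ^ n * T)) * (Kw * (u / t) ^ h' * v t ‖p‖) := by
          refine mul_le_mul ?_ h2 (hv0 u _ hu0 hp0) (by positivity)
          gcongr
      _ = (A * E * S + C1) * (1 + ‖p‖ ^ n * T) * Kw * v t ‖p‖ * (u⁻¹ * (u / t) ^ h') := by ring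
      _ = _ := by rw [e1]; ring
  obtain ⟨U, hUS, hUfix⟩ := exists_fixedPoint_of_contraction
    (dom := {z : Fin m × ℂ × ℂ × ℝ | z.2.1 ∈ X ∧ z.2.2.1 ∈ D ∧ z.2.2.2 ∈ Ioo 0 T})
    (v := fun z => v z.2.2.2 ‖z.2.2.1‖)
    (S := {U | good fun l Y p t => U (l, Y, p, t)}) (G := P) (U0 := fun _ => 0) (A := A)
    ⟨fun l => HoloFam.zero, fun l Y hY p hp t ht => by
      rw [norm_zero]; exact mul_nonneg hA0 (hv0 t _ ht.1 (hD.norm_pos hp))⟩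
        (fun U hU => hPgood _ hU) hA0
        (fun U hU z hz => hU.2 z.1 z.2.1 hz.1 z.2.2.1 hz.2.1 z.2.2.2 hz.2.2) (by
      intro U hU V hV o ho hUV z hz
      obtain ⟨i, Y, p, t⟩ := z
      obtain ⟨hY, hp, ht⟩ := hz
      have hct : ∀ U : Fin m → ParamFun, good U → ∀ u ∈ Ioo 0 T, ∀ q k i L,
        ContinuousOn (convMon (fun l p => U l Y p u) (fun p => BT q k i Y p u) L) D :=
        fun U hU u hu q k i L => ((HoloFam.convMon hX hD W.κ_pos W.κ_le hU.1
        (H.B_holo q k i) L).holo Y hY u hu).continuousOn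
      have hdiff : ∀ u ∈ Ioc 0 t, ‖nonlinFam (fun l Y p t => U (l, Y, p, t)) BT i Y p u -
        nonlinFam (fun l Y p t => V (l, Y, p, t)) BT i Y p u‖ ≤
        o * E * S * (u⁻¹ * (1 + ‖p‖ ^ n * u)) * v u ‖p‖ := fun u hu => by
        have hu' : u ∈ Ioo 0 T := ⟨hu.1, hu.2.trans_lt ht.2⟩
        exact (hCB Y hY u hu').norm_nonlin_sub_le hD (hW N hN1 hNc u hu') hA0 hE0 ho
          (hw0 u hu.1) (fun l p hp => hU.2 l Y hY p hp u hu') (fun l p hp => hV.2 l Y hY p hp u hu')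
          (fun l p hp => hUV (l, Y, p, u) ⟨hY, hp, hu'⟩)
          (fun l => ((hU.1 l).holo Y hY u hu').continuousOn)
          (fun l => ((hV.1 l).holo Y hY u hu').continuousOn)
          (fun q k i L => hct _ hU u hu' q k i L) (fun q k i L => hct _ hV u hu' q k i L) i hp
      have e : P U (i, Y, p, t) - P V (i, Y, p, t) = ∫ u in 0..t, cexp (-(lam i p * (t - u))) *
        (nonlinFam (fun l Y p t => U (l, Y, p, t)) BT i Y p u -
        nonlinFam (fun l Y p t => V (l, Y, p, t)) BT i Y p u) := by
        simp only [hP, duhamel]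
        rw [← intervalIntegral.integral_sub ((hint _ hU i Y hY p hp t ht).continuousOn_mul
          (by fun_prop)) ((hint _ hV i Y hY p hp t ht).continuousOn_mul (by fun_prop))]
        refine intervalIntegral.integral_congr fun u _ => ?_
        ring
      rw [e]
      refine (hduh i (o * E * S) _ (by positivity) p hp t ht hdiff).trans ?_
      refine mul_le_r ?_ (hv0 t _ ht.1 (hD.norm_pos hp))
      have : o * (Kd * E * S) ≤ o * (1 / 2) := mul_le_l hNE ho
      linarith) (by
      intro F U hF hFU
      have hloc' : ∀ t1 t2 r0 : ℝ, 0 < t1 → t2 < T → 0 < r0 → ∃ L, 0 ≤ L ∧ ∀ t ∈ Icc t1 t2,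
        ∀ r, 0 < r → r ≤ r0 → v t r ≤ L := fun t1 t2 r0 h1 h2 h3 => by
        obtain ⟨L, hL0, hL⟩ := exists_timeWeight_le (fun i => hh'.le.trans (W.le_a i)) W.h_pos.le
          W.one_le_b hN0.le
        exact ⟨L, hL0, fun t ht r hr hr0 => hL t (h1.trans_le ht.1) (ht.2.trans h2.le) r hr hr0⟩
      have hUb : ∀ l, ∀ Y ∈ X, ∀ p ∈ D, ∀ t ∈ Ioo 0 T, ‖U (l, Y, p, t)‖ ≤ A * v t ‖p‖ := fun l Y hY
        p hp t ht => by
        have ht2 : Tendsto (fun k => A * v t ‖p‖ + 4 * A * (1 / 2) ^ k * v t ‖p‖) atTop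
          (𝓝 (A * v t ‖p‖)) := by
          have : Tendsto (fun k : ℕ => (1 / 2 : ℝ) ^ k) atTop (𝓝 0) :=
            tendsto_pow_atTop_nhds_zero_of_lt_one (by norm_num) (by norm_num)
          simpa using ((this.const_mul (4 * A)).mul_const (v t ‖p‖)).const_add (A * v t ‖p‖)
        refine ge_of_tendsto ht2 (.of_forall fun k => ?_)
        have h1 := (hF k).2 l Y hY p hp t ht
        have h2 := hFU k (l, Y, p, t) ⟨hY, hp, ht⟩
        have h3 := norm_sub_norm_le (U (l, Y, p, t)) (F k (l, Y, p, t))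
        rw [norm_sub_rev] at h3; linarith
      refine ⟨fun l => HoloFam.of_tendsto (l := atTop) hX hD (fun k => (hF k).1 l) ?_ ?_, hUb⟩
      · intro t1 t2 r1 r0 h1 h2 h3 h4
        obtain ⟨L, hL0, hL⟩ := hloc' t1 t2 r0 h1 h2 h4
        rw [Metric.tendstoUniformlyOn_iff]
        intro d hd
        have h0 : Tendsto (fun k => 4 * A * (1 / 2) ^ k * L) atTop (𝓝 0) := by
          have : Tendsto (fun k : ℕ => (1 / 2 : ℝ) ^ k) atTop (𝓝 0) :=
            tendsto_pow_atTop_nhds_zero_of_lt_one (by norm_num) (by norm_num)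
          simpa using (this.const_mul (4 * A)).mul_const L
        filter_upwards [h0.eventually (gt_mem_nhds hd)] with k hk z hz
        obtain ⟨hY, hp, hp1, hp0, ht⟩ := hz
        rw [dist_eq_norm, norm_sub_rev]
        refine lt_of_le_of_lt ?_ hk
        refine (hFU k (l, z) ⟨hY, hp, h1.trans_le ht.1, ht.2.trans_lt h2⟩).trans ?_
        exact mul_le_l (hL _ ht _ (hD.norm_pos hp) hp0)
      · intro t1 t2 r0 h1 h2 h3
        obtain ⟨L, hL0, hL⟩ := hloc' t1 t2 r0 h1 h2 h3
        refine ⟨A * L * (r0 ^ (K - 1))⁻¹, by positivity, fun Y hY p hp hpr t ht => ?_⟩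
        have hp0 := hD.norm_pos hp
        have h4 := (rpow_sub_one_le_of_mem hp0 le_rfl hpr W.κ_le).1
        have h5 : 1 ≤ (r0 ^ (K - 1))⁻¹ * ‖p‖ ^ (K - 1) := by
          rw [inv_mul_eq_div, one_le_div (by positivity)]; exact h4
        calc _ ≤ A * v t ‖p‖ := hUb l Y hY p hp t ⟨h1.trans_le ht.1, ht.2.trans_lt h2⟩
          _ ≤ A * L := mul_le_l (hL t ht _ hp0 hpr)
          _ ≤ A * L * ((r0 ^ (K - 1))⁻¹ * ‖p‖ ^ (K - 1)) :=
            le_mul_of_one_le_right (by positivity) h5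
          _ = _ := by ring)
  refine ⟨A, N, A * E * S + C1 + A * E, hA0, hN1, by linarith, by positivity,
    fun l Y p t => U (l, Y, p, t), hUS.1, hnl _ hUS, hUS.2, ?_, ?_,
    fun i Y hY p hp t ht => hUfix (i, Y, p, t) ⟨hY, hp, ht⟩⟩
  · intro q k i Y hY p hp t ht
    refine (hterm _ hUS q k i Y hY p hp t ht).trans ?_
    have h1 := hw0 t ht.1 ‖p‖ (hD.norm_pos hp)
    have h2 := hv0 t ‖p‖ ht.1 (hD.norm_pos hp)
    have h3 : A * E ≤ A * E * S + C1 + A * E := by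
      have : 0 ≤ A * E * S + C1 := by positivity
      linarith
    gcongr
  · intro i Y hY p hp t ht
    refine (hHb _ hUS i Y hY p hp t ht).trans ?_
    have h1 := hw0 t ht.1 ‖p‖ (hD.norm_pos hp)
    have h2 := hv0 t ‖p‖ ht.1 (hD.norm_pos hp)
    have h3 : A * E * S + C1 ≤ A * E * S + C1 + A * E := by
      have : 0 ≤ A * E := by positivity
      linarith
    gcongr

end

section

variable {J : Type*} [Fintype J] {m n : ℕ}

/-- The bounds of the data of the system, in a region of `x` which grows like `t^h`. -/
structure SectorData (X : Set ℂ) (s1 R h h' u T C Q : ℝ) (a b : J → ℝ)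
    (r : Fin m → ParamFun)
    (B : CoeffFam m n ParamFun) : Prop where
  C_nonneg : 0 ≤ C
  one_le_Q : 1 ≤ Q
  r_fun : ∀ i, SectorFun X s1 R h T (r i)
  B_fun : ∀ q k i, SectorFun X s1 R h T (B q k i)
  r_bound : ∀ i, ∀ y ∈ X, ∀ t ∈ Ioo 0 T, ∀ x ∈ cone s1 (R * t ^ h),
    ‖r i y x t‖ ≤ C * t⁻¹ * ∑ j, t ^ a j * ‖x‖ ^ (-b j)
  B_bound : ∀ q k i, ∀ y ∈ X, ∀ t ∈ Ioo 0 T, ∀ x ∈ cone s1 (R * t ^ h),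
    ‖B q k i y x t‖ ≤ C * Q ^ multiSize k * t ^ coeffExp h h' u q k * ‖x‖ ^ (-u)
  B_zero : ∀ q k i, multiSize k + q.size = 0 → ∀ y x t, B q k i y x t = 0

lemma rpow_le_add_of_mem_Icc {t1 t2 t e : ℝ} (h1 : 0 < t1) (ht : t ∈ Icc t1 t2) :
    t ^ e ≤ t1 ^ e + t2 ^ e := by
  have ht0 := h1.trans_le ht.1
  have h3 := rpow_pos_of_pos h1 e
  have h4 := rpow_pos_of_pos (ht0.trans_le ht.2) e
  rcases le_total 0 e with he | he
  · linarith [rpow_le_rpow ht0.le ht.2 he]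
  · linarith [rpow_anti h1 ht.1 he]

variable {X : Set ℂ} {s1 R h h' u T C Q o D c1 : ℝ} {a b : J → ℝ} {M : ℕ}
    {r : Fin m → ParamFun} {B : CoeffFam m n ParamFun}

lemma SectorData.decay_r (W : WeightParams a b M h h' u T) (hR : 0 < R)
    (H : SectorData X s1 R h h' u T C Q a b r B) (i : Fin m) :
    SectorDecay X s1 R h T u (r i) := fun t1 t2 h1 h2 => by
  have hC := H.C_nonneg
  have hT := W.T_pos
  have ht1 := rpow_pos_of_pos h1 h
  refine ⟨C * t1⁻¹ * ∑ j, T ^ a j * (R * t1 ^ h) ^ (-(b j - u)), by positivity,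
    fun y hy t ht x hx => ?_⟩
  have ht0 := h1.trans_le ht.1
  have htT := ht.2.trans_lt h2
  have hx0 := (mul_le_l (rpow_le_rpow h1.le ht.1 W.h_pos.le)).trans hx.1.le
  refine (H.r_bound i y hy t ⟨ht0, htT⟩ x hx).trans ?_
  rw [mul_assoc (C * t1⁻¹), sum_mul]
  refine mul_le_lr (mul_le_l (inv_anti₀ h1 ht.1)) (sum_le_sum fun j _ => ?_)
  have e : ‖x‖ ^ (-b j) = ‖x‖ ^ (-(b j - u)) * ‖x‖ ^ (-u) := by
    rw [← rpow_add ((mul_pos hR ht1).trans_le hx0)]; congr 1; ring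
  rw [e, ← mul_assoc]
  have h6 := rpow_le_rpow ht0.le htT.le (W.h'_pos.le.trans (W.le_a j))
  have h7 : ‖x‖ ^ (-(b j - u)) ≤ (R * t1 ^ h) ^ (-(b j - u)) :=
    rpow_anti (mul_pos hR ht1) hx0 (by linarith [W.one_le_b j, W.κ_le])
  gcongr

lemma SectorData.decay_B (H : SectorData X s1 R h h' u T C Q a b r B) (q : DerivIdx m n)
    (k : Fin m → ℕ) (i : Fin m) : SectorDecay X s1 R h T u (B q k i) := fun t1 t2 h1 h2 => by
  have hC := H.C_nonneg
  have hQ := zero_le_one.trans H.one_le_Q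
  rcases le_or_gt t1 t2 with h12 | h12
  · have ht2 := h1.trans_le h12
    refine ⟨C * Q ^ multiSize k * (t1 ^ coeffExp h h' u q k + t2 ^ coeffExp h h' u q k),
      by positivity, fun y hy t ht x hx => ?_⟩
    refine (H.B_bound q k i y hy t ⟨h1.trans_le ht.1, ht.2.trans_lt h2⟩ x hx).trans ?_
    have := rpow_le_add_of_mem_Icc (e := coeffExp h h' u q k) h1 ht
    gcongr
  · exact ⟨0, le_rfl, fun y _ t ht => absurd (ht.1.trans ht.2) (not_le.2 h12)⟩

lemma SectorData.transformedData (H' : Contour s1 R o) (hX : IsOpen X) (hD : 0 < D)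
    (W : WeightParams a b M h h' u T) (hc1 : R < (1 - s1) / 2 * c1)
    (H : SectorData X s1 R h h' u T C Q a b r B) :
    ∃ C1 : ℝ, TransformedData X (dualCone o D) a b M h h' u T c1 C1 Q
    (fun i Y p t => invLap o (c1 * T ^ h) (fun x => r i Y x t) p)
    (fun q k i Y p t => invLap o (c1 * T ^ h) (fun x => B q k i Y x t) p) := by
  have hC := H.C_nonneg
  have hQ : 0 ≤ Q := zero_le_one.trans H.one_le_Q
  have hk : 0 < (1 - s1) / 2 := by linarith [H'.lt_one]
  have hc0 : 0 < c1 := pos_of_mul_pos_right (H'.pos.trans hc1) hk.le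
  obtain ⟨K, hK1, hK⟩ := one_add_pow_le_exp M (d := 1 / 2) (by norm_num)
  set S := 1 + ∑ j, ((1 - s1) / 2) ^ (-b j)
  have hSj : ∀ j, ((1 - s1) / 2) ^ (-b j) ≤ S := fun j => by
    have := single_le_sum (f := fun j => ((1 - s1) / 2) ^ (-b j))
      (fun _ _ => by positivity) (Finset.mem_univ j)
    beta_reduce at this
    linarith
  set C1 := exp 1 / D * C * (S * K + ((1 - s1) / 2) ^ (-u)) with hC1
  have hbdr := fun i => H.decay_r W H'.pos i
  have hbdB := H.decay_B
  have hvert : ∀ (g : ParamFun), SectorFun X s1 R h T g → SectorDecay X s1 R h T u g →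
    ∀ Y ∈ X, ∀ p ∈ dualCone o D, ∀ t ∈ Ioo 0 T, invLap o (c1 * T ^ h) (fun x => g Y x t) p =
    invLap o (c1 * t ^ h) (fun x => g Y x t) p := fun g hg hd Y hY p hp t ht => by
    obtain ⟨G, hG0, hG⟩ := hd t t ht.1 ht.2
    refine invLap_eq_of_time H' hD.le W.h_pos.le hc1 ht (hg.holo Y hY t ht)
      (G := G * (R * t ^ h) ^ (-u)) (fun z hz => (hG Y hY t ⟨le_rfl, le_rfl⟩ z hz).trans ?_) hp
    exact mul_le_l (rpow_anti (mul_pos H'.pos (rpow_pos_of_pos ht.1 h)) hz.1.le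
      (by linarith [W.κ_pos]))
  have hct : ∀ t ∈ Ioo 0 T, R * t ^ h < (1 - s1) / 2 * (c1 * t ^ h) := fun t ht => by
    rw [← mul_assoc]; exact mul_lt_mul_of_pos_right hc1 (rpow_pos_of_pos ht.1 h)
  refine ⟨C1, hc0.le, by positivity, H.one_le_Q,
    fun i => (H.r_fun i).invLap H' hX hD W.h_pos.le W.κ_pos.le hc1 (hbdr i),
    fun q k i => (H.B_fun q k i).invLap H' hX hD W.h_pos.le W.κ_pos.le hc1 (hbdB q k i), ?_, ?_, ?_⟩
  · intro v hv i Y hY p hp t ht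
    have ht0 := ht.1
    rw [hvert _ (H.r_fun i) (hbdr i) Y hY p hp t ht]
    have h1 := norm_invLap_le_rpow (H'.of_radius (mul_pos H'.pos (rpow_pos_of_pos ht.1 h))) hD (hct
      t ht) (C := fun j => C * t⁻¹ * t ^ a j) (b := b) ((H.r_fun i).holo Y hY t ht)
      (fun j => by positivity) (fun j => by linarith [W.one_le_b j])
      (fun z hz => (H.r_bound i Y hY t ht z hz).trans_eq (by
        rw [mul_sum]; exact sum_congr rfl fun j _ => by ring)) hp
    refine h1.trans ?_
    set y := v * t ^ h * ‖p‖ with hy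
    have hv0 : 0 < v := by linarith
    have hy0 : 0 ≤ y := by positivity
    have h2 : exp (c1 * t ^ h * ‖p‖) ≤ K * expWeight M y := by
      rw [expWeight, mul_div_assoc', le_div_iff₀ (by positivity)]
      calc _ ≤ exp (1 / 2 * y) * (K * exp (1 / 2 * y)) := by
            refine mul_le_lr (exp_le_exp.2 ?_) (hK y hy0)
            rw [hy]
            have : c1 ≤ 1 / 2 * v := by linarith
            calc c1 * t ^ h * ‖p‖ ≤ 1 / 2 * v * t ^ h * ‖p‖ := by gcongr
              _ = _ := by ring
        _ = _ := by rw [mul_left_comm, ← exp_add]; congr 2; ring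
    have h3 : ∑ j, ((1 - s1) / 2) ^ (-b j) * (C * t⁻¹ * t ^ a j * ‖p‖ ^ (b j - 1)) ≤
      S * (C * t⁻¹) * ∑ j, t ^ a j * ‖p‖ ^ (b j - 1) := by
      rw [mul_sum]
      refine sum_le_sum fun j _ => ?_
      calc _ ≤ S * (C * t⁻¹ * t ^ a j * ‖p‖ ^ (b j - 1)) := mul_le_r (hSj j)
        _ = _ := by ring
    have hew := (expWeight_pos M hy0).le
    calc _ ≤ exp 1 / D * (S * (C * t⁻¹) * ∑ j, t ^ a j * ‖p‖ ^ (b j - 1)) *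
      (K * expWeight M y) := by gcongr
      _ = exp 1 / D * C * (S * K) * t⁻¹ * ((∑ j, t ^ a j * ‖p‖ ^ (b j - 1)) *
        expWeight M y) := by ring
      _ ≤ _ := by
          rw [hC1, timeWeight, sumWeight]
          gcongr
          exact le_add_of_nonneg_right (by positivity)
  · intro q k i Y hY p hp t ht
    have ht0 := ht.1
    rw [hvert _ (H.B_fun q k i) (hbdB q k i) Y hY p hp t ht]
    have h1 := norm_invLap_le_rpow (J := Unit) (H'.of_radius (mul_pos H'.pos (rpow_pos_of_pos ht.1
      h))) hD (hct t ht) (C := fun _ => C * Q ^ multiSize k * t ^ coeffExp h h' u q k)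
      ((H.B_fun q k i).holo Y hY t ht) (fun j => by positivity) (fun j => W.κ_pos.le)
      (fun z hz => (H.B_bound q k i Y hY t ht z hz).trans_eq (by simp)) hp
    rw [Fintype.sum_unique] at h1
    refine h1.trans ?_
    calc _ = exp 1 / D * C * ((1 - s1) / 2) ^ (-u) * Q ^ multiSize k *
      t ^ coeffExp h h' u q k * (‖p‖ ^ (u - 1) * exp (c1 * t ^ h * ‖p‖)) := by ring
      _ ≤ _ := by
          rw [hC1]
          gcongr
          exact le_add_of_nonneg_left (by positivity)
  · intro q k i h0 Y hY p hp t ht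
    have : (fun x => B q k i Y x t) = fun _ => 0 := funext fun x => H.B_zero q k i h0 Y x t
    rw [this]; simp [invLap, armInt]

end

section

lemma abs_arg_lt_of_mem_dualCone {o d : ℝ} (hd : 0 ≤ d) (ho0 : 0 < o) (ho : o < π / 2)
    {p : ℂ} (hp : p ∈ dualCone o d) : |p.arg| < o := by
  have hp' : d * ‖p‖ + cos o * |p.im| < sin o * p.re := hp
  have hn : 0 < ‖p‖ := norm_pos_iff.2 fun h => zero_notMem_dualCone (h ▸ hp)
  have harg : |p.arg| < π / 2 := Complex.abs_arg_lt_pi_div_two_iff.2 (Or.inl (re_pos_of_mem_dualCone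
    hd (cos_pos_of_mem_Ioo ⟨by linarith, ho⟩).le (sin_pos_of_pos_of_lt_pi ho0 (by linarith)) hp))
  by_contra! hcon
  have h1 : sin (o - |p.arg|) ≤ 0 := sin_nonpos_of_nonpos_of_neg_pi_le (by linarith) (by linarith)
  rw [sin_sub, cos_abs] at h1
  have h2 := (abs_sin_eq_sin_abs_of_abs_le_pi (by linarith)).symm
  have h3 : |p.im| = ‖p‖ * |sin p.arg| := by
    rw [Complex.sin_arg, abs_div, abs_of_pos hn, mul_div_cancel₀ _ hn.ne']
  have h4 : p.re = ‖p‖ * cos p.arg := by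
    rw [Complex.cos_arg (norm_pos_iff.1 hn), mul_div_cancel₀ _ hn.ne']
  rw [h2] at h1; rw [h3, h4] at hp'
  nlinarith [mul_nonpos_of_nonneg_of_nonpos hn.le h1]

lemma exists_dualCone_re_ge {f f' o D : ℝ} (h0 : 0 < f) (h1 : f < f') (h2 : f' < π / 2)
    (hD : D < sin (o - f')) : ∃ E : ℝ, 0 < E ∧ ∀ x ∈ cone (sin f) 0, ∃ w ∈ dualCone o D, ‖w‖ = 1 ∧
    E * ‖x‖ ≤ (w * x).re := by
  have hc' : 0 < cos f' := cos_pos_of_mem_Ioo ⟨by linarith, h2⟩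
  have hs : 0 < sin f := sin_pos_of_pos_of_lt_pi h0 (by linarith)
  have hd : 0 < sin (f' - f) := sin_pos_of_pos_of_lt_pi (by linarith) (by linarith)
  have hds : sin (f' - f) ≤ sin f' :=
    sin_le_sin_of_le_of_le_pi_div_two (by linarith) h2.le (by linarith)
  have key : ∀ x ∈ cone (sin f) 0, min (cos f') (sin (f' - f)) * ‖x‖ ≤
    cos f' * x.re + sin f' * |x.im| := fun x hx => by
    have hx0 := norm_nonneg x
    have hx1 := hx.2
    rcases le_total 0 x.re with hre | hre
    · have h3 := Complex.norm_le_abs_re_add_abs_im x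
      rw [abs_of_nonneg hre] at h3
      calc _ ≤ min (cos f') (sin (f' - f)) * (x.re + |x.im|) := mul_le_l h3
        _ = min (cos f') (sin (f' - f)) * x.re +
          min (cos f') (sin (f' - f)) * |x.im| := mul_add _ _ _
        _ ≤ _ := add_le_add (mul_le_r (min_le_left _ _)) (mul_le_r ((min_le_right _ _).trans hds))
    · have h3 : cos f * ‖x‖ ≤ |x.im| := by
        refine abs_le_of_sq_le_sq' ?_ (abs_nonneg _) |>.2
        have e1 : ‖x‖ ^ 2 = x.re ^ 2 + x.im ^ 2 := by rw [← normSq_eq_norm_sq, normSq_apply]; ring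
        have e2 := sin_sq_add_cos_sq f
        have e3 : x.re ^ 2 ≤ (sin f * ‖x‖) ^ 2 := by
            exact sq_le_sq' hx1.le (hre.trans (by positivity))
        rw [sq_abs, mul_pow]; nlinarith
      rw [sin_sub] at *
      calc _ ≤ (sin f' * cos f - cos f' * sin f) * ‖x‖ := mul_le_r (min_le_right _ _)
        _ ≤ _ := by nlinarith [mul_le_l hx1.le, mul_le_l h3]
  have hmem : ∀ e : ℝ, |e| = 1 → (⟨cos f', e * sin f'⟩ : ℂ) ∈ dualCone o D ∧
    ‖(⟨cos f', e * sin f'⟩ : ℂ)‖ = 1 := fun e he => by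
    have hn : ‖(⟨cos f', e * sin f'⟩ : ℂ)‖ = 1 := by
      have e1 : ‖(⟨cos f', e * sin f'⟩ : ℂ)‖ ^ 2 = 1 := by
        rw [← normSq_eq_norm_sq, normSq_apply]
        have he2 : e ^ 2 = 1 := by rw [← sq_abs, he, one_pow]
        linear_combination (sin_sq_add_cos_sq f') + sin f' ^ 2 * he2
      exact (pow_eq_one_iff_of_nonneg (norm_nonneg _) two_ne_zero).1 e1
    refine ⟨?_, hn⟩
    show D * ‖(⟨cos f', e * sin f'⟩ : ℂ)‖ + cos o * |e * sin f'| < sin o * cos f'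
    rw [hn, abs_mul, he, abs_of_pos (sin_pos_of_pos_of_lt_pi (by linarith) (by linarith))]
    rw [sin_sub] at hD; linarith
  refine ⟨min (cos f') (sin (f' - f)), lt_min hc' hd, fun x hx => ?_⟩
  rcases le_total 0 x.im with him | him
  · refine ⟨_, (hmem (-1) (by simp)).1, (hmem (-1) (by simp)).2, (key x hx).trans_eq ?_⟩
    rw [mul_re, abs_of_nonneg him]; ring
  · refine ⟨_, (hmem 1 (by simp)).1, (hmem 1 (by simp)).2, (key x hx).trans_eq ?_⟩
    rw [mul_re, abs_of_nonpos him]; ring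

end

section
open Set

variable {m n : ℕ}

/-- The symbol `P(-p)`, truncated to degree `n`. -/
def symbol (n : ℕ) (P : Polynomial ℂ) (p : ℂ) : ℂ :=
  ∑ j ∈ Finset.range (n + 1), P.coeff j * (-p) ^ j

lemma differentiable_symbol (n : ℕ) (P : Polynomial ℂ) : Differentiable ℂ (symbol n P) := by
  unfold symbol
  fun_prop

lemma exists_common_pos {a : Type*} [Fintype a] {p : a → ℝ → Prop}
    (hp : ∀ l, ∃ c, 0 < c ∧ ∀ c', 0 < c' → c' ≤ c → p l c') : ∃ c, 0 < c ∧ ∀ l, p l c := by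
  choose c hc hp using hp
  have hs : 0 < 1 + ∑ l, (c l)⁻¹ := by
    have := sum_nonneg fun l (_ : l ∈ Finset.univ) => (inv_pos.2 (hc l)).le
    linarith
  refine ⟨(1 + ∑ l, (c l)⁻¹)⁻¹, inv_pos.2 hs, fun l => hp l _ (inv_pos.2 hs) ?_⟩
  refine inv_le_of_inv_le₀ (hc l) ?_
  have := single_le_sum (fun l _ => (inv_pos.2 (hc l)).le) (Finset.mem_univ l)
  beta_reduce at this
  linarith

lemma exists_leading_lower_bound {f f1 : ℝ} (hf : 0 < f) (hf1 : f < f1) (hπ : f < π)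
    (P : Fin m → Polynomial ℂ)
    (hP : ∀ l, ∀ p : ℂ, p ≠ 0 → |p.arg| ≤ f → 0 < ((P l).coeff n * (-p) ^ n).re) :
    ∃ o c : ℝ, f < o ∧ o < f1 ∧ 0 < c ∧ ∀ l, ∀ p : ℂ, |p.arg| ≤ o →
    c * ‖p‖ ^ n ≤ ((P l).coeff n * (-p) ^ n).re := by
  set g : Fin m → ℝ → ℝ := fun l G => ((P l).coeff n * (-cexp (G * I)) ^ n).re with hg
  have hgc : ∀ l, Continuous (g l) := fun l => by rw [hg]; fun_prop
  have hpos : ∀ l, ∀ G ∈ Icc (-f) f, 0 < g l G := fun l G hG => by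
    refine hP l _ (Complex.exp_ne_zero _) ?_
    rw [Complex.arg_exp_mul_I, (toIocMod_eq_self _).2 ⟨by linarith [hG.1], by linarith [hG.2]⟩]
    exact abs_le.2 hG
  have hopen : IsOpen {G | ∀ l, 0 < g l G} := by
    have : {G | ∀ l, 0 < g l G} = ⋂ l, {G | 0 < g l G} := by ext; simp
    rw [this]; exact isOpen_iInter_of_finite fun l => isOpen_lt continuous_const (hgc l)
  obtain ⟨e, he, hsub⟩ := (isCompact_Icc).exists_cthickening_subset_open hopen
    (fun G hG l => hpos l G hG)
  obtain ⟨o, ho, ho'⟩ := exists_between (lt_min hf1 (lt_add_of_pos_right f he))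
  have hpos' : ∀ l, ∀ G ∈ Icc (-o) o, 0 < g l G := fun l G hG => by
    refine hsub (Metric.mem_cthickening_of_dist_le G (max (-f) (min G f)) e _
      ⟨le_max_left _ _, max_le (by linarith) (min_le_right _ _)⟩ ?_) l
    have h5 := (lt_min_iff.1 ho').2
    rw [Real.dist_eq, abs_le]
    rcases le_total G f with h6 | h6
    · rw [min_eq_left h6]
      rcases le_total (-f) G with h7 | h7
      · rw [max_eq_right h7]; constructor <;> linarith
      · rw [max_eq_left h7]; constructor <;> linarith [hG.1]
    · rw [min_eq_right h6, max_eq_right (by linarith)]; constructor <;> linarith [hG.2]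
  obtain ⟨c, hc, hcb⟩ := exists_common_pos (p := fun l c => ∀ G ∈ Icc (-o) o, c ≤ g l G) fun l => by
      obtain ⟨G0, hG0, hmin⟩ := (isCompact_Icc (a := -o) (b := o)).exists_isMinOn
        ⟨0, by constructor <;> linarith⟩ (hgc l).continuousOn
      exact ⟨g l G0, hpos' l G0 hG0, fun c' _ hc' G hG => hc'.trans (hmin hG)⟩
  refine ⟨o, c, ho, (lt_min_iff.1 ho').1, hc, fun l p hp => ?_⟩
  have h2 : ((P l).coeff n * (-p) ^ n).re = ‖p‖ ^ n * g l p.arg := by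
    conv_lhs => rw [← Complex.norm_mul_exp_arg_mul_I p]
    rw [← re_ofReal_mul]; congr 1
    push_cast; rw [neg_mul_eq_mul_neg, mul_pow]
    ring
  rw [h2, mul_comm]; exact mul_le_l (hcb l p.arg (abs_le.1 hp))

lemma exists_symbol_lower_bound {D : Set ℂ} {c : ℝ} (hc : 0 < c) (P : Fin m → Polynomial ℂ)
    (hP : ∀ l, ∀ p ∈ D, c * ‖p‖ ^ n ≤ ((P l).coeff n * (-p) ^ n).re) :
    ∃ C0 : ℝ, 0 ≤ C0 ∧ ∀ l, ∀ p ∈ D, c / 2 * ‖p‖ ^ n - C0 ≤ (symbol n (P l) p).re := by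
  set S := ∑ l, ∑ j ∈ Finset.range n, ‖(P l).coeff j‖
  set R0 := 1 + 2 * S / c with hR0
  have hR1 : 1 ≤ R0 := by rw [hR0]; exact le_add_of_nonneg_right (by positivity)
  refine ⟨S * R0 ^ n, by positivity, fun l p hp => ?_⟩
  have hSl := single_le_sum (f := fun l => ∑ j ∈ Finset.range n, ‖(P l).coeff j‖)
    (fun l _ => by positivity) (Finset.mem_univ l)
  have h1 : ‖∑ j ∈ Finset.range n, (P l).coeff j * (-p) ^ j‖ ≤ c / 2 * ‖p‖ ^ n + S * R0 ^ n := by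
    have h2 : ‖∑ j ∈ Finset.range n, (P l).coeff j * (-p) ^ j‖ ≤
      ∑ j ∈ Finset.range n, ‖(P l).coeff j‖ * ‖p‖ ^ j := by
      refine (norm_sum_le _ _).trans_eq (sum_congr rfl fun j _ => ?_)
      rw [norm_mul, norm_pow, norm_neg]
    refine h2.trans ?_
    rcases le_total ‖p‖ R0 with h3 | h3
    · have : ∀ j ∈ Finset.range n, ‖(P l).coeff j‖ * ‖p‖ ^ j ≤ ‖(P l).coeff j‖ * R0 ^ n :=
        fun j hj => mul_le_l ((pow_le_pow_left₀ (norm_nonneg p) h3 j).trans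
        (pow_le_pow_right₀ hR1 (Finset.mem_range.1 hj).le))
      refine (sum_le_sum this).trans ?_
      rw [← sum_mul]
      have h4 : 0 ≤ c / 2 * ‖p‖ ^ n := by positivity
      nlinarith [mul_le_r hSl (by positivity : 0 ≤ R0 ^ n)]
    · have h1p := hR1.trans h3
      have hSp : S ≤ c / 2 * ‖p‖ := by
        have : 2 * S / c ≤ ‖p‖ := by linarith
        rw [div_le_iff₀ hc] at this; linarith
      have : ∀ j ∈ Finset.range n, ‖(P l).coeff j‖ * ‖p‖ ^ j * ‖p‖ ≤ ‖(P l).coeff j‖ * ‖p‖ ^ n :=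
        fun j hj => by
        rw [mul_assoc, ← pow_succ]; exact mul_le_l (pow_le_pow_right₀ h1p (Finset.mem_range.1 hj))
      have h5 := sum_le_sum this
      rw [← sum_mul, ← sum_mul] at h5
      have h6 : 0 ≤ S * R0 ^ n := by positivity
      have h7 : (∑ j ∈ Finset.range n, ‖(P l).coeff j‖ * ‖p‖ ^ j) * ‖p‖ ≤
        (c / 2 * ‖p‖ ^ n) * ‖p‖ := by
        refine h5.trans ((mul_le_r (hSl.trans hSp)).trans_eq ?_)
        ring
      have := le_of_mul_le_mul_right h7 (by linarith)
      linarith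
  have h3 : (symbol n (P l) p).re = (∑ j ∈ Finset.range n, (P l).coeff j * (-p) ^ j).re +
    ((P l).coeff n * (-p) ^ n).re := by rw [symbol, Finset.sum_range_succ, add_re]
  have h4 := (abs_le.1 (abs_re_le_norm (∑ j ∈ Finset.range n, (P l).coeff j * (-p) ^ j))).1
  have h5 := hP l p hp
  linarith

end

section

variable {w x : ℂ} {F G : ℂ → ℂ} {v C c t : ℝ} {D : Set ℂ}

lemma RayExp.congr (h : RayExp w F v)
    (hFG : ∀ r : ℝ, 0 < r → G (r * w) = F (r * w)) : RayExp w G v :=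
    IntegrableOn.congr_fun h (fun r hr => by rw [hFG r hr]) measurableSet_Ioi

lemma rayLap_congr (x : ℂ)
    (hFG : ∀ r : ℝ, 0 < r → G (r * w) = F (r * w)) : rayLap w G x = rayLap w F x := by
  rw [rayLap, rayLap]; congr 1
  exact setIntegral_congr_fun measurableSet_Ioi fun r hr => by rw [hFG r hr]

lemma RayExp.zero (w : ℂ) (v : ℝ) : RayExp w (fun _ => 0) v := by simp [RayExp]

lemma rayLap_sum {J : Type*} (s : Finset J) {F : J → ℂ → ℂ}
    (hF : ∀ i ∈ s, RayExp w (F i) v) : RayExp w (fun p => ∑ i ∈ s, F i p) v ∧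
    ∀ x : ℂ, v ≤ (w * x).re → rayLap w (fun p => ∑ i ∈ s, F i p) x = ∑ i ∈ s, rayLap w (F i) x := by
  classical
  induction s using Finset.induction_on with
  | empty => exact ⟨by simpa using RayExp.zero w v, fun x _ => by simp [rayLap]⟩
  | insert a s ha ih =>
    obtain ⟨h1, h2⟩ := ih fun i hi => hF i (Finset.mem_insert_of_mem hi)
    have h3 := hF a (Finset.mem_insert_self a s)
    simp only [Finset.sum_insert ha]
    exact ⟨h3.add h1, fun x hx => by rw [rayLap_add h3 h1 hx, h2 x hx]⟩

lemma rayExp_of_exp_bound (hD : OpenCone D) (hF : ContinuousOn F D) (hb : ∀ p ∈ D, ‖F p‖ ≤ C * exp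
    (c * ‖p‖)) (hw : w ∈ D) (hv : c * ‖w‖ < v) : RayExp w F v := by
  refine RayExp.of_rpow_bound (C := C) one_pos hv ?_ fun r hr => ?_
  · refine ContinuousOn.aestronglyMeasurable ?_ measurableSet_Ioi
    exact hF.comp (by fun_prop) fun r hr => hD.smul_mem w hw r hr
  · refine (hb _ (hD.smul_mem w hw r hr)).trans_eq ?_
    rw [norm_mul, norm_coe, sub_self, rpow_zero, mul_one]; congr 2; ring

lemma rayLap_eq_of_re_lt (hD : OpenCone D) (hDc : Convex ℝ D)
    (hF : DifferentiableOn ℂ F D) (hc : 0 ≤ c)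
    (hb : ∀ p ∈ D, ‖F p‖ ≤ C * exp (c * ‖p‖)) {w1 w2 : ℂ} (hw1 : w1 ∈ D)
    (hx1 : c * ‖w1‖ < (w1 * x).re) (hw2 : w2 ∈ D) (hx2 : c * ‖w2‖ < (w2 * x).re) :
    rayLap w1 F x = rayLap w2 F x := by
  set S := D ∩ {w | c * ‖w‖ < (w * x).re}
  have hcv : Convex ℝ S := by
    refine hDc.inter ?_
    intro p hp q hq a b ha hb hab
    have hp := hp
    have hq : c * ‖q‖ < (q * x).re := hq
    show c * ‖a • p + b • q‖ < ((a • p + b • q) * x).re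
    have h1 : ‖a • p + b • q‖ ≤ a * ‖p‖ + b * ‖q‖ := by
      refine (norm_add_le _ _).trans_eq ?_
      rw [norm_smul, norm_smul, norm_of_nonneg ha, norm_of_nonneg hb]
    have h2 : ((a • p + b • q) * x).re = a * (p * x).re + b * (q * x).re := by
      rw [add_mul, smul_mul_assoc, smul_mul_assoc, add_re, smul_re, smul_re,
        smul_eq_mul, smul_eq_mul]
    rw [h2]
    have h3 := mul_le_l h1
    rcases ha.eq_or_lt with rfl | ha'
    · have : b = 1 := by linarith
      subst this
      nlinarith
    · nlinarith [mul_lt_mul_of_pos_left hp ha', mul_le_l hq.le]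
  refine rayLap_rotation (hD.isOpen.inter (isOpen_lt (by fun_prop) (by fun_prop)))
    hcv.isPreconnected (fun h => hD.zero_notMem h.1) ?_
    (hF.mono inter_subset_left) (C := C) one_pos ?_ (fun w hw => hw.2) ⟨hw1, hx1⟩ ⟨hw2, hx2⟩
  · intro w hw r hr
    refine ⟨hD.smul_mem w hw.1 r hr, ?_⟩
    show c * ‖r * w‖ < (r * w * x).re
    rw [mul_assoc, re_ofReal_mul, norm_mul, norm_coe]
    have : c * ‖w‖ < (w * x).re := hw.2
    nlinarith
  · intro p hp
    simpa using hb p hp.1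

open Classical in
/-- The Laplace transform along any ray of `D` on which it converges absolutely. -/
def sectorLaplace (D : Set ℂ) (c : ℝ) (F : ℂ → ℂ) (x : ℂ) : ℂ :=
  if h : ∃ w ∈ D, c * ‖w‖ < (w * x).re then rayLap h.choose F x else 0

lemma sectorLaplace_eq (hD : OpenCone D) (hDc : Convex ℝ D)
    (hF : DifferentiableOn ℂ F D) (hc : 0 ≤ c)
    (hb : ∀ p ∈ D, ‖F p‖ ≤ C * exp (c * ‖p‖)) (hw : w ∈ D)
    (hx : c * ‖w‖ < (w * x).re) : sectorLaplace D c F x = rayLap w F x := by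
  have h : ∃ w ∈ D, c * ‖w‖ < (w * x).re := ⟨w, hw, hx⟩
  rw [sectorLaplace, dif_pos h]
  exact rayLap_eq_of_re_lt hD hDc hF hc hb h.choose_spec.1 h.choose_spec.2 hw hx

lemma norm_rayLap_le {J : Type*} [Fintype J] {A b : J → ℝ} {d : ℝ}
    (hw : ‖w‖ = 1) (hd : 0 < d) (hb : ∀ j, 0 < b j)
    (hF : ∀ r : ℝ, 0 < r → ‖F (r * w)‖ ≤ (∑ j, A j * r ^ (b j - 1)) * exp (v * r))
    (hA : ∀ j, 0 ≤ A j) (hx : v + d ≤ (w * x).re) :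
    ‖rayLap w F x‖ ≤ ∑ j, A j * (Real.Gamma (b j) * d ^ (-b j)) := by
  rw [rayLap, norm_mul, hw, one_mul]
  have hi : ∀ j, IntegrableOn (fun r => A j * (r ^ (b j - 1) * exp (-(d * r)))) (Ioi 0) :=
    fun j => (integrableOn_rpow_exp (hb j) hd).const_mul _
  refine (norm_integral_le_of_norm_le (g := fun r => ∑ j, A j * (r ^ (b j - 1) * exp (-(d * r))))
    (integrable_finsetSum _ fun j _ => hi j) ?_).trans_eq ?_
  · filter_upwards [ae_Ioi] with r hr
    have hr0 : 0 < r := hr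
    rw [norm_mul, norm_exp]
    calc _ ≤ (∑ j, A j * r ^ (b j - 1)) * exp (v * r) * exp (-(r * (v + d))) := by
          refine mul_le_mul (hF r hr) (exp_le_exp.2 ?_) (exp_pos _).le ?_
          · rw [neg_re, mul_assoc, re_ofReal_mul]
            exact neg_le_neg (mul_le_l hx)
          · exact mul_nonneg (sum_nonneg fun j _ =>
              mul_nonneg (hA j) (rpow_nonneg hr0.le _)) (exp_pos _).le
      _ = (∑ j, A j * r ^ (b j - 1)) * exp (-(d * r)) := by rw [mul_assoc, ← exp_add]; congr 2; ring
      _ = _ := by rw [sum_mul]; exact sum_congr rfl fun j _ => by ring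
  · rw [integral_finsetSum _ fun j _ => hi j]
    refine sum_congr rfl fun j _ => ?_
    rw [integral_const_mul, integral_rpow_mul_exp_neg_mul_Ioi (hb j) hd, one_div,
      inv_rpow hd.le, ← rpow_neg hd.le]
    ring

lemma hasDerivAt_rayLap_time {F F' : TimeFun} {I : Set ℝ}
    (hI : I ∈ 𝓝 t) (hv : v ≤ (w * x).re) (hc : c < v)
    (hm : ∀ u ∈ I, AEStronglyMeasurable (fun r : ℝ => F (r * w) u) (volume.restrict (Ioi 0)))
    (hm' : AEStronglyMeasurable (fun r : ℝ => F' (r * w) t) (volume.restrict (Ioi 0)))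
    (hF : RayExp w (fun p => F p t) v)
    (hd : ∀ r : ℝ, 0 < r → ∀ u ∈ I, HasDerivAt (F (r * w)) (F' (r * w) u) u)
    (hb : ∀ r : ℝ, 0 < r → ∀ u ∈ I, ‖F' (r * w) u‖ ≤ C * exp (c * r)) :
    HasDerivAt (fun u => rayLap w (fun p => F p u) x) (rayLap w (fun p => F' p t) x) t := by
  refine HasDerivAt.const_mul w ?_
  refine (hasDerivAt_integral_of_dominated_loc_of_deriv_le
    (F := fun u (r : ℝ) => F (r * w) u * cexp (-(r * w * x)))
    (F' := fun u (r : ℝ) => F' (r * w) u * cexp (-(r * w * x)))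
    (bound := fun r => |C| * exp (-((v - c) * r))) hI ?_ (hF.integrable hv) ?_ ?_ ?_ ?_).2
  · filter_upwards [hI] with u hu using (hm u hu).mul (by fun_prop)
  · exact hm'.mul (by fun_prop)
  · filter_upwards [ae_Ioi] with r hr u hu
    have hr0 : 0 < r := hr
    rw [norm_mul, norm_exp, neg_re, mul_assoc, re_ofReal_mul]
    calc _ ≤ |C| * exp (c * r) * exp (-(r * v)) := by
          refine mul_le_lr ((hb r hr u hu).trans (mul_le_r (le_abs_self C))) (exp_le_exp.2 ?_)
          exact neg_le_neg (mul_le_l hv)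
      _ = _ := by rw [mul_assoc, ← exp_add]; congr 2; ring
  · refine Integrable.const_mul ?_ _
    have := integrableOn_rpow_exp one_pos (sub_pos.2 hc)
    rw [← IntegrableOn]
    simpa using this
  · filter_upwards [ae_Ioi] with r hr u hu using (hd r hr u hu).mul_const _

variable {J : Type*} [Fintype J]

lemma exists_one_add_pow_mul_timeWeight_le {a b : J → ℝ} {M : ℕ} {h : ℝ} (ht : 0 < t)
    (hv : 0 ≤ v) (hb : ∀ i, 1 ≤ b i) (hM : ∀ i, b i + 1 ≤ M) (N : ℕ) : ∃ C, 0 ≤ C ∧ ∀ r, 0 < r →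
    (1 + r) ^ N * timeWeight a b M h v t r ≤ C * exp ((v + 1) * t ^ h * r) := by
  obtain ⟨K, hK1, hK⟩ := one_add_pow_le_exp (N + M) (rpow_pos_of_pos ht h)
  refine ⟨(∑ i, t ^ a i) * K, by positivity, fun r hr => ?_⟩
  have h1 : ∑ i, t ^ a i * r ^ (b i - 1) ≤ (∑ i, t ^ a i) * (1 + r) ^ M := by
    rw [sum_mul]
    refine sum_le_sum fun i _ => mul_le_l ?_
    calc _ ≤ (1 + r) ^ (b i - 1) := rpow_le_rpow hr.le (by linarith) (by linarith [hb i])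
      _ ≤ (1 + r) ^ (M : ℝ) := rpow_le_rpow_of_exponent_le (by linarith) (by linarith [hM i])
      _ = _ := rpow_natCast _ _
  have h2 : timeWeight a b M h v t r ≤ (∑ i, t ^ a i) * (1 + r) ^ M * exp (v * t ^ h * r) :=
    mul_le_mul h1 (expWeight_le_exp M (by positivity)) (expWeight_pos M (by positivity)).le
    (by positivity)
  calc _ ≤ (1 + r) ^ N * ((∑ i, t ^ a i) * (1 + r) ^ M * exp (v * t ^ h * r)) := by gcongr
    _ = (∑ i, t ^ a i) * (1 + r) ^ (N + M) * exp (v * t ^ h * r) := by ring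
    _ ≤ (∑ i, t ^ a i) * (K * exp (t ^ h * r)) * exp (v * t ^ h * r) := by
        have := hK r hr.le
        gcongr
    _ = _ := by rw [← mul_assoc, mul_assoc, ← exp_add]; congr 2; ring

end

section

variable {J : Type*} [Fintype J] {m n : ℕ} {X : Set ℂ} {s1 R h h' K T C Q o d : ℝ} {a b : J → ℝ}
    {M : ℕ} {r : Fin m → ParamFun} {B : CoeffFam m n ParamFun}

lemma rayLap_evolution (P : Fin m → Polynomial ℂ) {w x : ℂ} {v : ℝ}
    {U : Fin m → ℂ → ℂ} {BT : CoeffFam m n (ℂ → ℂ)} {RT : Fin m → ℂ → ℂ}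
    {b : DerivIdx m n → (Fin m → ℕ) → Fin m → ℂ} {rx : Fin m → ℂ} {f : ℂ → Fin m → ℂ}
    (hv : v < (w * x).re) (hU : ∀ l, RayExp w (U l) v)
    (hf : ∀ᶠ y in 𝓝 x, ∀ l, f y l = rayLap w (U l) y)
    (hB : ∀ q k i, RayExp w (BT q k i) (w * x).re ∧ rayLap w (BT q k i) x = b q k i)
    (hR : ∀ i, RayExp w (RT i) (w * x).re ∧ rayLap w (RT i) x = rx i) {G : ℝ → ℝ}
    (hG : IntegrableOn (fun s => G s * exp (-((w * x).re * s))) (Ioi 0))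
    (hterm : ∀ q k i, ∀ s : ℝ, 0 < s → ‖convMon U (BT q k i) (factors q k) (s * w)‖ ≤
    2 * (1 / 2) ^ multiSize k * G s)
    (hsum : ∀ q, Summable fun k : Fin m → ℕ => (∏ l, f x l ^ k l) • b q k) (i : Fin m) :
    rayLap w (fun p => -(symbol n (P i) p) * U i p + (nonlin U BT i p + RT i p)) x =
    -(∑ j ∈ Finset.range (n + 1), (P i).coeff j * iteratedDeriv j (fun y => f y i) x)
    + (∑ q : DerivIdx m n, (∑' k : Fin m → ℕ, (∏ l, f x l ^ k l) • b q k) i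
    * ∏ l, ∏ j : Fin n, iteratedDeriv ((j : ℕ) + 1) (fun y => f y l) x ^ q.1 l j) + rx i := by
  have hder := fun l j => Filter.EventuallyEq.iteratedDeriv_eq j (hf.mono fun y hy => hy l)
  have hlin : RayExp w (fun p => symbol n (P i) p * U i p) (w * x).re ∧
    rayLap w (fun p => symbol n (P i) p * U i p) x =
    ∑ j ∈ Finset.range (n + 1), (P i).coeff j * iteratedDeriv j (fun y => f y i) x := by
    have h1 := rayLap_sum (Finset.range (n + 1)) (w := w) (v := (w * x).re)
      (F := fun j p => (P i).coeff j * ((-p) ^ j * U i p))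
      fun j _ => ((hU i).mul_pow hv j).const_mul _
    have e : (fun p => symbol n (P i) p * U i p) = fun p => ∑ j ∈ Finset.range (n + 1),
      (P i).coeff j * ((-p) ^ j * U i p) := by
      ext p
      rw [symbol, sum_mul]; exact sum_congr rfl fun j _ => by ring
    rw [e]
    refine ⟨h1.1, (h1.2 x le_rfl).trans (sum_congr rfl fun j _ => ?_)⟩
    rw [rayLap_const_mul, hder, iteratedDeriv_rayLap (hU i) j hv]
  have hmono : ∀ q k, RayExp w (convMon U (BT q k i) (factors q k)) (w * x).re ∧
    rayLap w (convMon U (BT q k i) (factors q k)) x = ((∏ l, f x l ^ k l) • b q k) i *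
    ∏ l, ∏ j : Fin n, iteratedDeriv (j + 1) (fun y => f y l) x ^ q.1 l j := fun q k => by
    have h1 := rayLap_convMon hv hU (hB q k i).1 (factors q k)
    refine ⟨h1.1, ?_⟩
    rw [h1.2 x le_rfl, prod_factors, (hB q k i).2, Pi.smul_apply, smul_eq_mul]
    simp only [iteratedDeriv_zero, hf.self_of_nhds, hder]; ring
  have hser : ∀ q, RayExp w (fun p => ∑' k : Fin m → ℕ,
    convMon U (BT q k i) (factors q k) p) (w * x).re ∧
    rayLap w (fun p => ∑' k : Fin m → ℕ, convMon U (BT q k i) (factors q k) p) x =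
    (∑' k : Fin m → ℕ, (∏ l, f x l ^ k l) • b q k) i *
    ∏ l, ∏ j : Fin n, iteratedDeriv (j + 1) (fun y => f y l) x ^ q.1 l j := fun q => by
    have h1 := rayLap_tsum ((summable_half_pow m)) (fun k => (hmono q k).1) hG
      fun k s hs => hterm q k i s hs
    refine ⟨h1.1, ?_⟩
    rw [← (h1.2 x le_rfl).tsum_eq]
    simp_rw [fun k => (hmono q k).2]
    rw [tsum_mul_right, tsum_apply (hsum q)]
  have hnl := rayLap_sum (Finset.univ : Finset (DerivIdx m n)) fun q _ => (hser q).1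
  have e : (fun p => -(symbol n (P i) p) * U i p + (nonlin U BT i p + RT i p)) =
    fun p => (-1) * (symbol n (P i) p * U i p) + ((∑ q, ∑' k : Fin m → ℕ,
    convMon U (BT q k i) (factors q k) p) + RT i p) := by
    ext p
    rw [nonlin]; ring
  rw [e, rayLap_add (hlin.1.const_mul (-1)) (hnl.1.add (hR i).1) le_rfl, rayLap_const_mul, hlin.2,
    rayLap_add hnl.1 (hR i).1 le_rfl, hnl.2 x le_rfl, (hR i).2, neg_one_mul, add_assoc]
  congr 2; exact sum_congr rfl fun q _ => (hser q).2

lemma summable_smul_of_small {Q G x : ℝ} (hQ : 0 ≤ Q) (hx0 : 0 ≤ x) (hx : Q * x ≤ 1 / 2)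
    {u : Fin m → ℂ} (hu : ∀ l, ‖u l‖ ≤ x) {b : (Fin m → ℕ) → Fin m → ℂ}
    (hb : ∀ k i, ‖b k i‖ ≤ Q ^ multiSize k * G) (hG : 0 ≤ G) :
    Summable fun k : Fin m → ℕ => (∏ l, u l ^ k l) • b k := by
  refine Summable.of_norm_bounded ((summable_half_pow m).mul_left G) fun k => ?_
  rw [norm_smul, norm_prod]
  have h1 : ∏ l, ‖u l ^ k l‖ ≤ x ^ multiSize k := by
    rw [multiSize, ← prod_pow_eq_pow_sum]
    refine prod_le_prod (fun _ _ => norm_nonneg _) fun l _ => ?_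
    rw [norm_pow]; exact pow_le_pow_left₀ (norm_nonneg _) (hu l) _
  have h2 := (pi_norm_le_iff_of_nonneg (by positivity)).2 fun i => hb k i
  calc _ ≤ x ^ multiSize k * (Q ^ multiSize k * G) :=
    mul_le_mul h1 h2 (norm_nonneg _) (by positivity)
    _ = (Q * x) ^ multiSize k * G := by rw [mul_pow]; ring
    _ ≤ (1 / 2) ^ multiSize k * G := by gcongr
    _ ≤ _ := by
        have : 0 ≤ G * (1 / 2) ^ multiSize k := by positivity
        linarith

end

section

variable {J : Type*} [Fintype J] {m n : ℕ} {X : Set ℂ} {s1 R h h' v T C Q o d : ℝ} {a b : J → ℝ}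
    {M : ℕ} {r : Fin m → ParamFun} {B : CoeffFam m n ParamFun}

/-- A family of solutions of the evolution system with data `r`, `B`, in the region
`|x| > R t^h` of the sector given by `s`, for times in `(0,T)`. -/
structure EvolutionFam (X : Set ℂ) (s R h T C : ℝ) (a b : J → ℝ) (P : Fin m → Polynomial ℂ)
    (r : Fin m → ParamFun)
    (B : CoeffFam m n ParamFun)
    (f : ℂ → VecFun m) : Prop where
  holo : ∀ y ∈ X, ∀ t ∈ Ioo 0 T,
    DifferentiableOn ℂ (fun x => f y x t) (cone s (R * t ^ h))
  holo_param : ∀ t ∈ Ioo 0 T, ∀ x ∈ cone s (R * t ^ h),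
    DifferentiableOn ℂ (fun y => f y x t) X
  bound : ∀ y ∈ X, ∀ t ∈ Ioo 0 T, ∀ x ∈ cone s (R * t ^ h), ∀ i,
    ‖f y x t i‖ ≤ C * ∑ j, t ^ a j * ‖x‖ ^ (-b j)
  summable : ∀ y ∈ X, ∀ t ∈ Ioo 0 T, ∀ x ∈ cone s (R * t ^ h), ∀ q : DerivIdx m n,
    Summable fun k : Fin m → ℕ => (∏ l, f y x t l ^ k l) • fun i => B q k i y x t
  equation : ∀ y ∈ X, ∀ t ∈ Ioo 0 T, ∀ x ∈ cone s (R * t ^ h),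
    HasDerivAt (fun u => f y x u) (evolutionRHS P (fun q k x t i => B q k i y x t)
      (fun x t i => r i y x t) (f y) x t) t

lemma WeightParams.sum_mul_rpow_le (W : WeightParams a b M h h' v T) {C : ℝ} (hC : 0 ≤ C) {e : ℝ}
    (he : 0 < e) : ∃ R0 : ℝ, 1 ≤ R0 ∧ ∀ R, R0 ≤ R → ∀ t ∈ Ioo 0 T, ∀ x, R * t ^ h < x →
    C * ∑ j, t ^ a j * x ^ (-b j) ≤ e * t ^ h' := by
  set S := ∑ j, T ^ (a j - b j * h - h')
  have hT := W.T_pos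
  refine ⟨1 + C * S / e, le_add_of_nonneg_right (by positivity), fun R hR t ht x hx => ?_⟩
  have ht0 := ht.1
  have hR1 := (le_add_of_nonneg_right (by positivity)).trans hR
  have hR0 : 0 < R := by linarith
  have h1 : ∀ j, t ^ a j * x ^ (-b j) ≤ R⁻¹ * T ^ (a j - b j * h - h') * t ^ h' := fun j => by
    have h2 : x ^ (-b j) ≤ (R * t ^ h) ^ (-b j) :=
      rpow_anti (by positivity) hx.le (by linarith [W.one_le_b j])
    have h3 : R ^ (-b j) ≤ R⁻¹ := by
      rw [← rpow_neg_one]; exact rpow_le_rpow_of_exponent_le hR1 (by linarith [W.one_le_b j])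
    have h4 : t ^ (a j - b j * h - h') ≤ T ^ (a j - b j * h - h') :=
      rpow_le_rpow ht0.le ht.2.le (by linarith [W.le_sub j])
    calc _ ≤ t ^ a j * (R * t ^ h) ^ (-b j) := by gcongr
      _ = R ^ (-b j) * t ^ (a j - b j * h - h') * t ^ h' := by
          rw [mul_rpow hR0.le (rpow_pos_of_pos ht0 h).le, ← rpow_mul ht0.le, mul_left_comm,
            ← rpow_add ht0, mul_assoc, ← rpow_add ht0]
          congr 2; ring
      _ ≤ _ := by gcongr
  have h5 : C * S / e ≤ R := by linarith
  rw [div_le_iff₀ he] at h5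
  calc _ ≤ C * ∑ j, R⁻¹ * T ^ (a j - b j * h - h') * t ^ h' := mul_le_l (sum_le_sum fun j _ => h1 j)
    _ = R⁻¹ * (C * S) * t ^ h' := by rw [← sum_mul, ← mul_sum]; ring
    _ ≤ R⁻¹ * (R * e) * t ^ h' := by gcongr
    _ = _ := by rw [inv_mul_cancel_left₀ hR0.ne']

lemma rayLap_invLap_family {c1 : ℝ} {g : ParamFun} (H' : Contour s1 R o)
    (hd : 0 ≤ d) (hh : 0 ≤ h) (hk : 0 < v) (hk1 : v ≤ 1) (hc1 : R < (1 - s1) / 2 * c1)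
    (hg : SectorFun X s1 R h T g) (hb : SectorDecay X s1 R h T v g) {y : ℂ} (hy : y ∈ X) {t : ℝ}
    (ht : t ∈ Ioo 0 T) {w x : ℂ} (hw : w ∈ dualCone o d) (hx : c1 * t ^ h * ‖w‖ < (w * x).re) :
    RayExp w (fun p => invLap o (c1 * T ^ h) (fun x => g y x t) p) (w * x).re ∧
    rayLap w (fun p => invLap o (c1 * T ^ h) (fun x => g y x t) p) x = g y x t := by
  have hth := rpow_pos_of_pos ht.1 h
  have hR := H'.pos
  obtain ⟨G, hG0, hG⟩ := hb t t ht.1 ht.2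
  have hG' := fun z hz => hG y hy t ⟨le_rfl, le_rfl⟩ z hz
  have h1 := rayLap_invLap (H'.of_radius (mul_pos hR hth)) hd
    (by rw [← mul_assoc]; exact mul_lt_mul_of_pos_right hc1 hth) hk hk1
    (hg.holo y hy t ht) hG' hw hx
  have h2 : ∀ s : ℝ, 0 < s → invLap o (c1 * T ^ h) (fun x => g y x t) (s * w) =
    invLap o (c1 * t ^ h) (fun x => g y x t) (s * w) := fun s hs =>
    invLap_eq_of_time H' hd hh hc1 ht (hg.holo y hy t ht)
    (fun z hz => (hG' z hz).trans (mul_le_l (rpow_anti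
    (mul_pos hR hth) hz.1.le (by linarith)))) (dualCone_smul hw hs)
  exact ⟨h1.1.congr h2, (rayLap_congr x h2).trans h1.2⟩

lemma exists_norm_symbol_le (n : ℕ) (P : Polynomial ℂ) :
    ∃ L, 0 ≤ L ∧ ∀ p, ‖symbol n P p‖ ≤ L * (1 + ‖p‖) ^ n := by
  refine ⟨∑ j ∈ Finset.range (n + 1), ‖P.coeff j‖, by positivity, fun p => ?_⟩
  rw [symbol, sum_mul]
  refine (norm_sum_le _ _).trans (sum_le_sum fun j hj => ?_)
  rw [norm_mul, norm_pow, norm_neg]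
  have hp := norm_nonneg p
  refine mul_le_l ?_
  exact (pow_le_pow_left₀ hp (by linarith) j).trans
    (pow_le_pow_right₀ (by linarith) (Nat.lt_succ_iff.1 (Finset.mem_range.1 hj)))

set_option maxHeartbeats 1600000 in
lemma SectorData.exists_solution (hn : 0 < n) (hX : IsOpen X) (H' : Contour s1 R o)
    (hd : 0 < d) (W : WeightParams a b M h h' v T)
    (H : SectorData X s1 R h h' v T C Q a b r B) (P : Fin m → Polynomial ℂ) {c C0 : ℝ} (hc : 0 < c)
    (hC0 : 0 ≤ C0) (hlb : ∀ l, ∀ p ∈ dualCone o d, c * ‖p‖ ^ n - C0 ≤ (symbol n (P l) p).re)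
    {s z : ℝ} (hz : 0 < z)
    (hvis : ∀ x ∈ cone s 0, ∃ w ∈ dualCone o d, ‖w‖ = 1 ∧ z * ‖x‖ ≤ (w * x).re) :
    ∃ R0 C' : ℝ, 0 < R0 ∧ 0 ≤ C' ∧ ∃ f : ℂ → VecFun m, EvolutionFam X s R0 h T C' a b P r B f := by
  have hk : 0 < (1 - s1) / 2 := by linarith [H'.lt_one]
  obtain ⟨c1, hc1⟩ : ∃ c1, R < (1 - s1) / 2 * c1 := by
    refine ⟨(R + 1) / ((1 - s1) / 2), ?_⟩
    rw [mul_div_cancel₀ _ hk.ne']; linarith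
  have hD : OpenCone (dualCone o d) := OpenCone.dualCone o d
  have hDc := convex_dualCone hd.le H'.cos_pos.le
  set D := dualCone o d
  have hh := W.h_pos
  have hh' := W.h'_pos
  have hC := H.C_nonneg
  have hQ := H.one_le_Q
  obtain ⟨C1, HT⟩ := H.transformedData H' hX hd W hc1
  obtain ⟨A, ν, Bd, hA, hν1, hcν, hBd, U, hUh, hNh, hUb, htermb, hHb, hUeq⟩ :=
    HT.exists_solution hn hX hD W (fun i => differentiable_symbol n (P i)) hc hC0 hlb
  set RT := fun i Y p t => invLap o (c1 * T ^ h) (fun x => r i Y x t) p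
  set BT := fun q k i Y p t => invLap o (c1 * T ^ h) (fun x => B q k i Y x t) p
  have hν0 : 0 < ν := by linarith
  set ν1 := ν + 1
  have hv0 : ∀ t s, 0 < t → 0 < s → 0 ≤ timeWeight a b M h ν t s := fun t s ht hs =>
    timeWeight_nonneg hν0.le ht.le hs.le
  have hexp : ∀ N t, 0 < t → ∃ G, 0 ≤ G ∧ ∀ s, 0 < s →
    (1 + s) ^ N * timeWeight a b M h ν t s ≤ G * exp (ν1 * t ^ h * s) := fun N t ht =>
    exists_one_add_pow_mul_timeWeight_le ht hν0.le W.one_le_b W.b_le N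
  have hUexp : ∀ t ∈ Ioo 0 T, ∃ G, ∀ l, ∀ Y ∈ X, ∀ p ∈ D,
    ‖U l Y p t‖ ≤ G * exp (ν1 * t ^ h * ‖p‖) := fun t ht => by
    obtain ⟨G, hG0, hG⟩ := hexp 0 t ht.1
    refine ⟨A * G, fun l Y hY p hp => (hUb l Y hY p hp t ht).trans ?_⟩
    have := hG ‖p‖ (hD.norm_pos hp)
    rw [pow_zero, one_mul] at this; rw [mul_assoc]
    exact mul_le_l this
  set f := fun Y x t i => sectorLaplace D (ν1 * t ^ h) (fun p => U i Y p t) x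
  have hct : ∀ t, 0 < t → 0 ≤ ν1 * t ^ h := fun t ht => by positivity
  have hfeq : ∀ Y ∈ X, ∀ t ∈ Ioo 0 T, ∀ x, ∀ w ∈ D, ν1 * t ^ h * ‖w‖ < (w * x).re → ∀ i,
    f Y x t i = rayLap w (fun p => U i Y p t) x := fun Y hY t ht x w hw hx i => by
    obtain ⟨G, hG⟩ := hUexp t ht
    exact sectorLaplace_eq hD hDc ((hUh i).holo Y hY t ht) (hct t ht.1) (hG i Y hY) hw hx
  have hmeas : ∀ {F : ℂ → ℂ}, ContinuousOn F D → ∀ w ∈ D,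
    AEStronglyMeasurable (fun s : ℝ => F (s * w)) (volume.restrict (Ioi 0)) := fun hF w hw =>
    ContinuousOn.aestronglyMeasurable (hF.comp (by fun_prop) fun s hs => hD.smul_mem w hw s hs)
    measurableSet_Ioi
  set C' := A * ∑ j, Real.Gamma (b j) * (z / 2) ^ (-b j) with hC'
  have hv : ∀ j, 0 ≤ Real.Gamma (b j) * (z / 2) ^ (-b j) := fun j =>
    mul_nonneg (Real.Gamma_pos_of_pos (by linarith [W.one_le_b j])).le (by positivity)
  have hC'0 : 0 ≤ C' := mul_nonneg hA (sum_nonneg fun j _ => hv j)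
  obtain ⟨R1, hR11, hR1⟩ := W.sum_mul_rpow_le (C := Q * C') (by positivity)
    (e := 1 / 2) (by norm_num)
  set R0 := max (max R1 R) (2 * ν1 / z)
  have hR01 : R1 ≤ R0 := (le_max_left _ _).trans (le_max_left _ _)
  have hR00 : 0 < R0 := by linarith
  have hR0z : 2 * ν1 ≤ z * R0 := by
    have : 2 * ν1 / z ≤ R0 := le_max_right _ _
    rw [div_le_iff₀ hz] at this; linarith
  have hadm : ∀ t ∈ Ioo 0 T, ∀ x ∈ cone s (R0 * t ^ h), ∃ w ∈ D, ‖w‖ = 1 ∧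
    ν1 * t ^ h * ‖w‖ < (w * x).re ∧ ν * t ^ h + z / 2 * ‖x‖ ≤ (w * x).re := fun t ht x hx => by
    have hth := rpow_pos_of_pos ht.1 h
    obtain ⟨w, hw, hw1, hwx⟩ := hvis x ⟨lt_of_le_of_lt (by positivity) hx.1, hx.2⟩
    have h2 : 2 * ν1 * t ^ h < z * ‖x‖ := by
      calc 2 * ν1 * t ^ h ≤ z * R0 * t ^ h := mul_le_r hR0z
        _ < z * ‖x‖ := by rw [mul_assoc]; exact mul_lt_mul_of_pos_left hx.1 hz
    have h4 : 0 < ν1 * t ^ h := by positivity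
    refine ⟨w, hw, hw1, ?_, ?_⟩
    · rw [hw1]; linarith
    · linarith
  have hbound : ∀ Y ∈ X, ∀ t ∈ Ioo 0 T, ∀ x ∈ cone s (R0 * t ^ h), ∀ i,
    ‖f Y x t i‖ ≤ C' * ∑ j, t ^ a j * ‖x‖ ^ (-b j) := fun Y hY t ht x hx i => by
    have ht0 := ht.1
    obtain ⟨w, hw, hw1, hwx, hwx'⟩ := hadm t ht x hx
    have hx0 := lt_of_le_of_lt (by positivity) hx.1
    rw [hfeq Y hY t ht x w hw hwx i]
    refine (norm_rayLap_le (A := fun j => A * t ^ a j) (b := b) hw1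
      (by positivity : 0 < z / 2 * ‖x‖) (fun j => by linarith [W.one_le_b j]) ?_
      (fun j => by positivity) hwx').trans ?_
    · intro s hs
      have hsw : ‖s * w‖ = s := by rw [norm_mul, hw1, mul_one, norm_coe]
      refine (hUb i Y hY _ (hD.smul_mem w hw s hs) t ht).trans ?_
      rw [hsw, timeWeight, sumWeight, ← mul_assoc, mul_sum]
      have h5 := expWeight_le_exp M (y := ν * t ^ h * s) (by positivity)
      have h6 : ∑ j, A * (t ^ a j * s ^ (b j - 1)) = ∑ j, A * t ^ a j * s ^ (b j - 1) :=
        sum_congr rfl fun j _ => by ring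
      rw [h6]; exact mul_le_l h5 (sum_nonneg fun j _ => by positivity)
    · rw [hC', mul_assoc, mul_sum, mul_sum]
      refine sum_le_sum fun j _ => ?_
      have h7 := single_le_sum (fun j _ => hv j) (Finset.mem_univ j)
      rw [mul_rpow (by positivity) (by positivity)]
      calc _ = A * ((Real.Gamma (b j) * (z / 2) ^ (-b j)) * (t ^ a j * ‖x‖ ^ (-b j))) := by ring
        _ ≤ _ := mul_le_l (mul_le_r h7)
  have hsummable : ∀ Y ∈ X, ∀ t ∈ Ioo 0 T, ∀ x ∈ cone s (R0 * t ^ h), ∀ w ∈ D,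
    ν1 * t ^ h * ‖w‖ < (w * x).re → ∀ q : DerivIdx m n,
    Summable fun k : Fin m → ℕ => (∏ l, f Y x t l ^ k l) • fun i => B q k i Y x t := fun Y hY t ht x
    hx w hw hwx q => by
    have ht0 := ht.1
    have hxs : x ∈ cone s1 (R * t ^ h) := by
      refine halfPlane_subset_cone hd.le H'.cos_pos.le H'.sin_pos
        H'.sin_lt.le (mul_nonneg H'.pos.le (rpow_pos_of_pos ht0 h).le) ?_ hw hwx
      refine mul_le_r ?_
      have : (1 - s1) / 2 * c1 ≤ 1 * c1 := by
        refine mul_le_r ?_ HT.c₁_nonneg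
        linarith [H'.sin_pos, H'.sin_lt]
      linarith
    have hx0 := lt_of_le_of_lt (by positivity) hx.1
    have hxC := hR1 R0 hR01 t ht ‖x‖ hx.1
    refine summable_smul_of_small (Q := Q * t ^ (-h'))
      (x := C' * ∑ j, t ^ a j * ‖x‖ ^ (-b j)) (G := C * t ^ coeffExp h h' v q (0 : Fin m → ℕ) *
      ‖x‖ ^ (-v)) (by positivity) (by positivity) ?_ (hbound Y hY t ht x hx) (fun k i => ?_)
      (by positivity)
    · rw [rpow_neg ht0.le]
      calc Q * (t ^ h')⁻¹ * (C' * ∑ j, t ^ a j * ‖x‖ ^ (-b j))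
        = (t ^ h')⁻¹ * (Q * C' * ∑ j, t ^ a j * ‖x‖ ^ (-b j)) := by ring
        _ ≤ (t ^ h')⁻¹ * (1 / 2 * t ^ h') := by gcongr
        _ = 1 / 2 := by field_simp
    · refine (H.B_bound q k i Y hY t ht x hxs).trans_eq ?_
      have e : t ^ coeffExp h h' v q k = (t ^ (-h')) ^ multiSize k *
        t ^ coeffExp h h' v q (0 : Fin m → ℕ) := by
        rw [← rpow_natCast, ← rpow_mul ht0.le, ← rpow_add ht0]; congr 1
        simp [coeffExp, multiSize]; ring
      rw [e, mul_pow]; ring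
  refine ⟨R0, C', hR00, hC'0, f, ?_, ?_, hbound, ?_, ?_⟩
  · intro Y hY t ht
    refine differentiableOn_pi.2 fun i x hx => DifferentiableAt.differentiableWithinAt ?_
    obtain ⟨w, hw, hw1, hwx, -⟩ := hadm t ht x hx
    obtain ⟨G, hG⟩ := hUexp t ht
    obtain ⟨c', hc', hc''⟩ := exists_between hwx
    refine ((hasDerivAt_rayLap (rayExp_of_exp_bound hD ((hUh i).holo Y hY t ht).continuousOn (hG i Y
      hY) hw hc') hc'').differentiableAt).congr_of_eventuallyEq ?_
    have : ∀ᶠ y in 𝓝 x, ν1 * t ^ h * ‖w‖ < (w * y).re :=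
      (by fun_prop : Continuous fun y => (w * y).re).continuousAt.eventually (lt_mem_nhds hwx)
    exact this.mono fun y hy => hfeq Y hY t ht y w hw hy i
  · intro t ht x hx
    refine differentiableOn_pi.2 fun i => ?_
    obtain ⟨w, hw, hw1, hwx, -⟩ := hadm t ht x hx
    obtain ⟨G, hG⟩ := hUexp t ht
    refine DifferentiableOn.congr ?_ fun Y hY => hfeq Y hY t ht x w hw hwx i
    refine DifferentiableOn.const_mul (holomorphic_integral hX
      (fun Y hY => (hmeas ((hUh i).holo Y hY t ht).continuousOn w hw).mul (by fun_prop)) ?_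
      fun Y0 hY0 => ?_) w
    · filter_upwards [ae_Ioi] with S hS
      exact ((hUh i).holo_param _ (hD.smul_mem w hw S hS) t ht).mul_const _
    · refine ⟨univ, univ_mem, fun S => G * exp (-(((w * x).re - ν1 * t ^ h) * S)), ?_, ?_⟩
      · refine Integrable.const_mul ?_ _
        rw [← IntegrableOn]; rw [hw1, mul_one] at hwx
        simpa using integrableOn_rpow_exp one_pos (sub_pos.2 hwx)
      · filter_upwards [ae_Ioi] with S hS Y _ hY
        have hS0 : 0 < S := hS
        rw [Pi.mul_apply, norm_mul, norm_exp, neg_re, mul_assoc, re_ofReal_mul]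
        refine (mul_le_r (hG i Y hY _ (hD.smul_mem w hw S hS0))).trans_eq ?_
        rw [norm_mul, hw1, norm_coe, mul_assoc, ← exp_add]; congr 2; ring
  · intro Y hY t ht x hx q
    obtain ⟨w, hw, hw1, hwx, -⟩ := hadm t ht x hx
    exact hsummable Y hY t ht x hx w hw hwx q
  · intro Y hY t ht x hx
    obtain ⟨w, hw, hw1, hwx, -⟩ := hadm t ht x hx
    have ht0 := ht.1
    have hwx' := hwx
    rw [hw1, mul_one] at hwx
    have hev : ∀ᶠ g in 𝓝 t, ν1 * g ^ h < (w * x).re :=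
      (continuousAt_const.mul (continuousAt_rpow_const t h (Or.inl ht0.ne'))).eventually
      (gt_mem_nhds hwx)
    obtain ⟨t2, hw2, htt2, ht2T⟩ : ∃ t2, ν1 * t2 ^ h < (w * x).re ∧ t2 ∈ Ioo t T :=
      ((hev.filter_mono nhdsWithin_le_nhds).and (Ioo_mem_nhdsGT ht.2)).exists
    obtain ⟨t1, h01, htt1⟩ := exists_between ht0
    have hIT : ∀ g ∈ Ioo t1 t2, g ∈ Ioo 0 T := fun g hg => ⟨h01.trans hg.1, hg.2.trans ht2T⟩
    have ht20 : 0 < t2 := ht0.trans htt2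
    obtain ⟨K, hK0, hK⟩ := timeWeight_le_mul (b := b) M hh.le W.le_a
    have hnorm : ∀ S : ℝ, 0 < S → ‖(S : ℂ) * w‖ = S := fun S hS => by
      rw [norm_mul, hw1, mul_one, norm_coe hS.le]
    have hHh : ∀ i, HoloFam X D T v (fun Y p t => nonlinFam U BT i Y p t + RT i Y p t) :=
      fun i => (hNh i).add (HT.R_holo i)
    have hUd : ∀ i, ∀ p ∈ D, ∀ g ∈ Ioo 0 T, HasDerivAt (U i Y p)
      (-(symbol n (P i) p) * U i Y p g + (nonlinFam U BT i Y p g + RT i Y p g)) g := fun i p hp g hg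
      => by
      have hpn := hD.norm_pos hp
      have hint := (hHh i).intervalIntegrable hY hp (m := h')
        (L := Bd * (1 + ‖p‖ ^ n * T) * K * (g⁻¹) ^ h' * timeWeight a b M h ν g ‖p‖) hh' hg
        fun u hu => by
          have hu0 : 0 < u := hu.1
          have huT : u ≤ T := hu.2.trans hg.2.le
          refine (hHb i Y hY p hp u ⟨hu0, hu.2.trans_lt hg.2⟩).trans ?_
          have h1 := hK ν u g ‖p‖ hν0.le hu0 hu.2 hpn.le
          have hg0 := hg.1
          have hvu := hv0 u ‖p‖ hu0 hpn
          have hT0 := W.T_pos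
          calc _ ≤ Bd * (u⁻¹ * (1 + ‖p‖ ^ n * T)) *
            (K * (u / g) ^ h' * timeWeight a b M h ν g ‖p‖) := by gcongr
            _ = _ := by
                rw [div_eq_mul_inv, mul_rpow hu0.le (by positivity), rpow_sub_one hu0.ne',
                  div_eq_mul_inv]
                ring
      have h1 := (hHh i).hasDerivAt_duhamel (lam := symbol n (P i)) hY hp hg hint
      rw [← hUeq i Y hY p hp g hg] at h1
      refine h1.congr_of_eventuallyEq ?_
      filter_upwards [Ioo_mem_nhds hg.1 hg.2] with u hu using hUeq i Y hY p hp u hu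
    have hUE : ∀ l, RayExp w (fun p => U l Y p t) (w * x).re := fun l => by
      obtain ⟨G, hG⟩ := hUexp t ht
      exact rayExp_of_exp_bound hD ((hUh l).holo Y hY t ht).continuousOn (hG l Y hY) hw hwx'
    obtain ⟨ν', hν', hν''⟩ := exists_between hwx
    have hUE' : ∀ l, RayExp w (fun p => U l Y p t) ν' := fun l => by
      obtain ⟨G, hG⟩ := hUexp t ht
      exact rayExp_of_exp_bound hD ((hUh l).holo Y hY t ht).continuousOn (hG l Y hY) hw
        (by rwa [hw1, mul_one])
    refine hasDerivAt_pi.2 fun i => ?_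
    obtain ⟨Z, hZ0, hZ⟩ := exists_norm_symbol_le n (P i)
    obtain ⟨G2, hG20, hG2⟩ := hexp n t2 ht20
    have hpow1 : ∀ S : ℝ, 0 < S → 1 ≤ (1 + S) ^ n ∧ S ^ n ≤ (1 + S) ^ n := fun S hS =>
      ⟨one_le_pow₀ (by linarith), pow_le_pow_left₀ hS.le (by linarith) n⟩
    have hT0 := W.T_pos
    have hder := hasDerivAt_rayLap_time (F := fun p g => U i Y p g)
      (F' := fun p g => -(symbol n (P i) p) * U i Y p g + (nonlinFam U BT i Y p g + RT i Y p g))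
      (C := (Z * A + Bd * (t1⁻¹ * (1 + T))) * K * G2) (c := ν1 * t2 ^ h) (Ioo_mem_nhds htt1 htt2)
      le_rfl hw2 (fun g hg => hmeas ((hUh i).holo Y hY g (hIT g hg)).continuousOn w hw)
      (hmeas (F := fun p => -(symbol n (P i) p) * U i Y p t + (nonlinFam U BT i Y p t + RT i Y p t))
      (((differentiable_symbol n (P i)).continuous.neg.continuousOn.mul
      ((hUh i).holo Y hY t ht).continuousOn).add ((hHh i).holo Y hY t ht).continuousOn) w hw)
      (hUE i) (fun S hS g hg => hUd i _ (hD.smul_mem w hw S hS) g (hIT g hg)) (fun S hS g hg => by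
        have hp := hD.smul_mem w hw S hS
        have hg' := hIT g hg
        have hg0 := hg'.1
        have h1 := hUb i Y hY _ hp g hg'
        have h2 := hHb i Y hY _ hp g hg'
        have h3 := hZ (S * w)
        rw [hnorm S hS] at h1 h2 h3
        have h4 := hK ν g t2 S hν0.le hg0 hg.2.le hS.le
        have h5 : (g / t2) ^ h' ≤ 1 := rpow_le_one (by positivity)
          ((div_le_one ht20).2 hg.2.le) hh'.le
        have hv2 := hv0 t2 S ht20 hS
        have hvg := hv0 g S hg0 hS
        have h6 : timeWeight a b M h ν g S ≤ K * timeWeight a b M h ν t2 S := by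
          refine h4.trans (mul_le_r ?_ hv2)
          exact mul_le_of_le_one_right hK0.le h5
        have h7 : g⁻¹ * (1 + S ^ n * g) ≤ t1⁻¹ * (1 + T) * (1 + S) ^ n := by
          have h8 : g⁻¹ ≤ t1⁻¹ := inv_anti₀ h01 hg.1.le
          have h9 : 1 + S ^ n * g ≤ (1 + T) * (1 + S) ^ n := by
            have := mul_le_mul (hpow1 S hS).2 hg'.2.le hg0.le (by positivity)
            nlinarith [(hpow1 S hS).1]
          calc _ ≤ t1⁻¹ * ((1 + T) * (1 + S) ^ n) := by gcongr
            _ = _ := by ring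
        calc _ ≤ ‖-(symbol n (P i) (S * w)) * U i Y (S * w) g‖ +
          ‖nonlinFam U BT i Y (S * w) g + RT i Y (S * w) g‖ := norm_add_le _ _
          _ ≤ (Z * (1 + S) ^ n) * (A * timeWeight a b M h ν g S) +
            Bd * (t1⁻¹ * (1 + T) * (1 + S) ^ n) * timeWeight a b M h ν g S := by
              rw [norm_mul, norm_neg]
              refine add_le_add (mul_le_mul h3 h1 (norm_nonneg _) (by positivity)) (h2.trans ?_)
              gcongr
          _ = (Z * A + Bd * (t1⁻¹ * (1 + T))) * ((1 + S) ^ n * timeWeight a b M h ν g S) := by ring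
          _ ≤ (Z * A + Bd * (t1⁻¹ * (1 + T))) *
            ((1 + S) ^ n * (K * timeWeight a b M h ν t2 S)) := by gcongr
          _ = (Z * A + Bd * (t1⁻¹ * (1 + T))) * K *
            ((1 + S) ^ n * timeWeight a b M h ν t2 S) := by ring
          _ ≤ (Z * A + Bd * (t1⁻¹ * (1 + T))) * K * (G2 * exp (ν1 * t2 ^ h * S)) := by
              have := hG2 S hS
              gcongr
          _ = _ := by ring)
    have hfev : ∀ᶠ g in 𝓝 t, f Y x g i = rayLap w (fun p => U i Y p g) x := by
      filter_upwards [hev, Ioo_mem_nhds ht.1 ht.2] with g hg hg'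
      exact hfeq Y hY g hg' x w hw (by rwa [hw1, mul_one]) i
    refine (hder.congr_of_eventuallyEq hfev).congr_deriv ?_
    have hfx : ∀ᶠ y in 𝓝 x, ∀ l, f Y y t l = rayLap w (fun p => U l Y p t) y := by
      have : ∀ᶠ y in 𝓝 x, ν1 * t ^ h * ‖w‖ < (w * y).re :=
        (by fun_prop : Continuous fun y => (w * y).re).continuousAt.eventually (lt_mem_nhds hwx')
      exact this.mono fun y hy l => hfeq Y hY t ht y w hw hy l
    have hcx : c1 * t ^ h * ‖w‖ < (w * x).re := by
      refine lt_of_le_of_lt ?_ hwx'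
      gcongr
      linarith
    obtain ⟨G3, hG30, hG3⟩ := hexp n t ht0
    exact rayLap_evolution P hν'' hUE' hfx
      (fun q k i => rayLap_invLap_family H' hd.le hh.le W.κ_pos W.κ_le hc1 (H.B_fun q k i)
      (H.decay_B q k i) hY ht hw hcx)
      (fun i => rayLap_invLap_family H' hd.le hh.le W.κ_pos W.κ_le hc1 (H.r_fun i)
      (H.decay_r W H'.pos i) hY ht hw hcx)
      (G := fun S => Bd * (t⁻¹ * (1 + T)) * G3 * exp (ν1 * t ^ h * S)) (by
        refine IntegrableOn.congr_fun ((integrableOn_rpow_exp one_pos (sub_pos.2 hwx)).const_mul (Bd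
          * (t⁻¹ * (1 + T)) * G3)) (fun S _ => ?_) measurableSet_Ioi
        rw [sub_self, rpow_zero, one_mul, mul_assoc (Bd * (t⁻¹ * (1 + T)) * G3), ← exp_add]
        congr 2; ring) (fun q k i S hS => by
        have h1 := htermb q k i Y hY _ (hD.smul_mem w hw S hS) t ht
        rw [hnorm S hS] at h1
        have h2 := hG3 S hS
        have hvt := hv0 t S ht0 hS
        have h9 : 1 + S ^ n * t ≤ (1 + T) * (1 + S) ^ n := by
          have := mul_le_mul (hpow1 S hS).2 ht.2.le ht0.le (by positivity)
          nlinarith [(hpow1 S hS).1]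
        refine h1.trans ?_
        calc _ ≤ Bd * (t⁻¹ * ((1 + T) * (1 + S) ^ n)) * timeWeight a b M h ν t S *
          (2 * (1 / 2) ^ multiSize k) := by gcongr
          _ = 2 * (1 / 2) ^ multiSize k * (Bd * (t⁻¹ * (1 + T)) *
            ((1 + S) ^ n * timeWeight a b M h ν t S)) := by ring
          _ ≤ 2 * (1 / 2) ^ multiSize k * (Bd * (t⁻¹ * (1 + T)) *
            (G3 * exp (ν1 * t ^ h * S))) := by gcongr
          _ = _ := by ring) (fun q => hsummable Y hY t ht x hx w hw hwx' q) i

end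

section

variable {s R o c G t T : ℝ} {g : TimeFun} {p : ℂ}

lemma invLap_eq_of_rayLap {e k C v : ℝ} (H : Contour s R o) (he : 0 ≤ e)
    (hc : R < (1 - s) / 2 * c) (hk : 0 < k) (hk1 : k ≤ 1) {g F : ℂ → ℂ}
    (hg : DifferentiableOn ℂ g (cone s R)) (hb : ∀ z ∈ cone s R, ‖g z‖ ≤ C * ‖z‖ ^ (-k))
    (hF : DifferentiableOn ℂ F (dualCone o e)) (h1 : (1 : ℂ) ∈ dualCone o e) (hFe : RayExp 1 F v)
    (hL : ∀ x : ℂ, v ≤ x.re → rayLap 1 F x = g x) : ∀ p ∈ dualCone o e, invLap o c g p = F p := by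
  have hinv : ∀ x : ℂ, c < x.re → RayExp 1 (invLap o c g) x.re ∧
    rayLap 1 (invLap o c g) x = g x := fun x hx => by
    simpa using rayLap_invLap H he hc hk hk1 hg hb h1 (by simpa using hx)
  have hd := differentiableOn_invLap H he hc hg.continuousOn (fun z hz => (hb z hz).trans
    (mul_le_mul (le_abs_self C) (rpow_anti H.pos hz.1.le (by linarith)) (by positivity) (abs_nonneg
    C)))
  set v2 := max v c + 1
  have hv2v : v ≤ v2 := by linarith [le_max_left v c]
  have hv2c : c < v2 := by linarith [le_max_right v c]
  have hreal : ∀ r : ℝ, 0 < r → invLap o c g r = F r := fun r hr => by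
    have hE : RayExp 1 (invLap o c g) v2 := by simpa using (hinv v2 (by simpa using hv2c)).1
    have hE' := (hFe.mono hv2v).const_mul (-1)
    have hmem : ∀ r ∈ Ioi (0 : ℝ), (r : ℂ) ∈ dualCone o e := fun r hr => by
      simpa using dualCone_smul h1 hr
    have h0 := eq_zero_of_rayLap_eq_zero (((hd.continuousOn).comp (by fun_prop) hmem).add
      (continuousOn_const.mul (hF.continuousOn.comp (by fun_prop) hmem))) (hE.add hE')
      (fun x hx => by
        rw [rayLap_add hE hE' (by simp [hx]), rayLap_const_mul, (hinv x (hx ▸ hv2c)).2,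
          hL x (hx ▸ hv2v)]
        ring) hr
    beta_reduce at h0
    linear_combination h0
  have hD := isOpen_dualCone o e
  refine (hd.analyticOnNhd hD).eqOn_of_preconnected_of_frequently_eq (hF.analyticOnNhd hD)
    (isPreconnected_dualCone he H.cos_pos.le) h1 ?_
  have ht : Tendsto (fun r : ℝ => (r : ℂ)) (𝓝[≠] 1) (𝓝[≠] 1) := by
    refine tendsto_nhdsWithin_iff.2 ⟨?_, ?_⟩
    · simpa using (continuous_ofReal.tendsto 1).mono_left nhdsWithin_le_nhds
    · filter_upwards [self_mem_nhdsWithin] with r hr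
      simpa using hr
  refine ht.frequently (Eventually.frequently ?_)
  filter_upwards [nhdsWithin_le_nhds (lt_mem_nhds one_pos)] with r hr using hreal r hr

lemma hasDerivAt_invLap_time {D : ℝ} (H : Contour s R o) (hD : 0 ≤ D)
    (hc : R < (1 - s) / 2 * c) {g' : TimeFun} {I : Set ℝ} (hI : I ∈ 𝓝 t)
    (hgc : ∀ u ∈ I, ContinuousOn (fun z => g z u) (cone s R))
    (hgc' : ContinuousOn (fun z => g' z t) (cone s R)) (hgb : ∀ z ∈ cone s R, ‖g z t‖ ≤ G)
    (hd : ∀ z ∈ cone s R, ∀ u ∈ I, HasDerivAt (g z) (g' z u) u)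
    (hb : ∀ z ∈ cone s R, ∀ u ∈ I, ‖g' z u‖ ≤ G) (hp : p ∈ dualCone o D) :
    HasDerivAt (fun u => invLap o c (fun z => g z u) p) (invLap o c (fun z => g' z t) p) t := by
  have key : ∀ w : ℂ, (w * p).re < 0 → (∀ r : ℝ, 0 ≤ r → c + r * w ∈ cone s R) →
    HasDerivAt (fun u => armInt w c (fun z => g z u) p)
    (armInt w c (fun z => g' z t) p) t := fun w hw hmem => by
    have hm : ∀ {k : ℂ → ℂ}, ContinuousOn k (cone s R) →
      AEStronglyMeasurable (fun r : ℝ => k (c + r * w) * cexp ((c + r * w) * p))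
      (volume.restrict (Ioi 0)) := fun hk => ContinuousOn.aestronglyMeasurable
      ((hk.comp (by fun_prop) fun r hr => hmem r (le_of_lt hr)).mul (by fun_prop)) measurableSet_Ioi
    have hint : IntegrableOn (fun r => G * exp (c * p.re) * exp ((w * p).re * r))
      (Ioi 0) := (integrableOn_exp_mul_Ioi hw 0).const_mul _
    have hbd : ∀ {k : ℂ → ℂ}, (∀ z ∈ cone s R, ‖k z‖ ≤ G) → ∀ r : ℝ, 0 < r →
      ‖k (c + r * w) * cexp ((c + r * w) * p)‖ ≤
      G * exp (c * p.re) * exp ((w * p).re * r) := fun hk r hr => by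
      rw [norm_mul, norm_exp_ray, mul_assoc G, mul_comm r]; exact mul_le_r (hk _ (hmem r hr.le))
    refine HasDerivAt.const_mul w ?_
    refine (hasDerivAt_integral_of_dominated_loc_of_deriv_le
      (F' := fun u (r : ℝ) => g' (c + r * w) u * cexp ((c + r * w) * p)) hI ?_ ?_
      (hm hgc') ?_ hint ?_).2
    · filter_upwards [hI] with u hu using hm (hgc u hu)
    · refine Integrable.mono' hint (hm (hgc t (mem_of_mem_nhds hI))) ?_
      filter_upwards [ae_Ioi] with r hr using hbd hgb r hr
    · filter_upwards [ae_Ioi] with r hr u hu using hbd (fun z hz => hb z hz u hu) r hr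
    · filter_upwards [ae_Ioi] with r hr u hu using (hd _ (hmem r (le_of_lt hr)) u hu).mul_const _
  have ha := dualCone_arm H.cos_pos.le hp
  have hn := mul_nonneg hD (norm_nonneg p)
  exact ((key _ (by linarith) fun r hr => (H.arm_mem hc hr).1).sub
    (key _ (by linarith) fun r hr => (H.arm_mem hc hr).2)).const_mul _

lemma tendsto_invLap_zero {d : ℝ} (hT : 0 < T) (H : Contour s R o)
    (hd : 0 ≤ d) (hc : R < (1 - s) / 2 * c)
    (hgc : ∀ u ∈ Ioo 0 T, ContinuousOn (fun z => g z u) (cone s R))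
    (hgb : ∀ z ∈ cone s R, ∀ u ∈ Ioo 0 T, ‖g z u‖ ≤ G)
    (hg0 : ∀ z ∈ cone s R, Tendsto (g z) (𝓝[>] 0) (𝓝 0)) (hp : p ∈ dualCone o d) :
    Tendsto (fun u => invLap o c (fun z => g z u) p) (𝓝[>] 0) (𝓝 0) := by
  have hev : ∀ᶠ u in 𝓝[>] 0, u ∈ Ioo 0 T := Ioo_mem_nhdsGT hT
  have key : ∀ w : ℂ, (w * p).re < 0 → (∀ r : ℝ, 0 ≤ r → c + r * w ∈ cone s R) →
    Tendsto (fun u => armInt w c (fun z => g z u) p) (𝓝[>] 0) (𝓝 0) := fun w hw hmem => by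
    have h1 := tendsto_integral_filter_of_dominated_convergence (μ := volume.restrict (Ioi 0))
      (F := fun u (r : ℝ) => g (c + r * w) u * cexp ((c + r * w) * p))
      (fun r => G * exp (c * p.re) * exp ((w * p).re * r))
      (hev.mono fun u hu => ContinuousOn.aestronglyMeasurable (((hgc u hu).comp (by fun_prop)
      fun r hr => hmem r (le_of_lt hr)).mul (by fun_prop)) measurableSet_Ioi)
      (hev.mono fun u hu => by
        filter_upwards [ae_Ioi] with r hr
        rw [norm_mul, norm_exp_ray, mul_assoc G, mul_comm r]
        exact mul_le_r (hgb _ (hmem r (le_of_lt hr)) u hu))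
          ((integrableOn_exp_mul_Ioi hw 0).const_mul _) (by
        filter_upwards [ae_Ioi] with r hr
        simpa using (hg0 _ (hmem r (le_of_lt hr))).mul_const (cexp ((c + r * w) * p)))
    simpa [armInt] using h1.const_mul w
  have ha := dualCone_arm H.cos_pos.le hp
  have hn := mul_nonneg hd (norm_nonneg p)
  simpa [invLap] using ((key _ (by linarith) fun r hr => (H.arm_mem hc hr).1).sub
    (key _ (by linarith) fun r hr => (H.arm_mem hc hr).2)).const_mul (2 * π * I)⁻¹

lemma norm_le_of_dissipative {y F : ℝ → ℂ} {lam : ℂ} {g a K : ℝ} (ht : t ∈ Ioo 0 T)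
    (hy : ∀ u ∈ Ioo 0 T, HasDerivAt y (-lam * y u + F u) u)
    (hy0 : Tendsto y (𝓝[>] 0) (𝓝 0)) (ha : a = lam.re + g)
    (hK : 0 ≤ K) (hF : ∀ u ∈ Ioo 0 T, ‖F u‖ ≤ K * a * exp (g * u)) : ‖y t‖ ≤ K * exp (g * t) := by
  set z : ℝ → ℂ := fun u => cexp (lam * u) * y u with hz
  have hne : ∀ u : ℝ, ‖cexp (lam * u)‖ = exp (lam.re * u) := fun u => by
    rw [norm_exp, re_mul_ofReal]
  have hzd : ∀ u ∈ Ioo 0 T, HasDerivAt z (cexp (lam * u) * F u) u := fun u hu => by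
    have h1 : HasDerivAt (fun u : ℝ => cexp (lam * u)) (cexp (lam * u) * lam) u := by
      have : HasDerivAt (fun u : ℝ => lam * (u : ℂ)) lam u := by
        simpa using (ofRealCLM.hasDerivAt).const_mul lam
      exact this.cexp
    refine (h1.mul (hy u hu)).congr_deriv ?_
    ring
  have hcmp : ∀ e ∈ Ioo 0 t, ‖z t‖ ≤ ‖z e‖ + K * exp (a * t) - K * exp (a * e) := fun e he => by
    have hsub : ∀ u ∈ Icc e t, u ∈ Ioo 0 T := fun u hu => ⟨he.1.trans_le hu.1, hu.2.trans_lt ht.2⟩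
    refine image_norm_le_of_norm_deriv_right_le_deriv_boundary (a := e) (b := t)
      (B := fun u => ‖z e‖ + K * exp (a * u) - K * exp (a * e))
      (B' := fun u => K * (exp (a * u) * a))
      (fun u hu => (hzd u (hsub u hu)).continuousAt.continuousWithinAt)
      (fun u hu => (hzd u (hsub u ⟨hu.1, hu.2.le⟩)).hasDerivWithinAt) (by simp) (fun u => ?_)
      (fun u hu => ?_) ⟨he.2.le, le_rfl⟩
    · have : HasDerivAt (fun u => a * u) a u := by simpa using (hasDerivAt_id u).const_mul a
      exact ((this.exp.const_mul K).const_add _).sub_const _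
    · rw [norm_mul, hne]
      refine (mul_le_l (hF u (hsub u ⟨hu.1, hu.2.le⟩))).trans_eq ?_
      have : exp (a * u) = exp (lam.re * u) * exp (g * u) := by rw [← exp_add, ha]; congr 1; ring
      rw [this]; ring
  have hlim : Tendsto (fun e => ‖z e‖ + K * exp (a * t) - K * exp (a * e)) (𝓝[>] 0)
    (𝓝 (0 + K * exp (a * t) - K * exp (a * 0))) := by
    refine (Tendsto.add_const _ ?_).sub ?_
    · have h1 : Tendsto (fun u : ℝ => cexp (lam * u)) (𝓝[>] 0) (𝓝 (cexp (lam * (0 : ℝ)))) :=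
        ((by fun_prop : Continuous fun u : ℝ => cexp (lam * u)).tendsto 0).mono_left
        nhdsWithin_le_nhds
      simpa [hz] using (h1.mul hy0).norm
    · exact ((by fun_prop : Continuous fun u => K * exp (a * u)).tendsto 0).mono_left
        nhdsWithin_le_nhds
  have h2 := ge_of_tendsto hlim (by filter_upwards [Ioo_mem_nhdsGT ht.1] with e he using hcmp e he)
  rw [zero_add, mul_zero, exp_zero, mul_one] at h2
  have h3 : ‖z t‖ = exp (lam.re * t) * ‖y t‖ := by rw [hz, norm_mul, hne]
  have h4 : exp (a * t) = exp (lam.re * t) * exp (g * t) := by rw [← exp_add, ha]; congr 1; ring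
  rw [h3, h4] at h2
  refine le_of_mul_le_mul_left ?_ (exp_pos (lam.re * t))
  linarith

end

section

variable {m n : ℕ} {s R T K C Q o d c1 : ℝ} {r : Fin m → TimeFun}
    {b : CoeffFam m n TimeFun} {P : Fin m → Polynomial ℂ}

variable {g : TimeFun} {t : ℝ}

/-- Bounds of the data in a region of `x` which does not depend on time. -/
structure CoarseData (s R T K C Q : ℝ) (r : Fin m → TimeFun)
    (b : CoeffFam m n TimeFun) : Prop where
  C_nonneg : 0 ≤ C
  one_le_Q : 1 ≤ Q
  r_fun : ∀ i, SectorFun univ s R 0 T (fun _ => r i)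
  r_decay : ∀ i, SectorDecay univ s R 0 T 1 (fun _ => r i)
  b_fun : ∀ q k i, SectorFun univ s R 0 T (fun _ => b q k i)
  b_bound : ∀ q k i, ∀ t ∈ Ioo 0 T, ∀ x ∈ cone s R,
    ‖b q k i x t‖ ≤ C * Q ^ multiSize k * ‖x‖ ^ (-K)
  b_zero : ∀ q k i, multiSize k + q.size = 0 → ∀ t ∈ Ioo 0 T, ∀ x ∈ cone s R,
    b q k i x t = 0

/-- A solution of the system in a region of `x` which does not depend on time. -/
structure CoarseSol (P : Fin m → Polynomial ℂ) (s R T C : ℝ) (r : Fin m → TimeFun)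
    (b : CoeffFam m n TimeFun) (f : VecFun m) : Prop where
  C_nonneg : 0 ≤ C
  fn : ∀ i, SectorFun univ s R 0 T (fun _ x t => f x t i)
  bound : ∀ t ∈ Ioo 0 T, ∀ x ∈ cone s R, ∀ i, ‖f x t i‖ ≤ C * ‖x‖ ^ (-1 : ℝ)
  summable : ∀ t ∈ Ioo 0 T, ∀ x ∈ cone s R, ∀ q : DerivIdx m n,
    Summable fun k : Fin m → ℕ => (∏ l, f x t l ^ k l) • fun i => b q k i x t
  equation : ∀ t ∈ Ioo 0 T, ∀ x ∈ cone s R, HasDerivAt (fun u => f x u)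
    (evolutionRHS P (fun q k x t i => b q k i x t) (fun x t i => r i x t) f x t) t
  initial : ∀ x ∈ cone s R, ∀ i, Tendsto (fun t => f x t i) (𝓝[>] 0) (𝓝 0)

/-- The inverse Laplace transforms of a function of `x` and `t`. -/
def timeLap (o c : ℝ) (g : TimeFun) (p : ℂ) (t : ℝ) : ℂ :=
  invLap o c (fun x => g x t) p

lemma SectorDecay.of_exponent_le {X : Set ℂ} {g : ParamFun} {k' : ℝ} (hR : 0 < R)
    (h : SectorDecay X s R 0 T k' g) (hk : K ≤ k') : SectorDecay X s R 0 T K g := fun t1 t2 h1 h2 =>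
    by
  obtain ⟨G, hG0, hG⟩ := h t1 t2 h1 h2
  refine ⟨G * R ^ (K - k'), by positivity, fun y hy t ht x hx => (hG y hy t ht x hx).trans ?_⟩
  have hx' : R < ‖x‖ := by simpa using hx.1
  have e : ‖x‖ ^ (-k') = ‖x‖ ^ (K - k') * ‖x‖ ^ (-K) := by
    rw [← rpow_add (hR.trans hx')]; congr 1; ring
  rw [e, ← mul_assoc]
  have := rpow_anti hR hx'.le (by linarith : K - k' ≤ 0)
  gcongr

lemma holoFam_timeLap (H : Contour s R o) (hd : 0 < d) (hk : 0 ≤ K)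
    (hc1 : R < (1 - s) / 2 * c1) (hg : SectorFun univ s R 0 T (fun _ => g))
    (hb : SectorDecay univ s R 0 T K (fun _ => g)) :
    HoloFam univ (dualCone o d) T K (fun _ p t => timeLap o c1 g p t) := by
  simpa [timeLap] using hg.invLap H isOpen_univ hd le_rfl hk hc1 hb

lemma rayLap_timeLap (H : Contour s R o) (hd : 0 ≤ d) (hk : 0 < K) (hk1 : K ≤ 1)
    (hc1 : R < (1 - s) / 2 * c1) (hg : SectorFun univ s R 0 T (fun _ => g))
    (hb : SectorDecay univ s R 0 T K (fun _ => g)) (ht : t ∈ Ioo 0 T) {w x : ℂ}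
    (hw : w ∈ dualCone o d) (hx : c1 * ‖w‖ < (w * x).re) :
    RayExp w (fun p => timeLap o c1 g p t) (w * x).re ∧
    rayLap w (fun p => timeLap o c1 g p t) x = g x t := by
  simpa [timeLap] using rayLap_invLap_family H hd le_rfl hk hk1 hc1 hg hb
    (mem_univ 0) ht hw (by simpa using hx)

lemma norm_timeLap_le (H : Contour s R o) (hd : 0 < d) (hk : 0 ≤ K)
    (hc1 : R < (1 - s) / 2 * c1) {G : ℝ} (hG : 0 ≤ G)
    (hg : DifferentiableOn ℂ (fun x => g x t) (cone s R))
    (hb : ∀ x ∈ cone s R, ‖g x t‖ ≤ G * ‖x‖ ^ (-K)) {p : ℂ} (hp : p ∈ dualCone o d) :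
    ‖timeLap o c1 g p t‖ ≤ exp 1 / d * ((1 - s) / 2) ^ (-K) * G *
    (‖p‖ ^ (K - 1) * exp (c1 * ‖p‖)) := by
  have := norm_invLap_le_rpow (J := Unit) H hd hc1 hg
    (fun _ => hG) (fun _ => hk) (by simpa using hb) hp
  rw [Fintype.sum_unique] at this
  refine this.trans_eq ?_
  ring

/-- The weight of the comparison of two solutions. -/
def expWeight2 (v : ℝ) : ℝ → ℝ :=
  sumWeight (fun _ : Unit => (1 : ℝ)) (fun _ => 1) 2 v

lemma expWeight2_eq (v r : ℝ) : expWeight2 v r = expWeight 2 (v * r) := by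
  simp [expWeight2, sumWeight]

lemma CoarseData.exists_coeffBounds (hn : 0 < n) (H : Contour s R o) (hd : 0 < d)
    (hK : 0 < K) (hc1 : R < (1 - s) / 2 * c1) (Hd : CoarseData s R T K C Q r b) {A S : ℝ}
    (hA : 0 ≤ A) {e : ℝ} (he : 0 < e) :
    ∃ N k1 k2 E : ℝ, ∃ cf : DerivIdx m n → (Fin m → ℕ) → ℝ, 1 ≤ N ∧ 2 * c1 ≤ N ∧ 0 ≤ E ∧
    E * S ≤ e ∧ ConvWeights (expWeight2 N) (fun r => r ^ (K - 1) * exp (c1 * r)) k1 k2 ∧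
    ∀ t ∈ Ioo 0 T, CoeffBounds (dualCone o d) (fun r => r ^ (K - 1) * exp (c1 * r)) k1 k2 A E
    cf (fun r => 1 + r ^ n) (fun q k i p => timeLap o c1 (b q k i) p t) := by
  obtain ⟨K1, hK1, h1⟩ := convBound_sumWeight_rpow (b := fun _ : Unit => (1 : ℝ)) (M := 2)
    (fun _ => le_rfl) hK
  obtain ⟨K2, hK2, h2⟩ := convBound_sumWeight (b := fun _ : Unit => (1 : ℝ)) (M := 2)
    (fun _ => le_rfl) (fun _ => by norm_num)
  have hC := Hd.C_nonneg
  have hQ := Hd.one_le_Q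
  have hk : 0 < (1 - s) / 2 := by linarith [H.lt_one]
  set Cb := exp 1 / d * ((1 - s) / 2) ^ (-K) * C with hCb
  obtain ⟨N, hNS, hN1, hNc, hNA⟩ : ∃ N, Cb * Q * K1 * N ^ (-K) * S ≤ e ∧ 1 ≤ N ∧ 2 * c1 ≤ N ∧
    4 * (Q * A * K2) ≤ N := by
    have h3 := ((tendsto_rpow_neg_atTop hK).const_mul (Cb * Q * K1)).mul_const S
    rw [mul_zero, zero_mul] at h3
    exact (((h3.eventually (gt_mem_nhds he)).mono fun N h => h.le).and ((eventually_ge_atTop 1).and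
      ((eventually_ge_atTop (2 * c1)).and (eventually_ge_atTop _)))).exists
  have hN0 : 0 < N := by linarith
  have hv0 : ∀ r, 0 < r → 0 ≤ expWeight2 N r := fun r hr => by
    rw [expWeight2_eq]; exact (expWeight_pos 2 (by positivity)).le
  refine ⟨N, K1 * N ^ (-K), K2 / N, Cb * Q * K1 * N ^ (-K), fun q k => Cb * Q ^ multiSize k, hN1,
    hNc, by positivity, hNS, ⟨hv0, fun r hr => by positivity, by positivity, by positivity,
    h1 (fun _ => 1) N c1 (fun _ => zero_le_one) hN0 hNc, ?_⟩, fun t ht => ⟨fun q k => by positivity,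
    fun q k i p hp => ?_, fun q k i h0 p hp => ?_, fun q k L hL r hr => ?_⟩⟩
  · have := h2 (fun _ => 1) N (fun _ => zero_le_one) hN0
    simpa [expWeight2, rpow_neg_one, div_eq_mul_inv] using this
  · have := norm_timeLap_le H hd hK.le hc1 (G := C * Q ^ multiSize k) (by positivity)
      (by simpa using (Hd.b_fun q k i).holo 0 (mem_univ 0) t ht) (Hd.b_bound q k i t ht) hp
    refine this.trans_eq ?_
    rw [hCb]; ring
  · have := norm_timeLap_le H hd hK.le hc1 le_rfl
      (by simpa using (Hd.b_fun q k i).holo 0 (mem_univ 0) t ht)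
      (fun x hx => by rw [Hd.b_zero q k i h0 t ht x hx]; simp) hp
    rw [mul_zero, zero_mul] at this; exact norm_le_zero_iff.1 this
  · have e1 : Q ^ multiSize k ≤ Q * Q ^ L := by
      rw [← pow_succ']; exact pow_le_pow_right₀ hQ (by omega)
    have e2 : (Q * A * K2 / N) ^ L ≤ (1 / 4) ^ L := by
      refine pow_le_pow_left₀ (by positivity) ?_ L
      rw [div_le_iff₀ hN0]; linarith
    have e3 : r ^ q.order ≤ 1 + r ^ n := by
      have := rpow_mul_rpow_le_one_add hr one_pos q.2 hn
      rw [one_rpow, one_mul, mul_one] at this; exact this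
    calc _ ≤ Cb * (Q * Q ^ L) * (K1 * N ^ (-K)) * (A * (K2 / N)) ^ L * (1 + r ^ n) := by gcongr
      _ = Cb * Q * K1 * N ^ (-K) * (Q * A * K2 / N) ^ L * (1 + r ^ n) := by
          simp only [mul_pow, div_pow]; ring
      _ ≤ _ := by gcongr

end

section

variable {m n : ℕ} {s R T a C Q o d c1 : ℝ} {r : Fin m → TimeFun}
    {b : CoeffFam m n TimeFun} {P : Fin m → Polynomial ℂ}

variable {C' : ℝ} {f : VecFun m}

lemma CoarseData.holoFam_b (Hd : CoarseData s R T a C Q r b) (H : Contour s R o)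
    (hd : 0 < d) (hk : 0 < a) (hc1 : R < (1 - s) / 2 * c1) (q : DerivIdx m n) (k : Fin m → ℕ)
    (i : Fin m) : SectorDecay univ s R 0 T a (fun _ => b q k i) ∧
    HoloFam univ (dualCone o d) T a (fun _ p t => timeLap o c1 (b q k i) p t) := by
  have hC := Hd.C_nonneg
  have hQ := Hd.one_le_Q
  have h1 : SectorDecay univ s R 0 T a (fun _ => b q k i) := fun t1 t2 h1 h2 =>
    ⟨C * Q ^ multiSize k, by positivity, fun _ _ t ht x hx =>
    Hd.b_bound q k i t ⟨h1.trans_le ht.1, ht.2.trans_lt h2⟩ x (by simpa using hx)⟩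
  exact ⟨h1, holoFam_timeLap H hd hk.le hc1 (Hd.b_fun q k i) h1⟩

lemma CoarseSol.decay (Hf : CoarseSol P s R T C' r b f)
    (i : Fin m) : SectorDecay univ s R 0 T 1 (fun _ x t => f x t i) := fun t1 t2 h1 h2 =>
    ⟨C', Hf.C_nonneg, fun _ _ t ht x hx =>
    Hf.bound t ⟨h1.trans_le ht.1, ht.2.trans_lt h2⟩ x (by simpa using hx) i⟩

set_option maxHeartbeats 1600000 in
lemma CoarseSol.hasDerivAt_timeLap (H : Contour s R o) (hd : 0 < d)
    (hq : 0 < a) (hq1 : a ≤ 1) (hc1 : R < (1 - s) / 2 * c1) (Hd : CoarseData s R T a C Q r b) (Hf :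
    CoarseSol P s R T C' r b f)
    {N k1 k2 A E : ℝ} {cf : DerivIdx m n → (Fin m → ℕ) → ℝ} (hN : 1 ≤ N) (hNc : 2 * c1 ≤ N)
    (hE : 0 ≤ E) (hA : 0 ≤ A)
    (W : ConvWeights (expWeight2 N) (fun r => r ^ (a - 1) * exp (c1 * r)) k1 k2)
    (HB : ∀ t ∈ Ioo 0 T, CoeffBounds (dualCone o d) (fun r => r ^ (a - 1) * exp (c1 * r)) k1 k2
    A E cf (fun r => 1 + r ^ n) (fun q k i p => timeLap o c1 (b q k i) p t))
    (hU : ∀ t ∈ Ioo 0 T, ∀ l, ∀ p ∈ dualCone o d,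
    ‖timeLap o c1 (fun x t => f x t l) p t‖ ≤ A * expWeight2 N ‖p‖)
    {s2 o2 h : ℝ} (hs2 : s2 ≤ s) (hh : 0 < h) (H2 : ∀ R2, 0 < R2 → Contour s2 R2 o2)
    (hsub : dualCone o2 d ⊆ dualCone o d) (hone : (1 : ℂ) ∈ dualCone o2 d)
    (hvis : ∀ x ∈ cone s2 0, ∃ w ∈ dualCone o d, ‖w‖ = 1 ∧ h * ‖x‖ ≤ (w * x).re) {t : ℝ}
    (ht : t ∈ Ioo 0 T) {p : ℂ} (hp : p ∈ dualCone o2 d) (i : Fin m) :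
    HasDerivAt (timeLap o c1 (fun x t => f x t i) p)
    (-(symbol n (P i) p) * timeLap o c1 (fun x t => f x t i) p t +
    (nonlin (fun l p => timeLap o c1 (fun x t => f x t l) p t)
    (fun q k i p => timeLap o c1 (b q k i) p t) i p + timeLap o c1 (r i) p t)) t := by
  have hR := H.pos
  have hC' := Hf.C_nonneg
  have hk : 0 < (1 - s) / 2 := by linarith [H.lt_one]
  have hc10 : 0 < c1 := by
    by_contra hneg
    nlinarith [not_lt.1 hneg]
  have hRc : R ≤ c1 := by nlinarith [H.sin_pos, H.sin_lt]
  have hD := OpenCone.dualCone o d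
  set D := dualCone o d
  set U := fun l p t => timeLap o c1 (fun x t => f x t l) p t
  set BT := fun q k i p t => timeLap o c1 (b q k i) p t
  set RT := fun i p t => timeLap o c1 (r i) p t
  set G := fun i p t => -(symbol n (P i) p) * U i p t +
    (nonlin (fun l p => U l p t) (fun q k i p => BT q k i p t) i p + RT i p t)
  set M := N + 1 with hM
  have hw0 : ∀ r : ℝ, 0 < r → 0 ≤ 1 + r ^ n := fun r hr => by positivity
  obtain ⟨K, hK1, hK⟩ := one_add_pow_le_exp n one_pos
  have hv : ∀ r : ℝ, 0 < r → expWeight2 N r ≤ exp (N * r) := fun r hr => by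
    rw [expWeight2_eq]; exact expWeight_le_exp 2 (by positivity)
  have hvK : ∀ r : ℝ, 0 < r → (1 + r) ^ n * expWeight2 N r ≤ K * exp (M * r) := fun r hr => by
    calc _ ≤ (K * exp (1 * r)) * exp (N * r) := mul_le_lr (hK r hr.le) (hv r hr) (W.v_nonneg r hr)
      _ = _ := by rw [mul_assoc, ← exp_add, hM]; congr 2; ring
  have hpow : ∀ r : ℝ, 0 < r → 1 + r ^ n ≤ 2 * (1 + r) ^ n := fun r hr => by
    have h1 : (1 : ℝ) ≤ (1 + r) ^ n := one_le_pow₀ (by linarith)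
    have h2 := pow_le_pow_left₀ hr.le (by linarith : r ≤ 1 + r) n
    linarith
  have hvK2 : ∀ r : ℝ, 0 < r → (1 + r ^ n) * expWeight2 N r ≤ 2 * K * exp (M * r) := fun r hr => by
      have := mul_le_r (hpow r hr) (W.v_nonneg r hr)
      nlinarith [hvK r hr]
  have hUh : ∀ l, HoloFam univ D T a (fun _ => U l) := fun l =>
    holoFam_timeLap H hd hq.le hc1 (Hf.fn l) ((Hf.decay l).of_exponent_le hR hq1)
  have hBh := fun q k i => (Hd.holoFam_b H hd hq hc1 q k i).2
  have hRh := fun i =>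
    holoFam_timeLap H hd hq.le hc1 (Hd.r_fun i) ((Hd.r_decay i).of_exponent_le hR hq1)
  have hNh := fun i => holoFam_nonlin isOpen_univ hD hq hq1 hUh hBh
    (B := fun _ r => A * E * (1 + r ^ n) * expWeight2 N r) i
    (fun q k _ _ p hp t ht => (HB t ht).norm_term_le hD W hA hE hw0 (hU t ht) q k i hp)
    (fun t1 t2 r0 _ _ _ => ⟨A * E * (2 * K * exp (M * r0)), by positivity, fun t _ r hr hr0 => by
      rw [mul_assoc (A * E)]
      refine mul_le_l ((hvK2 r hr).trans ?_)
      gcongr⟩)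
  have hGd := fun i t ht =>
    ((differentiable_symbol n (P i)).neg.differentiableOn.mul ((hUh i).holo 0 (mem_univ 0) t
    ht)).add (((hNh i).holo 0 (mem_univ 0) t ht).add ((hRh i).holo 0 (mem_univ 0) t ht))
  have hGb : ∀ i, ∀ t1 t2 : ℝ, 0 < t1 → t2 < T → ∃ Cg, 0 ≤ Cg ∧ ∀ t ∈ Icc t1 t2, ∀ p ∈ D,
    ‖G i p t‖ ≤ Cg * exp (M * ‖p‖) := fun i t1 t2 h1 h2 => by
    obtain ⟨Gr, hGr0, hGr⟩ := Hd.r_decay i t1 t2 h1 h2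
    obtain ⟨j, hj0, hj⟩ := exists_norm_symbol_le n (P i)
    refine ⟨j * A * K + (A * E * indexSum m n * (2 * K) +
      exp 1 / d * ((1 - s) / 2) ^ (-1 : ℝ) * Gr), ?_, fun t ht p hp => ?_⟩
    · have : 0 ≤ indexSum m n := by unfold indexSum; positivity
      positivity
    have ht' : t ∈ Ioo 0 T := ⟨h1.trans_le ht.1, ht.2.trans_lt h2⟩
    have hpn := hD.norm_pos hp
    have hS : 0 ≤ indexSum m n := by unfold indexSum; positivity
    have e1 : ‖-(symbol n (P i) p) * U i p t‖ ≤ j * A * K * exp (M * ‖p‖) := by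
      rw [norm_mul, norm_neg]
      calc _ ≤ (j * (1 + ‖p‖) ^ n) * (A * expWeight2 N ‖p‖) := mul_le_lr (hj p) (hU t ht' i p hp)
        _ = j * A * ((1 + ‖p‖) ^ n * expWeight2 N ‖p‖) := by ring
        _ ≤ j * A * (K * exp (M * ‖p‖)) := mul_le_l (hvK _ hpn)
        _ = _ := by ring
    have e2 : ‖nonlin (fun l p => U l p t) (fun q k i p => BT q k i p t) i p‖ ≤
      A * E * indexSum m n * (2 * K) * exp (M * ‖p‖) := by
      refine ((HB t ht').norm_nonlin_le hD W hA hE hw0 (hU t ht') i hp).trans ?_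
      rw [mul_assoc (A * E * indexSum m n), mul_assoc (A * E * indexSum m n)]
      exact mul_le_l (hvK2 _ hpn)
    have e3 : ‖RT i p t‖ ≤ exp 1 / d * ((1 - s) / 2) ^ (-1 : ℝ) * Gr * exp (M * ‖p‖) := by
      have := norm_timeLap_le H hd zero_le_one hc1 hGr0
        (by simpa using (Hd.r_fun i).holo 0 (mem_univ 0) t ht')
        (fun x hx => hGr 0 (mem_univ 0) t ht x (by simpa using hx)) hp
      rw [sub_self, rpow_zero, one_mul] at this
      refine this.trans (mul_le_l (exp_le_exp.2 ?_))
      exact mul_le_r (by linarith) hpn.le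
    rw [add_mul (j * A * K), add_mul (A * E * indexSum m n * (2 * K))]
    exact (norm_add_le _ _).trans (add_le_add e1 ((norm_add_le _ _).trans (add_le_add e2 e3)))
  set rhs := evolutionRHS P (fun q k x t i => b q k i x t) (fun x t i => r i x t) f
  have hL : ∀ t ∈ Ioo 0 T, ∀ w ∈ D, ‖w‖ = 1 → ∀ x : ℂ, M < (w * x).re →
    rayLap w (fun p => G i p t) x = rhs x t i := fun t ht w hw hw1 x hx => by
    have hxc : c1 * ‖w‖ < (w * x).re := by rw [hw1]; linarith
    have hUr := fun l => rayLap_timeLap H hd.le one_pos le_rfl hc1 (Hf.fn l) (Hf.decay l)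
      ht hw (x := x)
    obtain ⟨N', hN', hN''⟩ := exists_between hxc
    refine rayLap_evolution P (U := fun l p => U l p t) hN'' (fun l => ?_)
      (f := fun y => f y t) ?_ (b := fun q k i => b q k i x t) (rx := fun i => r i x t)
      (fun q k i => rayLap_timeLap H hd.le hq hq1 hc1 (Hd.b_fun q k i)
      (Hd.holoFam_b H hd hq hc1 q k i).1 ht hw hxc)
      (fun i => rayLap_timeLap H hd.le one_pos le_rfl hc1 (Hd.r_fun i) (Hd.r_decay i) ht
      hw hxc) (G := fun e => A * E * (2 * K) * exp (M * e)) ?_ (fun q k i e he => ?_)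
      (fun q => Hf.summable t ht x (halfPlane_subset_cone (c := M) hd.le H.cos_pos.le H.sin_pos
      H.sin_lt.le hR.le (by linarith) hw (by rwa [hw1, mul_one])) q) i
    · have hw0 : w ≠ 0 := by rintro rfl; simp at hw1
      have := (rayLap_timeLap H hd.le one_pos le_rfl hc1 (Hf.fn l) (Hf.decay l) ht hw
        (x := N' / w) (by rwa [mul_div_cancel₀ _ hw0, ofReal_re])).1
      rwa [mul_div_cancel₀ _ hw0, ofReal_re] at this
    · have : ∀ᶠ y in 𝓝 x, c1 * ‖w‖ < (w * y).re :=
        (by fun_prop : Continuous fun y : ℂ => (w * y).re).continuousAt.eventually (lt_mem_nhds hxc)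
      exact this.mono fun y hy l => (rayLap_timeLap H hd.le one_pos le_rfl hc1 (Hf.fn l)
        (Hf.decay l) ht hw hy).2.symm
    · have h1 := (integrableOn_rpow_exp one_pos (sub_pos.2 hx)).const_mul (A * E * (2 * K))
      refine IntegrableOn.congr_fun h1 (fun e _ => ?_) measurableSet_Ioi
      rw [sub_self, rpow_zero, one_mul, mul_assoc (A * E * (2 * K)), ← exp_add]; congr 2; ring
    · have h1 := (HB t ht).norm_term_le hD W hA hE hw0 (hU t ht) q k i (hD.smul_mem w hw e he)
      have h2 : ‖(e : ℂ) * w‖ = e := by rw [norm_mul, hw1, mul_one, norm_coe]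
      rw [h2] at h1
      refine h1.trans ?_
      rw [mul_comm, mul_assoc (A * E), mul_assoc (A * E)]; exact mul_le_l (mul_le_l (hvK2 e he))
  set R2 := max R (2 * M / h)
  have hR20 : 0 < R2 := hR.trans_le (le_max_left _ _)
  have hR2h : 2 * M ≤ h * R2 := by
    have : 2 * M / h ≤ R2 := le_max_right _ _
    rw [div_le_iff₀ hh] at this; linarith
  have H2 := H2 R2 hR20
  have hk2 : 0 < (1 - s2) / 2 := by linarith
  obtain ⟨c2, hc2⟩ : ∃ c2, R2 < (1 - s2) / 2 * c2 := by
    refine ⟨(R2 + 1) / ((1 - s2) / 2), ?_⟩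
    rw [mul_div_cancel₀ _ hk2.ne']; linarith
  have hreg : cone s2 R2 ⊆ cone s R := cone_mono hs2 (le_max_left _ _)
  have hadm : ∀ x ∈ cone s2 R2, ∃ w ∈ D, ‖w‖ = 1 ∧ M < (w * x).re ∧
    M + h / 2 * ‖x‖ ≤ (w * x).re := fun x hx => by
    obtain ⟨w, hw, hw1, hwx⟩ := hvis x ⟨hR20.trans hx.1, hx.2⟩
    have h1 : h * R2 < h * ‖x‖ := mul_lt_mul_of_pos_left hx.1 hh
    exact ⟨w, hw, hw1, by linarith, by linarith⟩
  have hrd : ∀ t ∈ Ioo 0 T, DifferentiableOn ℂ (fun x => rhs x t i) (cone s2 R2) := fun t ht x hx =>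
    by
    obtain ⟨w, hw, hw1, hwx, -⟩ := hadm x hx
    obtain ⟨Cg, hCg0, hCg⟩ := hGb i t t ht.1 ht.2
    obtain ⟨c', hc', hc''⟩ := exists_between hwx
    refine (((hasDerivAt_rayLap (rayExp_of_exp_bound hD (hGd i t ht).continuousOn (hCg t ⟨le_rfl,
      le_rfl⟩) hw (by rwa [hw1, mul_one] : M * ‖w‖ < c'))
      hc'').differentiableAt).congr_of_eventuallyEq ?_).differentiableWithinAt
    have : ∀ᶠ y in 𝓝 x, M < (w * y).re :=
      (by fun_prop : Continuous fun y : ℂ => (w * y).re).continuousAt.eventually (lt_mem_nhds hwx)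
    exact this.mono fun y hy => (hL t ht w hw hw1 y hy).symm
  have hrb : ∀ t1 t2 : ℝ, 0 < t1 → t2 < T → ∃ Cg, 0 ≤ Cg ∧ ∀ t ∈ Icc t1 t2,
    ∀ x ∈ cone s2 R2, ‖rhs x t i‖ ≤ Cg * ‖x‖ ^ (-1 : ℝ) := fun t1 t2 h1 h2 => by
    obtain ⟨Cg, hCg0, hCg⟩ := hGb i t1 t2 h1 h2
    refine ⟨Cg * (h / 2) ^ (-1 : ℝ), by positivity, fun t ht x hx => ?_⟩
    obtain ⟨w, hw, hw1, hwx, hwx'⟩ := hadm x hx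
    have hx0 : 0 < ‖x‖ := hR20.trans hx.1
    rw [← hL t ⟨h1.trans_le ht.1, ht.2.trans_lt h2⟩ w hw hw1 x hwx]
    have := norm_rayLap_le (J := Unit) (A := fun _ => Cg) (b := fun _ => 1) hw1
      (by positivity : 0 < h / 2 * ‖x‖) (fun _ => one_pos) (F := fun p => G i p t) (v := M)
      (fun e he => by
        have h3 := hCg t ht _ (hD.smul_mem w hw e he)
        rw [norm_mul, hw1, mul_one, norm_coe he.le] at h3
        simpa using h3) (fun _ => hCg0) hwx'
    refine this.trans_eq ?_
    rw [Fintype.sum_unique, Real.Gamma_one, one_mul, mul_rpow (by positivity) hx0.le]; ring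
  have honeD := hsub hone
  have hUeq : ∀ u ∈ Ioo 0 T, invLap o2 c2 (fun x => f x u i) p = U i p u := fun u hu => by
    have hL1 := fun x : ℂ => rayLap_timeLap H hd.le one_pos le_rfl hc1 (Hf.fn i)
      (Hf.decay i) hu honeD (x := x)
    refine invLap_eq_of_rayLap H2 hd.le hc2 one_pos le_rfl (v := c1 + 1)
      (((by simpa using (Hf.fn i).holo 0 (mem_univ 0) u hu :
      DifferentiableOn ℂ (fun x => f x u i) (cone s R))).mono hreg)
      (fun z hz => Hf.bound u hu z (hreg hz) i)
      (((hUh i).holo 0 (mem_univ 0) u hu).mono hsub) hone ?_ ?_ p hp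
    · simpa using (hL1 ((c1 + 1 : ℝ) : ℂ) (by simp)).1
    · intro x hx
      exact (hL1 x (by simp; linarith)).2
  have hGeq : invLap o2 c2 (fun x => rhs x t i) p = G i p t := by
    obtain ⟨Cr, hCr0, hCr⟩ := hrb t t ht.1 ht.2
    obtain ⟨Cg, hCg0, hCg⟩ := hGb i t t ht.1 ht.2
    refine invLap_eq_of_rayLap H2 hd.le hc2 one_pos le_rfl (v := M + 1) (hrd t ht)
      (hCr t ⟨le_rfl, le_rfl⟩) ((hGd i t ht).mono hsub) hone
      (rayExp_of_exp_bound hD (hGd i t ht).continuousOn (hCg t ⟨le_rfl, le_rfl⟩) honeD (by simp))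
      (fun x hx => hL t ht 1 honeD (by simp) x (by simp; linarith)) p hp
  obtain ⟨t1, h01, htt1⟩ := exists_between ht.1
  obtain ⟨t2, htt2, ht2T⟩ := exists_between ht.2
  have hI : ∀ u ∈ Ioo t1 t2, u ∈ Ioo 0 T := fun u hu => ⟨h01.trans hu.1, hu.2.trans ht2T⟩
  obtain ⟨Cr, hCr0, hCr⟩ := hrb t1 t2 h01 ht2T
  have hinv : ∀ {x : ℂ}, x ∈ cone s2 R2 → ‖x‖ ^ (-1 : ℝ) ≤ R2 ^ (-1 : ℝ) := fun hx =>
    rpow_anti hR20 hx.1.le (by norm_num)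
  have hder := hasDerivAt_invLap_time H2 hd.le hc2 (g := fun x t => f x t i)
    (g' := fun x t => rhs x t i) (G := (C' + Cr) * R2 ^ (-1 : ℝ)) (Ioo_mem_nhds htt1 htt2)
    (fun u hu => ((by simpa using (Hf.fn i).holo 0 (mem_univ 0) u (hI u hu) :
    DifferentiableOn ℂ (fun x => f x u i) (cone s R)).mono hreg).continuousOn)
    (hrd t ht).continuousOn (fun z hz => (Hf.bound t ht z (hreg hz) i).trans
    (mul_le_lr (by linarith) (hinv hz)))
    (fun z hz u hu => hasDerivAt_pi.1 (Hf.equation u (hI u hu) z (hreg hz)) i)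
    (fun z hz u hu => (hCr u ⟨hu.1.le, hu.2.le⟩ z hz).trans (mul_le_lr (by linarith) (hinv hz))) hp
  rw [hGeq] at hder
  refine hder.congr_of_eventuallyEq ?_
  filter_upwards [Ioo_mem_nhds ht.1 ht.2] with u hu using (hUeq u hu).symm

end

section

variable {m n : ℕ} {s R T a C Q : ℝ} {r : Fin m → TimeFun}
    {b : CoeffFam m n TimeFun} {P : Fin m → Polynomial ℂ}

lemma exists_exp_le_expWeight2 : ∃ K : ℝ, 0 ≤ K ∧ ∀ c v r : ℝ, 0 ≤ c → 2 * c ≤ v → 0 ≤ r →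
    exp (c * r) ≤ K * expWeight2 v r := by
  obtain ⟨K, hK1, hK⟩ := one_add_pow_le_exp 2 (by norm_num : (0 : ℝ) < 1 / 2)
  refine ⟨K, by linarith, fun c v r hc hv hr => ?_⟩
  have h0 : 0 ≤ v * r := mul_nonneg (by linarith) hr
  rw [expWeight2_eq, expWeight, ← mul_div_assoc, le_div_iff₀ (by positivity)]
  calc _ ≤ exp (1 / 2 * (v * r)) * (K * exp (1 / 2 * (v * r))) :=
    mul_le_mul (exp_le_exp.2 (by nlinarith)) (hK _ h0) (by positivity) (exp_pos _).le
    _ = _ := by rw [mul_left_comm, ← exp_add]; congr 2; ring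

lemma CoarseData.eq_of_solutions (hn : 0 < n) {o c0 : ℝ} (ho : 0 < o) (ho2 : o < π / 2)
    (hR : 0 < R) (hq : 0 < a) (hq1 : a ≤ 1) (hc0 : 0 < c0)
    (hP : ∀ l, ∀ p : ℂ, |p.arg| ≤ o → c0 * ‖p‖ ^ n ≤ ((P l).coeff n * (-p) ^ n).re)
    (Hd : CoarseData (sin o) R T a C Q r b) {C' : ℝ} {f f' : VecFun m}
    (Hf : CoarseSol P (sin o) R T C' r b f) (Hf' : CoarseSol P (sin o) R T C' r b f') :
    ∃ c, ∀ t ∈ Ioo 0 T, ∀ x : ℂ, c < x.re → f x t = f' x t := by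
  set u := o / 8 with hu
  have hmono : ∀ {x y : ℝ}, 0 ≤ x → x < y → y ≤ o → sin x < sin y := fun h1 h2 h3 =>
    sin_lt_sin_of_lt_of_le_pi_div_two (by linarith) (by linarith) h2
  have hpos : ∀ {x : ℝ}, 0 < x → x ≤ o → 0 < sin x := fun h1 h2 =>
    sin_pos_of_pos_of_lt_pi h1 (by linarith)
  have hcos : ∀ {x : ℝ}, 0 < x → x ≤ o → 0 < cos x := fun h1 h2 =>
    cos_pos_of_mem_Ioo ⟨by linarith, by linarith⟩
  have hlt1 : sin o < 1 := by
    have := hcos ho le_rfl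
    nlinarith [sin_sq_add_cos_sq o]
  have H : Contour (sin o) R (6 * u) := ⟨hcos (by linarith) (by linarith),
    hpos (by linarith) (by linarith), hmono (by linarith) (by linarith) le_rfl, hlt1, hR⟩
  have H2 : ∀ R2, 0 < R2 → Contour (sin (3 * u)) R2 (2 * u) := fun R2 h =>
    ⟨hcos (by linarith) (by linarith), hpos (by linarith) (by linarith),
    hmono (by linarith) (by linarith) (by linarith),
    (hmono (by linarith) (by linarith) le_rfl).trans hlt1, h⟩
  set d := sin (2 * u) / 2 with hd
  have h2u : 0 < sin (2 * u) := hpos (by linarith) (by linarith)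
  have hd0 : 0 < d := by linarith
  have hd2 : d < sin (2 * u) := by linarith
  obtain ⟨w, hw, hvis⟩ := exists_dualCone_re_ge (f := 3 * u) (f' := 4 * u) (o := 6 * u) (D := d)
    (by linarith) (by linarith) (by linarith) (by
      rw [show 6 * u - 4 * u = 2 * u by ring]; exact hd2)
  have hsub : dualCone (2 * u) d ⊆ dualCone (6 * u) d := fun p hp => by
    have hp' : d * ‖p‖ + cos (2 * u) * |p.im| < sin (2 * u) * p.re := hp
    have h1 : cos (6 * u) * |p.im| ≤ cos (2 * u) * |p.im| :=
      mul_le_r (cos_le_cos_of_nonneg_of_le_pi (by linarith) (by linarith) (by linarith))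
    have h2 : 0 < p.re := by
      have := mul_nonneg (hcos (x := 2 * u) (by linarith) (by linarith)).le (abs_nonneg p.im)
      have := mul_nonneg hd0.le (norm_nonneg p)
      exact pos_of_mul_pos_right (lt_of_le_of_lt (by linarith) hp') h2u.le
    have h3 := mul_le_r
      (hmono (x := 2 * u) (y := 6 * u) (by linarith) (by linarith) (by linarith)).le h2.le
    change d * ‖p‖ + cos (6 * u) * |p.im| < sin (6 * u) * p.re
    linarith
  have hone : (1 : ℂ) ∈ dualCone (2 * u) d := by
    change d * ‖(1 : ℂ)‖ + cos (2 * u) * |(1 : ℂ).im| < sin (2 * u) * (1 : ℂ).re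
    simpa using hd2
  obtain ⟨C0, hC0, hlb⟩ := exists_symbol_lower_bound (D := dualCone (6 * u) d) hc0 P
    fun l p hp => hP l p ((abs_arg_lt_of_mem_dualCone hd0.le (by linarith) (by linarith)
    hp).le.trans (by linarith))
  have hk : 0 < (1 - sin o) / 2 := by linarith
  obtain ⟨c1, hc1⟩ : ∃ c1, R < (1 - sin o) / 2 * c1 := by
    refine ⟨(R + 1) / ((1 - sin o) / 2), ?_⟩
    rw [mul_div_cancel₀ _ hk.ne']; linarith
  have hc10 : 0 < c1 := by
    by_contra hneg
    nlinarith [not_lt.1 hneg]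
  obtain ⟨K, hK0, hK⟩ := exists_exp_le_expWeight2
  have hC' := Hf.C_nonneg
  set A := exp 1 / d * ((1 - sin o) / 2) ^ (-1 : ℝ) * C' * K with hA
  have hA0 : 0 ≤ A := by positivity
  obtain ⟨v, k1, k2, E, cf, hv1, hvc, hE, hES, W, HB⟩ :=
    Hd.exists_coeffBounds hn H hd0 hq hc1 (S := indexSum m n) hA0 (e := c0 / 4) (by positivity)
  have hUb : ∀ {g : VecFun m}, CoarseSol P (sin o) R T C' r b g →
    ∀ t ∈ Ioo 0 T, ∀ l, ∀ p ∈ dualCone (6 * u) d,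
    ‖timeLap (6 * u) c1 (fun x t => g x t l) p t‖ ≤ A * expWeight2 v ‖p‖ := fun {g} Hg t ht l p hp
    => by
    refine (norm_timeLap_le H hd0 zero_le_one hc1 hC'
      (by simpa using (Hg.fn l).holo 0 (mem_univ 0) t ht)
      (fun x hx => Hg.bound t ht x hx l) hp).trans ?_
    rw [sub_self, rpow_zero, one_mul, hA, mul_assoc _ K]
    exact mul_le_l (hK _ _ _ hc10.le hvc (norm_nonneg p))
  have hder : ∀ {g : VecFun m}, CoarseSol P (sin o) R T C' r b g → _ :=
    fun {g} Hg => fun (i : Fin m) p hp t (ht : t ∈ Ioo 0 T) =>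
    Hg.hasDerivAt_timeLap H hd0 hq hq1 hc1 Hd hv1 hvc hE hA0 W HB (hUb Hg)
    (hmono (by linarith) (by linarith) le_rfl).le hw H2 hsub hone hvis ht (p := p) hp i
  have hh : ∀ {g : VecFun m}, CoarseSol P (sin o) R T C' r b g → ∀ l,
    HoloFam univ (dualCone (6 * u) d) T a
    (fun _ p t => timeLap (6 * u) c1 (fun x t => g x t l) p t) := fun Hg l =>
    holoFam_timeLap H hd0 hq.le hc1 (Hg.fn l) ((Hg.decay l).of_exponent_le hR hq1)
  have hlim : ∀ {g : VecFun m}, CoarseSol P (sin o) R T C' r b g → ∀ l,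
    ∀ p ∈ dualCone (6 * u) d, 0 < T →
    Tendsto (timeLap (6 * u) c1 (fun x t => g x t l) p) (𝓝[>] 0) (𝓝 0) :=
    fun Hg l p hp hT => tendsto_invLap_zero hT H hd0.le hc1
    (fun e he => (by simpa using (Hg.fn l).holo 0 (mem_univ 0) e he :
    DifferentiableOn ℂ _ (cone (sin o) R)).continuousOn)
    (fun z hz e he => (Hg.bound e he z hz l).trans (mul_le_l (rpow_anti hR hz.1.le (by norm_num))))
    (fun z hz => Hg.initial z hz l) hp
  have hstep : ∀ N : ℕ, ∀ t ∈ Ioo 0 T, ∀ l, ∀ p ∈ dualCone (2 * u) d,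
    ‖timeLap (6 * u) c1 (fun x t => f x t l) p t - timeLap (6 * u) c1 (fun x t => f' x t l) p t‖ ≤
    2 * A * (1 / 2) ^ N * exp ((C0 + c0 / 2) * t) * expWeight2 v ‖p‖ := by
    intro N
    induction N with
    | zero =>
      intro t ht l p hp
      have h3 : 1 ≤ exp ((C0 + c0 / 2) * t) := one_le_exp (by have := ht.1; positivity)
      have h4 : 0 ≤ expWeight2 v ‖p‖ := W.v_nonneg _ ((OpenCone.dualCone _ _).norm_pos hp)
      refine (norm_sub_le _ _).trans ((add_le_add (hUb Hf t ht l p (hsub hp)) (hUb Hf' t ht l p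
        (hsub hp))).trans ?_)
      have h5 : 0 ≤ 2 * A * expWeight2 v ‖p‖ := by positivity
      nlinarith
    | succ N ih =>
      intro t ht l p hp
      have hv : 0 ≤ expWeight2 v ‖p‖ := W.v_nonneg _ ((OpenCone.dualCone _ _).norm_pos hp)
      have hc : ∀ {F : ParamFun}, HoloFam univ (dualCone (6 * u) d) T a F → ∀ t ∈ Ioo 0 T,
        ContinuousOn (fun p => F 0 p t) (dualCone (2 * u) d) := fun hF t ht =>
        ((hF.holo 0 (mem_univ 0) t ht).mono hsub).continuousOn
      have hcm : ∀ {g : VecFun m}, CoarseSol P (sin o) R T C' r b g →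
        ∀ t ∈ Ioo 0 T, ∀ q k i L, ContinuousOn (convMon
        (fun l p => timeLap (6 * u) c1 (fun x t => g x t l) p t)
        (fun p => timeLap (6 * u) c1 (b q k i) p t) L) (dualCone (2 * u) d) :=
        fun Hg t ht q k i L => hc (HoloFam.convMon isOpen_univ (OpenCone.dualCone _ _) hq
        hq1 (hh Hg) (Hd.holoFam_b H hd0 hq hc1 q k i).2 L) t ht
      have hN : ∀ e ∈ Ioo 0 T, _ := fun e he => CoeffBounds.norm_nonlin_sub_le
        (OpenCone.dualCone (2 * u) d) W
        ⟨(HB e he).c_nonneg, fun q k i p hp => (HB e he).bound q k i p (hsub hp),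
        fun q k i h0 p hp => (HB e he).eq_zero q k i h0 p (hsub hp), (HB e he).le⟩ hA0 hE
        (by positivity) (fun r hr => by positivity) (fun l p hp => hUb Hf e he l p (hsub hp))
        (fun l p hp => hUb Hf' e he l p (hsub hp)) (ih e he) (fun l => hc (hh Hf l) e he)
        (fun l => hc (hh Hf' l) e he) (hcm Hf e he) (hcm Hf' e he) l hp
      have hy := norm_le_of_dissipative (g := C0 + c0 / 2) (K := A * (1 / 2) ^ N * expWeight2 v ‖p‖)
        (y := fun e => timeLap (6 * u) c1 (fun x t => f x t l) p e -
        timeLap (6 * u) c1 (fun x t => f' x t l) p e)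
        (F := fun e => nonlin (fun l p => timeLap (6 * u) c1 (fun x t => f x t l) p e)
        (fun q k i p => timeLap (6 * u) c1 (b q k i) p e) l p -
        nonlin (fun l p => timeLap (6 * u) c1 (fun x t => f' x t l) p e)
        (fun q k i p => timeLap (6 * u) c1 (b q k i) p e) l p) ht
        (fun e he => ((hder Hf l p hp e he).fun_sub (hder Hf' l p hp e he)).congr_deriv (by ring))
        (by
          have := (hlim Hf l p (hsub hp) (ht.1.trans ht.2)).sub
            (hlim Hf' l p (hsub hp) (ht.1.trans ht.2))
          rwa [sub_zero] at this) rfl (by positivity) (fun e he => ?_)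
      · refine hy.trans_eq ?_
        rw [pow_succ]; ring
      · have h2 := hlb l p (hsub hp)
        refine (hN e he).trans ?_
        have h3 : 2 * (E * indexSum m n) * (1 + ‖p‖ ^ n) ≤
          (symbol n (P l) p).re + (C0 + c0 / 2) := by
          have : 0 ≤ ‖p‖ ^ n := by positivity
          nlinarith
        have h4 : 0 ≤ A * (1 / 2) ^ N * exp ((C0 + c0 / 2) * e) * expWeight2 v ‖p‖ := by positivity
        have := mul_le_l h3 h4
        linarith
  have heq : ∀ t ∈ Ioo 0 T, ∀ l, ∀ p ∈ dualCone (2 * u) d,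
    timeLap (6 * u) c1 (fun x t => f x t l) p t =
    timeLap (6 * u) c1 (fun x t => f' x t l) p t := fun t ht l p hp => by
    have h1 : Tendsto (fun N => 2 * A * (1 / 2) ^ N * exp ((C0 + c0 / 2) * t) *
      expWeight2 v ‖p‖) atTop (𝓝 0) := by
      have := ((((tendsto_pow_atTop_nhds_zero_of_lt_one (by norm_num : (0 : ℝ) ≤ 1 / 2)
        (by norm_num)).const_mul (2 * A)).mul_const (exp ((C0 + c0 / 2) * t))).mul_const
        (expWeight2 v ‖p‖))
      simpa using this
    exact sub_eq_zero.1 (norm_le_zero_iff.1 (ge_of_tendsto' h1 fun N => hstep N t ht l p hp))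
  refine ⟨c1, fun t ht x hx => funext fun l => ?_⟩
  have h1 := fun {g : VecFun m} (Hg : CoarseSol P (sin o) R T C' r b g) =>
    (rayLap_timeLap H hd0.le one_pos le_rfl hc1 (Hg.fn l) (Hg.decay l) ht (hsub hone)
    (by simpa using hx)).2
  rw [← h1 Hf, ← h1 Hf']
  refine rayLap_congr x fun j hj => ?_
  rw [mul_one]; exact heq t ht l _ (by simpa using dualCone_smul hone hj)

end

section

variable {J : Type*} [Fintype J] {m n M : ℕ} {N F v T T' R0 R K C Q h' : ℝ} {a1 b1 : J → ℝ}
    {P : Fin m → Polynomial ℂ} {b : Coeffs m n} {r : VecFun m}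

variable {x : ℂ} {t : ℝ} {r' : Fin m → TimeFun} {b' : CoeffFam m n TimeFun} {f : VecFun m}

lemma mem_similarityRegion_iff (hf : 0 ≤ F) (hf2 : F ≤ π / 2) (hr : 0 ≤ v) :
    (x, t) ∈ similarityRegion N F v T ↔ t ∈ Ioc 0 T ∧ x ∈ cone (sin F) (v * t ^ (1 / N)) := by
  rw [similarityRegion, mem_ofPred_eq, ← and_assoc]
  refine and_congr_right fun ht => ?_
  have e : v = t ^ (-(1 / N)) * (v * t ^ (1 / N)) := by rw [mul_left_comm, ← rpow_add ht.1]; simp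
  rw [wideSector_eq_cone hf hf2 hr, mul_comm]
  conv_lhs => rw [e]
  exact cone_smul (rpow_pos_of_pos ht.1 _)

lemma vecAbs_le {u : Fin m → ℂ} {c : ℝ} (h : ∀ i, ‖u i‖ ≤ c) : vecAbs u ≤ m * c := by
  simpa [vecAbs] using sum_le_sum fun i (_ : i ∈ Finset.univ) => h i

lemma norm_le_vecAbs (u : Fin m → ℂ) (i : Fin m) : ‖u i‖ ≤ vecAbs u :=
    single_le_sum (fun _ _ => norm_nonneg _) (Finset.mem_univ i)

/-- The coefficients agree with a second family where `‖x‖ > v t^{1/N}`. -/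
def DataAgree (N s v T : ℝ) (b : Coeffs m n) (r : VecFun m) (r' : Fin m → TimeFun)
    (b' : CoeffFam m n TimeFun) : Prop :=
  ∀ t ∈ Ioc 0 T, ∀ x ∈ cone s (v * t ^ (1 / N)),
    (r x t = fun i => r' i x t) ∧ ∀ q k, b q k x t = fun i => b' q k i x t

lemma DataAgree.evolutionRHS_eq {s : ℝ} (h : DataAgree N s v T b r r' b')
    (f : VecFun m) (ht : t ∈ Ioc 0 T)
    (hx : x ∈ cone s (v * t ^ (1 / N))) : evolutionRHS P b r f x t =
    evolutionRHS P (fun q k x t i => b' q k i x t) (fun x t i => r' i x t) f x t := by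
  obtain ⟨h1, h2⟩ := h t ht x hx
  unfold evolutionRHS
  simp only [h1, h2]

lemma EvolutionFam.isSolution (hf : 0 ≤ F) (hf2 : F ≤ π / 2)
    (W : WeightParams a1 b1 M (1 / N) h' K T') {X : Set ℂ} {r' : Fin m → ParamFun}
    {b' : CoeffFam m n ParamFun} {f : ℂ → VecFun m}
    (Hf : EvolutionFam X (sin F) R0 (1 / N) T' C a1 b1 P r' b' f) (hC : 0 ≤ C)
    (hR0 : 0 < R0) (hr : R0 ≤ v) (hT' : T < T') {Y : ℂ} (hY : Y ∈ X)
    (hag : DataAgree N (sin F) v T b r (fun i => r' i Y) fun q k i => b' q k i Y) :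
    IsSolution P b r N F v T (f Y) := by
  have hr0 : 0 < v := hR0.trans_le hr
  have hmem := fun {x : ℂ} {t : ℝ} =>
    mem_similarityRegion_iff (N := N) (T := T) hf hf2 hr0.le (x := x) (t := t)
  have hI : ∀ {t}, t ∈ Ioc 0 T → t ∈ Ioo 0 T' := fun ht => ⟨ht.1, ht.2.trans_lt hT'⟩
  have hreg : ∀ {t : ℝ}, t ∈ Ioc 0 T → cone (sin F) (v * t ^ (1 / N)) ⊆
    cone (sin F) (R0 * t ^ (1 / N)) := fun ht => cone_mono le_rfl
    (mul_le_r hr (rpow_nonneg ht.1.le _))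
  refine ⟨fun t => ?_, ⟨m * (C * ∑ j, T ^ (a1 j - b1 j * (1 / N) + 1 / N) * v ^ (1 - b1 j)), ?_⟩,
    fun x t hx q => ?_, fun x t hx => ?_, fun x hx => ?_⟩
  · intro x hx
    obtain ⟨ht, hx⟩ := hmem.1 hx
    exact ((Hf.holo Y hY t (hI ht)).mono (hreg ht)).mono (fun y hy => (hmem.1 hy).2) x
      (hmem.2 ⟨ht, hx⟩)
  · intro x t hx
    obtain ⟨ht, hx⟩ := hmem.1 hx
    have ht0 := ht.1
    have hx0 := (by positivity : 0 < v * t ^ (1 / N)).trans hx.1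
    refine (mul_le_l (vecAbs_le fun i => Hf.bound Y hY t (hI ht) x (hreg ht hx) i) hx0.le).trans ?_
    rw [mul_left_comm, mul_left_comm ‖x‖, mul_sum]
    refine mul_le_l (mul_le_l (sum_le_sum fun j _ => ?_) hC)
    have h1 : ‖x‖ * ‖x‖ ^ (-b1 j) ≤ (v * t ^ (1 / N)) ^ (1 - b1 j) := by
      rw [mul_comm, ← rpow_add_one hx0.ne']
      exact (rpow_anti (by positivity) hx.1.le
        (by linarith [W.one_le_b j])).trans_eq (by congr 1; ring)
    have h2 : t ^ (a1 j - b1 j * (1 / N) + 1 / N) ≤ T ^ (a1 j - b1 j * (1 / N) + 1 / N) :=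
      rpow_le_rpow ht0.le ht.2 (by linarith [W.le_sub j, W.h'_pos, W.h_pos])
    calc _ = t ^ a1 j * (‖x‖ * ‖x‖ ^ (-b1 j)) := by ring
      _ ≤ t ^ a1 j * (v * t ^ (1 / N)) ^ (1 - b1 j) := mul_le_l h1
      _ = t ^ (a1 j - b1 j * (1 / N) + 1 / N) * v ^ (1 - b1 j) := by
          rw [mul_rpow hr0.le (rpow_pos_of_pos ht0 (1 / N)).le, ← rpow_mul ht0.le, mul_left_comm,
            ← rpow_add ht0, mul_comm]
          congr 2; ring
      _ ≤ _ := mul_le_r h2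
  · obtain ⟨ht, hx⟩ := hmem.1 hx
    refine (Hf.summable Y hY t (hI ht) x (hreg ht hx) q).congr fun k => ?_
    rw [(hag t ht x hx).2 q k]
  · obtain ⟨ht, hx⟩ := hmem.1 hx
    rw [hag.evolutionRHS_eq (f Y) ht hx]
    exact (Hf.equation Y hY t (hI ht) x (hreg ht hx)).hasDerivWithinAt
  · rw [wideSector_eq_cone hf hf2 le_rfl] at hx
    have h1 : ∀ᶠ t in 𝓝[>] 0, t ∈ Ioo 0 T' ∧ x ∈ cone (sin F) (R0 * t ^ (1 / N)) := by
      have hc : Tendsto (fun t => R0 * t ^ (1 / N)) (𝓝[>] 0) (𝓝 0) := by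
        have := ((continuous_rpow_const W.h_pos.le).tendsto 0).const_mul R0
        rw [zero_rpow W.h_pos.ne', mul_zero] at this; exact this.mono_left nhdsWithin_le_nhds
      filter_upwards [Ioo_mem_nhdsGT W.T_pos, hc.eventually (gt_mem_nhds hx.1)] with t h2 h3
        using ⟨h2, h3, hx.2⟩
    have h2 : Tendsto (fun t => C * ∑ j, t ^ a1 j * ‖x‖ ^ (-b1 j)) (𝓝[>] 0) (𝓝 0) := by
      have : Tendsto (fun t => C * ∑ j, t ^ a1 j * ‖x‖ ^ (-b1 j)) (𝓝[>] 0)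
        (𝓝 (C * ∑ j, 0 ^ a1 j * ‖x‖ ^ (-b1 j))) := by
        refine (tendsto_finsetSum _ fun j _ => Tendsto.mul_const _ ?_).const_mul C
        exact ((continuous_rpow_const (W.h'_pos.trans_le (W.le_a j)).le).tendsto 0).mono_left
          nhdsWithin_le_nhds
      simpa [(fun j => zero_rpow (W.h'_pos.trans_le (W.le_a j)).ne')] using this
    exact tendsto_pi_nhds.2 fun i => squeeze_zero_norm'
      (h1.mono fun t ht => Hf.bound Y hY t ht.1 x ht.2 i) h2

lemma hatBound_of_norm_le {E : Exponents m n} (hF : 0 ≤ F) (hF2 : F ≤ π / 2) (hr : 0 < v)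
    (hf : ∀ t ∈ Ioc 0 T, ∀ x ∈ cone (sin F) (v * t ^ (1 / E.nhat)), ∀ i, ‖f x t i‖ ≤
    C * ∑ j : Fin (E.Jr + 1) × Fin (E.K + 1), t ^ (E.γ j.2 * E.deg j.1) *
    ‖x‖ ^ (-(E.β j.2 * E.deg j.1 - E.ω j.1))) :
    HatBound E (fun j => ∑ l, MvPolynomial.C (m * C) * MvPolynomial.X l ^ E.deg j) F v T f := fun z
    hz t ht => by
  have ht0 := ht.1
  have hth := rpow_pos_of_pos ht0 (1 / E.nhat)
  rw [wideSector_eq_cone hF hF2 hr.le] at hz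
  have hz0 := hr.trans hz.1
  refine (vecAbs_le (hf t ht _ (by rw [mul_comm v]; exact (cone_smul hth).2 hz))).trans_eq ?_
  rw [Fintype.sum_prod_type, ← mul_assoc, mul_sum]
  refine sum_congr rfl fun j _ => ?_
  simp only [map_sum, map_mul, map_pow, MvPolynomial.eval_C, MvPolynomial.eval_X, mul_sum]
  refine sum_congr rfl fun l _ => ?_
  rw [norm_mul, norm_coe, mul_rpow hth.le hz0.le, mul_pow,
    ← rpow_natCast, ← rpow_natCast, ← rpow_mul ht0.le, ← rpow_mul ht0.le, ← rpow_mul hz0.le]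
  have e1 : t ^ (E.γ l * E.deg j) * t ^ (1 / E.nhat * -(E.β l * E.deg j - E.ω j)) =
    t ^ (E.ω j / E.nhat) * t ^ ((E.γ l - E.β l / E.nhat) * E.deg j) := by
    rw [← rpow_add ht0, ← rpow_add ht0]; congr 1; ring
  have e2 : ‖z‖ ^ (-(E.β l * E.deg j - E.ω j)) = ‖z‖ ^ E.ω j * ‖z‖ ^ (-E.β l * E.deg j) := by
    rw [← rpow_add hz0]; congr 1; ring
  rw [e2]
  linear_combination m * C * (‖z‖ ^ E.ω j * ‖z‖ ^ (-E.β l * E.deg j)) * e1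

lemma IsSolution.coarseSol (hN : 0 < N) (hf : 0 ≤ F) (hf2 : F ≤ π / 2) (hr : 0 < v) (Hf : IsSolution
    P b r N F v T f)
    (hag : DataAgree N (sin F) v T b r r' b') (hR : v * T ^ (1 / N) ≤ R) (hR0 : 0 < R) :
    ∃ C0, ∀ C, C0 ≤ C → CoarseSol P (sin F) R T C r' b' f := by
  have hmem := fun {x : ℂ} {t : ℝ} =>
    mem_similarityRegion_iff (N := N) (T := T) hf hf2 hr.le (x := x) (t := t)
  have hI : ∀ {t x}, t ∈ Ioo 0 T → x ∈ cone (sin F) R →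
    t ∈ Ioc 0 T ∧ x ∈ cone (sin F) (v * t ^ (1 / N)) := fun ht hx =>
    ⟨⟨ht.1, ht.2.le⟩, cone_mono le_rfl ((mul_le_l
    (rpow_le_rpow ht.1.le ht.2.le (by positivity))).trans hR) hx⟩
  have hder : ∀ {t x}, t ∈ Ioo 0 T → x ∈ cone (sin F) R → HasDerivAt (fun u => f x u)
    (evolutionRHS P (fun q k x t i => b' q k i x t) (fun x t i => r' i x t) f x t) t := fun {t x} ht
    hx => by
    rw [← hag.evolutionRHS_eq f (hI ht hx).1 (hI ht hx).2]
    exact (Hf.equation x t (hmem.2 (hI ht hx))).hasDerivAt (Iic_mem_nhds ht.2)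
  obtain ⟨C1, hC1⟩ := Hf.bounded
  refine ⟨max 0 C1, fun C hC => ⟨(le_max_left _ _).trans hC, fun i => ⟨fun _ _ t ht => ?_,
    fun _ _ _ _ => differentiableOn_const _, fun _ _ x hx t ht => ?_⟩, fun t ht x hx i => ?_,
    fun t ht x hx q => ?_, fun t ht x hx => hder ht hx, fun x hx i => ?_⟩⟩
  · rw [rpow_zero, mul_one]
    exact (differentiableOn_pi.1 (Hf.analytic t) i).mono fun x hx => hmem.2 (hI ht hx)
  · rw [rpow_zero, mul_one] at hx
    exact (hasDerivAt_pi.1 (hder ht hx) i).continuousAt.continuousWithinAt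
  · have h1 := hC1 x t (hmem.2 (hI ht hx))
    rw [rpow_neg_one, ← div_eq_mul_inv, le_div_iff₀ (hR0.trans hx.1), mul_comm]
    exact (mul_le_l (norm_le_vecAbs _ i)).trans (h1.trans ((le_max_right _ _).trans hC))
  · refine (Hf.summable x t (hmem.2 (hI ht hx)) q).congr fun k => ?_
    rw [(hag t (hI ht hx).1 x (hI ht hx).2).2 q k]
  · have := Hf.initial x (by
      rw [wideSector_eq_cone hf hf2 le_rfl]; exact cone_mono le_rfl hR0.le hx)
    exact tendsto_pi_nhds.1 this i

lemma IsSolution.eq_of_isSolution (hn : 0 < n) (hN : 0 < N) (hf : 0 < F) (hf2 : F < π / 2)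
    (hr : 0 < v) {f' : VecFun m} (Hf : IsSolution P b r N F v T f)
    (Hf' : IsSolution P b r N F v T f')
    (hag : DataAgree N (sin F) v T b r r' b') (hR : v * T ^ (1 / N) ≤ R) (hR0 : 0 < R)
    (hk : 0 < K) (hk1 : K ≤ 1) (Hd : CoarseData (sin F) R T K C Q r' b') {c0 : ℝ} (hc0 : 0 < c0)
    (hP : ∀ l, ∀ p : ℂ, |p.arg| ≤ F → c0 * ‖p‖ ^ n ≤ ((P l).coeff n * (-p) ^ n).re)
    (hx : (x, t) ∈ similarityRegion N F v T) : f' x t = f x t := by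
  have hmem := fun {x : ℂ} {t : ℝ} =>
    mem_similarityRegion_iff (N := N) (T := T) hf.le hf2.le hr.le (x := x) (t := t)
  obtain ⟨C1, h1⟩ := Hf.coarseSol hN hf.le hf2.le hr hag hR hR0
  obtain ⟨C2, h2⟩ := Hf'.coarseSol hN hf.le hf2.le hr hag hR hR0
  obtain ⟨c, hc⟩ := Hd.eq_of_solutions hn hf hf2 hR0 hk hk1 hc0 hP (h1 _ (le_max_left C1 C2))
    (h2 _ (le_max_right _ _))
  have hs0 := sin_pos_of_pos_of_lt_pi hf (by linarith)
  have hs1 : sin F < 1 := by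
    have := cos_pos_of_mem_Ioo ⟨by linarith, hf2⟩
    nlinarith [sin_sq_add_cos_sq F]
  have key : ∀ t ∈ Ioo 0 T, ∀ x ∈ cone (sin F) (v * t ^ (1 / N)), f' x t = f x t := fun t ht x hx =>
    by
    set D := cone (sin F) (v * t ^ (1 / N))
    have hrt : 0 ≤ v * t ^ (1 / N) := mul_nonneg hr.le (rpow_nonneg ht.1.le _)
    have hd : ∀ {g : VecFun m}, IsSolution P b r N F v T g →
      AnalyticOnNhd ℂ (fun x => g x t) D := fun Hg =>
      ((Hg.analytic t).mono fun y hy => hmem.2 ⟨⟨ht.1, ht.2.le⟩, hy⟩).analyticOnNhd (isOpen_cone _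
      _)
    set z := ((max c (v * t ^ (1 / N)) + 1 : ℝ) : ℂ) with hz
    have hzc : c < z.re := by simp [hz, (le_max_left c _).trans_lt (lt_add_one _)]
    have hzD : z ∈ D := by
      have h3 : v * t ^ (1 / N) < max c (v * t ^ (1 / N)) + 1 :=
        (le_max_right c _).trans_lt (lt_add_one _)
      have h4 : 0 < max c (v * t ^ (1 / N)) + 1 := hrt.trans_lt h3
      refine ⟨?_, ?_⟩
      · rwa [hz, norm_coe]
      · rw [hz, norm_coe, ofReal_re]
        nlinarith
    refine (hd Hf').eqOn_of_preconnected_of_eventuallyEq (hd Hf)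
      (isPreconnected_cone hs0.le hs1 hrt) hzD ?_ hx
    filter_upwards [continuous_re.continuousAt.eventually (lt_mem_nhds hzc)] with y hy
      using (hc t ht y hy).symm
  obtain ⟨ht, hx'⟩ := hmem.1 hx
  rcases ht.2.lt_or_eq with h | rfl
  · exact key t ⟨ht.1, h⟩ x hx'
  · have hlim : ∀ {g : VecFun m}, IsSolution P b r N F v t g →
      Tendsto (fun u => g x u) (𝓝[<] t) (𝓝 (g x t)) := fun Hg =>
      (Hg.equation x t hx).continuousWithinAt.mono_left (nhdsWithin_mono _ Iio_subset_Iic_self)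
    refine tendsto_nhds_unique (hlim Hf') ((hlim Hf).congr' ?_)
    filter_upwards [Ioo_mem_nhdsLT ht.1] with u hu
    refine (key u hu x (cone_mono le_rfl (mul_le_l
      (rpow_le_rpow hu.1.le hu.2.le (by positivity))) hx')).symm

end

section

variable {m n : ℕ}

variable {Y : ℂ} {s' T0 : ℝ}

/-- The pairs `(x,t)`, `t < T`, with `x` in a sector and all `t^{γ_l}|x|^{-β_l}` below `y`. -/
def rawRegion (E : Exponents m n) (s y T : ℝ) : Set (ℂ × ℝ) :=
  {z | z.1 ∈ cone s 0 ∧ z.2 ∈ Ioo 0 T ∧ ∀ l, z.2 ^ E.γ l * ‖z.1‖ ^ (-E.β l) < y}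

/-- Regularity of a function of `y`, `x`, `t`. -/
structure RawFun (X : Set ℂ) (S : Set (ℂ × ℝ)) (g : ParamFun) : Prop where
  holo : ∀ Y ∈ X, ∀ x t, (x, t) ∈ S → DifferentiableAt ℂ (fun x => g Y x t) x
  holo_param : ∀ x t, (x, t) ∈ S → DifferentiableOn ℂ (fun Y => g Y x t) X
  cont : ∀ Y ∈ X, ∀ x t, (x, t) ∈ S → ContinuousAt (g Y x) t

/-- The exponent of a term of the bound of `b_{q,k}`. -/
def Exponents.e (E : Exponents m n) (q : DerivIdx m n) (k : Fin m → ℕ)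
    (j : Fin (E.J q + 1)) : ℝ := E.α q j + E.βk * multiSize k

/-- Bounds of the data of a system which holds in both settings. -/
structure RawData (E : Exponents m n) (nz : DerivIdx m n → (Fin m → ℕ) → Prop) (X : Set ℂ)
    (s y T A B : ℝ) (r : Fin m → ParamFun)
    (b : CoeffFam m n ParamFun) : Prop where
  adm : E.Admissible nz
  δ_pos : 0 < y
  T_pos : 0 < T
  A_nonneg : 0 ≤ A
  one_le_B : 1 ≤ B
  r_fun : ∀ i, RawFun X (rawRegion E s y T) (r i)
  b_fun : ∀ q k i, RawFun X (rawRegion E s y T) (b q k i)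
  r_bound : ∀ i, ∀ Y ∈ X, ∀ x t, (x, t) ∈ rawRegion E s y T → ‖r i Y x t‖ ≤
    A * t⁻¹ * ∑ j, ‖x‖ ^ E.ω j * ∑ l, (t ^ E.γ l * ‖x‖ ^ (-E.β l)) ^ E.deg j
  b_bound : ∀ q k i, nz q k → ∀ Y ∈ X, ∀ x t, (x, t) ∈ rawRegion E s y T → ‖b q k i Y x t‖ ≤
    A * B ^ multiSize k * ∑ j, if 0 < E.e q k j then ‖x‖ ^ (-E.e q k j) else
      ∑ l, t ^ E.γ l * ‖x‖ ^ (-E.β l)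
  b_zero : ∀ q k i, ¬ nz q k → ∀ Y x t, b q k i Y x t = 0
  nz_zero : ∀ q k, multiSize k + q.size = 0 → ¬ nz q k

/-- The conditions on the decay exponent of the coefficients. -/
structure DecayExponent (E : Exponents m n) (K : ℝ) : Prop where
  pos : 0 < K
  le_one : K ≤ 1
  le_β : ∀ l, K ≤ E.β l
  le_e : ∀ q k j, 0 < E.e q k j → K ≤ E.e q k j

lemma Exponents.Admissible.exists_decayExponent {E : Exponents m n}
    {nz : DerivIdx m n → (Fin m → ℕ) → Prop} (H : E.Admissible nz) : ∃ K, DecayExponent E K := by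
  have hbk := H.βk_cond.elim le_of_lt fun h => h.1.ge
  obtain ⟨K, hk, h⟩ := exists_common_pos
    (a := Unit ⊕ Fin (E.K + 1) ⊕ ((q : DerivIdx m n) × Fin (E.J q + 1)))
    (p := Sum.elim (fun _ K => K ≤ 1) (Sum.elim (fun l K => K ≤ E.β l)
    fun p K => ∀ N : ℕ, 0 < E.α p.1 p.2 + E.βk * N → K ≤ E.α p.1 p.2 + E.βk * N)) (by
    rintro (_ | l | p)
    · exact ⟨1, one_pos, fun c _ h => h⟩
    · exact ⟨E.β l, H.β_pos l, fun c _ h => h⟩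
    · classical
      by_cases hp : ∃ N : ℕ, 0 < E.α p.1 p.2 + E.βk * N
      · refine ⟨_, Nat.find_spec hp, fun c _ hc N hN => hc.trans ?_⟩
        have : ((Nat.find hp) : ℝ) ≤ N := by exact_mod_cast Nat.find_min' hp hN
        nlinarith
      · exact ⟨1, one_pos, fun c _ _ N hN => absurd ⟨N, hN⟩ hp⟩)
  exact ⟨K, hk, h (Sum.inl ()), fun l => h (Sum.inr (Sum.inl l)),
    fun q k j => h (Sum.inr (Sum.inr ⟨q, j⟩)) (multiSize k)⟩

/-- The exponents of `t` and `1/|x|` in the bound of the solution. -/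
def Exponents.timeExp (E : Exponents m n) (p : Fin (E.Jr + 1) × Fin (E.K + 1)) : ℝ :=
  E.γ p.2 * E.deg p.1

/-- See `Exponents.timeExp`. -/
def Exponents.spaceExp (E : Exponents m n) (p : Fin (E.Jr + 1) × Fin (E.K + 1)) : ℝ :=
  E.β p.2 * E.deg p.1 - E.ω p.1

variable {E : Exponents m n} {nz : DerivIdx m n → (Fin m → ℕ) → Prop} {X : Set ℂ}
    {s y T A B K R h0 : ℝ} {r : Fin m → ParamFun} {b : CoeffFam m n ParamFun}

lemma Exponents.Admissible.γ_nonneg (H : E.Admissible nz) (l : Fin (E.K + 1)) :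
    1 / E.nhat * E.β l ≤ E.γ l := by
  have h1 := H.ratio_anti (Fin.zero_le l)
  have h3 : 0 < E.nhat := div_pos (H.β_pos 0) (H.γ_pos 0)
  rw [div_le_iff₀ (H.γ_pos l)] at h1; rw [one_div, inv_mul_le_iff₀ h3]
  exact h1

lemma Exponents.Admissible.weightParams (H : E.Admissible nz) (hk : DecayExponent E K)
    (hT : 0 < T) : ∃ M, WeightParams E.timeExp E.spaceExp M (1 / E.nhat) (E.ω 0 / E.nhat) K T := by
  have hN : 0 < E.nhat := div_pos (H.β_pos 0) (H.γ_pos 0)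
  obtain ⟨M, hM⟩ := exists_nat_ge_add_one E.spaceExp
  refine ⟨M, one_div_pos.2 hN, div_pos (H.ω_pos 0) hN, hk.pos, hk.le_one, hT, fun p => ?_, hM,
    fun p => ?_⟩
  · have := H.deg_cond p.1 p.2
    rw [Exponents.spaceExp]; linarith
  · have h1 := mul_le_r (H.γ_nonneg p.2) (Nat.cast_nonneg (α := ℝ) (E.deg p.1))
    have h2 := div_le_div_of_nonneg_right (H.ω_mono.monotone (Fin.zero_le p.1)) hN.le
    rw [Exponents.spaceExp, Exponents.timeExp]
    have : (E.β p.2 * E.deg p.1 - E.ω p.1) * (1 / E.nhat) =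
      1 / E.nhat * E.β p.2 * E.deg p.1 - E.ω p.1 / E.nhat := by ring
    linarith

lemma RawData.r_le (H : RawData E nz X s y T A B r b) (i : Fin m) (hY : Y ∈ X) {x : ℂ}
    {t : ℝ} (hx : (x, t) ∈ rawRegion E s y T) :
    ‖r i Y x t‖ ≤ A * t⁻¹ * ∑ p, t ^ E.timeExp p * ‖x‖ ^ (-E.spaceExp p) := by
  have hx0 := hx.1.1
  refine (H.r_bound i Y hY x t hx).trans_eq ?_
  rw [Fintype.sum_prod_type]; congr 1
  refine sum_congr rfl fun j _ => ?_
  rw [mul_sum]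
  refine sum_congr rfl fun l _ => ?_
  rw [Exponents.timeExp, Exponents.spaceExp, mul_pow, ← rpow_natCast, ← rpow_natCast,
    ← rpow_mul hx.2.1.1.le, ← rpow_mul hx0.le, mul_left_comm, ← rpow_add hx0]
  congr 2; ring

lemma RawData.b_le (H : RawData E nz X s y T A B r b) (hk : DecayExponent E K)
    (hg : ∀ l, h0 * E.β l ≤ E.γ l) : ∃ L, 0 ≤ L ∧ ∀ R, 1 ≤ R → ∀ q k i, nz q k → ∀ Y ∈ X, ∀ x t,
    (x, t) ∈ rawRegion E s y T → R * t ^ h0 < ‖x‖ → ‖b q k i Y x t‖ ≤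
    A * B ^ multiSize k * ∑ j, L * (t ^ (h0 * (K - E.e q k j)) * ‖x‖ ^ (-K)) := by
  have hT := H.T_pos
  have hA := H.A_nonneg
  have hB := H.one_le_B
  refine ⟨1 + ∑ l, T ^ (E.γ l - h0 * E.β l), by positivity, fun R hR q k i hq Y hY x t hx hRx =>
    (H.b_bound q k i hq Y hY x t hx).trans (mul_le_l (sum_le_sum fun j _ => ?_))⟩
  have ht := hx.2.1.1
  have hth := rpow_pos_of_pos ht h0
  have key : ∀ d, K ≤ d → ‖x‖ ^ (-d) ≤ t ^ (h0 * (K - d)) * ‖x‖ ^ (-K) := fun d hd => by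
    have e : ‖x‖ ^ (-d) = ‖x‖ ^ (K - d) * ‖x‖ ^ (-K) := by rw [← rpow_add hx.1.1]; congr 1; ring
    rw [e, rpow_mul ht.le]
    exact mul_le_r (rpow_anti hth ((le_mul_of_one_le_left hth.le hR).trans hRx.le) (by linarith))
  have hS : 0 ≤ ∑ l, T ^ (E.γ l - h0 * E.β l) := by positivity
  split_ifs with he
  · exact (key _ (hk.le_e q k j he)).trans (le_mul_of_one_le_left (by positivity) (by linarith))
  · have he0 := le_antisymm (not_lt.1 he) (H.adm.α_cond q k hq j)
    refine le_trans ?_ (mul_le_r (le_add_of_nonneg_left zero_le_one))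
    rw [sum_mul]
    refine sum_le_sum fun l _ => ?_
    rw [he0]
    calc _ ≤ t ^ E.γ l * (t ^ (h0 * (K - E.β l)) * ‖x‖ ^ (-K)) := mul_le_l (key _ (hk.le_β l))
      _ = t ^ (E.γ l - h0 * E.β l) * (t ^ (h0 * (K - 0)) * ‖x‖ ^ (-K)) := by
          rw [← mul_assoc, ← mul_assoc, ← rpow_add ht, ← rpow_add ht]; congr 2; ring
      _ ≤ _ := mul_le_r (rpow_le_rpow ht.le hx.2.1.2.le (sub_nonneg.2 (hg l)))

lemma Exponents.Admissible.exists_radius (H : E.Admissible nz) (hd : 0 < y) (T : ℝ) :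
    ∃ R1, 1 ≤ R1 ∧ ∀ R, R1 ≤ R → ∀ h0, 0 ≤ h0 → (∀ l, h0 * E.β l ≤ E.γ l) → ∀ t ∈ Ioo 0 T,
    ∀ x ∈ cone s (R * t ^ h0), (x, t) ∈ rawRegion E s y T := by
  have hev := eventually_all.2 fun l => by
      have := (tendsto_rpow_neg_atTop (H.β_pos l)).const_mul ((max T 1) ^ E.γ l)
      rw [mul_zero] at this; exact this.eventually (gt_mem_nhds hd)
  obtain ⟨R1, h1⟩ := eventually_atTop.1 (hev.and (eventually_ge_atTop 1))
  refine ⟨R1, (h1 R1 le_rfl).2, fun R hR h0 hh0 hg t ht x hx => ?_⟩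
  obtain ⟨h2, h3⟩ := h1 R hR
  have ht0 := ht.1
  have hRt : 0 < R * t ^ h0 := by positivity
  refine ⟨⟨hRt.trans hx.1, hx.2⟩, ht, fun l => lt_of_le_of_lt ?_ (h2 l)⟩
  calc _ ≤ t ^ E.γ l * (R * t ^ h0) ^ (-E.β l) := mul_le_l (rpow_anti hRt hx.1.le
    (by linarith [H.β_pos l]))
    _ = t ^ (E.γ l - h0 * E.β l) * R ^ (-E.β l) := by
        rw [mul_rpow (by linarith) (rpow_pos_of_pos ht0 h0).le, ← rpow_mul ht0.le, mul_left_comm,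
          ← rpow_add ht0, mul_comm]
        congr 2; ring
    _ ≤ _ := mul_le_r ((rpow_le_rpow ht0.le
      (ht.2.le.trans (le_max_left _ _)) (sub_nonneg.2 (hg l))).trans
      (rpow_le_rpow_of_exponent_le (le_max_right _ _) (by
          linarith [mul_nonneg hh0 (H.β_pos l).le])))

lemma RawFun.sectorFun {g : ParamFun} {h : ℝ}
    (hg : RawFun X (rawRegion E s y T) g) (hR : 0 ≤ R) (hh : 0 ≤ h)
    (hS : ∀ t ∈ Ioo 0 T0, ∀ x ∈ cone s' (R * t ^ h), (x, t) ∈ rawRegion E s y T) :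
    SectorFun X s' R h T0 g :=
    ⟨fun Y hY t ht x hx => (hg.holo Y hY x t (hS t ht x hx)).differentiableWithinAt,
    fun t ht x hx => hg.holo_param x t (hS t ht x hx),
    fun Y hY x hx t ht => (hg.cont Y hY x t (hS t ht x (cone_mono le_rfl
    (mul_le_l (rpow_le_rpow ht.1.le ht.2.le hh)) hx))).continuousWithinAt⟩

lemma RawData.exists_sectorData (H : RawData E nz X s y T A B r b) (hk : DecayExponent E K) :
    ∃ R C Q, 0 < R ∧ SectorData X s R (1 / E.nhat) (E.ω 0 / E.nhat) K T C Q E.timeExp E.spaceExp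
    r b := by
  have hA := H.A_nonneg
  have hB := H.one_le_B
  have hN : 0 < E.nhat := div_pos (H.adm.β_pos 0) (H.adm.γ_pos 0)
  have hh := one_div_pos.2 hN
  obtain ⟨R, hR1, hR⟩ := H.adm.exists_radius H.δ_pos T
  have hreg := hR R le_rfl _ hh.le H.adm.γ_nonneg
  obtain ⟨L, hL, hb⟩ := H.b_le hk H.adm.γ_nonneg
  set T1 := max T 1
  have hT1 : 1 ≤ T1 := le_max_right _ _
  obtain ⟨D, hD⟩ : ∃ D : (q : DerivIdx m n) → Fin (E.J q + 1) → ℝ, ∀ q j, D q j =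
    T1 ^ (1 / E.nhat * (E.nhat + E.ω 0 * q.size + |E.α q j|)) := ⟨_, fun _ _ => rfl⟩
  set Q1 := T1 ^ (1 / E.nhat * E.ω 0) with hQ1
  have hQ11 : 1 ≤ Q1 := one_le_rpow hT1 (by have := H.adm.ω_pos 0; positivity)
  have hD0 : ∀ q j, 0 ≤ D q j := fun q j => by rw [hD]; positivity
  obtain ⟨S, hS⟩ : ∃ S, S = ∑ q, ∑ j, D q j := ⟨_, rfl⟩
  have hS0 := hS ▸ sum_nonneg fun q _ => sum_nonneg fun j _ => hD0 q j
  refine ⟨R, A * (1 + L * S), B * Q1, by linarith, ?_, one_le_mul_of_one_le_of_one_le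
    hB hQ11, fun i => (H.r_fun i).sectorFun (by linarith) hh.le hreg,
    fun q k i => (H.b_fun q k i).sectorFun (by linarith) hh.le hreg, fun i Y hY t ht x hx => ?_,
    fun q k i Y hY t ht x hx => ?_, fun q k i h Y x t => H.b_zero q k i (H.nz_zero q k h) Y x t⟩
  · positivity
  · have ht0 := ht.1
    refine (H.r_le i hY (hreg t ht x hx)).trans (mul_le_r (mul_le_r ?_))
    exact le_mul_of_one_le_right hA (le_add_of_nonneg_right (by positivity))
  · have ht0 := ht.1
    by_cases hq : nz q k
    swap
    · rw [H.b_zero q k i hq Y x t, norm_zero]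
      positivity
    refine (hb R hR1 q k i hq Y hY x t (hreg t ht x hx) hx.1).trans ?_
    have key : ∀ j, t ^ (1 / E.nhat * (K - E.e q k j)) ≤ D q j * Q1 ^ multiSize k *
      t ^ coeffExp (1 / E.nhat) (E.ω 0 / E.nhat) K q k := fun j => by
      have hm := H.adm.m_cond q k hq
      have ha := (H.adm.α_anti q).antitone (Fin.zero_le j)
      have hbk := H.adm.βk_cond.elim le_of_lt fun h => h.1.ge
      have hk0 : 0 ≤ E.βk * multiSize k := by positivity
      have ho : 0 ≤ E.nhat / n * q.order := by positivity
      have hw := H.adm.ω_pos 0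
      have e : 1 / E.nhat * (K - E.e q k j) = coeffExp (1 / E.nhat) (E.ω 0 / E.nhat) K q k +
        1 / E.nhat * (E.mqk q k + E.α q 0 - E.α q j) := by
        rw [coeffExp, Exponents.mqk, Exponents.e]
        field_simp; ring
      have hd : 0 ≤ 1 / E.nhat * (E.mqk q k + E.α q 0 - E.α q j) := mul_nonneg hh.le (by linarith)
      rw [e, rpow_add ht0, mul_comm, hQ1, hD, ← rpow_natCast,
        ← rpow_mul (zero_le_one.trans hT1), ← rpow_add (one_pos.trans_le hT1)]
      refine mul_le_r ((rpow_le_rpow ht0.le (ht.2.le.trans (le_max_left _ _))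
        hd).trans (rpow_le_rpow_of_exponent_le hT1 ?_))
      rw [mul_assoc, ← mul_add]
      refine mul_le_l ?_
      rw [Exponents.mqk]; linarith [neg_le_abs (E.α q j)]
    have hsum : ∑ j, t ^ (1 / E.nhat * (K - E.e q k j)) ≤ S * Q1 ^ multiSize k *
      t ^ coeffExp (1 / E.nhat) (E.ω 0 / E.nhat) K q k := by
      refine (sum_le_sum fun j _ => key j).trans ?_
      rw [← sum_mul, ← sum_mul, hS]
      have := single_le_sum (f := fun q => ∑ j, D q j)
        (fun q _ => sum_nonneg fun j _ => hD0 q j) (Finset.mem_univ q)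
      gcongr
    rw [← mul_sum, ← sum_mul, mul_pow]
    calc _ ≤ A * B ^ multiSize k * (L * (S * Q1 ^ multiSize k *
      t ^ coeffExp (1 / E.nhat) (E.ω 0 / E.nhat) K q k * ‖x‖ ^ (-K))) := by gcongr
      _ = A * (L * S) * (B ^ multiSize k * Q1 ^ multiSize k *
        t ^ coeffExp (1 / E.nhat) (E.ω 0 / E.nhat) K q k * ‖x‖ ^ (-K)) := by ring
      _ ≤ A * (1 + L * S) * (B ^ multiSize k * Q1 ^ multiSize k *
        t ^ coeffExp (1 / E.nhat) (E.ω 0 / E.nhat) K q k * ‖x‖ ^ (-K)) := by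
          gcongr
          linarith
      _ = _ := by ring

lemma RawData.exists_coarseData (H : RawData E nz X s y T A B r b) (hk : DecayExponent E K) (hY : Y
    ∈ X) (hs' : s' ≤ s) (hT0 : T0 ≤ T) :
    ∃ R1, 0 < R1 ∧ ∀ R, R1 ≤ R → ∃ C, CoarseData s' R T0 K C B (fun i => r i Y)
    (fun q k i => b q k i Y) := by
  have hA := H.A_nonneg
  have hB := H.one_le_B
  have hG : ∀ l, 0 * E.β l ≤ E.γ l := fun l => by rw [zero_mul]; exact (H.adm.γ_pos l).le
  obtain ⟨R1, hR1, hR⟩ := H.adm.exists_radius H.δ_pos T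
  obtain ⟨L, hL, hb⟩ := H.b_le hk hG
  obtain ⟨M, W⟩ := H.adm.weightParams hk H.T_pos
  refine ⟨R1, by linarith, fun R hR1' => ?_⟩
  have hR0 := hR1.trans hR1'
  have hreg := fun t (ht : t ∈ Ioo 0 T0) x hx => hR R hR1' 0 le_rfl hG t
    ⟨ht.1, ht.2.trans_le hT0⟩ x (cone_mono hs' le_rfl hx)
  have hreg' := fun t ht x hx => hreg t ht x (by simpa using hx)
  have hfun : ∀ {g : ParamFun}, RawFun X (rawRegion E s y T) g →
    SectorFun univ s' R 0 T0 (fun _ => g Y) := fun hg =>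
    (⟨fun _ _ => hg.holo Y hY, fun _ _ _ => differentiableOn_const _,
    fun _ _ => hg.cont Y hY⟩ : RawFun univ _ _).sectorFun (by linarith) le_rfl hreg
  refine ⟨A * (L * ∑ q, ((E.J q : ℝ) + 1)), by positivity, hB, fun i => hfun (H.r_fun i),
    fun i t1 t2 h1 h2 => ⟨A * t1⁻¹ * ∑ p, T ^ E.timeExp p, ?_, fun _ _ t ht x hx => ?_⟩,
    fun q k i => hfun (H.b_fun q k i), fun q k i t ht x hx => ?_,
    fun q k i h t _ x _ => H.b_zero q k i (H.nz_zero q k h) Y x t⟩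
  · have := H.T_pos
    positivity
  · have ht' : t ∈ Ioo 0 T0 := ⟨h1.trans_le ht.1, ht.2.trans_lt h2⟩
    have ht0 := ht'.1
    have hT := H.T_pos
    refine (H.r_le i hY (hreg t ht' x hx)).trans ?_
    rw [mul_assoc _ (∑ p, _), sum_mul]
    refine mul_le_lr (mul_le_l (inv_anti₀ h1 ht.1) hA)
      (sum_le_sum fun p _ => mul_le_lr (rpow_le_rpow ht0.le (ht'.2.le.trans hT0)
      (W.h'_pos.trans_le (W.le_a p)).le) (rpow_le_rpow_of_exponent_le (hR0.trans
      (by simpa using hx.1.le)) (neg_le_neg (W.one_le_b p))))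
  · by_cases hq : nz q k
    swap
    · rw [H.b_zero q k i hq Y x t, norm_zero]
      positivity
    refine (hb R hR0 q k i hq Y hY x t (hreg' t ht x hx) (by simpa using hx.1)).trans ?_
    have h1 := single_le_sum (f := fun q => (E.J q : ℝ) + 1)
      (fun q _ => by positivity) (Finset.mem_univ q)
    simp
    calc _ = A * (L * ((E.J q : ℝ) + 1)) * B ^ multiSize k * ‖x‖ ^ (-K) := by ring
      _ ≤ _ := by gcongr

end

section

variable {m n : ℕ}

lemma exists_contour {f f1 : ℝ} (hf : 0 < f) (hf1 : f < f1) (hf12 : f1 < π / 2)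
    (P : Fin m → Polynomial ℂ)
    (hP : ∀ l, ∀ p : ℂ, p ≠ 0 → |p.arg| ≤ f → 0 < ((P l).coeff n * (-p) ^ n).re) :
    ∃ o d c C0 e : ℝ, (∀ R, 0 < R → Contour (sin f1) R o) ∧ 0 < d ∧ 0 < c ∧ 0 ≤ C0 ∧
    0 < e ∧ (∀ l, ∀ p : ℂ, |p.arg| ≤ f → c * ‖p‖ ^ n ≤ ((P l).coeff n * (-p) ^ n).re) ∧
    (∀ l, ∀ p ∈ dualCone o d, c / 2 * ‖p‖ ^ n - C0 ≤ (symbol n (P l) p).re) ∧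
    ∀ x ∈ cone (sin f) 0, ∃ w ∈ dualCone o d, ‖w‖ = 1 ∧ e * ‖x‖ ≤ (w * x).re := by
  obtain ⟨o, c, h1, h2, hc, hlb⟩ := exists_leading_lower_bound hf hf1 (by linarith) P hP
  have hs : ∀ {x y : ℝ}, 0 ≤ x → x < y → y ≤ f1 → sin x < sin y := fun h1 h2 h3 =>
    sin_lt_sin_of_lt_of_le_pi_div_two (by linarith) (by linarith) h2
  have hcos : ∀ {x : ℝ}, 0 < x → x ≤ f1 → 0 < cos x := fun h1 h2 =>
    cos_pos_of_mem_Ioo ⟨by linarith, by linarith⟩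
  have hd : 0 < sin (o - (f + o) / 2) := sin_pos_of_pos_of_lt_pi (by linarith) (by linarith)
  obtain ⟨e, he, hvis⟩ := exists_dualCone_re_ge hf (by linarith) (by linarith) (half_lt_self hd)
  obtain ⟨C0, hC0, hsym⟩ := exists_symbol_lower_bound hc P fun l p hp => hlb l p
    (abs_arg_lt_of_mem_dualCone (half_pos hd).le (by linarith) (by linarith) hp).le
  refine ⟨o, _, c, C0, e, fun R hR => ⟨hcos (by linarith) h2.le, ?_, hs (by linarith) h2 le_rfl, ?_,
    hR⟩, half_pos hd, hc, hC0, he, fun l p hp => hlb l p (hp.trans h1.le), hsym, hvis⟩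
  · exact sin_pos_of_pos_of_lt_pi (by linarith) (by linarith)
  · have := hcos (hf.trans hf1) le_rfl
    nlinarith [sin_sq_add_cos_sq f1]

lemma isHomogeneous_sum_X_pow {S : Type*} [Fintype S] {c : ℝ} (hc : 0 ≤ c) (d : ℕ) :
    (∑ l : S, MvPolynomial.C c * MvPolynomial.X l ^ d : MvPolynomial S ℝ).IsHomogeneous d ∧
    NonnegCoeffs (∑ l : S, MvPolynomial.C c * MvPolynomial.X l ^ d : MvPolynomial S ℝ) := by
  classical
  refine ⟨MvPolynomial.IsHomogeneous.sum _ _ _ fun l _ => ?_, fun s => ?_⟩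
  · simpa using (MvPolynomial.isHomogeneous_C S c).mul (MvPolynomial.isHomogeneous_X_pow l d)
  · rw [MvPolynomial.coeff_sum]
    refine sum_nonneg fun l _ => ?_
    rw [MvPolynomial.coeff_C_mul, MvPolynomial.coeff_X_pow]
    split_ifs <;> simp [hc]

lemma RawData.exists_solutions {E : Exponents m n} {nz : DerivIdx m n → (Fin m → ℕ) → Prop}
    {X : Set ℂ} {f f1 d T T' A B : ℝ} {r : Fin m → ParamFun}
    {b : CoeffFam m n ParamFun} (hn : 0 < n) (hX : IsOpen X)
    (hf : 0 < f) (hf1 : f < f1) (hf12 : f1 < π / 2) (P : Fin m → Polynomial ℂ)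
    (hP : ∀ l, ∀ p : ℂ, p ≠ 0 → |p.arg| ≤ f → 0 < ((P l).coeff n * (-p) ^ n).re)
    (H : RawData E nz X (sin f1) d T' A B r b) (hT : 0 < T) (hT' : T < T') :
    ∃ g : Fin (E.Jr + 1) → MvPolynomial (Fin (E.K + 1)) ℝ,
    (∀ j, (g j).IsHomogeneous (E.deg j) ∧ NonnegCoeffs (g j)) ∧ ∃ ρ0 : ℝ, 0 < ρ0 ∧
    ∃ F : ℂ → VecFun m, (∀ y ∈ X, ∀ ρ, ρ0 ≤ ρ → ∀ b0 r0,
    (∀ x t, x ∈ cone (sin f) 0 → t ≤ T → (x, t) ∈ rawRegion E (sin f1) d T' →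
    (r0 x t = fun i => r i y x t) ∧ ∀ q k, b0 q k x t = fun i => b q k i y x t) →
    IsUniqueBoundedSolution P E b0 r0 g f ρ T (F y)) ∧ (∀ x ∈ cone (sin f) (ρ0 * T ^ (1 / E.nhat)),
    DifferentiableOn ℂ (fun y => F y x T) X) ∧ (∀ y ∈ X, DifferentiableOn ℂ (fun x => F y x T)
    (cone (sin f) (ρ0 * T ^ (1 / E.nhat)))) ∧
    ∃ M, ∀ y ∈ X, ∀ x ∈ cone (sin f) (ρ0 * T ^ (1 / E.nhat)), ∀ i, ‖F y x T i‖ ≤ M := by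
  obtain ⟨o, d', c, C0, e, hcp, hd', hc, hC0, he, hlead, hlb, hvis⟩ :=
    exists_contour hf hf1 hf12 P hP
  obtain ⟨K, hK⟩ := H.adm.exists_decayExponent
  obtain ⟨R, C, Q, hR, Hs⟩ := H.exists_sectorData hK
  obtain ⟨M, W⟩ := H.adm.weightParams hK H.T_pos
  have hN := div_pos (H.adm.β_pos 0) (H.adm.γ_pos 0)
  obtain ⟨R0, C', hR0, hC', F, HF⟩ := Hs.exists_solution hn hX (hcp R hR) hd' W P (half_pos hc)
    hC0 hlb he hvis
  obtain ⟨R1, hR1, hreg⟩ := H.adm.exists_radius H.δ_pos T'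
  have hsin := sin_le_sin_of_le_of_le_pi_div_two (by linarith) hf12.le hf1.le
  have hf2 := hf1.trans hf12
  set ρ0 := max R0 R1
  have hρR : R0 ≤ ρ0 := le_max_left _ _
  have hρ0 : 0 < ρ0 := hR0.trans_le hρR
  have hTI : T ∈ Ioo 0 T' := ⟨hT, hT'⟩
  have hth := rpow_pos_of_pos hT (1 / E.nhat)
  have hsub : cone (sin f) (ρ0 * T ^ (1 / E.nhat)) ⊆
    cone (sin f) (R0 * T ^ (1 / E.nhat)) := cone_mono le_rfl (mul_le_r hρR)
  refine ⟨_, fun j => isHomogeneous_sum_X_pow (c := m * C') (by positivity) (E.deg j), ρ0, hρ0, F,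
    fun y hy ρ hρ b0 r0 hag => ?_, fun x hx => HF.holo_param T hTI x (hsub hx),
    fun y hy => (HF.holo y hy T hTI).mono hsub,
    C' * ∑ p, T ^ E.timeExp p * (ρ0 * T ^ (1 / E.nhat)) ^ (-E.spaceExp p), fun y hy x hx i =>
    (HF.bound y hy T hTI x (hsub hx) i).trans (mul_le_l (sum_le_sum
    fun p _ => mul_le_l (rpow_anti (by positivity) hx.1.le (by linarith [W.one_le_b p]))))⟩
  have hρ' := hρ0.trans_le hρ
  have hag' : DataAgree E.nhat (sin f) ρ T b0 r0 (fun i => r i y) fun q k i => b q k i y :=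
    fun t ht x hx => hag x t ⟨lt_of_le_of_lt (mul_nonneg hρ'.le (rpow_nonneg ht.1.le _)) hx.1,
    hx.2⟩ ht.2 (hreg ρ ((le_max_right _ _).trans hρ) _ ((one_div_pos.2 hN).le) H.adm.γ_nonneg t
    ⟨ht.1, ht.2.trans_lt hT'⟩ x (cone_mono hsin le_rfl hx))
  have hsol := HF.isSolution hf.le hf2.le W hC' hR0 (hρR.trans hρ) hT' hy hag'
  obtain ⟨R2, hR2, hcd⟩ := H.exists_coarseData hK hy hsin hT'.le
  obtain ⟨Cc, Hd⟩ := hcd (max R2 (ρ * T ^ (1 / E.nhat))) (le_max_left _ _)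
  refine ⟨hsol, fun f' hf' x t hx => hsol.eq_of_isSolution hn hN hf hf2 hρ' hf' hag'
    (le_max_right _ _) (hR2.trans_le (le_max_left _ _)) hK.pos hK.le_one Hd hc hlead hx,
    hatBound_of_norm_le hf.le hf2.le hρ' fun t ht x hx i => ?_⟩
  exact HF.bound y hy t ⟨ht.1, ht.2.trans_lt hT'⟩ x (cone_mono le_rfl
    (mul_le_r (hρR.trans hρ) (rpow_nonneg ht.1.le _)) hx) i

end

section

variable {y : Type*} [Fintype y]

lemma NonnegCoeffs.eval_mono {p : MvPolynomial y ℝ} (hp : NonnegCoeffs p) {z w : y → ℝ}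
    (hz : ∀ l, 0 ≤ z l) (hzw : ∀ l, z l ≤ w l) : eval z p ≤ eval w p := by
  exact sum_le_sum fun s _ => mul_le_l (prod_le_prod
    (fun l _ => pow_nonneg (hz l) _) fun l _ => pow_le_pow_left₀ (hz l) (hzw l) _) (hp s)

lemma NonnegCoeffs.eval_le_pow_mul {p : MvPolynomial y ℝ} (hp : NonnegCoeffs p) {d : ℕ}
    {z : y → ℝ} {u c : ℝ} (hz : ∀ l, 0 ≤ z l) (hzu : ∀ l, z l ≤ u * c) (hc : 0 ≤ c)
    (hd : ∀ s, p.coeff s ≠ 0 → u ^ (∑ l, s l) ≤ u ^ d) :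
    eval z p ≤ u ^ d * eval (fun _ => c) p := by
  refine (hp.eval_mono hz hzu).trans ?_
  rw [eval_eq', eval_eq', mul_sum]
  refine sum_le_sum fun s hs => ?_
  simp only [mul_pow, prod_mul_distrib, prod_pow_eq_pow_sum]; rw [mul_left_comm]
  exact mul_le_r (hd s (MvPolynomial.mem_support_iff.1 hs)) (mul_nonneg (hp s) (by positivity))

lemma NonnegCoeffs.eval_nonneg {p : MvPolynomial y ℝ} (hp : NonnegCoeffs p) {z : y → ℝ}
    (hz : ∀ l, 0 ≤ z l) : 0 ≤ eval z p := by
  exact sum_nonneg fun s _ => mul_nonneg (hp s) (Finset.prod_nonneg fun l _ => pow_nonneg (hz l) _)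

lemma NonnegCoeffs.eval_le_of_isHomogeneous [Nonempty y] {p : MvPolynomial y ℝ}
    (hp : NonnegCoeffs p) {d : ℕ} (hd : p.IsHomogeneous d) {z : y → ℝ} (hz : ∀ l, 0 ≤ z l) :
    eval z p ≤ eval (fun _ => 1) p * ∑ l, z l ^ d := by
  obtain ⟨l0, h⟩ := Finite.exists_max z
  refine (hp.eval_le_pow_mul (d := d) (u := z l0) hz (by simpa using h) zero_le_one fun s hs =>
    ?_).trans ?_
  · rw [← hd hs, Finsupp.weight_apply, Finsupp.sum_fintype _ _ (by simp)]
    simp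
  · rw [mul_comm]
    exact mul_le_l (single_le_sum
      (fun l _ => pow_nonneg (hz l) d) (Finset.mem_univ l0)) (hp.eval_nonneg fun _ => zero_le_one)

lemma NonnegCoeffs.eval_le_of_constantCoeff [Nonempty y] {p : MvPolynomial y ℝ}
    (hp : NonnegCoeffs p) (h0 : MvPolynomial.constantCoeff p = 0) {z : y → ℝ} {D : ℝ} (hD : 0 < D)
    (hz : ∀ l, 0 ≤ z l) (hzD : ∀ l, z l ≤ D) : eval z p ≤ eval (fun _ => D) p / D * ∑ l, z l := by
  obtain ⟨l0, h⟩ := Finite.exists_max z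
  have hE := hp.eval_nonneg fun _ => hD.le
  refine (hp.eval_le_pow_mul (d := 1) hz
    (fun l => by rw [div_mul_cancel₀ _ hD.ne']; exact h l) hD.le fun s hs => ?_).trans ?_
  · refine pow_le_pow_of_le_one (div_nonneg (hz l0) hD.le) ((div_le_one hD).2 (hzD l0)) ?_
    by_contra hn
    refine hs ?_
    have : s = 0 := Finsupp.ext fun l => Finset.sum_eq_zero_iff.1 (by omega) l (Finset.mem_univ l)
    rw [this]; exact h0
  · rw [pow_one, div_mul_comm]
    exact mul_le_l (single_le_sum (fun l _ => hz l) (Finset.mem_univ l0))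

variable {m n : ℕ} {F T F1 : ℝ} {E : Exponents m n} {b : Coeffs m n} {r : VecFun m}
    {h : Fin (E.Jr + 1) → MvPolynomial (Fin (E.K + 1)) ℝ}

lemma exists_hom_bound (hh : ∀ j, (h j).IsHomogeneous (E.deg j) ∧ NonnegCoeffs (h j)) :
    ∃ S, 0 ≤ S ∧ ∀ j z, (∀ l, 0 ≤ z l) → eval z (h j) ≤ S * ∑ l, z l ^ E.deg j := by
  have h0 := fun j => (hh j).2.eval_nonneg fun _ => zero_le_one
  refine ⟨∑ j, eval (fun _ => 1) (h j), sum_nonneg fun j _ => h0 j,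
    fun j z hz => ((hh j).2.eval_le_of_isHomogeneous (hh j).1 hz).trans
    (mul_le_r (single_le_sum (fun j _ => h0 j) (Finset.mem_univ j))
    (sum_nonneg fun l _ => pow_nonneg (hz l) _))⟩

lemma rawFun_frozen {s d T' : ℝ} {D : Set ℂ} (hD : IsOpen D) (hs : cone s 0 ⊆ D) (hT : 0 < T)
    {g : VecFun m} (ha : ∀ t ∈ Ioc 0 T, DifferentiableOn ℂ (fun x => g x t) D)
    (hc : ContinuousOn (fun z : ℂ × ℝ => g z.1 z.2) (D ×ˢ Ioc 0 T)) (i : Fin m) :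
    RawFun univ (rawRegion E s d T') (fun _ x t => g x (min t T) i) := by
  have hm : ∀ {t : ℝ}, 0 < t → min t T ∈ Ioc 0 T := fun ht => ⟨lt_min ht hT, min_le_right _ _⟩
  refine ⟨fun _ _ x t hx => (differentiableOn_pi.1 (ha _ (hm hx.2.1.1)) i).differentiableAt
    (hD.mem_nhds (hs hx.1)), fun _ _ _ => differentiableOn_const _, fun _ _ x t hx => ?_⟩
  have h1 := hc.comp (f := fun t => (x, min t T)) (by fun_prop) fun t ht => ⟨hs hx.1, hm ht⟩
  exact continuousAt_pi.1 (h1.continuousAt (Ioi_mem_nhds hx.2.1.1)) i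

open Classical in
lemma SettingOne.exists_rawData
    {p : (q : DerivIdx m n) → (Fin m → ℕ) → Fin (E.J q + 1) → MvPolynomial (Fin (E.K + 1)) ℝ}
    (hf1 : 0 ≤ F1) (hf12 : F1 ≤ π / 2) (hT : 0 < T) (H : SettingOne F T E b r F1 h p) :
    ∃ d A B, RawData E (NonzeroOn b (wideSector F1 0 ×ˢ Ioc 0 T)) univ (sin F1) d (2 * T) A
    B (fun i _ x t => r x (min t T) i) (fun q k i _ x t =>
        if NonzeroOn b (wideSector F1 0 ×ˢ Ioc 0 T) q k then b q k x (min t T) i else 0) := by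
  obtain ⟨A, B, d, hd, hAB⟩ := H.p_unif
  obtain ⟨S, hS, hhS⟩ := exists_hom_bound H.h_hom
  have hD := wideSector_eq_cone hf1 hf12 le_rfl
  have hDo : IsOpen (wideSector F1 0) := hD ▸ isOpen_cone _ _
  have hm : ∀ {x t}, (x, t) ∈ rawRegion E (sin F1) d (2 * T) → x ∈ wideSector F1 0 ∧
    min t T ∈ Ioc 0 T ∧ ∀ l, 0 ≤ min t T ^ E.γ l * ‖x‖ ^ (-E.β l) ∧
    min t T ^ E.γ l * ‖x‖ ^ (-E.β l) ≤ t ^ E.γ l * ‖x‖ ^ (-E.β l) := fun hx => by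
    have h0 := lt_min hx.2.1.1 hT
    exact ⟨hD ▸ hx.1, ⟨h0, min_le_right _ _⟩, fun l => ⟨by positivity, mul_le_r
      (rpow_le_rpow h0.le (min_le_left _ _) (H.admissible.γ_pos l).le)⟩⟩
  set A' := max (2 * S) (|A| * (1 + 1 / d))
  refine ⟨d, A', max |B| 1, H.admissible, hd, by positivity, le_max_of_le_left (by positivity),
    le_max_right _ _, fun i => rawFun_frozen hDo hD.ge hT H.r_analytic H.r_cont i, fun q k i => ?_,
    fun i _ _ x t hx => ?_, fun q k i hq _ _ x t hx => ?_, fun q k i hq _ x t => if_neg hq,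
    fun q k h => H.b_zero q k (by omega) (by omega)⟩
  · by_cases hq : NonzeroOn b (wideSector F1 0 ×ˢ Ioc 0 T) q k
    · simp only [if_pos hq]
      exact rawFun_frozen hDo hD.ge hT (H.b_analytic q k) (H.b_cont q k) i
    · simp only [if_neg hq]
      exact ⟨fun _ _ _ _ _ => differentiableAt_const _, fun _ _ _ => differentiableOn_const _,
        fun _ _ _ _ _ => continuousAt_const⟩
  · obtain ⟨hxD, ht, hz⟩ := hm hx
    have ht0 := hx.2.1.1
    refine (norm_le_vecAbs _ i).trans ((H.r_bound x hxD _ ht).trans ?_)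
    have h1 : (min t T)⁻¹ ≤ 2 * t⁻¹ := by
      rw [← div_eq_mul_inv, inv_le_comm₀ ht.1 (by positivity), inv_div]
      exact le_min (by linarith) (by linarith [hx.2.1.2])
    have h2 : ∀ j, ‖x‖ ^ E.ω j * eval (fun l => min t T ^ E.γ l * ‖x‖ ^ (-E.β l)) (h j) ≤
      S * (‖x‖ ^ E.ω j * ∑ l, (t ^ E.γ l * ‖x‖ ^ (-E.β l)) ^ E.deg j) := fun j => by
      rw [mul_left_comm S]
      exact mul_le_l (((H.h_hom j).2.eval_mono (fun l => (hz l).1)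
        fun l => (hz l).2).trans (hhS j _ fun l => by positivity))
    calc _ ≤ 2 * t⁻¹ * ∑ j, S * (‖x‖ ^ E.ω j * ∑ l, (t ^ E.γ l * ‖x‖ ^ (-E.β l)) ^ E.deg j) :=
      mul_le_mul h1 (sum_le_sum fun j _ => h2 j) (sum_nonneg fun j _ =>
      mul_nonneg (by positivity) ((H.h_hom j).2.eval_nonneg fun l => (hz l).1)) (by positivity)
      _ = 2 * S * t⁻¹ * ∑ j, ‖x‖ ^ E.ω j * ∑ l, (t ^ E.γ l * ‖x‖ ^ (-E.β l)) ^ E.deg j := by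
          rw [← mul_sum]; ring
      _ ≤ _ := by
          gcongr
          exact le_max_left _ _
  · obtain ⟨hxD, ht, hz⟩ := hm hx
    simp only [if_pos hq]
    refine (norm_le_vecAbs _ i).trans ((H.b_bound q k x hxD _ ht).trans ?_)
    rw [mul_sum, mul_sum]
    refine sum_le_sum fun j _ => ?_
    have hp := H.p_nonneg q k j
    have hzd := fun l => (hz l).2.trans (hx.2.2 l).le
    have hpA : eval (fun _ => d) (p q k j) ≤ |A| * max |B| 1 ^ multiSize k := by
      refine (hAB q k hq j).trans ((le_abs_self _).trans ?_)
      rw [abs_mul, abs_pow]; exact mul_le_l (pow_le_pow_left₀ (abs_nonneg B) (le_max_left _ _) _)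
    have hM : 0 ≤ max |B| 1 ^ multiSize k := by positivity
    have e : ‖x‖ ^ (-(E.βk * multiSize k)) * ‖x‖ ^ (-E.α q j) = ‖x‖ ^ (-E.e q k j) := by
      rw [← rpow_add hx.1.1, Exponents.e]; congr 1; ring
    rw [← mul_assoc, e]
    split_ifs with he
    · rw [mul_comm]
      refine mul_le_r ((hp.eval_mono (fun l => (hz l).1) hzd).trans
        (hpA.trans (mul_le_r ((le_mul_of_one_le_right (abs_nonneg A) ?_).trans
        (le_max_right _ _)))))
      exact le_add_of_nonneg_right (by positivity)
    · have he0 := le_antisymm (not_lt.1 he) (H.admissible.α_cond q k hq j)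
      rw [he0, neg_zero, rpow_zero, one_mul]
      refine (hp.eval_le_of_constantCoeff (H.p_decay q k hq j he0) hd (fun l => (hz l).1) hzd).trans
        (mul_le_lr ?_ (sum_le_sum fun l _ => (hz l).2) (sum_nonneg fun l _ => (hz l).1))
      calc _ ≤ |A| * max |B| 1 ^ multiSize k / d := by gcongr
        _ = |A| * (1 / d) * max |B| 1 ^ multiSize k := by ring
        _ ≤ _ := mul_le_r (le_trans (by gcongr; linarith) (le_max_right _ _))

end

section

variable {m n J : ℕ} {E : Exponents m n} {N : Fin (J + 1) → ℕ} {w : Fin (J + 1) → ℝ}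
    {p : Fin (E.K + 1) → ℕ} {a : Fin (J + 1) → (Fin (E.K + 1) → ℂ) → Fin m → ℂ} {s d T : ℝ}

variable {t S : ℝ} {y x : ℂ}

/-- The sum `∑ y^{N_j} x^{w_j} a_j(y^{p_1} t^{γ_1} x^{-β_1}, …)`. -/
def powerSum (E : Exponents m n) (N : Fin (J + 1) → ℕ) (w : Fin (J + 1) → ℝ)
    (p : Fin (E.K + 1) → ℕ) (a : Fin (J + 1) → (Fin (E.K + 1) → ℂ) → Fin m → ℂ) (y x : ℂ) (t : ℝ) :
    Fin m → ℂ :=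
  ∑ j, (y ^ N j * x ^ (w j : ℂ)) • a j fun l => y ^ p l * E.args x t l

lemma Exponents.norm_args (E : Exponents m n) (x : ℂ) (ht : 0 ≤ t) (l : Fin (E.K + 1)) :
    ‖E.args x t l‖ = t ^ E.γ l * ‖x‖ ^ (-E.β l) := by
  rw [Exponents.args, norm_mul, norm_coe, norm_cpow_real]

lemma norm_pow_mul_args_le (hy : ‖y‖ ≤ 1) (ht : 0 ≤ t) (l : Fin (E.K + 1)) :
    ‖y ^ p l * E.args x t l‖ ≤ t ^ E.γ l * ‖x‖ ^ (-E.β l) := by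
  rw [norm_mul, norm_pow, E.norm_args x ht]
  exact mul_le_of_le_one_left (by positivity) (pow_le_one₀ (norm_nonneg _) hy)

lemma pow_mul_args_mem_ball (hd : 0 < d) (hy : ‖y‖ ≤ 1) (hx : (x, t) ∈ rawRegion E s d T) :
    (fun l => y ^ p l * E.args x t l) ∈ ball (0 : Fin (E.K + 1) → ℂ) d := by
  rw [mem_ball_zero_iff, pi_norm_lt_iff hd]
  exact fun l => (norm_pow_mul_args_le hy hx.2.1.1.le l).trans_lt (hx.2.2 l)

lemma cone_subset_slitPlane (hs : s ≤ 1) : cone s 0 ⊆ slitPlane := fun z hz => by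
  rw [Complex.mem_slitPlane_iff]
  by_contra! h
  have h1 := hz.2
  have h2 : ‖z‖ = |z.re| := by rw [← re_add_im z, h.2]; simp
  rw [h2, abs_of_nonpos h.1] at h1; nlinarith

lemma rawFun_powerSum (hs : s ≤ 1) (hd : 0 < d) (ha : ∀ j, AnalyticOnNhd ℂ (a j) (ball 0 d))
    {X : Set ℂ} {g : ℂ → ℂ} (hg : DifferentiableOn ℂ g X) (hg1 : ∀ y ∈ X, ‖g y‖ ≤ 1) {h : ℝ → ℂ}
    (hh : ∀ t, 0 < t → ContinuousAt h t) (i : Fin m) :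
    RawFun X (rawRegion E s d T) fun y x t => h t * powerSum E N w p a (g y) x t i := by
  have had : ∀ y ∈ X, ∀ x t, (x, t) ∈ rawRegion E s d T → ∀ j, DifferentiableAt ℂ
    (fun z => a j z i) fun l => g y ^ p l * E.args x t l := fun y hy x t hx j =>
    differentiableAt_pi.1 (ha j _ (pow_mul_args_mem_ball hd (hg1 y hy) hx)).differentiableAt i
  simp only [powerSum, Finset.sum_apply, Pi.smul_apply, smul_eq_mul]
  refine ⟨fun y hy x t hx => ?_, fun x t hx y hy => ?_, fun y hy x t hx => ?_⟩
  · have h1 : ∀ c : ℂ, DifferentiableAt ℂ (fun x => x ^ c) x := fun c =>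
      differentiableAt_id.cpow_const ((fun hx => cone_subset_slitPlane hs hx.1) hx)
    have h2 : DifferentiableAt ℂ (fun x l => g y ^ p l * E.args x t l) x :=
      differentiableAt_pi.2 fun l => ((h1 _).const_mul _).const_mul _
    exact (DifferentiableAt.fun_sum fun j _ => ((h1 _).const_mul _).mul
      ((had y hy x t hx j).fun_comp' x h2)).const_mul _
  · have h1 := hg y hy
    have h2 : DifferentiableWithinAt ℂ (fun y l => g y ^ p l * E.args x t l) X y :=
      differentiableWithinAt_pi.2 fun l => (h1.fun_pow _).mul_const _
    exact (DifferentiableWithinAt.fun_sum fun j _ => ((h1.fun_pow _).mul_const _).mul ((fun j =>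
      (had y hy x t hx j).comp_differentiableWithinAt (f := fun y l => g y ^ p l * E.args x t l) y
      h2) j)).const_mul _
  · have ht := hx.2.1.1
    refine (hh t ht).mul (tendsto_finsetSum _ fun j _ => ContinuousAt.mul continuousAt_const ?_)
    refine (had y hy x t hx j).continuousAt.comp' (f := fun t l => g y ^ p l * E.args x t l)
      (continuousAt_pi.2 fun l => continuousAt_const.mul (ContinuousAt.mul ?_ continuousAt_const))
    exact continuous_ofReal.continuousAt.comp' (continuousAt_rpow_const _ _ (Or.inl ht.ne'))

lemma ofReal_mul_cpow (hS : 0 < S) (hx : x ≠ 0) (c : ℝ) :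
    ((S : ℂ) * x) ^ (c : ℂ) = ((S ^ c : ℝ) : ℂ) * x ^ (c : ℂ) := by
  have h := ofReal_ne_zero.2 hS.ne'
  rw [cpow_def_of_ne_zero (mul_ne_zero h hx), Complex.log_ofReal_mul hS hx, add_mul,
    Complex.exp_add, cpow_def_of_ne_zero hx, Complex.ofReal_cpow hS.le,
    cpow_def_of_ne_zero h, Complex.ofReal_log hS.le]

lemma powerSum_scale {W M : ℝ} (hS : 0 < S) (hN : ∀ j, N j * W = w j / n + M)
    (hp : ∀ l, p l * W = E.γ l - E.β l / n) (hx : x ≠ 0) (ht : 0 ≤ t) :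
    powerSum E N w p a ((S ^ W : ℝ) : ℂ) x t = ((S ^ M : ℝ) : ℂ) •
    powerSum E N w p a 1 (((S ^ (1 / n : ℝ) : ℝ) : ℂ) * x) (S * t) := by
  have hs := rpow_pos_of_pos hS (1 / n)
  have e1 : ∀ (k : ℕ) (c : ℝ), k * W = c → ((S ^ W : ℝ) : ℂ) ^ k = ((S ^ c : ℝ) : ℂ) := fun k c h =>
    by rw [← h, mul_comm, rpow_mul hS.le, rpow_natCast, Complex.ofReal_pow]
  have e2 : ∀ l, ((S ^ W : ℝ) : ℂ) ^ p l * E.args x t l =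
    1 ^ p l * E.args (((S ^ (1 / n : ℝ) : ℝ) : ℂ) * x) (S * t) l := fun l => by
    rw [e1 _ _ (hp l), one_pow, one_mul, Exponents.args, Exponents.args, ofReal_mul_cpow hs hx,
      mul_rpow hS.le ht, sub_eq_add_neg, rpow_add hS, ← rpow_mul hS.le,
      show 1 / n * -E.β l = -(E.β l / n) by ring]
    push_cast; ring
  simp only [powerSum, Finset.smul_sum, e2, smul_smul]
  refine sum_congr rfl fun j _ => ?_
  congr 1
  rw [e1 _ _ (hN j), one_pow, one_mul, ofReal_mul_cpow hs hx, rpow_add hS, ← rpow_mul hS.le,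
    one_div_mul_eq_div]
  push_cast; ring

lemma norm_powerSum_le (hy : ‖y‖ ≤ 1) (t : ℝ) (i : Fin m) : ‖powerSum E N w p a y x t i‖ ≤
    ∑ j, ‖x‖ ^ w j * ‖a j (fun l => y ^ p l * E.args x t l) i‖ := by
  simp only [powerSum, Finset.sum_apply, Pi.smul_apply, smul_eq_mul]
  refine norm_sum_le_of_le _ fun j _ => ?_
  rw [norm_mul, norm_mul, norm_pow, norm_cpow_real]
  exact mul_le_r (mul_le_of_le_one_left (by positivity) (pow_le_one₀ (norm_nonneg _) hy))

end

section

variable {m n : ℕ} {F w d : ℝ} {P : Fin m → Polynomial ℂ} {E : Exponents m n} {b : Coeffs m n}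
    {r : VecFun m} {a : Fin (E.Jr + 1) → (Fin (E.K + 1) → ℂ) → Fin m → ℂ}
    {h : Fin (E.Jr + 1) → MvPolynomial (Fin (E.K + 1)) ℝ}
    {c : (q : DerivIdx m n) → (Fin m → ℕ) → Fin (E.J q + 1) → (Fin (E.K + 1) → ℂ) → Fin m → ℂ}

lemma exists_nat_mul_eq_div (hn : 0 < n) (hw : 0 < w) {y : ℝ} (hy : 0 ≤ y)
    (h : ∃ z : ℤ, y = z * (n * w)) : ∃ N : ℕ, N * w = y / n := by
  obtain ⟨z, rfl⟩ := h
  lift z to ℕ using by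
    have := nonneg_of_mul_nonneg_left hy (by positivity)
    exact_mod_cast this
  exact ⟨z, by push_cast; field_simp⟩

lemma SettingTwo.exists_multiples (hn : 0 < n) (H : SettingTwo F P E b r w d a h c) :
    ∃ (N : Fin (E.Jr + 1) → ℕ) (p : Fin (E.K + 1) → ℕ)
    (M : (q : DerivIdx m n) → (Fin m → ℕ) → Fin (E.J q + 1) → ℕ),
    (∀ j, N j * w = E.ω j / n + -(E.ω 0 / n)) ∧ (∀ l, p l * w = E.γ l - E.β l / n) ∧
    ∀ q k, NonzeroOn b (smallArgs E F d) q k → ∀ j, M q k j * w =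
    -E.e q k j / n + (E.mqk q k + E.α q 0 + E.βk * multiSize k) / n := by
  have hnat := fun {y : ℝ} => exists_nat_mul_eq_div (y := y) hn H.ω_pos
  have h2 := fun l => by
    have := H.admissible.γ_nonneg l
    rw [H.nhat_eq, one_div, inv_mul_le_iff₀ (by exact_mod_cast hn)] at this
    exact hnat (by linarith) (H.γ_int l)
  have h3 : ∀ q k j, ∃ N : ℕ, NonzeroOn b (smallArgs E F d) q k →
    N * w = (E.mqk q k + (E.α q 0 - E.α q j)) / n := fun q k j => by
    by_cases hq : NonzeroOn b (smallArgs E F d) q k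
    · obtain ⟨z, hz⟩ := H.m_int q k hq
      obtain ⟨z', hz'⟩ := H.α_int q j
      obtain ⟨N, hN⟩ := hnat (add_nonneg (H.admissible.m_cond q k hq)
        (sub_nonneg.2 ((H.admissible.α_anti q).antitone (Fin.zero_le j))))
        ⟨z + z', by rw [hz, hz']; push_cast; ring⟩
      exact ⟨N, fun _ => hN⟩
    · exact ⟨0, fun h => absurd h hq⟩
  choose N hN using (fun j => hnat (sub_nonneg.2 (H.admissible.ω_mono.monotone (Fin.zero_le j)))
    (H.ω_int j))
  choose p hp using h2
  choose M hM using h3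
  refine ⟨N, p, M, fun j => ?_, fun l => ?_, fun q k hq j => ?_⟩
  · rw [hN]; ring
  · rw [hp]; field_simp
  · rw [hM q k j hq, Exponents.e]; ring

lemma norm_apply_le_of_zero {K : ℕ} {f : (Fin (K + 1) → ℂ) → Fin m → ℂ} {D : ℝ} (hd : 0 < d)
    (hf : AnalyticOnNhd ℂ f (ball 0 d)) (hD : ∀ z ∈ ball 0 d, vecAbs (f z) ≤ D)
    (h0 : f 0 = 0) {z : Fin (K + 1) → ℂ} (hz : z ∈ ball 0 d) (i : Fin m) :
    ‖f z i‖ ≤ D / d * ∑ l, ‖z l‖ := by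
  have h1 := Complex.dist_le_div_mul_dist_of_mapsTo_ball
    (fun z hz => (differentiableAt_pi.1 (hf z hz).differentiableAt i).differentiableWithinAt)
    (fun z hz => by simpa [h0] using (norm_le_vecAbs _ i).trans (hD z hz)) hz
  rw [h0, Pi.zero_apply, dist_zero_right, dist_zero_right] at h1
  have hD0 := (sum_nonneg fun i _ => norm_nonneg _).trans (hD z hz)
  refine h1.trans (mul_le_l ((pi_norm_le_iff_of_nonneg (by positivity)).2
    fun l => single_le_sum (fun l _ => norm_nonneg _) (Finset.mem_univ l)))

open Classical in
lemma SettingTwo.exists_rawData {N : Fin (E.Jr + 1) → ℕ} {p : Fin (E.K + 1) → ℕ}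
    {M : (q : DerivIdx m n) → (Fin m → ℕ) → Fin (E.J q + 1) → ℕ}
    (H : SettingTwo F P E b r w d a h c) {s T : ℝ} (hs : s ≤ 1) (hT : 0 < T) {X : Set ℂ} {g : ℂ → ℂ}
    (hg : DifferentiableOn ℂ g X) (hg1 : ∀ y ∈ X, ‖g y‖ ≤ 1) :
    ∃ A B, RawData E (NonzeroOn b (smallArgs E F d)) X s d T A B
    (fun i y x t => (t : ℂ)⁻¹ * powerSum E N E.ω p a (g y) x t i) (fun q k i y x t =>
        if NonzeroOn b (smallArgs E F d) q k then
          1 * powerSum E (M q k) (fun j => -E.e q k j) p (c q k) (g y) x t i else 0) := by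
  obtain ⟨A, B, hAB⟩ := H.c_unif
  obtain ⟨S, hS, hhS⟩ := exists_hom_bound H.h_hom
  have hd := H.δ_pos
  refine ⟨S + |A| * (1 + 1 / d), max |B| 1, H.admissible, hd, hT, (by positivity), le_max_right _ _,
    fun i => rawFun_powerSum hs hd H.a_analytic hg hg1 (fun t ht =>
    continuous_ofReal.continuousAt.inv₀ (ofReal_ne_zero.2 ht.ne')) i,
    fun q k i => ?_, fun i y hy x t hx => ?_, fun q k i hq y hy x t hx => ?_,
    fun q k i hq _ x t => if_neg hq, fun q k h => H.b_zero q k (by omega) (by omega)⟩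
  · by_cases hq : NonzeroOn b (smallArgs E F d) q k
    · simp only [if_pos hq]
      exact rawFun_powerSum hs hd (H.c_analytic q k) hg hg1 (fun t _ => continuousAt_const) i
    · simp only [if_neg hq]
      exact ⟨fun _ _ _ _ _ => differentiableAt_const _, fun _ _ _ => differentiableOn_const _,
        fun _ _ _ _ _ => continuousAt_const⟩
  · have ht0 := hx.2.1.1
    rw [norm_mul, norm_inv, norm_coe, mul_right_comm, mul_comm]
    refine mul_le_r ((norm_powerSum_le (hg1 y hy) t i).trans ?_)
    rw [mul_sum]
    refine sum_le_sum fun j _ => ?_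
    rw [mul_left_comm]
    refine mul_le_l ((norm_le_vecAbs _ i).trans ((H.a_bound j _
      (pow_mul_args_mem_ball hd (hg1 y hy) hx)).trans (((H.h_hom j).2.eval_mono
      (fun l => norm_nonneg _) fun l => norm_pow_mul_args_le (hg1 y hy) ht0.le l).trans
      ((hhS j _ fun l => by positivity).trans ?_))))
    exact mul_le_r (le_add_of_nonneg_right (by positivity))
  · have ht0 := hx.2.1.1
    simp only [if_pos hq, one_mul]
    refine (norm_powerSum_le (hg1 y hy) t i).trans ?_
    rw [mul_sum]
    refine sum_le_sum fun j _ => ?_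
    have hz := pow_mul_args_mem_ball (p := p) hd (hg1 y hy) hx
    have hc : ∀ z ∈ ball (0 : Fin (E.K + 1) → ℂ) d, vecAbs (c q k j z) ≤
        |A| * max |B| 1 ^ multiSize k := fun z hz => by
      refine (hAB q k hq j z hz).trans ((le_abs_self _).trans ?_)
      rw [abs_mul, abs_pow]; exact mul_le_l (pow_le_pow_left₀ (abs_nonneg B) (le_max_left _ _) _)
    split_ifs with he
    · rw [mul_comm]
      refine mul_le_r ((norm_le_vecAbs _ i).trans ((hc _ hz).trans (mul_le_r ?_)))
      have : 0 ≤ |A| * (1 / d) := by positivity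
      linarith
    · have he0 := le_antisymm (not_lt.1 he) (H.admissible.α_cond q k hq j)
      rw [he0, neg_zero, rpow_zero, one_mul]
      refine (norm_apply_le_of_zero hd (H.c_analytic q k j) hc (H.c_decay q k hq j he0) hz i).trans
        (mul_le_lr ?_ (sum_le_sum fun l _ => norm_pow_mul_args_le (hg1 y hy) ht0.le l))
      calc _ = |A| * (1 / d) * max |B| 1 ^ multiSize k := by ring
        _ ≤ _ := mul_le_r (by nlinarith [abs_nonneg A])

end

section

variable {m n : ℕ}

lemma iteratedDeriv_comp_mul (f : ℂ → ℂ) (c : ℂ) (j : ℕ) :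
    iteratedDeriv j (fun y => f (c * y)) = fun x => c ^ j * iteratedDeriv j f (c * x) := by
  induction j with
  | zero => simp
  | succ j ih =>
    ext x
    rw [iteratedDeriv_succ, ih, deriv_const_mul_field, iteratedDeriv_succ, deriv_comp_mul_left,
      smul_eq_mul, pow_succ, mul_assoc]

lemma IsSolution.scale {P : Fin m → Polynomial ℂ} {b : Coeffs m n} {r : VecFun m}
    {N F R T : ℝ} {f : VecFun m} (hN : N = n) (hn : 0 < n) (hP : ∀ l, P l = (-Polynomial.X) ^ n)
    (H : IsSolution P b r N F R T f) {S s c : ℝ} (hS : 0 < S) (hS1 : S ≤ 1)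
    (hsS : s = S ^ (1 / n : ℝ)) (hc : c ≠ 0) : IsSolution P
    (fun q k x t => ((c * S * (c ^ (multiSize k + q.size))⁻¹ * (s ^ q.order)⁻¹ : ℝ) : ℂ) •
    b q k (s * x) (S * t)) (fun x t => ((c * S : ℝ) : ℂ) • r (s * x) (S * t)) N F R T
    (fun x t => (c : ℂ) • f (s * x) (S * t)) := by
  subst hN
  have hs := hsS ▸ rpow_pos_of_pos hS _
  have hsn : s ^ n = S := by rw [hsS, one_div, rpow_inv_natCast_pow hS.le hn.ne']
  have hmem : ∀ {x : ℂ} {t}, (x, t) ∈ similarityRegion n F R T →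
    (s * x, S * t) ∈ similarityRegion n F R T := fun {x t} ⟨h1, h2, h3⟩ => by
    refine ⟨mul_pos hS h1, (mul_le_of_le_one_left h1.le hS1).trans h2, ?_⟩
    have e : s * x * (((S * t) ^ (-(1 / n) : ℝ) : ℝ) : ℂ) = x * ((t ^ (-(1 / n) : ℝ) : ℝ) : ℂ) := by
      have : s * S ^ (-(1 / n) : ℝ) = 1 := by rw [hsS, ← rpow_add hS]; simp
      rw [mul_rpow hS.le h1.le, ofReal_mul, mul_right_comm, ← mul_assoc,
        ← ofReal_mul, this, ofReal_one, one_mul, mul_comm]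
    exact e ▸ h3
  have hcC := ofReal_ne_zero.2 hc
  have hsC := ofReal_ne_zero.2 hs.ne'
  have hterm : ∀ x t (k : Fin m → ℕ) (q : DerivIdx m n), (∏ l, ((c : ℂ) • f (s * x) (S * t)) l ^ k
    l) •
    (((c * S * (c ^ (multiSize k + q.size))⁻¹ * (s ^ q.order)⁻¹ : ℝ) : ℂ) • b q k (s * x) (S * t)) =
    ((c * S * (c ^ q.size)⁻¹ * (s ^ q.order)⁻¹ : ℝ) : ℂ) •
    ((∏ l, f (s * x) (S * t) l ^ k l) • b q k (s * x) (S * t)) := fun x t k q => by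
    simp only [Pi.smul_apply, smul_eq_mul, mul_pow, prod_mul_distrib, smul_smul,
      prod_pow_eq_pow_sum]
    congr 1; rw [multiSize, pow_add]
    push_cast
    field_simp
  have hd : ∀ t l j x, iteratedDeriv j (fun y => ((c : ℂ) • f (s * y) (S * t)) l) x =
    c * s ^ j * iteratedDeriv j (fun y => f y (S * t) l) (s * x) := fun t l j x => by
    simp only [Pi.smul_apply, smul_eq_mul]
    rw [iteratedDeriv_const_mul_field, iteratedDeriv_comp_mul (fun y => f y (S * t) l), mul_assoc]
  obtain ⟨C, hC⟩ := H.bounded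
  refine ⟨fun t x hx => ?_, ⟨|c| * s⁻¹ * C, fun x t hx => ?_⟩, fun x t hx q => ?_, fun x t hx => ?_,
    fun x hx => ?_⟩
  · exact ((H.analytic (S * t)).comp (differentiableOn_id.const_mul _) fun y hy =>
      hmem hy).const_smul c x hx
  · have h1 := hC _ _ (hmem hx)
    have e : vecAbs ((c : ℂ) • f (s * x) (S * t)) = |c| * vecAbs (f (s * x) (S * t)) := by
      simp [vecAbs, mul_sum]
    rw [norm_mul, norm_coe] at h1; rw [e, mul_assoc, mul_left_comm]
    refine mul_le_l ?_
    rw [← div_eq_inv_mul, le_div_iff₀' hs, ← mul_assoc]; exact h1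
  · simp only [hterm]
    exact (H.summable _ _ (hmem hx) q).const_smul _
  · have hT := hx.1.le.trans hx.2.1
    have h1 : HasDerivWithinAt (fun t => S * t) S (Iic T) t := by
      simpa using ((hasDerivAt_id t).const_mul S).hasDerivWithinAt
    have h2 := ((H.equation _ _ (hmem hx)).scomp t h1 fun t ht => by
      rcases le_or_gt 0 t with h0 | h0
      · exact (mul_le_of_le_one_left h0 hS1).trans ht
      · exact (mul_neg_of_pos_of_neg hS h0).le.trans hT).const_smul c
    refine h2.congr_deriv (funext fun i => ?_)
    have hPc : ∀ j, (P i).coeff j = if j = n then (-1) ^ n else 0 := fun j => by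
      rw [hP, neg_pow, ← map_one Polynomial.C, ← map_neg, ← map_pow, Polynomial.coeff_C_mul,
        Polynomial.coeff_X_pow]
      simp
    have hprod : ∀ q : DerivIdx m n, ∏ l, ∏ j : Fin n, ((c : ℂ) * s ^ ((j : ℕ) + 1) *
      iteratedDeriv ((j : ℕ) + 1) (fun y => f y (S * t) l) (s * x)) ^ q.1 l j =
      c ^ q.size * s ^ q.order *
      ∏ l, ∏ j : Fin n, iteratedDeriv ((j : ℕ) + 1) (fun y => f y (S * t) l) (s * x) ^ q.1 l j :=
      fun q => by
        simp only [mul_pow, prod_mul_distrib, ← pow_mul, prod_pow_eq_pow_sum]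
        rfl
    simp only [evolutionRHS, hterm, hd, hprod, hPc]
    simp only [Pi.smul_apply, evolutionRHS, hPc, smul_eq_mul, ite_mul, zero_mul, Finset.sum_ite_eq',
      Finset.mem_range, Nat.lt_succ_self, if_true, tsum_const_smul'', real_smul, mul_add, mul_sum]
    congr 1
    · congr 1
      · rw [← hsn]; push_cast; ring
      · refine sum_congr rfl fun q _ => ?_
        push_cast
        field_simp
    · push_cast; ring
  · have h1 : s * x ∈ wideSector F 0 := by
      refine ⟨by rw [norm_mul, norm_coe]; exact mul_pos hs hx.1, ?_⟩
      rw [arg_real_mul _ hs]; exact hx.2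
    have h2 : Tendsto (fun t => S * t) (𝓝[>] 0) (𝓝[>] 0) := by
      refine tendsto_nhdsWithin_iff.2 ⟨?_, eventually_mem_nhdsWithin.mono fun t ht => mul_pos hS ht⟩
      have := (continuous_const_mul S).tendsto 0
      rw [mul_zero] at this; exact this.mono_left nhdsWithin_le_nhds
    simpa using ((H.initial _ h1).comp h2).const_smul c

end

section
open Metric BoundedContinuousFunction

variable {g : ℂ → ℂ → ℂ} {R M : ℝ} {z0 w0 : ℂ}

lemma closedBall_half_subset (hR : 0 < R) : closedBall z0 (R / 2) ⊆ ball z0 R :=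
    closedBall_subset_ball (half_lt_self hR)

lemma exists_analyticAt_boundary_values (hR : 0 < R)
    (h1 : ∀ w ∈ ball w0 R, DifferentiableOn ℂ (fun z => g z w) (ball z0 R))
    (h2 : ∀ z ∈ ball z0 R, DifferentiableOn ℂ (g z) (ball w0 R))
    (hM : ∀ z ∈ ball z0 R, ∀ w ∈ ball w0 R, ‖g z w‖ ≤ M) : ∃ u : ℂ → (ℝ →ᵇ ℂ), AnalyticAt ℂ u z0 ∧
    ∀ z ∈ ball z0 (R / 2), ∀ t, u z t = g z (circleMap w0 (R / 2) t) := by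
  have hr := half_pos hR
  have hw : ∀ t, circleMap w0 (R / 2) t ∈ ball w0 R := fun t =>
    closedBall_half_subset hR (sphere_subset_closedBall (circleMap_mem_sphere _ hr.le t))
  have hex : ∀ z, ∃ f : ℝ →ᵇ ℂ, z ∈ ball z0 R → ∀ t, f t = g z (circleMap w0 (R / 2) t) := fun z =>
    by
    by_cases hz : z ∈ ball z0 R
    · exact ⟨ofNormedAddCommGroup _ ((h2 z hz).continuousOn.comp_continuous
        (continuous_circleMap w0 (R / 2)) hw) M fun t => hM z hz _ (hw t), fun _ t => rfl⟩
    · exact ⟨0, fun h => absurd h hz⟩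
  choose f hf using hex
  have hball : ∀ {Z}, Z ∈ closedBall z0 (R / 2) → ball Z (R / 2) ⊆ ball z0 R := fun hZ =>
    ball_subset_ball' (by linarith [mem_closedBall.1 hZ])
  have hM0 : 0 ≤ M := (norm_nonneg _).trans (hM z0 (mem_ball_self hR) w0 (mem_ball_self hR))
  have hc : ContinuousOn f (closedBall z0 (R / 2)) := fun Z hZ => by
    refine (ContinuousAt.continuousWithinAt ?_)
    have hl : ∀ᶠ z in 𝓝 Z, dist (f z) (f Z) ≤ 2 * M / (R / 2) * dist z Z := by
      filter_upwards [ball_mem_nhds Z hr] with z hz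
      refine (dist_le (by positivity)).2 fun t => ?_
      rw [hf z (hball hZ hz), hf Z (closedBall_half_subset hR hZ)]
      refine Complex.dist_le_div_mul_dist_of_mapsTo_ball
        ((h1 _ (hw t)).mono (hball hZ)) (fun y hy => ?_) hz
      rw [mem_closedBall, dist_eq_norm]
      linarith [norm_sub_le (g y (circleMap w0 (R / 2) t)) (g Z (circleMap w0 (R / 2) t)),
        hM y (hball hZ hy) _ (hw t), hM Z (closedBall_half_subset hR hZ) _ (hw t)]
    refine tendsto_iff_dist_tendsto_zero.2 (squeeze_zero' (.of_forall fun _ => dist_nonneg) hl ?_)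
    have : Tendsto (fun z => 2 * M / (R / 2) * dist z Z) (𝓝 Z) (𝓝 (2 * M / (R / 2) * dist Z Z)) :=
      Continuous.tendsto (by fun_prop) Z
    simpa using this
  have hi := (hc.mono sphere_subset_closedBall).circleIntegrable hr.le
  refine ⟨_, (hasFPowerSeriesOn_cauchy_integral (R := ⟨R / 2, hr.le⟩) hi hr).analyticAt, fun z hz t
    => ?_⟩
  have h4 : (∮ Z in C(z0, R / 2), (Z - z)⁻¹ • f Z) t =
    ∮ Z in C(z0, R / 2), (Z - z)⁻¹ • g Z (circleMap w0 (R / 2) t) := by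
    have hne := ((continuousOn_id.sub continuousOn_const).inv₀ fun Z hZ => sub_ne_zero.2 fun h => by
        obtain rfl : Z = z := h; exact (mem_ball.1 hz).ne (mem_sphere.1 hZ)).smul
        (hc.mono sphere_subset_closedBall)
    refine ((evalCLM ℂ t).intervalIntegral_comp_comm (hne.circleIntegrable hr.le).out).symm.trans ?_
    refine intervalIntegral.integral_congr fun s _ => ?_
    have := hf _ (closedBall_half_subset hR (sphere_subset_closedBall
      (circleMap_mem_sphere z0 hr.le s))) t
    simp [this]
  change (2 * π * I)⁻¹ • (∮ Z in C(z0, R / 2), (Z - z)⁻¹ • f Z) t = _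
  rw [h4, ((h1 _ (hw t)).mono (closedBall_half_subset hR)).circleIntegral_sub_inv_smul hz,
    inv_smul_smul₀ (by simp)]

lemma exists_analyticAt_cauchyKernel (hR : 0 < R) (w0 : ℂ) : ∃ k : ℂ → (ℝ →ᵇ ℂ),
    AnalyticAt ℂ k w0 ∧ ∀ᶠ w in 𝓝 w0, ∀ t, k w t = (circleMap w0 R t - w)⁻¹ := by
  have hn : ∀ t, ‖circleMap 0 R t‖ = R := fun t => by simp [abs_of_pos hR]
  set c : ℝ →ᵇ ℂ := ofNormedAddCommGroup _ (continuous_circleMap 0 R) R fun t => (hn t).le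
  have h0 := fun t => norm_pos_iff.1 ((hn t).symm ▸ hR)
  set d := ofNormedAddCommGroup (fun t => (circleMap 0 R t)⁻¹)
    ((continuous_circleMap 0 R).inv₀ h0) R⁻¹ fun t => by rw [norm_inv, hn]
  have h1 : c * d = 1 := ext fun t => mul_inv_cancel₀ (h0 t)
  have hL : AnalyticAt ℂ (fun w => c - algebraMap ℂ (ℝ →ᵇ ℂ) (w - w0)) w0 :=
    analyticAt_const.sub (((Algebra.linearMap ℂ (ℝ →ᵇ ℂ)).mkContinuous ‖(1 : ℝ →ᵇ ℂ)‖ fun w => by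
      rw [Algebra.linearMap_apply, norm_algebraMap, mul_comm]).analyticAt _ |>.comp
        (analyticAt_id.sub analyticAt_const))
  have hu : c - algebraMap ℂ (ℝ →ᵇ ℂ) (w0 - w0) = (⟨c, d, h1, mul_comm c d ▸ h1⟩ : (ℝ →ᵇ ℂ)ˣ) := by
    simp
  have hI := hu ▸ analyticAt_inverse (𝕜 := ℂ) _
  refine ⟨_, hI.comp (f := fun w => c - algebraMap ℂ (ℝ →ᵇ ℂ) (w - w0)) hL, ?_⟩
  filter_upwards [hL.continuousAt.eventually (Units.isOpen.mem_nhds ⟨_, hu.symm⟩)] with w hw t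
  have h2 := congrArg (fun f => f t) (Ring.mul_inverse_cancel _ hw)
  have h3 : (c - algebraMap ℂ (ℝ →ᵇ ℂ) (w - w0)) t = circleMap w0 R t - w := by
    rw [Algebra.algebraMap_eq_smul_one, BoundedContinuousFunction.sub_apply,
      BoundedContinuousFunction.smul_apply, BoundedContinuousFunction.coe_one, Pi.one_apply,
      smul_eq_mul, mul_one]
    change circleMap 0 R t - (w - w0) = _
    rw [← circleMap_sub_center, sub_sub_sub_cancel_right]
  simp only [mul_apply, h3] at h2; exact eq_inv_of_mul_eq_one_right h2

lemma analyticAt_of_separately (hR : 0 < R)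
    (h1 : ∀ w ∈ ball w0 R, DifferentiableOn ℂ (fun z => g z w) (ball z0 R))
    (h2 : ∀ z ∈ ball z0 R, DifferentiableOn ℂ (g z) (ball w0 R))
    (hM : ∀ z ∈ ball z0 R, ∀ w ∈ ball w0 R, ‖g z w‖ ≤ M) :
    AnalyticAt ℂ (fun p : ℂ × ℂ => g p.1 p.2) (z0, w0) := by
  have hr := half_pos hR
  obtain ⟨y, hy, hye⟩ := exists_analyticAt_boundary_values hR h1 h2 hM
  obtain ⟨k, hk, hke⟩ := exists_analyticAt_cauchyKernel hr w0
  have hint : ∀ f : ℝ →ᵇ ℂ, IntervalIntegrable (fun t => deriv (circleMap w0 (R / 2)) t • f t)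
    volume 0 (2 * π) := fun f => by
    simp only [deriv_circleMap]
    exact Continuous.intervalIntegrable (((continuous_circleMap _ _).mul continuous_const).smul
      f.continuous) _ _
  set J : (ℝ →ᵇ ℂ) →L[ℂ] ℂ := LinearMap.mkContinuous
    { toFun := fun f => ∫ t in 0..2 * π, deriv (circleMap w0 (R / 2)) t • f t
      map_add' := fun f f' => by
        rw [← intervalIntegral.integral_add (hint f) (hint f')]; simp [mul_add]
      map_smul' := fun c f => by
        rw [RingHom.id_apply, ← intervalIntegral.integral_smul]; simp [mul_left_comm] }
    (R / 2 * (2 * π)) (fun f => by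
      refine (intervalIntegral.norm_integral_le_of_norm_le_const (C := R / 2 * ‖f‖)
        fun t _ => ?_).trans_eq (by rw [sub_zero, abs_of_pos two_pi_pos]; ring)
      rw [norm_smul, deriv_circleMap, norm_mul, norm_I, norm_circleMap_zero, abs_of_pos hr, mul_one]
      exact mul_le_l (f.norm_coe_le_norm t))
  have hA : AnalyticAt ℂ (fun p => (2 * π * I : ℂ)⁻¹ * J (k p.2 * y p.1)) (z0, w0) := by
    have e1 : AnalyticAt ℂ (fun p : ℂ × ℂ => k p.2) (z0, w0) :=
      AnalyticAt.fun_comp hk analyticAt_snd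
    have e2 : AnalyticAt ℂ (fun p : ℂ × ℂ => y p.1) (z0, w0) :=
      AnalyticAt.fun_comp hy analyticAt_fst
    exact analyticAt_const.mul ((J.analyticAt _).fun_comp (e1.mul e2))
  refine hA.congr ?_
  filter_upwards [(prod_mem_nhds (ball_mem_nhds z0 hr) (inter_mem hke (ball_mem_nhds w0 hr)))]
    with p hp
  rw [inv_mul_eq_iff_eq_mul₀ (by simp)]
  refine Eq.trans ?_ (((h2 p.1 (ball_subset_ball (half_le_self hR.le) hp.1)).mono
    (closedBall_half_subset hR)).circleIntegral_sub_inv_smul hp.2.2)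
  change ∫ t in 0..2 * π, deriv (circleMap w0 (R / 2)) t • (k p.2 t * y p.1 t) = _
  simp only [hp.2.1 _, hye p.1 hp.1]
  rfl

end

section

variable {m n : ℕ} {o W d : ℝ} {P : Fin m → Polynomial ℂ} {E : Exponents m n} {b : Coeffs m n}
    {r : VecFun m} {a : Fin (E.Jr + 1) → (Fin (E.K + 1) → ℂ) → Fin m → ℂ}
    {h : Fin (E.Jr + 1) → MvPolynomial (Fin (E.K + 1)) ℝ}
    {c : (q : DerivIdx m n) → (Fin m → ℕ) → Fin (E.J q + 1) → (Fin (E.K + 1) → ℂ) → Fin m → ℂ}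
    {N : Fin (E.Jr + 1) → ℕ} {p : Fin (E.K + 1) → ℕ}
    {M : (q : DerivIdx m n) → (Fin m → ℕ) → Fin (E.J q + 1) → ℕ}

variable {x : ℂ} {t T : ℝ}

lemma SettingTwo.r_eq_powerSum (H : SettingTwo o P E b r W d a h c)
    (hx : (x, t) ∈ smallArgs E o d) : r x t = (t : ℂ)⁻¹ • powerSum E N E.ω p a 1 x t := by
  simp [H.r_eq x t hx, powerSum]

lemma SettingTwo.b_eq_powerSum (H : SettingTwo o P E b r W d a h c)
    (hx : (x, t) ∈ smallArgs E o d) (q : DerivIdx m n) (k : Fin m → ℕ) :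
    b q k x t = powerSum E (M q k) (fun j => -E.e q k j) p (c q k) 1 x t := by
  simp only [H.b_eq q k x t hx, powerSum, one_pow, one_mul, Finset.smul_sum, smul_smul,
    ← Complex.cpow_add _ _ (norm_pos_iff.1 hx.1.1)]
  refine sum_congr rfl fun j _ => ?_
  rw [Exponents.e]
  push_cast; ring_nf

lemma smallArgs_scale (hp : ∀ l, p l * W = E.γ l - E.β l / n) (hw : 0 < W) {S : ℝ}
    (hS : 0 < S) (hS1 : S ≤ 1) (hx : (x, t) ∈ smallArgs E o d) :
    (((S ^ (1 / n : ℝ) : ℝ) : ℂ) * x, S * t) ∈ smallArgs E o d := by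
  have hs := rpow_pos_of_pos hS (1 / n)
  have ht := hx.2.1
  have e : ‖((S ^ (1 / n : ℝ) : ℝ) : ℂ) * x‖ = S ^ (1 / n : ℝ) * ‖x‖ := by rw [norm_mul, norm_coe]
  refine ⟨⟨e ▸ mul_pos hs hx.1.1, by rw [arg_real_mul _ hs]; exact hx.1.2⟩, mul_pos hS ht,
    fun l => lt_of_le_of_lt ?_ (hx.2.2 l)⟩
  simp only [e]
  rw [mul_rpow hS.le ht.le, mul_rpow hs.le (norm_nonneg _), ← rpow_mul hS.le,
    mul_mul_mul_comm, ← rpow_add hS, show E.γ l + 1 / n * -E.β l = E.γ l - E.β l / n by ring]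
  exact mul_le_of_le_one_left (by positivity) (rpow_le_one hS.le hS1 (by rw [← hp]; positivity))

lemma SettingTwo.exists_solutions (hn : 2 ≤ n) (hf : 0 < o) (hfn : o < π / (2 * n))
    (hP : ∀ l, ∀ p : ℂ, p ≠ 0 → |p.arg| ≤ o → 0 < ((P l).coeff n * (-p) ^ n).re)
    (H : SettingTwo o P E b r W d a h c) (hT : 0 < T) :
    ∃ g : Fin (E.Jr + 1) → MvPolynomial (Fin (E.K + 1)) ℝ,
    (∀ j, (g j).IsHomogeneous (E.deg j) ∧ NonnegCoeffs (g j)) ∧ ∃ R0 : ℝ, 0 < R0 ∧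
    ∃ (f : VecFun m) (F : ℂ → ℂ → Fin m → ℂ),
    (∀ R, R0 ≤ R → IsUniqueBoundedSolution P E b r g o R T f) ∧
    (∀ x ∈ cone (sin o) (R0 * T ^ (1 / n : ℝ)), DifferentiableOn ℂ (fun y => F y x) (ball 0 1)) ∧
    (∀ y ∈ ball 0 1, DifferentiableOn ℂ (F y) (cone (sin o) (R0 * T ^ (1 / n : ℝ)))) ∧
    (∃ M, ∀ y ∈ ball 0 1, ∀ x ∈ cone (sin o) (R0 * T ^ (1 / n : ℝ)), ∀ i, ‖F y x i‖ ≤ M) ∧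
    ∀ S, 0 < S → S < 1 → ∀ x ∈ cone (sin o) (R0 * T ^ (1 / n : ℝ)), F ((S ^ W : ℝ) : ℂ) x =
    ((S ^ (-(E.ω 0 / n)) : ℝ) : ℂ) • f (((S ^ (1 / n : ℝ) : ℝ) : ℂ) * x) (S * T) := by
  have hn0 : 0 < n := by omega
  have hn' : (2 : ℝ) ≤ n := by exact_mod_cast hn
  have hf1 : π / (2 * n) < π / 2 := div_lt_div_of_pos_left pi_pos two_pos (by linarith)
  have hf2 : o ≤ π / 2 := (hfn.trans hf1).le
  obtain ⟨N, p, M, hN, hp, hM⟩ := H.exists_multiples hn0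
  have hT1 : 0 < T + 1 := by linarith
  obtain ⟨A1, B1, H1⟩ := H.exists_rawData (N := N) (p := p) (M := M) (X := univ) (g := fun _ => 1)
    (sin_le_one (π / (2 * n))) hT1 (differentiableOn_const _) (by simp)
  obtain ⟨A2, B2, H2⟩ := H.exists_rawData (N := N) (p := p) (M := M) (X := ball 0 1) (g := id)
    (sin_le_one (π / (2 * n))) hT1 differentiableOn_id fun y hy => (mem_ball_zero_iff.1 hy).le
  obtain ⟨g, hg, R1, hR1, F1, hF1, -⟩ :=
    H1.exists_solutions hn0 isOpen_univ hf hfn hf1 P hP hT (lt_add_one T)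
  obtain ⟨g2, -, R2, hR2, F2, hF2, hd1, hd2, K, hK⟩ :=
    H2.exists_solutions hn0 isOpen_ball hf hfn hf1 P hP hT (lt_add_one T)
  have hsub : cone (sin o) (max R1 R2 * T ^ (1 / n : ℝ)) ⊆
    cone (sin o) (R2 * T ^ (1 / n : ℝ)) := cone_mono le_rfl
    (mul_le_r (le_max_right _ _) (rpow_pos_of_pos hT (1 / n)).le)
  have hsmall : ∀ {x t}, x ∈ cone (sin o) 0 →
    (x, t) ∈ rawRegion E (sin (π / (2 * n))) d (T + 1) → (x, t) ∈ smallArgs E o d :=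
    fun {x t} hx h1 => ⟨by rw [wideSector_eq_cone hf.le hf2 le_rfl]; exact hx, h1.2.1.1, h1.2.2⟩
  have hzero : ∀ {q k x t}, ¬ NonzeroOn b (smallArgs E o d) q k → (x, t) ∈ smallArgs E o d →
    b q k x t = 0 := fun {q k x t} hq hx => by
    by_contra hb
    exact hq ⟨x, t, hx, hb⟩
  have hsol : ∀ R, max R1 R2 ≤ R → IsUniqueBoundedSolution P E b r g o R T (F1 0) := fun R hR => by
    refine hF1 0 (mem_univ _) R ((le_max_left _ _).trans hR) b r fun x t hx ht hxt =>
      ⟨H.r_eq_powerSum (hsmall hx hxt), fun q k => ?_⟩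
    split_ifs with hq
    · simp
      exact H.b_eq_powerSum (hsmall hx hxt) q k
    · exact hzero hq (hsmall hx hxt)
  rw [H.nhat_eq] at hd1 hd2 hK
  refine ⟨g, hg, max R1 R2, lt_max_of_lt_left hR1, F1 0, fun y x => F2 y x T, hsol,
    fun x hx => hd1 x (hsub hx), fun y hy => (hd2 y hy).mono hsub,
    ⟨K, fun y hy x hx => hK y hy x (hsub hx)⟩, fun S hS hS1 x hx => ?_⟩
  have hmemx : (x, T) ∈ similarityRegion E.nhat o (max R1 R2) T :=
    (mem_similarityRegion_iff hf.le hf2 (hR1.le.trans (le_max_left _ _))).2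
    ⟨⟨hT, le_rfl⟩, by rwa [H.nhat_eq]⟩
  have hy : ((S ^ W : ℝ) : ℂ) ∈ ball (0 : ℂ) 1 := by
    rw [mem_ball_zero_iff, norm_coe]; exact rpow_lt_one hS.le hS1 H.ω_pos
  have huniq := (hF2 _ hy _ (le_max_right R1 R2) _ _ fun x t hx ht hxt => ⟨?_, fun q k => ?_⟩).2.1 _
    ((hsol _ le_rfl).1.scale H.nhat_eq hn0 H.P_eq hS hS1.le rfl (c := S ^ (-(E.ω 0 / n)))
    (rpow_pos_of_pos hS _).ne') x T hmemx
  · exact huniq.symm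
  all_goals
    have hx0 := norm_pos_iff.1 hx.1
    have ht0 := hxt.2.1.1
    have hsm := smallArgs_scale hp H.ω_pos hS hS1.le (hsmall hx hxt)
  · refine (congrArg _ (H.r_eq_powerSum (N := N) (p := p) hsm)).trans ?_
    change _ = (t : ℂ)⁻¹ • powerSum E N E.ω p a ((S ^ W : ℝ) : ℂ) x t
    rw [powerSum_scale hS hN hp hx0 ht0.le, smul_smul, smul_smul]; congr 1
    have : (S : ℂ) ≠ 0 := ofReal_ne_zero.2 hS.ne'
    push_cast
    field_simp
  · split_ifs with hq
    · refine (congrArg _ (H.b_eq_powerSum (M := M) (p := p) hsm q k)).trans ?_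
      simp only [one_mul]
      change _ = powerSum E (M q k) (fun j => -E.e q k j) p (c q k) ((S ^ W : ℝ) : ℂ) x t
      rw [powerSum_scale hS (hM q k hq) hp hx0 ht0.le]; congr 2
      rw [← rpow_natCast, ← rpow_natCast, ← rpow_mul hS.le, ← rpow_mul hS.le,
        ← rpow_neg hS.le, ← rpow_neg hS.le, ← rpow_add_one hS.ne', ← rpow_add hS,
        ← rpow_add hS, Exponents.mqk, H.nhat_eq]
      congr 1
      push_cast
      field_simp; ring
    · exact (congrArg _ (hzero hq hsm)).trans (smul_zero _)

lemma SettingTwo.exists_analytic_extension (hn : 2 ≤ n) (ho : 0 < o) (hon : o < π / (2 * n))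
    (hP : ∀ l, ∀ p : ℂ, p ≠ 0 → |p.arg| ≤ o → 0 < ((P l).coeff n * (-p) ^ n).re)
    (H : SettingTwo o P E b r W d a h c) (hT : 0 < T) :
    ∃ g : Fin (E.Jr + 1) → MvPolynomial (Fin (E.K + 1)) ℝ,
    (∀ j, (g j).IsHomogeneous (E.deg j) ∧ NonnegCoeffs (g j)) ∧ ∃ R0 : ℝ, 0 < R0 ∧ ∀ R : ℝ, R0 ≤ R →
    ∃ f : ℂ → ℝ → (Fin m → ℂ), IsUniqueBoundedSolution P E b r g o R (T ^ (1 / W)) f ∧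
    ∃ G : ℂ × ℂ → (Fin m → ℂ), AnalyticOnNhd ℂ G (wideSector o R ×ˢ ball (0 : ℂ) T) ∧
    ∀ Z ∈ wideSector o R, ∀ O ∈ Ioo 0 T, G (Z, (O : ℂ)) =
    ((O ^ (-(E.ω 0 / (n * W))) : ℝ) : ℂ) • E.hat f Z (O ^ (1 / W)) := by
  have hn' : (2 : ℝ) ≤ n := by exact_mod_cast hn
  have hT1 := rpow_pos_of_pos hT (1 / W)
  obtain ⟨g, hg, R0, hR0, f, F, hf, hF1, hF2, ⟨K, hK⟩, hF⟩ := H.exists_solutions hn ho hon hP hT1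
  refine ⟨g, hg, R0, hR0, fun R hR => ⟨f, hf R hR, ?_⟩⟩
  have hW := H.ω_pos
  set T1 := T ^ (1 / W) with hT₁
  have hw := wideSector_eq_cone ho.le (hon.le.trans (div_le_div_of_nonneg_left pi_pos.le two_pos
    (by linarith))) (hR0.le.trans hR)
  have hcone : ∀ {Z}, Z ∈ wideSector o R → ((T1 ^ (1 / n : ℝ) : ℝ) : ℂ) * Z ∈
    cone (sin o) (R0 * T1 ^ (1 / n : ℝ)) := fun hZ => by
    rw [mul_comm R0, cone_smul (rpow_pos_of_pos hT1 (1 / n))]; exact cone_mono le_rfl hR (hw ▸ hZ)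
  have hball : ∀ {O}, O ∈ ball (0 : ℂ) T → O / T ∈ ball (0 : ℂ) 1 := fun hO => by
    rw [mem_ball_zero_iff, norm_div, norm_coe, div_lt_one hT]; exact mem_ball_zero_iff.1 hO
  refine ⟨fun z => ((T1 ^ (-(E.ω 0 / n)) : ℝ) : ℂ) •
    F (z.2 / T) (((T1 ^ (1 / n : ℝ) : ℝ) : ℂ) * z.1), ?_, fun Z hZ O hO => ?_⟩
  · rintro ⟨Z0, O0⟩ ⟨hZ0, hO0⟩
    refine analyticAt_const.fun_smul (analyticAt_pi_iff.2 fun i => ?_)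
    obtain ⟨R1, hR1, hb1⟩ := Metric.isOpen_iff.1 (hw ▸ isOpen_cone _ _) Z0 hZ0
    obtain ⟨R2, hR2, hb2⟩ := Metric.isOpen_iff.1 isOpen_ball O0 hO0
    have hz : ∀ {z}, z ∈ ball Z0 (min R1 R2) → z ∈ wideSector o R := fun h =>
      hb1 (ball_subset_ball (min_le_left _ _) h)
    have hO : ∀ {z}, z ∈ ball O0 (min R1 R2) → z ∈ ball (0 : ℂ) T := fun h =>
      hb2 (ball_subset_ball (min_le_right _ _) h)
    refine analyticAt_of_separately (lt_min hR1 hR2) (fun w hw => ?_) (fun z hz' => ?_)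
      fun z hz' w hw' => hK _ (hball (hO hw')) _ (hcone (hz hz')) i
    · exact (differentiableOn_pi.1 (hF2 _ (hball (hO hw))) i).comp (differentiableOn_id.const_mul _)
        fun z h => hcone (hz h)
    · exact (differentiableOn_pi.1 (hF1 _ (hcone (hz hz'))) i).comp (differentiableOn_id.div_const
        _) fun w h => hball (hO h)
  · have hy := div_pos hO.1 hT
    have hS : 0 < (O / T) ^ (1 / W) := rpow_pos_of_pos hy _
    have e1 : (O / T) ^ (1 / W) * T1 = O ^ (1 / W) := by
      rw [hT₁, ← mul_rpow hy.le hT.le, div_mul_cancel₀ _ hT.ne']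
    have h1 := hF _ hS (rpow_lt_one hy.le ((div_lt_one hT).2 hO.2) (by positivity)) _ (hcone hZ)
    rw [← rpow_mul hy.le, one_div_mul_cancel hW.ne', rpow_one, ← mul_assoc,
      ← ofReal_mul, ← mul_rpow hS.le hT1.le, e1] at h1
    rw [Exponents.hat, H.nhat_eq]
    dsimp only
    rw [← Complex.ofReal_div, h1, smul_smul, ← ofReal_mul, mul_comm,
      ← mul_rpow hS.le hT1.le, e1, ← rpow_mul hO.1.le]
    field_simp

end

end

theorem theorem3 {m n : ℕ} (hn : 2 ≤ n) (φ : ℝ) (hφ : 0 < φ) (hφn : φ < Real.pi / (2 * n))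
    (P : Fin m → Polynomial ℂ) (hPdeg : ∀ l, (P l).natDegree = n)
    (hP : ∀ l, ∀ p : ℂ, p ≠ 0 → |p.arg| ≤ φ → 0 < ((P l).coeff n * (-p) ^ n).re)
    (E : Exponents m n) (b : Coeffs m n) (r : ℂ → ℝ → (Fin m → ℂ)) :
    (∀ T : ℝ, 0 < T → ∀ (φ₁ : ℝ) (h : Fin (E.Jr + 1) → MvPolynomial (Fin (E.K + 1)) ℝ)
      (p : (q : DerivIdx m n) → (Fin m → ℕ) → Fin (E.J q + 1) →
        MvPolynomial (Fin (E.K + 1)) ℝ),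
      SettingOne φ T E b r φ₁ h p →
      ∃ g : Fin (E.Jr + 1) → MvPolynomial (Fin (E.K + 1)) ℝ,
        (∀ j, (g j).IsHomogeneous (E.deg j) ∧ NonnegCoeffs (g j)) ∧
        ∃ ρ₀ : ℝ, 0 < ρ₀ ∧ ∀ ρ : ℝ, ρ₀ ≤ ρ →
          ∃ f : ℂ → ℝ → (Fin m → ℂ), IsUniqueBoundedSolution P E b r g φ ρ T f) ∧
    (∀ (ω δ : ℝ) (a : Fin (E.Jr + 1) → (Fin (E.K + 1) → ℂ) → (Fin m → ℂ))
      (h : Fin (E.Jr + 1) → MvPolynomial (Fin (E.K + 1)) ℝ)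
      (c : (q : DerivIdx m n) → (Fin m → ℕ) → Fin (E.J q + 1) →
        (Fin (E.K + 1) → ℂ) → (Fin m → ℂ)),
      SettingTwo φ P E b r ω δ a h c →
      ∀ T : ℝ, 0 < T →
      ∃ g : Fin (E.Jr + 1) → MvPolynomial (Fin (E.K + 1)) ℝ,
        (∀ j, (g j).IsHomogeneous (E.deg j) ∧ NonnegCoeffs (g j)) ∧
        ∃ ρ₀ : ℝ, 0 < ρ₀ ∧ ∀ ρ : ℝ, ρ₀ ≤ ρ →
          ∃ f : ℂ → ℝ → (Fin m → ℂ),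
            IsUniqueBoundedSolution P E b r g φ ρ (T ^ (1 / ω)) f ∧
            ∃ G : ℂ × ℂ → (Fin m → ℂ),
              AnalyticOnNhd ℂ G (wideSector φ ρ ×ˢ Metric.ball (0 : ℂ) T) ∧
              ∀ ζ ∈ wideSector φ ρ, ∀ θ ∈ Set.Ioo 0 T,
                G (ζ, (θ : ℂ)) =
                  ((θ ^ (-(E.ω 0 / (n * ω))) : ℝ) : ℂ) • E.hat f ζ (θ ^ (1 / ω))) := by
  have hn' : (2 : ℝ) ≤ n := by exact_mod_cast hn
  refine ⟨fun T hT φ₁ h p H => ?_, fun ω δ a h c H T hT =>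
    H.exists_analytic_extension hn hφ hφn hP hT⟩
  have hφ₁ : φ₁ < Real.pi / 2 := H.φ₁_le.trans_lt
    (div_lt_div_of_pos_left Real.pi_pos two_pos (by linarith))
  have hφ2 : φ ≤ Real.pi / 2 := (H.lt_φ₁.trans hφ₁).le
  obtain ⟨δ, A, B, H'⟩ := H.exists_rawData (hφ.trans H.lt_φ₁).le hφ₁.le hT
  obtain ⟨g, hg, ρ₀, hρ₀, F, hF, -⟩ := H'.exists_solutions (by omega) isOpen_univ hφ H.lt_φ₁ hφ₁ P hP
    hT (by linarith : T < 2 * T)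
  refine ⟨g, hg, ρ₀, hρ₀, fun ρ hρ => ⟨F 0, hF 0 (Set.mem_univ _) ρ hρ b r fun x t hx ht hxt => ?_⟩⟩
  rw [min_eq_left ht]
  refine ⟨rfl, fun q k => ?_⟩
  split_ifs with hq
  · rfl
  · by_contra hb
    refine hq ⟨x, t, ⟨?_, hxt.2.1.1, ht⟩, hb⟩
    rw [wideSector_eq_cone (hφ.trans H.lt_φ₁).le hφ₁.le le_rfl]
    exact hxt.1
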